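/- Let $\langle z,w\rangle=\bar z_1w_3+\bar z_2w_2+\bar z_3w_1$ on $\mathbb C^3$ (signature $(2,1)$), let $\mathbf H^2_{\mathbb C}=\{[z]\in\mathbb{CP}^2:\langle z,z\rangle<0\}$ be the complex hyperbolic plane, $\partial_\infty\mathbf H^2_{\mathbb C}=\{[z]:\langle z,z\rangle=0\}$ and $\overline{\mathbf H^2_{\mathbb C}}$ their union. For $\alpha_2\in\,]0,\pi/2[$ put $e=e^{i\alpha_2}$ and $$p_A=\begin{pmatrix}1\\0\\0\end{pmatrix},\quad p_B=\begin{pmatrix}0\\0\\1\end{pmatrix},\quad p_U=\begin{pmatrix}1\\-\frac{\sqrt2}{2}e\\e^2\end{pmatrix},\quad p_V=\begin{pmatrix}-e^2\\-\frac{\sqrt2}{2}e\\-1\end{pmatrix},\quad p_W=\begin{pmatrix}-e^2\\\sqrt2e^3+\frac{\sqrt2}{2}e\\e^2\end{pmatrix},$$ $$U=\begin{pmatrix}1&-\sqrt2e&-1\\-\sqrt2e&1+2e^2&2\sqrt2\cos\alpha_2\\-1&2\sqrt2\cos\alpha_2&2+2e^{-2}\end{pmatrix}\in \mathrm{SU}(2,1).$$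 For $k\in\mathbb Z$ let $$\mathcal J_k^+=\{[z]\in\overline{\mathbf H^2_{\mathbb C}}:|\langle z,p_U\rangle|=|\langle z,U^kp_V\rangle|\},\qquad \mathcal J_k^-=\{[z]\in\overline{\mathbf H^2_{\mathbb C}}:|\langle z,p_U\rangle|=|\langle z,U^kp_W\rangle|\},$$ let $\partial_\infty\mathcal J_k^\pm=\mathcal J_k^\pm\cap\partial_\infty\mathbf H^2_{\mathbb C}$ be their spinal surfaces, and define the faces $$\mathcal F_k^+=\{[z]\in\mathcal J_k^+:|\langle z,p_U\rangle|\le\min(|\langle z,U^kp_W\rangle|,|\langle z,U^{k-1}p_W\rangle|)\},$$ $$\mathcal F_k^-=\{[z]\in\mathcal J_k^-:|\langle z,p_U\rangle|\le\min(|\langle z,U^kp_V\rangle|,|\langle z,U^{k+1}p_V\rangle|)\},\qquad \partial_\infty\mathcal F_k^\pm=\mathcal F_k^\pm\cap\partial_\infty\mathbf H^2_{\mathbb C}.$$ In $\partial_\infty\mathcal J_k^+$ consider the Giraud circles $C_1=\partial_\infty\mathcal J_k^+\cap\partial_\infty\mathcal J_k^-$, $C_2=\partial_\infty\mathcal J_k^+\cap\partial_\infty\mathcal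 J_{k-1}^-$ and the points $a=[U^kp_A]$, $b=[U^kp_B]$, $c_1=[U^{k+1}p_A]$, $c_2=[U^{k-1}p_B]$. In $\partial_\infty\mathcal J_k^-$ consider $C_1=\partial_\infty\mathcal J_k^-\cap\partial_\infty\mathcal J_k^+$, $C_2=\partial_\infty\mathcal J_k^-\cap\partial_\infty\mathcal J_{k+1}^+$ and $a=[U^{k+1}p_A]$, $b=[U^kp_B]$, $c_1=[U^kp_A]$, $c_2=[U^{k+1}p_B]$. Then for all $\alpha_2\in\,]0,\pi/2[$, all $k\in\mathbb Z$ and both signs, the bigon $B_k^\pm$ and the quadrilateral $Q_k^\pm$ are well defined. That is: 1. $C_1$ and $C_2$ are smooth circles, $a\neq b$, $C_1\cap C_2=\{a,b\}$, $C_1$ and $C_2$ are tangent at $a$ and at $b$, and $c_i\in C_i\setminus\{a,b\}$ for $i=1,2$. 2. $\partial_\infty\mathcal J_k^\pm\setminus(C_1\cup C_2)$ has exactly four connected components. Exactly one of them has as boundary in $\partial_\infty\mathcal J_k^\pm$ the union of the arc of $C_1$ from $a$ to $b$ through $c_1$ and the arc of $C_2$ from $a$ to $b$ through $c_2$; its closure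 is the quadrilateral $Q_k^\pm$, with vertices $a,c_1,b,c_2$. Exactly one has as boundary the union of the two other arcs; its closure is the bigon $B_k^\pm$, with vertices $a,b$. Moreover $\partial_\infty\mathcal F_k^\pm=B_k^\pm\cup Q_k^\pm$ and $B_k^\pm\cap Q_k^\pm=\{a,b\}$. 3. $B_k^\pm$ is a closed topological disk bounded by its two arcs. If $\alpha_2\in[\pi/6,\pi/2[$, then $Q_k^\pm$ is a closed topological disk bounded by its two arcs. 4. If $\alpha_2\in\,]0,\pi/6[$, then $Q_k^\pm$ has genus $1$, i.e. it is a torus minus a disk: $Q_k^\pm$ is homeomorphic to a torus minus an open disk, the boundary circle corresponding to the union of its two arcs, and the interior of $Q_k^\pm$ is diffeomorphic to a torus minus a closed disk. -/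

import Mathlib

open scoped LinearAlgebra.Projectivization ContDiff Topology

namespace FordFaces

noncomputable section

/-! ### The complex projective plane and the complex hyperbolic plane -/

/-- The complex projective plane. -/
abbrev CP2 : Type := ℙ ℂ (Fin 3 → ℂ)

/-- The quotient topology coming from `ℂ³ ∖ {0}`. -/
instance instTopologicalSpaceCP2 : TopologicalSpace CP2 :=
  TopologicalSpace.coinduced (Projectivization.mk' ℂ) inferInstance

/-- The Hermitian form of signature `(2,1)`, antilinear in the first variable:
`⟨z, w⟩ = z̄₁ w₃ + z̄₂ w₂ + z̄₃ w₁`. -/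
def herm (z w : Fin 3 → ℂ) : ℂ :=
  star (z 0) * w 2 + star (z 1) * w 1 + star (z 2) * w 0

/-- The complex hyperbolic plane together with its boundary at infinity. The condition does not
depend on the chosen representative of the point; the same holds for the sets below. -/
def closedH2C : Set CP2 := {x | (herm x.rep x.rep).re ≤ 0}

/-- The boundary at infinity of the complex hyperbolic plane. -/
def boundaryH2C : Set CP2 := {x | herm x.rep x.rep = 0}

/-- The extor of two vectors of equal norm: `{[z] : |⟨z, p⟩| = |⟨z, q⟩|}`. -/
def extor (p q : Fin 3 → ℂ) : Set CP2 := {x | ‖herm x.rep p‖ = ‖herm x.rep q‖}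

/-- The bisector: the part of the extor in the closure of the complex hyperbolic plane. -/
def bisector (p q : Fin 3 → ℂ) : Set CP2 := extor p q ∩ closedH2C

/-- The affine chart `[z] ↦ (√2 z₂ / (z₁ - z₃), (z₁ + z₃) / (z₁ - z₃))` of the projective plane.
It maps the complex hyperbolic plane onto the open unit ball of `ℂ²`, and its boundary at infinity
onto the unit sphere (no point `[z]` of the closure has `z₁ = z₃`). -/
def ballChart (x : CP2) : ℂ × ℂ :=
  (((√2 : ℝ) : ℂ) * x.rep 1 / (x.rep 0 - x.rep 2),
    (x.rep 0 + x.rep 2) / (x.rep 0 - x.rep 2))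

/-! ### The group element `U` and the vectors defining the bisectors -/

/-- `e^{iα}`. -/
def eI (α : ℝ) : ℂ := Complex.exp (Complex.I * α)

/-- `√2` as a complex number. -/
def sqrtTwo : ℂ := ((√2 : ℝ) : ℂ)

def pA : Fin 3 → ℂ := ![1, 0, 0]

def pB : Fin 3 → ℂ := ![0, 0, 1]

def pU (α : ℝ) : Fin 3 → ℂ := ![1, -(sqrtTwo / 2) * eI α, eI α ^ 2]

def pV (α : ℝ) : Fin 3 → ℂ := ![-eI α ^ 2, -(sqrtTwo / 2) * eI α, -1]

def pW (α : ℝ) : Fin 3 → ℂ :=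
  ![-eI α ^ 2, sqrtTwo * eI α ^ 3 + (sqrtTwo / 2) * eI α, eI α ^ 2]

/-- The matrix of `U`. -/
def matU (α : ℝ) : Matrix (Fin 3) (Fin 3) ℂ :=
  !![1, -sqrtTwo * eI α, -1;
    -sqrtTwo * eI α, 1 + 2 * eI α ^ 2, 2 * sqrtTwo * (Real.cos α : ℂ);
    -1, 2 * sqrtTwo * (Real.cos α : ℂ), 2 + 2 * eI (-α) ^ 2]

theorem matU_det (α : ℝ) : (matU α).det = 1 := by
  have h2 : sqrtTwo ^ 2 = 2 := by
    unfold sqrtTwo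
    rw [← Complex.ofReal_pow, Real.sq_sqrt (by norm_num)]
    norm_num
  have he : eI α * eI (-α) = 1 := by
    unfold eI
    rw [← Complex.exp_add, ← Complex.exp_zero]
    congr 1
    push_cast
    ring
  have hc : 2 * (Real.cos α : ℂ) = eI α + eI (-α) := by
    rw [Complex.ofReal_cos, Complex.cos]
    unfold eI
    push_cast
    rw [mul_div_cancel₀ _ (two_ne_zero)]
    congr 2 <;> ring
  rw [matU, Matrix.det_fin_three]
  simp only [Matrix.of_apply, Matrix.cons_val', Matrix.cons_val_zero, Matrix.cons_val_one,
    Matrix.cons_val]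
  have hc' : (Real.cos α : ℂ) = (eI α + eI (-α)) / 2 := by rw [← hc]; ring
  rw [hc']
  generalize eI α = e at *
  generalize eI (-α) = f at *
  generalize sqrtTwo = s at *
  linear_combination (-2 * e ^ 2 - 2 * e ^ 2 * f ^ 2 - (e + f) ^ 2 + 2 * e * (e + f)) * h2

/-- The element `U`, which preserves the Hermitian form and fixes `pU`. -/
def U (α : ℝ) : Matrix.SpecialLinearGroup (Fin 3) ℂ := ⟨matU α, matU_det α⟩

/-- The vector `U^k v`. -/
def Upow (α : ℝ) (k : ℤ) (v : Fin 3 → ℂ) : Fin 3 → ℂ :=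
  Matrix.mulVec ((U α ^ k : Matrix.SpecialLinearGroup (Fin 3) ℂ) : Matrix (Fin 3) (Fin 3) ℂ) v

/-- The point `[U^k p_A]`. -/
def ptA (α : ℝ) (k : ℤ) : CP2 :=
  (U α ^ k) • Projectivization.mk ℂ pA (fun h => one_ne_zero (congrFun h 0))

/-- The point `[U^k p_B]`. -/
def ptB (α : ℝ) (k : ℤ) : CP2 :=
  (U α ^ k) • Projectivization.mk ℂ pB (fun h => one_ne_zero (congrFun h 2))

/-! ### Bisectors, spinal surfaces, faces -/

/-- The upper index `±`. -/
inductive Sgn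
  | plus
  | minus

/-- The bisectors `J_k^+ = J(p_U, U^k p_V)` and `J_k^- = J(p_U, U^k p_W)`. -/
def J (α : ℝ) : Sgn → ℤ → Set CP2
  | .plus, k => bisector (pU α) (Upow α k (pV α))
  | .minus, k => bisector (pU α) (Upow α k (pW α))

/-- The spinal surface `∂_∞ J_k^±`. -/
def spinal (α : ℝ) (s : Sgn) (k : ℤ) : Set CP2 := J α s k ∩ boundaryH2C

/-- The three-dimensional faces `F_k^±`. -/
def face (α : ℝ) : Sgn → ℤ → Set CP2
  | .plus, k => {x ∈ J α .plus k | ‖herm x.rep (pU α)‖ ≤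
      min ‖herm x.rep (Upow α k (pW α))‖ ‖herm x.rep (Upow α (k - 1) (pW α))‖}
  | .minus, k => {x ∈ J α .minus k | ‖herm x.rep (pU α)‖ ≤
      min ‖herm x.rep (Upow α k (pV α))‖ ‖herm x.rep (Upow α (k + 1) (pV α))‖}

/-- The boundary at infinity of a face. -/
def faceInfinity (α : ℝ) (s : Sgn) (k : ℤ) : Set CP2 := face α s k ∩ boundaryH2C

/-- The first Giraud circle in `∂_∞ J_k^±`: the intersection with `∂_∞ J_k^∓`. -/
def circle₁ (α : ℝ) : Sgn → ℤ → Set CP2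
  | .plus, k => spinal α .plus k ∩ spinal α .minus k
  | .minus, k => spinal α .minus k ∩ spinal α .plus k

/-- The second Giraud circle: the intersection of `∂_∞ J_k^+` with `∂_∞ J_{k-1}^-`, respectively
of `∂_∞ J_k^-` with `∂_∞ J_{k+1}^+`. -/
def circle₂ (α : ℝ) : Sgn → ℤ → Set CP2
  | .plus, k => spinal α .plus k ∩ spinal α .minus (k - 1)
  | .minus, k => spinal α .minus k ∩ spinal α .plus (k + 1)

/-- The first vertex shared by the bigon and the quadrilateral. -/
def vertexA (α : ℝ) : Sgn → ℤ → CP2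
  | .plus, k => ptA α k
  | .minus, k => ptA α (k + 1)

/-- The second vertex shared by the bigon and the quadrilateral. -/
def vertexB (α : ℝ) (_s : Sgn) (k : ℤ) : CP2 := ptB α k

/-- The remaining vertex of the quadrilateral on the first Giraud circle. -/
def vertex₁ (α : ℝ) : Sgn → ℤ → CP2
  | .plus, k => ptA α (k + 1)
  | .minus, k => ptA α k

/-- The remaining vertex of the quadrilateral on the second Giraud circle. -/
def vertex₂ (α : ℝ) : Sgn → ℤ → CP2
  | .plus, k => ptB α (k - 1)
  | .minus, k => ptB α (k + 1)

/-! ### Bigons and quadrilaterals -/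

/-- The open arc of `C ∖ {a, b}` that contains `c`. -/
def arc (C : Set CP2) (a b c : CP2) : Set CP2 := connectedComponentIn (C \ {a, b}) c

/-- The boundary of the quadrilateral: the arc of the first Giraud circle through `vertex₁` and the
arc of the second one through `vertex₂`, together with their common endpoints. -/
def quadBoundary (α : ℝ) (s : Sgn) (k : ℤ) : Set CP2 :=
  arc (circle₁ α s k) (vertexA α s k) (vertexB α s k) (vertex₁ α s k) ∪
    arc (circle₂ α s k) (vertexA α s k) (vertexB α s k) (vertex₂ α s k) ∪
    {vertexA α s k, vertexB α s k}

/-- The boundary of the bigon: the other arcs of the two Giraud circles, with their endpoints. -/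
def bigonBoundary (α : ℝ) (s : Sgn) (k : ℤ) : Set CP2 :=
  (circle₁ α s k \ arc (circle₁ α s k) (vertexA α s k) (vertexB α s k) (vertex₁ α s k)) ∪
    (circle₂ α s k \ arc (circle₂ α s k) (vertexA α s k) (vertexB α s k) (vertex₂ α s k))

/-- The connected components of the complement of the two Giraud circles in the spinal surface. -/
def pieces (α : ℝ) (s : Sgn) (k : ℤ) : Set (Set CP2) :=
  {R | ∃ x ∈ spinal α s k \ (circle₁ α s k ∪ circle₂ α s k),
    R = connectedComponentIn (spinal α s k \ (circle₁ α s k ∪ circle₂ α s k)) x}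

/-- `R` is the interior of the quadrilateral `Q_k^±`: a piece bordered exactly by the arcs through
`vertex₁` and `vertex₂`. The quadrilateral itself is `closure R`. -/
def IsOpenQuad (α : ℝ) (s : Sgn) (k : ℤ) (R : Set CP2) : Prop :=
  R ∈ pieces α s k ∧ closure R \ R = quadBoundary α s k

/-- `R` is the interior of the bigon `B_k^±`: a piece bordered exactly by the two other arcs.
The bigon itself is `closure R`. -/
def IsOpenBigon (α : ℝ) (s : Sgn) (k : ℤ) (R : Set CP2) : Prop :=
  R ∈ pieces α s k ∧ closure R \ R = bigonBoundary α s k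

/-! ### Topology and smoothness -/

/-- `f` is smooth on the subset `X`: near each point of `X` it agrees on `X` with a smooth map
defined on an open subset of the ambient space. -/
def SmoothOnSubset {E F : Type*} [NormedAddCommGroup E] [NormedSpace ℝ E]
    [NormedAddCommGroup F] [NormedSpace ℝ F] (f : E → F) (X : Set E) : Prop :=
  ∀ x ∈ X, ∃ N : Set E, IsOpen N ∧ x ∈ N ∧
    ∃ g : E → F, ContDiffOn ℝ ∞ g N ∧ Set.EqOn f g (X ∩ N)

/-- The subsets `X` and `Y` of two real normed spaces are diffeomorphic. -/
def AreDiffeomorphic {E F : Type*} [NormedAddCommGroup E] [NormedSpace ℝ E]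
    [NormedAddCommGroup F] [NormedSpace ℝ F] (X : Set E) (Y : Set F) : Prop :=
  ∃ (f : E → F) (g : F → E), SmoothOnSubset f X ∧ SmoothOnSubset g Y ∧
    Set.MapsTo f X Y ∧ Set.MapsTo g Y X ∧ Set.InvOn g f X Y

/-- `C ⊆ ∂_∞ H²_ℂ` is a smoothly embedded circle. -/
def IsSmoothCircle (C : Set CP2) : Prop :=
  AreDiffeomorphic (Metric.sphere (0 : ℂ) 1) (ballChart '' C)

/-- The curves `C` and `C'` have the same tangent space at `x`. -/
def TangentAt (C C' : Set CP2) (x : CP2) : Prop :=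
  tangentConeAt ℝ (ballChart '' C) (ballChart x) = tangentConeAt ℝ (ballChart '' C') (ballChart x)

/-- `D` is a closed topological disk with boundary curve `bd`. -/
def IsClosedDisk (D bd : Set CP2) : Prop :=
  bd ⊆ D ∧ ∃ h : Metric.closedBall (0 : ℂ) 1 ≃ₜ D,
    ∀ x : Metric.closedBall (0 : ℂ) 1, ‖(x : ℂ)‖ = 1 ↔ ((h x : D) : CP2) ∈ bd

/-- The torus `S¹ × S¹` in `ℂ²`. -/
def torus : Set (ℂ × ℂ) := Metric.sphere (0 : ℂ) 1 ×ˢ Metric.sphere (0 : ℂ) 1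

/-- The universal covering `ℝ² → S¹ × S¹`; it embeds the closed unit disk. -/
def torusCover (t : ℝ × ℝ) : ℂ × ℂ := (eI t.1, eI t.2)

def openDiskInTorus : Set (ℂ × ℂ) := torusCover '' {t | t.1 ^ 2 + t.2 ^ 2 < 1}

def closedDiskInTorus : Set (ℂ × ℂ) := torusCover '' {t | t.1 ^ 2 + t.2 ^ 2 ≤ 1}

/-- `D` is homeomorphic to a torus minus an open disk, with boundary curve `bd`. -/
def IsTorusMinusDisk (D bd : Set CP2) : Prop :=
  bd ⊆ D ∧ ∃ h : (torus \ openDiskInTorus : Set (ℂ × ℂ)) ≃ₜ D,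
    ∀ x : (torus \ openDiskInTorus : Set (ℂ × ℂ)),
      (x : ℂ × ℂ) ∈ closedDiskInTorus ↔ ((h x : D) : CP2) ∈ bd

end

end FordFaces

open FordFaces

/-! All faces are moved onto one explicit surface. A point (v, u) of the unit sphere of ℂ² is lifted
to the null vector (u + i, √2 v, u - i), and an isometry of the form (`frame`) brings every face
into the same position. For the sign minus the isometry `T` is added: it fixes p_U and exchanges p_V
and p_W, always up to sign, so that both signs and all k become a single computation. Put s = sin α
and c = cos α. The pairings with p_U and p_V have moduli |2cu + (2s - v)| and |2cu - (2s - v)|, so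
the spinal surface is Re(ū(2s - v)) = 0 on the sphere. On this surface u drops out of the other two
conditions: the squared modulus for p_U minus the one for p_W, respectively for U⁻¹p_W, is 12c(∓Im v
- c|v|²). The Giraud circles are therefore ∓Im v = c|v|² and the face at infinity is |Im v| ≤ c|v|².
Since c < 1 and |v| ≤ 1, this region meets Re v = 0 only where v = 0, that is at the vertices (0,
±i). The sign of Re v separates the bigon (Re v ≤ 0) from the quadrilateral (Re v ≥ 0), and the
opposite strict inequalities give the two other components.

The topology is read off the projection to v. For v ≠ 2s, u is a real multiple r of the unit vector
i(2s - v)/|2s - v|, with r² = 1 - |v|². The surface thus consists of two sheets over the unit disk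
glued along |v| = 1, except that for 2s < 1 a whole circle of values of u lies over the interior
point v = 2s and creates a handle. The bigon stays away from v = 2s. So does the quadrilateral when
2s > 1, and when 2s = 1 it only meets u = 0 there. In these cases (r, Im v) are global coordinates;
because |v|² = 1 - r², the region becomes |Im v| ≤ c(1 - r²), a compact convex set, hence a disk
(`exists_homeomorph_modelClosedPiece`).

The case 2s < 1 is α < π/6. Three diffeomorphisms are composed. The equation of the surface says
that 2s - v and u/κ are orthogonal, that is, that their sum and difference have equal norm;
normalizing these two gives S¹ × S¹ (`torusToSpinal`, `spinalToTorus`). The slit Im v = 0, Re v ≤ 0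
is an arc joining the two vertices, and sliding points along the circles |v| = R carries its
complement onto the open quadrilateral (`areDiffeomorphic_slit_piece`). Finally a closed disk of the
torus is collapsed onto an arc (`areDiffeomorphic_torus_slit`), and κ is chosen so that this arc is
the slit (`torusToSpinal_mem_slit_iff`).

These maps are not injective on the boundary: both the closed quadrilateral and the torus minus an
open disk are folded two to one onto the slit. `SlitCover` records such a folding together with a
sign telling the two sides apart, and two compact surfaces folded in this way are homeomorphic
(`SlitCover.exists_homeomorph`), boundary going to boundary. -/

namespace FordFaces

/-! ### Smooth maps on subsets -/

section Smooth

variable {E F H : Type*} [NormedAddCommGroup E] [NormedSpace ℝ E]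
  [NormedAddCommGroup F] [NormedSpace ℝ F] [NormedAddCommGroup H] [NormedSpace ℝ H]

/-- The local smooth representative may differ from `f` off `X`; this is needed near the branch cut
of the argument. -/
theorem SmoothOnSubset.of_eventually {f : E → F} {X : Set E}
    (h : ∀ x ∈ X, ∃ g : E → F, (∀ᶠ y in 𝓝 x, ContDiffAt ℝ ∞ g y) ∧
      ∀ᶠ y in 𝓝 x, y ∈ X → f y = g y) : SmoothOnSubset f X := by
  intro x hx
  obtain ⟨g, hg, hfg⟩ := h x hx
  obtain ⟨N, hN, hNo, hxN⟩ := eventually_nhds_iff.1 (hg.and hfg)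
  exact ⟨N, hNo, hxN, g, fun y hy => (hN y hy).1.contDiffWithinAt, fun y hy => (hN y hy.2).2 hy.1⟩

theorem SmoothOnSubset.of_contDiffAt {f : E → F} {X : Set E}
    (h : ∀ x ∈ X, ∀ᶠ y in 𝓝 x, ContDiffAt ℝ ∞ f y) : SmoothOnSubset f X :=
  SmoothOnSubset.of_eventually fun x hx => ⟨f, h x hx, .of_forall fun _ _ => rfl⟩

theorem SmoothOnSubset.mono {f : E → F} {X Y : Set E} (hf : SmoothOnSubset f Y) (h : X ⊆ Y) :
    SmoothOnSubset f X := by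
  intro x hx
  obtain ⟨N, hNo, hxN, g, hg, hfg⟩ := hf x (h hx)
  exact ⟨N, hNo, hxN, g, hg, hfg.mono (Set.inter_subset_inter_left _ h)⟩

theorem SmoothOnSubset.continuousOn {f : E → F} {X : Set E} (hf : SmoothOnSubset f X) :
    ContinuousOn f X := by
  intro x hx
  obtain ⟨N, hNo, hxN, g, hg, hfg⟩ := hf x hx
  have h1 : ContinuousWithinAt g X x :=
    (hg.continuousOn.continuousAt (hNo.mem_nhds hxN)).continuousWithinAt
  refine h1.congr_of_eventuallyEq ?_ (hfg ⟨hx, hxN⟩)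
  filter_upwards [self_mem_nhdsWithin, mem_nhdsWithin_of_mem_nhds (hNo.mem_nhds hxN)] with y hy hyN
  exact hfg ⟨hy, hyN⟩

theorem SmoothOnSubset.comp {f : E → F} {f' : F → H} {X : Set E} {Y : Set F}
    (hf' : SmoothOnSubset f' Y) (hf : SmoothOnSubset f X) (h : Set.MapsTo f X Y) :
    SmoothOnSubset (f' ∘ f) X := by
  intro x hx
  obtain ⟨N, hNo, hxN, g, hg, hfg⟩ := hf x hx
  obtain ⟨N', hNo', hxN', g', hg', hfg'⟩ := hf' (f x) (h hx)
  have hgo : IsOpen (N ∩ g ⁻¹' N') := hg.continuousOn.isOpen_inter_preimage hNo hNo'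
  refine ⟨N ∩ g ⁻¹' N', hgo, ⟨hxN, ?_⟩, g' ∘ g, ?_, ?_⟩
  · rw [Set.mem_preimage, ← hfg ⟨hx, hxN⟩]; exact hxN'
  · exact hg'.comp (hg.mono Set.inter_subset_left) fun y hy => hy.2
  · intro y hy
    have e : f y = g y := hfg ⟨hy.1, hy.2.1⟩
    have : f y ∈ Y ∩ N' := ⟨h hy.1, by rw [e]; exact hy.2.2⟩
    simp only [Function.comp]
    rw [hfg' this, e]

theorem AreDiffeomorphic.trans {X : Set E} {Y : Set F} {Z : Set H} (h : AreDiffeomorphic X Y)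
    (h' : AreDiffeomorphic Y Z) : AreDiffeomorphic X Z := by
  obtain ⟨f, g, hf, hg, hm, hm', hi⟩ := h
  obtain ⟨f', g', hf', hg', hn, hn', hj⟩ := h'
  exact ⟨f' ∘ f, g ∘ g', hf'.comp hf hm, hg.comp hg' hn', hn.comp hm, hm'.comp hn',
    hi.comp hj hm hn'⟩

/-- A map which is smooth on `Z` with a smooth inverse is a diffeomorphism from each subset. -/
theorem AreDiffeomorphic.image {f : E → F} {g : F → E} {X Z : Set E} (hXZ : X ⊆ Z)
    (hf : SmoothOnSubset f Z) (hg : SmoothOnSubset g (f '' Z)) (h : Set.LeftInvOn g f Z) :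
    AreDiffeomorphic X (f '' X) := by
  refine ⟨f, g, hf.mono hXZ, hg.mono (Set.image_mono hXZ), Set.mapsTo_image _ _, ?_, ?_⟩
  · rintro _ ⟨x, hx, rfl⟩
    rw [h (hXZ hx)]; exact hx
  · refine ⟨h.mono hXZ, ?_⟩
    rintro _ ⟨x, hx, rfl⟩
    rw [h (hXZ hx)]

/-- Tangent cones are carried along by maps with a differentiable left inverse. -/
theorem tangentConeAt_image {f : E → F} {g : F → E} {X : Set E} {x : E} (hx : x ∈ X)
    (hf : DifferentiableAt ℝ f x) (hg : DifferentiableAt ℝ g (f x)) (h : Set.LeftInvOn g f X) :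
    tangentConeAt ℝ (f '' X) (f x) = fderiv ℝ f x '' tangentConeAt ℝ X x := by
  apply Set.Subset.antisymm
  · intro y hy
    have h1 : fderiv ℝ g (f x) y ∈ tangentConeAt ℝ X x := by
      have := hg.hasFDerivAt.hasFDerivWithinAt (s := f '' X) |>.mapsTo_tangent_cone hy
      rwa [h.image_image, h hx] at this
    refine ⟨_, h1, ?_⟩
    have hx' : g (f x) = x := h hx
    -- Both the composite of the two derivatives and the identity are derivatives of `f ∘ g` within
    -- the image, where `f ∘ g` is the identity; two such derivatives agree on tangent vectors.
    have h2 : HasFDerivWithinAt (f ∘ g) ((fderiv ℝ f x).comp (fderiv ℝ g (f x))) (f '' X) (f x) := by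
      refine (HasFDerivAt.comp (f x) ?_ hg.hasFDerivAt).hasFDerivWithinAt
      rw [hx']; exact hf.hasFDerivAt
    have h3 : HasFDerivWithinAt (f ∘ g) (ContinuousLinearMap.id ℝ F) (f '' X) (f x) := by
      refine (hasFDerivWithinAt_id (𝕜 := ℝ) (f x) (f '' X)).congr ?_ ?_
      · rintro _ ⟨z, hz, rfl⟩
        simp [h hz]
      · simp [hx']
    exact h2.unique_on h3 hy
  · rintro _ ⟨y, hy, rfl⟩
    exact hf.hasFDerivAt.hasFDerivWithinAt.mapsTo_tangent_cone hy

end Smooth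

/-! ### Components and closures under embeddings -/

section Topology

variable {X Y : Type*} [TopologicalSpace X] [TopologicalSpace Y]

/-- No connected subset of `S` can meet both of two disjoint open sets covering it, so a trace that
is itself connected is a whole component. All components below are identified in this way. -/
theorem connectedComponentIn_eq_inter {S u v : Set X} {x : X} (hu : IsOpen u) (hv : IsOpen v)
    (hS : S ⊆ u ∪ v) (huv : Disjoint u v) (hc : IsPreconnected (S ∩ u)) (hx : x ∈ S ∩ u) :
    connectedComponentIn S x = S ∩ u := by
  apply Set.Subset.antisymm
  · refine Set.subset_inter (connectedComponentIn_subset S x) ?_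
    exact isPreconnected_connectedComponentIn.subset_left_of_subset_union hu hv huv
      ((connectedComponentIn_subset S x).trans hS) ⟨x, mem_connectedComponentIn hx.1, hx.2⟩
  · exact hc.subset_connectedComponentIn hx Set.inter_subset_left

/-- `G` embeds the closed set `K` as a closed set, with continuous inverse `g`. -/
structure EmbedsClosed (G : X → Y) (g : Y → X) (K : Set X) : Prop where
  continuousOn : ContinuousOn G K
  continuousOn_inv : ContinuousOn g (G '' K)
  leftInv : Set.LeftInvOn g G K
  isClosed : IsClosed K
  isClosed_image : IsClosed (G '' K)

namespace EmbedsClosed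

variable {G : X → Y} {g : Y → X} {K : Set X}

theorem isClosed_image_of_subset (h : EmbedsClosed G g K) {T : Set X} (hT : IsClosed T)
    (hTK : T ⊆ K) : IsClosed (G '' T) := by
  have : G '' T = G '' K ∩ g ⁻¹' T := by
    ext y
    constructor
    · rintro ⟨x, hx, rfl⟩
      exact ⟨⟨x, hTK hx, rfl⟩, by rw [Set.mem_preimage, h.leftInv (hTK hx)]; exact hx⟩
    · rintro ⟨⟨x, hx, rfl⟩, h2⟩
      rw [Set.mem_preimage, h.leftInv hx] at h2
      exact ⟨x, h2, rfl⟩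
  rw [this]
  exact h.continuousOn_inv.preimage_isClosed_of_isClosed h.isClosed_image hT

theorem closure_image (h : EmbedsClosed G g K) {T : Set X} (hTK : T ⊆ K) :
    closure (G '' T) = G '' closure T := by
  have hcl : closure T ⊆ K := h.isClosed.closure_subset_iff.2 hTK
  apply Set.Subset.antisymm
  · exact (h.isClosed_image_of_subset isClosed_closure hcl).closure_subset_iff.2
      (Set.image_mono subset_closure)
  · exact (h.continuousOn.mono hcl).image_closure

/-- The continuous inverse pulls the component upstairs back into a component downstairs, which
gives the inclusion that continuity of `G` alone does not. -/
theorem connectedComponentIn_image (h : EmbedsClosed G g K) {S : Set X} (hS : S ⊆ K) {x : X}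
    (hx : x ∈ S) : connectedComponentIn (G '' S) (G x) = G '' connectedComponentIn S x := by
  apply Set.Subset.antisymm
  · have h1 := ContinuousOn.image_connectedComponentIn_subset
      (h.continuousOn_inv.mono (Set.image_mono hS)) (Set.mem_image_of_mem G hx)
    rw [(h.leftInv.mono hS).image_image, h.leftInv (hS hx)] at h1
    intro y hy
    obtain ⟨z, hz, rfl⟩ := connectedComponentIn_subset _ _ hy
    refine ⟨z, ?_, rfl⟩
    have := h1 ⟨_, hy, rfl⟩
    rwa [h.leftInv (hS hz)] at this
  · exact ContinuousOn.image_connectedComponentIn_subset (h.continuousOn.mono hS) hx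

theorem mapsTo_inv (h : EmbedsClosed G g K) {T : Set X} (hT : T ⊆ K) :
    Set.MapsTo g (G '' T) T := by
  rintro _ ⟨x, hx, rfl⟩
  rw [h.leftInv (hT hx)]; exact hx

theorem rightInv (h : EmbedsClosed G g K) {T : Set X} (hT : T ⊆ K) :
    ∀ y ∈ G '' T, G (g y) = y := by
  rintro _ ⟨x, hx, rfl⟩
  rw [h.leftInv (hT hx)]

/-- The homeomorphism of a subset of `K` onto its image. -/
noncomputable def homeomorph (h : EmbedsClosed G g K) {T : Set X} (hT : T ⊆ K) : T ≃ₜ (G '' T) where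
  toFun x := ⟨G x, Set.mem_image_of_mem G x.2⟩
  invFun y := ⟨g y, h.mapsTo_inv hT y.2⟩
  left_inv x := Subtype.ext (h.leftInv (hT x.2))
  right_inv y := Subtype.ext (h.rightInv hT y y.2)
  continuous_toFun := (continuousOn_iff_continuous_domRestrict.1
    (h.continuousOn.mono hT)).subtype_mk _
  continuous_invFun := (continuousOn_iff_continuous_domRestrict.1
    (h.continuousOn_inv.mono (Set.image_mono hT))).subtype_mk _

end EmbedsClosed

/-- A continuous bijection of a compact subset onto a subset of a Hausdorff space. -/
noncomputable def homeomorphOfBijOn [T2Space Y] {A : Set X} {B : Set Y} {f : X → Y}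
    (hA : IsCompact A) (hf : ContinuousOn f A) (hb : Set.BijOn f A B) : A ≃ₜ B :=
  haveI : CompactSpace A := isCompact_iff_compactSpace.1 hA
  Continuous.homeoOfEquivCompactToT2 (f := hb.equiv f)
    (((continuousOn_iff_continuous_domRestrict.1 hf).subtype_mk fun x => hb.mapsTo x.2))

end Topology

end FordFaces

namespace FordFaces

/-! ### The model of the spinal surface in the unit sphere of `ℂ²` -/

section Model

/-- The unit sphere of `ℂ²`. -/
def modelSphere : Set (ℂ × ℂ) := {w | Complex.normSq w.1 + Complex.normSq w.2 = 1}

/-- The model of the spinal surface: the points `(v, u)` of the sphere with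
`Re (ū (2s - v)) = 0`. -/
def modelSpinal (s : ℝ) : Set (ℂ × ℂ) :=
  {w | w ∈ modelSphere ∧ w.2.re * (2 * s - w.1.re) - w.2.im * w.1.im = 0}

/-- The model of the first Giraud circle. -/
def modelCircle₁ (s c : ℝ) : Set (ℂ × ℂ) :=
  {w | w ∈ modelSpinal s ∧ -w.1.im = c * Complex.normSq w.1}

/-- The model of the second Giraud circle. -/
def modelCircle₂ (s c : ℝ) : Set (ℂ × ℂ) :=
  {w | w ∈ modelSpinal s ∧ w.1.im = c * Complex.normSq w.1}

/-- The closed bigon (`ε = -1`) and the closed quadrilateral (`ε = 1`) of the model. -/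
def modelClosedPiece (ε s c : ℝ) : Set (ℂ × ℂ) :=
  {w | w ∈ modelSpinal s ∧ |w.1.im| ≤ c * Complex.normSq w.1 ∧ 0 ≤ ε * w.1.re}

/-- The open bigon (`ε = -1`) and the open quadrilateral (`ε = 1`) of the model. -/
def modelPiece (ε s c : ℝ) : Set (ℂ × ℂ) :=
  {w | w ∈ modelSpinal s ∧ |w.1.im| < c * Complex.normSq w.1 ∧ 0 < ε * w.1.re}

theorem isClosed_modelSphere : IsClosed modelSphere :=
  isClosed_eq (by fun_prop) continuous_const

theorem isClosed_modelSpinal (s : ℝ) : IsClosed (modelSpinal s) := by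
  refine isClosed_modelSphere.inter (isClosed_eq ?_ continuous_const)
  fun_prop

theorem isCompact_modelSphere : IsCompact modelSphere := by
  refine (isCompact_closedBall (0 : ℂ × ℂ) 1).of_isClosed_subset isClosed_modelSphere ?_
  intro w hw
  have hw' : Complex.normSq w.1 + Complex.normSq w.2 = 1 := hw
  rw [Complex.normSq_eq_norm_sq, Complex.normSq_eq_norm_sq] at hw'
  rw [mem_closedBall_zero_iff, Prod.norm_def, max_le_iff]
  constructor
  · nlinarith [sq_nonneg ‖w.2‖, norm_nonneg w.1]
  · nlinarith [sq_nonneg ‖w.1‖, norm_nonneg w.2]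

theorem isClosed_modelClosedPiece (ε s c : ℝ) : IsClosed (modelClosedPiece ε s c) := by
  have : modelClosedPiece ε s c = modelSpinal s ∩
      ({w | |w.1.im| ≤ c * Complex.normSq w.1} ∩ {w | 0 ≤ ε * w.1.re}) := rfl
  rw [this]
  refine (isClosed_modelSpinal s).inter ((isClosed_le ?_ ?_).inter (isClosed_le ?_ ?_)) <;> fun_prop

theorem modelClosedPiece_subset (ε s c : ℝ) : modelClosedPiece ε s c ⊆ modelSpinal s :=
  fun _ h => h.1

theorem modelPiece_subset (ε s c : ℝ) : modelPiece ε s c ⊆ modelClosedPiece ε s c :=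
  fun _ h => ⟨h.1, h.2.1.le, h.2.2.le⟩

theorem modelSpinal_subset (s : ℝ) : modelSpinal s ⊆ modelSphere := fun _ h => h.1

theorem normSq_le_one_of_mem_modelSphere {w : ℂ × ℂ} (h : w ∈ modelSphere) :
    Complex.normSq w.1 ≤ 1 := by
  have h' : Complex.normSq w.1 + Complex.normSq w.2 = 1 := h
  linarith [Complex.normSq_nonneg w.2]

/-- The second coordinate of the point of the model over `v`, on the sheet given by the sign
of `r`. -/
noncomputable def sheet (s r : ℝ) (v : ℂ) : ℂ := Complex.I * r * (2 * s - v) / ‖2 * (s : ℂ) - v‖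

/-- The signed modulus of the second coordinate. -/
noncomputable def sheetCoord (s : ℝ) (w : ℂ × ℂ) : ℝ :=
  (w.2.im * (2 * s - w.1.re) + w.2.re * w.1.im) / ‖2 * (s : ℂ) - w.1‖

theorem normSq_two_mul_sub (s : ℝ) (v : ℂ) :
    ‖2 * (s : ℂ) - v‖ ^ 2 = (2 * s - v.re) ^ 2 + v.im ^ 2 := by
  rw [← Complex.normSq_eq_norm_sq, Complex.normSq_apply]
  simp
  ring

theorem norm_sheet_le (s r : ℝ) (v : ℂ) : ‖sheet s r v‖ ≤ |r| := by
  rw [sheet, norm_div, norm_mul, norm_mul, Complex.norm_I, one_mul, Complex.norm_real,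
    Complex.norm_real, norm_norm, Real.norm_eq_abs]
  rcases eq_or_ne (‖2 * (s : ℂ) - v‖) 0 with h | h
  · simp [h]
  · rw [mul_div_cancel_right₀ _ h]

theorem sheet_re (s r : ℝ) (v : ℂ) : (sheet s r v).re = r * v.im / ‖2 * (s : ℂ) - v‖ := by
  rw [sheet, Complex.div_ofReal_re]
  simp

theorem sheet_im (s r : ℝ) (v : ℂ) :
    (sheet s r v).im = r * (2 * s - v.re) / ‖2 * (s : ℂ) - v‖ := by
  rw [sheet, Complex.div_ofReal_im]
  simp

/-- Over `v = 2s` the division by zero returns `0`, so the formula is correct there only for `r =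
0`. This is the origin of the hypothesis `v = 2 * s → r = 0` in later lemmas. -/
theorem normSq_sheet {s r : ℝ} {v : ℂ} (hv : v = 2 * s → r = 0) :
    Complex.normSq (sheet s r v) = r ^ 2 := by
  rcases eq_or_ne v (2 * s) with h | h
  · simp [hv h, sheet]
  · have h0 : ‖2 * (s : ℂ) - v‖ ≠ 0 := norm_ne_zero_iff.2 (sub_ne_zero.2 h.symm)
    rw [Complex.normSq_apply, sheet_re, sheet_im]
    field_simp
    rw [normSq_two_mul_sub]
    ring

theorem sheet_mem {s r : ℝ} {v : ℂ} (h : Complex.normSq v + r ^ 2 = 1)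
    (hv : v = 2 * s → r = 0) : (v, sheet s r v) ∈ modelSpinal s := by
  refine ⟨by simpa [modelSphere, normSq_sheet hv] using h, ?_⟩
  simp only [sheet_re, sheet_im]
  ring

/-- The equation of the model says that `u` is orthogonal to `2s - v`, hence a real multiple of
`i(2s - v)`; `sheetCoord` is the coefficient with respect to the unit vector. -/
theorem sheet_sheetCoord {s : ℝ} {w : ℂ × ℂ} (hw : w ∈ modelSpinal s) (h : w.1 ≠ 2 * s) :
    sheet s (sheetCoord s w) w.1 = w.2 := by
  have h0 : ‖2 * (s : ℂ) - w.1‖ ≠ 0 := norm_ne_zero_iff.2 (sub_ne_zero.2 h.symm)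
  have h1 := hw.2
  apply Complex.ext
  · rw [sheet_re, sheetCoord]
    field_simp
    rw [normSq_two_mul_sub]
    linear_combination (-(2 * s - w.1.re)) * h1
  · rw [sheet_im, sheetCoord]
    field_simp
    rw [normSq_two_mul_sub]
    linear_combination (w.1.im) * h1

theorem sheetCoord_sheet {s r : ℝ} {v : ℂ} (h : v ≠ 2 * s) : sheetCoord s (v, sheet s r v) = r := by
  have h0 : ‖2 * (s : ℂ) - v‖ ≠ 0 := norm_ne_zero_iff.2 (sub_ne_zero.2 h.symm)
  simp only [sheetCoord, sheet_re, sheet_im]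
  field_simp
  rw [normSq_two_mul_sub]

theorem sheetCoord_sq {s : ℝ} {w : ℂ × ℂ} (hw : w ∈ modelSpinal s) (h : w.1 ≠ 2 * s) :
    sheetCoord s w ^ 2 = Complex.normSq w.2 := by
  conv_rhs => rw [← sheet_sheetCoord hw h]
  rw [normSq_sheet fun h' => absurd h' h]

/-- The unit vector has no limit at `v = 2s`, but it is bounded, so continuity survives there as
soon as `r` tends to `0`. -/
theorem continuousAt_sheet {s : ℝ} {p : ℝ × ℂ} (h : p.2 = 2 * s → p.1 = 0) :
    ContinuousAt (fun p : ℝ × ℂ => sheet s p.1 p.2) p := by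
  rcases eq_or_ne p.2 (2 * s) with h' | h'
  · have h0 : sheet s p.1 p.2 = 0 := by simp [h h', sheet]
    rw [ContinuousAt, h0]
    refine squeeze_zero_norm (fun q => norm_sheet_le s q.1 q.2) ?_
    have : ContinuousAt (fun q : ℝ × ℂ => |q.1|) p := by fun_prop
    simpa [ContinuousAt, h h'] using this
  · have h0 : ((‖2 * (s : ℂ) - p.2‖ : ℝ) : ℂ) ≠ 0 := by
      exact_mod_cast norm_ne_zero_iff.2 (sub_ne_zero.2 h'.symm)
    unfold sheet
    fun_prop (disch := exact h0)

/-! ### The planar parametrization of the bigon and of the quadrilateral -/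

/-- The region between two parabolas. -/
def parabolicRegion (c : ℝ) : Set ℂ := {z | |z.im| < c * (1 - z.re ^ 2)}

/-- The closed region between two parabolas. -/
def closedParabolicRegion (c : ℝ) : Set ℂ := {z | |z.im| ≤ c * (1 - z.re ^ 2)}

theorem parabolicRegion_subset (c : ℝ) : parabolicRegion c ⊆ closedParabolicRegion c := by
  intro z hz
  have h : |z.im| < c * (1 - z.re ^ 2) := hz
  exact h.le

theorem isOpen_parabolicRegion (c : ℝ) : IsOpen (parabolicRegion c) :=
  isOpen_lt (by fun_prop) (by fun_prop)

theorem isClosed_closedParabolicRegion (c : ℝ) : IsClosed (closedParabolicRegion c) :=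
  isClosed_le (by fun_prop) (by fun_prop)

theorem convex_parabolicRegion {c : ℝ} (hc : 0 < c) : Convex ℝ (parabolicRegion c) := by
  intro x hx y hy a b ha hb hab
  simp only [parabolicRegion, Set.mem_ofPred_eq, Complex.add_im, Complex.add_re,
    Complex.real_smul, Complex.mul_im, Complex.mul_re, Complex.ofReal_re, Complex.ofReal_im,
    zero_mul, add_zero, sub_zero] at *
  have h1 : |a * x.im + b * y.im| ≤ a * |x.im| + b * |y.im| := by
    refine (abs_add_le _ _).trans ?_
    rw [abs_mul, abs_mul, abs_of_nonneg ha, abs_of_nonneg hb]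
  have h2 : a * |x.im| + b * |y.im| < a * (c * (1 - x.re ^ 2)) + b * (c * (1 - y.re ^ 2)) := by
    rcases ha.eq_or_lt with h | h
    · have : b = 1 := by linarith
      subst h this; simpa using hy
    · exact add_lt_add_of_lt_of_le (mul_lt_mul_of_pos_left hx h)
        (mul_le_mul_of_nonneg_left hy.le hb)
  have h3 : (a * x.re + b * y.re) ^ 2 ≤ a * x.re ^ 2 + b * y.re ^ 2 := by
    have : b = 1 - a := by linarith
    subst this
    nlinarith [mul_nonneg (mul_nonneg ha hb) (sq_nonneg (x.re - y.re))]
  have : b = 1 - a := by linarith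
  subst this
  nlinarith

theorem re_sq_le_one {c : ℝ} (hc : 0 < c) {z : ℂ} (hz : z ∈ closedParabolicRegion c) :
    z.re ^ 2 ≤ 1 := by
  have h : |z.im| ≤ c * (1 - z.re ^ 2) := hz
  by_contra! h'
  nlinarith [abs_nonneg z.im]

theorem closedParabolicRegion_bound {c : ℝ} (hc : 0 < c) {z : ℂ}
    (hz : z ∈ closedParabolicRegion c) : z.im ^ 2 ≤ c ^ 2 * (1 - z.re ^ 2) := by
  have h : |z.im| ≤ c * (1 - z.re ^ 2) := hz
  have h1 := re_sq_le_one hc hz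
  have h2 : |z.im| ^ 2 ≤ (c * (1 - z.re ^ 2)) ^ 2 := pow_le_pow_left₀ (abs_nonneg _) h 2
  rw [sq_abs] at h2
  nlinarith [sq_nonneg z.re, sq_nonneg c,
    mul_nonneg (sq_nonneg c) (mul_nonneg (sub_nonneg.2 h1) (sq_nonneg z.re))]

/-- The assumption `c < 1` places the region inside the unit disk, which keeps the radicand of
`pieceBase` nonnegative. -/
theorem closedParabolicRegion_bound' {c : ℝ} (hc : 0 < c) (hc1 : c < 1) {z : ℂ}
    (hz : z ∈ closedParabolicRegion c) : 0 ≤ 1 - z.re ^ 2 - z.im ^ 2 := by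
  have h := closedParabolicRegion_bound hc hz
  have h1 := re_sq_le_one hc hz
  have h2 : c ^ 2 ≤ 1 := by nlinarith
  nlinarith [mul_le_mul_of_nonneg_right h2 (sub_nonneg.2 h1)]

theorem isBounded_parabolicRegion {c : ℝ} (hc : 0 < c) (hc1 : c < 1) :
    Bornology.IsBounded (parabolicRegion c) := by
  refine (Metric.isBounded_closedBall (x := (0 : ℂ)) (r := 1)).subset fun z hz => ?_
  have h := closedParabolicRegion_bound' hc hc1 (parabolicRegion_subset c hz)
  rw [mem_closedBall_zero_iff]
  have : ‖z‖ ^ 2 ≤ 1 := by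
    rw [← Complex.normSq_eq_norm_sq, Complex.normSq_apply]; nlinarith
  nlinarith [norm_nonneg z]

/-- The points of the closed region are limits of points off the real axis. -/
theorem mem_closure_parabolicRegion {c : ℝ} (hc : 0 < c) {z : ℂ}
    (hz : z ∈ closedParabolicRegion c) :
    z ∈ closure (parabolicRegion c ∩ {z | z.im ≠ 0}) := by
  have h : |z.im| ≤ c * (1 - z.re ^ 2) := hz
  obtain ⟨σ, hσ, hσz⟩ : ∃ σ : ℝ, |σ| = 1 ∧ z.im = σ * |z.im| := by
    rcases le_total 0 z.im with h' | h'
    · exact ⟨1, by simp, by rw [abs_of_nonneg h', one_mul]⟩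
    · exact ⟨-1, by simp, by rw [abs_of_nonpos h']; ring⟩
  have hσ0 : σ ≠ 0 := by rintro rfl; simp at hσ
  -- The real part is contracted towards `0` while the modulus of the imaginary part moves towards
  -- `c/2`, strictly inside the region. For real `z` the side `σ` is immaterial.
  let g : ℝ → ℂ := fun t => (t * z.re : ℝ) + (σ * (t * |z.im| + (1 - t) * (c / 2)) : ℝ) * Complex.I
  have hg : Filter.Tendsto g (𝓝[<] 1) (𝓝 z) := by
    have h1 : ContinuousAt g 1 := by
      have : Continuous g := by fun_prop
      exact this.continuousAt
    have h2 : g 1 = z := by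
      apply Complex.ext <;> simp [g, ← hσz]
    rw [ContinuousAt, h2] at h1
    exact h1.mono_left nhdsWithin_le_nhds
  refine mem_closure_of_tendsto hg ?_
  filter_upwards [Ioo_mem_nhdsLT (zero_lt_one' ℝ)] with t ht
  have hre : (g t).re = t * z.re := by simp [g]
  have him : (g t).im = σ * (t * |z.im| + (1 - t) * (c / 2)) := by simp [g]
  have hpos : 0 < t * |z.im| + (1 - t) * (c / 2) := by
    have := mul_nonneg ht.1.le (abs_nonneg z.im)
    have := mul_pos (sub_pos.2 ht.2) (half_pos hc)
    linarith
  constructor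
  · change |(g t).im| < c * (1 - (g t).re ^ 2)
    rw [hre, him, abs_mul, hσ, one_mul, abs_of_pos hpos]
    have h1 : t * |z.im| ≤ t * (c * (1 - z.re ^ 2)) := mul_le_mul_of_nonneg_left h ht.1.le
    have h2 : 0 < c * (1 - t) * (1 / 2 + t * z.re ^ 2) :=
      mul_pos (mul_pos hc (sub_pos.2 ht.2)) (by have := mul_nonneg ht.1.le (sq_nonneg z.re); linarith)
    nlinarith
  · change (g t).im ≠ 0
    rw [him]
    exact mul_ne_zero hσ0 hpos.ne'

theorem closure_parabolicRegion {c : ℝ} (hc : 0 < c) :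
    closure (parabolicRegion c) = closedParabolicRegion c :=
  Set.Subset.antisymm
    ((isClosed_closedParabolicRegion c).closure_subset_iff.2
      (parabolicRegion_subset c))
    fun _ hz => closure_mono Set.inter_subset_left (mem_closure_parabolicRegion hc hz)

/-- The parametrization of the bigon (`ε = -1`) and of the quadrilateral (`ε = 1`). -/
noncomputable def pieceBase (ε : ℝ) (z : ℂ) : ℂ :=
  (ε * √(1 - z.re ^ 2 - z.im ^ 2) : ℝ) + (z.im : ℝ) * Complex.I

noncomputable def pieceParam (ε s : ℝ) (z : ℂ) : ℂ × ℂ :=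
  (pieceBase ε z, sheet s z.re (pieceBase ε z))

@[simp] theorem pieceBase_re (ε : ℝ) (z : ℂ) :
    (pieceBase ε z).re = ε * √(1 - z.re ^ 2 - z.im ^ 2) := by simp [pieceBase]

@[simp] theorem pieceBase_im (ε : ℝ) (z : ℂ) : (pieceBase ε z).im = z.im := by simp [pieceBase]

theorem continuous_pieceBase (ε : ℝ) : Continuous (pieceBase ε) := by
  unfold pieceBase
  fun_prop

/-- This identity is the reason for the parabolas: with `|v|² = 1 - r²`, the condition `|Im v| ≤
c|v|²` becomes the definition of the region in the plane of `(r, Im v)`. -/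
theorem normSq_pieceBase {ε c : ℝ} (hε : ε ^ 2 = 1) (hc : 0 < c) (hc1 : c < 1) {z : ℂ}
    (hz : z ∈ closedParabolicRegion c) : Complex.normSq (pieceBase ε z) = 1 - z.re ^ 2 := by
  rw [Complex.normSq_apply, pieceBase_re, pieceBase_im]
  have := Real.sq_sqrt (closedParabolicRegion_bound' hc hc1 hz)
  linear_combination ε ^ 2 * this + (1 - z.re ^ 2 - z.im ^ 2) * hε

theorem continuousAt_pieceParam {ε s : ℝ} {z : ℂ} (h : pieceBase ε z = 2 * s → z.re = 0) :
    ContinuousAt (pieceParam ε s) z := by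
  have h1 : ContinuousAt (fun z : ℂ => (z.re, pieceBase ε z)) z :=
    (Complex.continuous_re.prodMk (continuous_pieceBase ε)).continuousAt
  have h2 : ContinuousAt (fun p : ℝ × ℂ => sheet s p.1 p.2) (z.re, pieceBase ε z) :=
    continuousAt_sheet h
  have h3 : ContinuousAt ((fun p : ℝ × ℂ => sheet s p.1 p.2) ∘
      (fun z : ℂ => (z.re, pieceBase ε z))) z := ContinuousAt.comp h2 h1
  exact ContinuousAt.prodMk (continuous_pieceBase ε).continuousAt h3

theorem pieceParam_mem {ε s c : ℝ} (hε : ε ^ 2 = 1) (hc : 0 < c) (hc1 : c < 1) {z : ℂ}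
    (hz : z ∈ closedParabolicRegion c) (h : pieceBase ε z = 2 * s → z.re = 0) :
    pieceParam ε s z ∈ modelClosedPiece ε s c := by
  have h1 := normSq_pieceBase hε hc hc1 hz
  have h2 : |(pieceBase ε z).im| ≤ c * Complex.normSq (pieceBase ε z) := by
    rw [h1, pieceBase_im]; exact hz
  have h3 : 0 ≤ ε * (pieceBase ε z).re := by
    rw [pieceBase_re, ← mul_assoc, ← sq, hε, one_mul]; positivity
  exact ⟨sheet_mem (by rw [h1]; ring) h, h2, h3⟩

theorem pieceParam_mem_piece {ε s c : ℝ} (hε : ε ^ 2 = 1) (hc : 0 < c) (hc1 : c < 1) {z : ℂ}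
    (hz : z ∈ parabolicRegion c) (h : pieceBase ε z = 2 * s → z.re = 0) :
    pieceParam ε s z ∈ modelPiece ε s c := by
  have hz' : z ∈ closedParabolicRegion c := parabolicRegion_subset c hz
  have h1 := normSq_pieceBase hε hc hc1 hz'
  have h2 := pieceParam_mem hε hc hc1 hz' h
  have h3 := closedParabolicRegion_bound hc hz'
  have h4 : |z.im| < c * (1 - z.re ^ 2) := hz
  have h5 : 0 < 1 - z.re ^ 2 := by
    by_contra! h5
    nlinarith [abs_nonneg z.im]
  have h6 : |(pieceBase ε z).im| < c * Complex.normSq (pieceBase ε z) := by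
    rw [h1, pieceBase_im]; exact hz
  have h7 : 0 < ε * (pieceBase ε z).re := by
    rw [pieceBase_re, ← mul_assoc, ← sq, hε, one_mul]
    apply Real.sqrt_pos.2
    nlinarith [mul_pos (mul_pos (sub_pos.2 hc1) (by linarith : 0 < 1 + c)) h5]
  exact ⟨h2.1, h6, h7⟩

/-- The point of the planar region corresponding to a point of a piece. -/
noncomputable def pieceCoord (s : ℝ) (w : ℂ × ℂ) : ℂ := (sheetCoord s w : ℝ) + (w.1.im : ℝ) * Complex.I

@[simp] theorem pieceCoord_re (s : ℝ) (w : ℂ × ℂ) : (pieceCoord s w).re = sheetCoord s w := by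
  simp [pieceCoord]

@[simp] theorem pieceCoord_im (s : ℝ) (w : ℂ × ℂ) : (pieceCoord s w).im = w.1.im := by
  simp [pieceCoord]

theorem sheetCoord_eq_zero {s : ℝ} {w : ℂ × ℂ} (h : w.1 = 2 * s) : sheetCoord s w = 0 := by
  simp [sheetCoord, h]

theorem pieceBase_pieceCoord {ε s : ℝ} (hε : ε ^ 2 = 1) {w : ℂ × ℂ} (hw : w ∈ modelSpinal s)
    (h : w.1 = 2 * s → w.2 = 0) (hre : 0 ≤ ε * w.1.re) : pieceBase ε (pieceCoord s w) = w.1 := by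
  have hsq : sheetCoord s w ^ 2 = Complex.normSq w.2 := by
    by_cases h' : w.1 = 2 * s
    · rw [sheetCoord_eq_zero h', h h']; simp
    · exact sheetCoord_sq hw h'
  have h1 : Complex.normSq w.1 + Complex.normSq w.2 = 1 := hw.1
  have h2 : 1 - sheetCoord s w ^ 2 - w.1.im ^ 2 = (ε * w.1.re) ^ 2 := by
    rw [hsq, mul_pow, hε]
    rw [Complex.normSq_apply w.1] at h1
    linarith
  apply Complex.ext
  · rw [pieceBase_re, pieceCoord_re, pieceCoord_im, h2, Real.sqrt_sq hre]
    linear_combination w.1.re * hε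
  · simp

theorem pieceParam_pieceCoord {ε s : ℝ} (hε : ε ^ 2 = 1) {w : ℂ × ℂ} (hw : w ∈ modelSpinal s)
    (h : w.1 = 2 * s → w.2 = 0) (hre : 0 ≤ ε * w.1.re) : pieceParam ε s (pieceCoord s w) = w := by
  have h1 := pieceBase_pieceCoord hε hw h hre
  refine Prod.ext h1 ?_
  simp only [pieceParam, h1, pieceCoord_re]
  by_cases h' : w.1 = 2 * s
  · rw [h h', h', sheet]; simp
  · exact sheet_sheetCoord hw h'

theorem normSq_add_sheetCoord_sq {s : ℝ} {w : ℂ × ℂ} (hw : w ∈ modelSpinal s)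
    (h : w.1 = 2 * s → w.2 = 0) : Complex.normSq w.1 = 1 - sheetCoord s w ^ 2 := by
  have h1 : Complex.normSq w.1 + Complex.normSq w.2 = 1 := hw.1
  by_cases h' : w.1 = 2 * s
  · rw [sheetCoord_eq_zero h']
    rw [h h'] at h1
    simpa using h1
  · rw [sheetCoord_sq hw h']; linarith

theorem pieceCoord_mem {ε s c : ℝ} {w : ℂ × ℂ} (hw : w ∈ modelClosedPiece ε s c)
    (h : w.1 = 2 * s → w.2 = 0) : pieceCoord s w ∈ closedParabolicRegion c := by
  have := hw.2.1
  rw [normSq_add_sheetCoord_sq hw.1 h] at this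
  simpa [closedParabolicRegion] using this

theorem pieceCoord_pieceParam {ε s : ℝ} {z : ℂ} (h : pieceBase ε z = 2 * s → z.re = 0) :
    pieceCoord s (pieceParam ε s z) = z := by
  apply Complex.ext
  · rw [pieceCoord_re]
    by_cases h' : pieceBase ε z = 2 * s
    · rw [h h', sheetCoord_eq_zero]
      exact h'
    · exact sheetCoord_sheet h'
  · simp [pieceParam]

end Model

end FordFaces

namespace FordFaces

/-! ### The two caps beyond the Giraud circles, and complex conjugation. -/

section Pieces

/-- The side of the first Giraud circle. -/
def modelCap₁ (s c : ℝ) : Set (ℂ × ℂ) :=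
  {w | w ∈ modelSpinal s ∧ c * Complex.normSq w.1 < -w.1.im}

/-- The side of the second Giraud circle. -/
def modelCap₂ (s c : ℝ) : Set (ℂ × ℂ) :=
  {w | w ∈ modelSpinal s ∧ c * Complex.normSq w.1 < w.1.im}

/-- Complex conjugation on `ℂ²`. -/
def conjPair (w : ℂ × ℂ) : ℂ × ℂ := (starRingEnd ℂ w.1, starRingEnd ℂ w.2)

theorem conjPair_conjPair (w : ℂ × ℂ) : conjPair (conjPair w) = w := by simp [conjPair]

theorem continuous_conjPair : Continuous conjPair := by
  unfold conjPair
  exact (Complex.continuous_conj.comp continuous_fst).prodMk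
    (Complex.continuous_conj.comp continuous_snd)

theorem conjPair_mem_modelSpinal {s : ℝ} {w : ℂ × ℂ} (h : w ∈ modelSpinal s) :
    conjPair w ∈ modelSpinal s := by
  have h1 : Complex.normSq w.1 + Complex.normSq w.2 = 1 := h.1
  have h2 := h.2
  refine ⟨?_, ?_⟩
  · change Complex.normSq (starRingEnd ℂ w.1) + Complex.normSq (starRingEnd ℂ w.2) = 1
    rw [Complex.normSq_conj, Complex.normSq_conj, h1]
  · simp only [conjPair, Complex.conj_re, Complex.conj_im]
    linarith

theorem conjPair_image {A B : Set (ℂ × ℂ)} (h : ∀ w ∈ A, conjPair w ∈ B)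
    (h' : ∀ w ∈ B, conjPair w ∈ A) : conjPair '' A = B :=
  Set.Subset.antisymm (by rintro _ ⟨w, hw, rfl⟩; exact h w hw)
    fun w hw => ⟨conjPair w, h' w hw, conjPair_conjPair w⟩

theorem conjPair_image_modelCap₁ (s c : ℝ) : conjPair '' modelCap₁ s c = modelCap₂ s c := by
  apply conjPair_image
  · intro w hw
    refine ⟨conjPair_mem_modelSpinal hw.1, ?_⟩
    have := hw.2
    simpa [conjPair] using this
  · intro w hw
    refine ⟨conjPair_mem_modelSpinal hw.1, ?_⟩
    have := hw.2
    simpa [conjPair] using this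

theorem conjPair_image_modelCircle₁ (s c : ℝ) :
    conjPair '' modelCircle₁ s c = modelCircle₂ s c := by
  apply conjPair_image
  · intro w hw
    refine ⟨conjPair_mem_modelSpinal hw.1, ?_⟩
    have := hw.2
    simpa [conjPair] using this
  · intro w hw
    refine ⟨conjPair_mem_modelSpinal hw.1, ?_⟩
    have := hw.2
    simpa [conjPair] using this

/-- The condition `c|v|² < -Im v` describes an open round disk, and the set is its intersection with
the closed unit disk. -/
theorem convex_lowerDisk {c : ℝ} (hc : 0 < c) :
    Convex ℝ {v : ℂ | Complex.normSq v ≤ 1 ∧ c * Complex.normSq v < -v.im} := by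
  intro x hx y hy a b ha hb hab
  simp only [Set.mem_ofPred_eq, Complex.normSq_apply, Complex.add_im, Complex.add_re,
    Complex.real_smul, Complex.mul_im, Complex.mul_re, Complex.ofReal_re, Complex.ofReal_im,
    zero_mul, add_zero, sub_zero] at *
  have hb' : b = 1 - a := by linarith
  have h3 : (a * x.re + b * y.re) * (a * x.re + b * y.re) +
      (a * x.im + b * y.im) * (a * x.im + b * y.im) ≤
      a * (x.re * x.re + x.im * x.im) + b * (y.re * y.re + y.im * y.im) := by
    subst hb'
    nlinarith [mul_nonneg (mul_nonneg ha hb) (sq_nonneg (x.re - y.re)),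
      mul_nonneg (mul_nonneg ha hb) (sq_nonneg (x.im - y.im))]
  constructor
  · refine h3.trans ?_
    have := mul_le_mul_of_nonneg_left hx.1 ha
    have := mul_le_mul_of_nonneg_left hy.1 hb
    linarith
  · have h4 := mul_le_mul_of_nonneg_left h3 hc.le
    refine h4.trans_lt ?_
    rcases ha.eq_or_lt with h | h
    · have : b = 1 := by linarith
      subst h this; simpa using hy.2
    · have h5 := mul_lt_mul_of_pos_left hx.2 h
      have h6 := mul_le_mul_of_nonneg_left hy.2.le hb
      linarith

/-- The cap is the union of two sheets over a convex set which avoids the real point `2s`. Both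
sheets contain `(-i, 0)`, because `r = 0` when `|v| = 1`. -/
theorem isPreconnected_modelCap₁ {s c : ℝ} (hc : 0 < c) (hc1 : c < 1) :
    IsPreconnected (modelCap₁ s c) := by
  set K := {v : ℂ | Complex.normSq v ≤ 1 ∧ c * Complex.normSq v < -v.im} with hK
  have hne : ∀ v ∈ K, v ≠ 2 * s := by
    rintro v hv rfl
    have := hv.2
    have h0 := mul_nonneg hc.le (Complex.normSq_nonneg (2 * (s : ℂ)))
    simp only [Complex.mul_im, Complex.ofReal_im, Complex.ofReal_re, Complex.im_ofNat,
      Complex.re_ofNat] at this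
    linarith
  let f : ℝ → ℂ → ℂ × ℂ := fun σ v => (v, sheet s (σ * √(1 - Complex.normSq v)) v)
  have hf : ∀ σ, ContinuousOn (f σ) K := by
    intro σ v hv
    refine ContinuousAt.continuousWithinAt ?_
    have h1 : ContinuousAt (fun v : ℂ => (σ * √(1 - Complex.normSq v), v)) v := by
      have : Continuous (fun v : ℂ => (σ * √(1 - Complex.normSq v), v)) := by fun_prop
      exact this.continuousAt
    have h2 : ContinuousAt (fun p : ℝ × ℂ => sheet s p.1 p.2) (σ * √(1 - Complex.normSq v), v) :=
      continuousAt_sheet fun h => absurd h (hne v hv)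
    have h3 : ContinuousAt ((fun p : ℝ × ℂ => sheet s p.1 p.2) ∘
      (fun v : ℂ => (σ * √(1 - Complex.normSq v), v))) v := ContinuousAt.comp h2 h1
    exact ContinuousAt.prodMk continuousAt_id h3
  have hKc : IsPreconnected K := (convex_lowerDisk hc).isPreconnected
  have hI : -Complex.I ∈ K := by simp [hK, hc1]
  have hI' : ∀ σ, f σ (-Complex.I) = (-Complex.I, 0) := by intro σ; simp [f, sheet]
  have hU := IsPreconnected.union (-Complex.I, 0) (hI' 1 ▸ Set.mem_image_of_mem (f 1) hI)
    (hI' (-1) ▸ Set.mem_image_of_mem (f (-1)) hI) (hKc.image _ (hf 1)) (hKc.image _ (hf (-1)))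
  convert hU using 1
  have hmem : ∀ σ : ℝ, σ ^ 2 = 1 → ∀ v ∈ K, f σ v ∈ modelCap₁ s c := by
    intro σ hσ v hv
    refine ⟨sheet_mem ?_ fun h => absurd h (hne v hv), hv.2⟩
    rw [mul_pow, hσ, Real.sq_sqrt (sub_nonneg.2 hv.1)]
    ring
  ext w
  constructor
  · intro hw
    have hv : w.1 ∈ K := ⟨normSq_le_one_of_mem_modelSphere hw.1.1, hw.2⟩
    have h1 := sheet_sheetCoord hw.1 (hne _ hv)
    have h2 := sheetCoord_sq hw.1 (hne _ hv)
    have h4 : Complex.normSq w.1 + Complex.normSq w.2 = 1 := hw.1.1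
    have h5 : √(1 - Complex.normSq w.1) = |sheetCoord s w| := by
      rw [← Real.sqrt_sq_eq_abs, h2]; congr 1; linarith
    rcases le_total 0 (sheetCoord s w) with h | h
    · left
      refine ⟨w.1, hv, Prod.ext rfl ?_⟩
      change sheet s (1 * √(1 - Complex.normSq w.1)) w.1 = w.2
      rw [h5, abs_of_nonneg h, one_mul, h1]
    · right
      refine ⟨w.1, hv, Prod.ext rfl ?_⟩
      change sheet s (-1 * √(1 - Complex.normSq w.1)) w.1 = w.2
      rw [h5, abs_of_nonpos h, neg_mul_neg, one_mul, h1]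
  · rintro (⟨v, hv, rfl⟩ | ⟨v, hv, rfl⟩)
    · exact hmem 1 (by norm_num) v hv
    · exact hmem (-1) (by norm_num) v hv

theorem isPreconnected_modelCap₂ {s c : ℝ} (hc : 0 < c) (hc1 : c < 1) :
    IsPreconnected (modelCap₂ s c) := by
  rw [← conjPair_image_modelCap₁]
  exact (isPreconnected_modelCap₁ hc hc1).image _ continuous_conjPair.continuousOn

/-! ### Bigon and quadrilateral as disks -/

theorem pieceParam_bijOn {ε s c : ℝ} (hε : ε ^ 2 = 1) (hc : 0 < c) (hc1 : c < 1)
    (h : ∀ z, pieceBase ε z = 2 * s → z.re = 0) :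
    Set.BijOn (pieceParam ε s) (closedParabolicRegion c) (modelClosedPiece ε s c) := by
  refine ⟨fun z hz => pieceParam_mem hε hc hc1 hz (h z), ?_, ?_⟩
  · intro z _ z' _ hzz
    rw [← pieceCoord_pieceParam (h z), hzz, pieceCoord_pieceParam (h z')]
  · intro w hw
    have h2 : w.1 = 2 * s → w.2 = 0 := by
      intro hw1
      have h3 : Complex.normSq w.1 + Complex.normSq w.2 = 1 := hw.1.1
      have h4 := hw.2.2
      have hi : w.1.im = 0 := by rw [hw1]; simp
      have h5 : 0 ≤ 1 - w.1.re ^ 2 := by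
        rw [Complex.normSq_apply w.1, hi] at h3
        nlinarith [Complex.normSq_nonneg w.2]
      -- The hypothesis is tested on the real parameter lying over `w.1 = 2s`. It forces `1 - (Re
      -- v)² = 0`, hence `|v| = 1` and `u = 0`.
      have h6 := h (√(1 - w.1.re ^ 2) : ℝ) (by
        apply Complex.ext
        · rw [pieceBase_re, Complex.ofReal_re, Complex.ofReal_im, Real.sq_sqrt h5, ← hw1]
          have : 1 - (1 - w.1.re ^ 2) - 0 ^ 2 = (ε * w.1.re) ^ 2 := by rw [mul_pow, hε]; ring
          rw [this, Real.sqrt_sq h4]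
          linear_combination w.1.re * hε
        · rw [pieceBase_im, Complex.ofReal_im, ← hw1, hi])
      rw [Complex.ofReal_re] at h6
      have h7 : 1 - w.1.re ^ 2 = 0 := (Real.sqrt_eq_zero h5).1 h6
      rw [Complex.normSq_apply w.1, hi] at h3
      apply Complex.normSq_eq_zero.1
      linarith
    exact ⟨pieceCoord s w, pieceCoord_mem hw h2, pieceParam_pieceCoord hε hw.1 h2 hw.2.2⟩

/-- The parameter region is a bounded convex set with interior, so its closure is homeomorphic to
the closed ball with frontier going to the sphere. The frontier consists of the points of equality
in the defining inequality. -/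
theorem exists_homeomorph_modelClosedPiece {ε s c : ℝ} (hε : ε ^ 2 = 1) (hc : 0 < c) (hc1 : c < 1)
    (h : ∀ z, pieceBase ε z = 2 * s → z.re = 0) :
    ∃ e : Metric.closedBall (0 : ℂ) 1 ≃ₜ modelClosedPiece ε s c,
      ∀ x : Metric.closedBall (0 : ℂ) 1, ‖(x : ℂ)‖ = 1 ↔ |(e x : ℂ × ℂ).1.im| = c * Complex.normSq (e x : ℂ × ℂ).1 := by
  have ho := isOpen_parabolicRegion c
  obtain ⟨g, hg1, hg2, hg3⟩ := exists_homeomorph_image_interior_closure_frontier_eq_unitBall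
    (convex_parabolicRegion hc) (by
      rw [ho.interior_eq]
      exact ⟨0, by simp [parabolicRegion, hc]⟩) (isBounded_parabolicRegion hc hc1)
  rw [closure_parabolicRegion hc] at hg2
  have hcpt : IsCompact (closedParabolicRegion c) := by
    rw [← closure_parabolicRegion hc]
    exact (isBounded_parabolicRegion hc hc1).isCompact_closure
  have hcont : ContinuousOn (pieceParam ε s) (closedParabolicRegion c) := fun z _ =>
    (continuousAt_pieceParam (h z)).continuousWithinAt
  let e₂ := homeomorphOfBijOn hcpt hcont (pieceParam_bijOn hε hc hc1 h)
  let e₁ : closedParabolicRegion c ≃ₜ Metric.closedBall (0 : ℂ) 1 :=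
    (g.image _).trans (Homeomorph.setCongr hg2)
  refine ⟨e₁.symm.trans e₂, fun x => ?_⟩
  obtain ⟨z, rfl⟩ := e₁.surjective x
  have h1 : ((e₁.symm.trans e₂) (e₁ z) : ℂ × ℂ) = pieceParam ε s z := by
    rw [Homeomorph.trans_apply, Homeomorph.symm_apply_apply]
    rfl
  have h2 : (e₁ z : ℂ) = g z := rfl
  rw [h1, h2]
  have h3 : ‖g z‖ = 1 ↔ (z : ℂ) ∈ frontier (parabolicRegion c) := by
    rw [← mem_sphere_zero_iff_norm, ← hg3, g.injective.mem_set_image]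
  have h4 : (pieceParam ε s z).1 = pieceBase ε z := rfl
  rw [h3, ho.frontier_eq, closure_parabolicRegion hc, h4, normSq_pieceBase hε hc hc1 z.2,
    pieceBase_im]
  constructor
  · rintro ⟨h5, h6⟩
    have h5' : |(z : ℂ).im| ≤ c * (1 - (z : ℂ).re ^ 2) := h5
    exact h5'.antisymm (not_lt.1 h6)
  · intro h5
    exact ⟨z.2, fun h6 => absurd h5 (ne_of_lt h6)⟩

/-- The bigon lies in `Re v ≤ 0`, so it never meets the exceptional fibre over `2s > 0`. -/
theorem pieceBase_neg_ne {s : ℝ} (hs : 0 < s) (z : ℂ) : pieceBase (-1) z = 2 * s → z.re = 0 := by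
  intro h
  have h1 := congrArg Complex.re h
  rw [pieceBase_re] at h1
  simp only [Complex.mul_re, Complex.ofReal_re, Complex.ofReal_im, Complex.re_ofNat,
    Complex.im_ofNat] at h1
  have := Real.sqrt_nonneg (1 - z.re ^ 2 - z.im ^ 2)
  linarith

/-- This is where the threshold enters: for `2s ≥ 1` the point `2s` can belong to the unit disk only
as a boundary point, and there `r = 0`. -/
theorem pieceBase_one_ne {s : ℝ} (hs : 1 / 2 ≤ s) (z : ℂ) : pieceBase 1 z = 2 * s → z.re = 0 := by
  intro h
  have h1 := congrArg Complex.re h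
  rw [pieceBase_re] at h1
  simp only [Complex.mul_re, Complex.ofReal_re, Complex.ofReal_im, Complex.re_ofNat,
    Complex.im_ofNat] at h1
  have h2 := Real.sqrt_le_sqrt (show 1 - z.re ^ 2 - z.im ^ 2 ≤ 1 - z.re ^ 2 by nlinarith)
  have h3 : (1 : ℝ) ≤ √(1 - z.re ^ 2) := by linarith
  have h4 := (Real.le_sqrt' one_pos).1 h3
  nlinarith [sq_nonneg z.re]

/-! ### Connectedness and closure of the pieces -/

/-- Parameters off the real axis never lie over the real point `2s`, and they are dense. Approaching
through them treats the disk case and the torus case uniformly. -/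
theorem mem_closure_modelPiece_aux {ε s c : ℝ} (hε : ε ^ 2 = 1) (hc : 0 < c)
    {w : ℂ × ℂ} (hw : w ∈ modelClosedPiece ε s c) (h : w.1 = 2 * s → w.2 = 0) :
    w ∈ closure (pieceParam ε s '' (parabolicRegion c ∩ {z | z.im ≠ 0})) := by
  have h1 := mem_closure_parabolicRegion hc (pieceCoord_mem hw h)
  have h2 : ContinuousAt (pieceParam ε s) (pieceCoord s w) := by
    apply continuousAt_pieceParam
    rw [pieceBase_pieceCoord hε hw.1 h hw.2.2, pieceCoord_re]
    exact sheetCoord_eq_zero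
  have h3 := mem_closure_image h2 h1
  rwa [pieceParam_pieceCoord hε hw.1 h hw.2.2] at h3

/-- For a point over `v = 2s` with `u ≠ 0`, moving `v` in the direction `i u` keeps `2s - v`
orthogonal to `u`, and rescaling `u` keeps the point on the sphere. The nearby points no longer lie
over `2s`, so the previous lemma applies to them, and taking the closure twice finishes. -/
theorem mem_closure_modelPiece {ε s c : ℝ} (hε : ε ^ 2 = 1) (hc : 0 < c)
    (hs : 0 < s) {w : ℂ × ℂ} (hw : w ∈ modelClosedPiece ε s c) :
    w ∈ closure (pieceParam ε s '' (parabolicRegion c ∩ {z | z.im ≠ 0})) := by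
  by_cases h : w.1 = 2 * s → w.2 = 0
  · exact mem_closure_modelPiece_aux hε hc hw h
  push Not at h
  obtain ⟨hw1, hw2⟩ := h
  have hn : ((‖w.2‖ : ℝ) : ℂ) ≠ 0 := by exact_mod_cast norm_ne_zero_iff.2 hw2
  have hn' : ‖w.2‖ ≠ 0 := norm_ne_zero_iff.2 hw2
  have hsph : Complex.normSq w.1 + Complex.normSq w.2 = 1 := hw.1.1
  -- nearby points of the surface lying over the punctured neighbourhood
  let v : ℝ → ℂ := fun δ => 2 * s + δ * (Complex.I * w.2 / ‖w.2‖)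
  let g : ℝ → ℂ × ℂ := fun δ => (v δ, (√(1 - Complex.normSq (v δ)) / ‖w.2‖ : ℝ) * w.2)
  have hv0 : v 0 = w.1 := by simp [v, hw1]
  have hvc : Continuous v := by fun_prop
  have hgc : Continuous g := by fun_prop
  have hg0 : g 0 = w := by
    refine Prod.ext hv0 ?_
    change (√(1 - Complex.normSq (v 0)) / ‖w.2‖ : ℝ) * w.2 = w.2
    have : 1 - Complex.normSq w.1 = ‖w.2‖ ^ 2 := by
      rw [← Complex.normSq_eq_norm_sq]; linarith
    rw [hv0, this, Real.sqrt_sq (norm_nonneg _), div_self hn', Complex.ofReal_one, one_mul]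
  have hlim : Filter.Tendsto g (𝓝[≠] 0) (𝓝 w) := by
    have := hgc.tendsto 0
    rw [hg0] at this
    exact this.mono_left nhdsWithin_le_nhds
  rw [← closure_closure]
  refine mem_closure_of_tendsto hlim ?_
  have hw2s : 0 < Complex.normSq w.2 := Complex.normSq_pos.2 hw2
  have e1 : ∀ᶠ δ in 𝓝 (0 : ℝ), Complex.normSq (v δ) < 1 := by
    have : Continuous fun δ => Complex.normSq (v δ) := by fun_prop
    refine this.continuousAt.eventually_lt continuousAt_const ?_
    rw [hv0]; linarith
  have e2 : ∀ᶠ δ in 𝓝 (0 : ℝ), |(v δ).im| < c * Complex.normSq (v δ) := by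
    have h1 : Continuous fun δ => |(v δ).im| := by fun_prop
    have h2 : Continuous fun δ => c * Complex.normSq (v δ) := by fun_prop
    refine h1.continuousAt.eventually_lt h2.continuousAt ?_
    rw [hv0, hw1]
    simp only [Complex.mul_im, Complex.ofReal_im, Complex.im_ofNat, mul_zero, zero_mul, add_zero,
      abs_zero]
    refine mul_pos hc (Complex.normSq_pos.2 ?_)
    simp [hs.ne']
  have e3 : ∀ᶠ δ in 𝓝 (0 : ℝ), 0 < ε * (v δ).re := by
    have h1 : Continuous fun δ => ε * (v δ).re := by fun_prop
    refine continuousAt_const.eventually_lt h1.continuousAt ?_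
    rw [hv0]
    have h3 := hw.2.2
    refine lt_of_le_of_ne h3 fun h4 => ?_
    have hε0 : ε ≠ 0 := by rintro rfl; norm_num at hε
    rcases mul_eq_zero.1 h4.symm with h5 | h5
    · exact hε0 h5
    · rw [hw1] at h5; simp [hs.ne'] at h5
  filter_upwards [self_mem_nhdsWithin, nhdsWithin_le_nhds e1, nhdsWithin_le_nhds e2,
    nhdsWithin_le_nhds e3] with δ hδ h1 h2 h3
  have hδ' : δ ≠ 0 := hδ
  have hvne : v δ ≠ 2 * s := by
    intro h4
    have : (δ : ℂ) * (Complex.I * w.2 / ‖w.2‖) = 0 := by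
      have : (2 : ℂ) * s + δ * (Complex.I * w.2 / ‖w.2‖) = 2 * s := h4
      linear_combination this
    have h5 : Complex.I * w.2 / ‖w.2‖ ≠ 0 :=
      div_ne_zero (mul_ne_zero Complex.I_ne_zero hw2) hn
    exact (mul_ne_zero (by exact_mod_cast hδ') h5) this
  refine mem_closure_modelPiece_aux hε hc ⟨⟨?_, ?_⟩, h2.le, h3.le⟩ fun h => absurd h hvne
  · change Complex.normSq (v δ) + Complex.normSq ((√(1 - Complex.normSq (v δ)) / ‖w.2‖ : ℝ) * w.2)
      = 1
    rw [Complex.normSq_mul, Complex.normSq_ofReal, ← sq, div_pow,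
      Real.sq_sqrt (by linarith), Complex.normSq_eq_norm_sq w.2, div_mul_cancel₀ _ (pow_ne_zero 2 hn')]
    ring
  · have hvre : (v δ).re = 2 * s - δ * (w.2.im / ‖w.2‖) := by
      simp [v, Complex.div_ofReal_re, neg_div]
      ring
    have hvim : (v δ).im = δ * (w.2.re / ‖w.2‖) := by
      simp [v, Complex.div_ofReal_im]
    change (((√(1 - Complex.normSq (v δ)) / ‖w.2‖ : ℝ) : ℂ) * w.2).re * (2 * s - (v δ).re) -
      (((√(1 - Complex.normSq (v δ)) / ‖w.2‖ : ℝ) : ℂ) * w.2).im * (v δ).im = 0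
    rw [Complex.re_ofReal_mul, Complex.im_ofReal_mul, hvre, hvim]
    ring

theorem pieceParam_image_subset {ε s c : ℝ} (hε : ε ^ 2 = 1) (hc : 0 < c) (hc1 : c < 1) :
    pieceParam ε s '' (parabolicRegion c ∩ {z | z.im ≠ 0}) ⊆ modelPiece ε s c := by
  rintro _ ⟨z, ⟨hz, hz'⟩, rfl⟩
  refine pieceParam_mem_piece hε hc hc1 hz fun h => absurd ?_ hz'
  have := congrArg Complex.im h
  simpa using this

theorem closure_modelPiece {ε s c : ℝ} (hε : ε ^ 2 = 1) (hc : 0 < c) (hc1 : c < 1)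
    (hs : 0 < s) : closure (modelPiece ε s c) = modelClosedPiece ε s c :=
  Set.Subset.antisymm
    ((isClosed_modelClosedPiece ε s c).closure_subset_iff.2 (modelPiece_subset ε s c))
    fun _ hw => closure_mono (pieceParam_image_subset hε hc hc1)
      (mem_closure_modelPiece hε hc hs hw)

/-- The parametrization may jump at real parameters lying over `2s`. It is therefore restricted to
the two open halves of the region joined by the segment `Re z = 0`. The image is connected and dense
in the piece, and connectedness passes to sets between a connected set and its closure. -/
theorem isPreconnected_modelPiece {ε s c : ℝ} (hε : ε ^ 2 = 1) (hc : 0 < c) (hc1 : c < 1)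
    (hs : 0 < s) : IsPreconnected (modelPiece ε s c) := by
  set T₀ : Set ℂ := parabolicRegion c ∩ {z | z.im ≠ 0} with hT₀
  set T : Set ℂ := parabolicRegion c ∩ {z | z.im ≠ 0 ∨ z.re = 0} with hT
  have hT₀T : T₀ ⊆ T := fun z hz => ⟨hz.1, Or.inl hz.2⟩
  have hTex : ∀ z ∈ T, pieceBase ε z = 2 * s → z.re = 0 := by
    intro z hz h
    rcases hz.2 with h' | h'
    · refine absurd ?_ h'
      have := congrArg Complex.im h
      simpa using this
    · exact h'
  have hconv := convex_parabolicRegion hc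
  have e1 : IsPreconnected (parabolicRegion c ∩ {z | 0 < z.im}) :=
    (hconv.inter (convex_halfSpace_im_gt 0)).isPreconnected
  have e2 : IsPreconnected (parabolicRegion c ∩ {z | z.im < 0}) :=
    (hconv.inter (convex_halfSpace_im_lt 0)).isPreconnected
  have e3 : IsPreconnected (parabolicRegion c ∩ {z | z.re = 0}) := by
    refine (hconv.inter ?_).isPreconnected
    have : {z : ℂ | z.re = 0} = {z | 0 ≤ z.re} ∩ {z | z.re ≤ 0} := by
      ext z; exact ⟨fun h => ⟨h.ge, h.le⟩, fun h => le_antisymm h.2 h.1⟩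
    rw [this]
    exact (convex_halfSpace_re_ge 0).inter (convex_halfSpace_re_le 0)
  have hmem : ∀ t : ℝ, |t| < c → (t : ℂ) * Complex.I ∈ parabolicRegion c := by
    intro t ht
    change |((t : ℂ) * Complex.I).im| < c * (1 - ((t : ℂ) * Complex.I).re ^ 2)
    simpa using ht
  have hc2 : |c / 2| < c := by rw [abs_of_pos (half_pos hc)]; linarith
  have hc3 : |-(c / 2)| < c := by rwa [abs_neg]
  have n1 : ((parabolicRegion c ∩ {z | 0 < z.im}) ∩
      (parabolicRegion c ∩ {z | z.re = 0})).Nonempty :=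
    ⟨_, ⟨hmem _ hc2, by simp [hc]⟩, hmem _ hc2, by simp⟩
  have n2 : ((parabolicRegion c ∩ {z | 0 < z.im} ∪ parabolicRegion c ∩ {z | z.re = 0}) ∩
      (parabolicRegion c ∩ {z | z.im < 0})).Nonempty :=
    ⟨_, Or.inr ⟨hmem _ hc3, by simp⟩, hmem _ hc3, by simp [hc]⟩
  have hTc : IsPreconnected T := by
    have h2 := IsPreconnected.union' n2 (IsPreconnected.union' n1 e1 e3) e2
    convert h2 using 1
    ext z
    simp only [hT, Set.mem_inter_iff, Set.mem_union, Set.mem_ofPred_eq, ne_iff_lt_or_gt]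
    tauto
  have himg : IsPreconnected (pieceParam ε s '' T) :=
    hTc.image _ fun z hz => (continuousAt_pieceParam (hTex z hz)).continuousWithinAt
  refine himg.subset_closure ?_ ?_
  · rintro _ ⟨z, hz, rfl⟩
    exact pieceParam_mem_piece hε hc hc1 hz.1 (hTex z hz)
  · intro w hw
    have h1 := mem_closure_modelPiece hε hc hs (modelPiece_subset ε s c hw)
    exact closure_mono (Set.image_mono hT₀T) h1

end Pieces

end FordFaces

namespace FordFaces

/-! ### The Giraud circles -/

section Circles

@[fun_prop] theorem contDiff_re {n : WithTop ℕ∞} : ContDiff ℝ n Complex.re :=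
  Complex.reCLM.contDiff

@[fun_prop] theorem contDiff_im {n : WithTop ℕ∞} : ContDiff ℝ n Complex.im :=
  Complex.imCLM.contDiff

@[fun_prop] theorem contDiff_ofReal {n : WithTop ℕ∞} : ContDiff ℝ n Complex.ofReal :=
  Complex.ofRealCLM.contDiff

@[fun_prop] theorem contDiff_normSq {n : WithTop ℕ∞} : ContDiff ℝ n Complex.normSq := by
  have : (fun z : ℂ => Complex.normSq z) = fun z => z.re * z.re + z.im * z.im := by
    ext z; simp [Complex.normSq_apply]
  change ContDiff ℝ n (fun z : ℂ => Complex.normSq z)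
  rw [this]
  fun_prop

theorem contDiffAt_cdiv {E : Type*} [NormedAddCommGroup E] [NormedSpace ℝ E] {f g : E → ℂ} {x : E}
    {n : WithTop ℕ∞} (hf : ContDiffAt ℝ n f x) (hg : ContDiffAt ℝ n g x) (h : g x ≠ 0) :
    ContDiffAt ℝ n (fun y => f y / g y) x := by
  simp only [div_eq_mul_inv]
  exact hf.mul (hg.inv h)

theorem contDiffAt_sheet {s : ℝ} {p : ℝ × ℂ} (h : p.2 ≠ 2 * s) :
    ContDiffAt ℝ ∞ (fun p : ℝ × ℂ => sheet s p.1 p.2) p := by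
  have h0 : 2 * (s : ℂ) - p.2 ≠ 0 := sub_ne_zero.2 h.symm
  have h1 : ((‖2 * (s : ℂ) - p.2‖ : ℝ) : ℂ) ≠ 0 := by exact_mod_cast norm_ne_zero_iff.2 h0
  have h2 : ContDiffAt ℝ ∞ (fun p : ℝ × ℂ => 2 * (s : ℂ) - p.2) p := by fun_prop
  have h3 : ContDiffAt ℝ ∞ (fun p : ℝ × ℂ => ((‖2 * (s : ℂ) - p.2‖ : ℝ) : ℂ)) p :=
    contDiff_ofReal.contDiffAt.comp p (h2.norm ℝ h0)
  have h4 : ContDiffAt ℝ ∞ (fun p : ℝ × ℂ => Complex.I * p.1 * (2 * (s : ℂ) - p.2)) p := by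
    fun_prop
  exact contDiffAt_cdiv h4 h3 h1

theorem contDiffAt_sheetCoord {s : ℝ} {w : ℂ × ℂ} (h : w.1 ≠ 2 * s) :
    ContDiffAt ℝ ∞ (sheetCoord s) w := by
  have h0 : 2 * (s : ℂ) - w.1 ≠ 0 := sub_ne_zero.2 h.symm
  have h2 : ContDiffAt ℝ ∞ (fun p : ℂ × ℂ => 2 * (s : ℂ) - p.1) w := by fun_prop
  have h3 : ContDiffAt ℝ ∞
      (fun w : ℂ × ℂ => w.2.im * (2 * s - w.1.re) + w.2.re * w.1.im) w := by fun_prop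
  exact h3.div (h2.norm ℝ h0) (norm_ne_zero_iff.2 h0)

/-- The parametrization of the first Giraud circle by the unit circle. -/
noncomputable def circleParam (s c : ℝ) (z : ℂ) : ℂ × ℂ :=
  (z.re / (s + Complex.I * (c * z.re : ℝ)),
    sheet s (s * z.im / √(s ^ 2 + c ^ 2 * z.re ^ 2)) (z.re / (s + Complex.I * (c * z.re : ℝ))))

/-- The inverse of the parametrization. -/
noncomputable def circleCoord (s c : ℝ) (w : ℂ × ℂ) : ℂ :=
  (s * w.1.re / (1 - c ^ 2 * Complex.normSq w.1) : ℝ) +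
    (sheetCoord s w / √(1 - c ^ 2 * Complex.normSq w.1) : ℝ) * Complex.I

variable {s c : ℝ}

theorem circle_denom_ne (hs : 0 < s) (q : ℝ) : (s : ℂ) + Complex.I * (c * q : ℝ) ≠ 0 := by
  intro h
  have := congrArg Complex.re h
  simp at this
  exact hs.ne' this

theorem normSq_circle_denom (q : ℝ) :
    Complex.normSq ((s : ℂ) + Complex.I * (c * q : ℝ)) = s ^ 2 + c ^ 2 * q ^ 2 := by
  rw [Complex.normSq_apply]
  simp
  ring

theorem circleParam_fst_re (z : ℂ) : (circleParam s c z).1.re =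
    z.re * s / (s ^ 2 + c ^ 2 * z.re ^ 2) := by
  simp only [circleParam]
  rw [Complex.div_re, normSq_circle_denom]
  simp

theorem circleParam_fst_im (z : ℂ) : (circleParam s c z).1.im =
    -(c * z.re ^ 2) / (s ^ 2 + c ^ 2 * z.re ^ 2) := by
  simp only [circleParam]
  rw [Complex.div_im, normSq_circle_denom]
  simp
  ring

theorem normSq_circleParam_fst (z : ℂ) : Complex.normSq (circleParam s c z).1 =
    z.re ^ 2 / (s ^ 2 + c ^ 2 * z.re ^ 2) := by
  simp only [circleParam]
  rw [Complex.normSq_div, normSq_circle_denom, Complex.normSq_ofReal, ← sq]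

theorem circleParam_fst_ne (hs : 0 < s) (hc : 0 < c) (z : ℂ) : (circleParam s c z).1 ≠ 2 * s := by
  intro h
  have h1 := congrArg Complex.im h
  have h2 := congrArg Complex.re h
  rw [circleParam_fst_im] at h1
  rw [circleParam_fst_re] at h2
  have hpos : 0 < s ^ 2 + c ^ 2 * z.re ^ 2 := by positivity
  simp only [Complex.mul_im, Complex.mul_re, Complex.ofReal_im, Complex.ofReal_re, Complex.im_ofNat,
    Complex.re_ofNat] at h1 h2
  have h3 : z.re = 0 := by
    have h4 : -(c * z.re ^ 2) = 0 := by
      rcases div_eq_zero_iff.1 (h1.trans (by ring)) with h | h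
      · exact h
      · exact absurd h hpos.ne'
    have h5 : z.re ^ 2 = 0 := by
      rcases mul_eq_zero.1 (neg_eq_zero.1 h4) with h | h
      · exact absurd h hc.ne'
      · exact h
    exact pow_eq_zero_iff (two_ne_zero) |>.1 h5
  rw [h3] at h2
  simp at h2
  exact hs.ne' h2

/-- For `v ≠ 0` the equation `-Im v = c|v|²` reads `Im(1/v) = c`. Writing `1/v = s/x + ic` gives `v
= x/(s + icx)`, and with `s² + c² = 1` the bound `|v| ≤ 1` becomes `x² ≤ 1`. Then `1 - |v|² = s²(1 -
x²)/(s² + c²x²)`, so `x` and the normalized sheet coordinate are the real and imaginary parts of a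
point of the unit circle. -/
theorem circleParam_mem (hs : 0 < s) (hc : 0 < c) (h : s ^ 2 + c ^ 2 = 1) {z : ℂ}
    (hz : Complex.normSq z = 1) : circleParam s c z ∈ modelCircle₁ s c := by
  have hpos : 0 < s ^ 2 + c ^ 2 * z.re ^ 2 := by positivity
  rw [Complex.normSq_apply] at hz
  refine ⟨sheet_mem ?_ fun h' => absurd h' (circleParam_fst_ne hs hc z), ?_⟩
  · have := normSq_circleParam_fst (s := s) (c := c) z
    simp only [circleParam] at this
    rw [this, div_pow, Real.sq_sqrt hpos.le, ← add_div, div_eq_one_iff_eq hpos.ne']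
    linear_combination s ^ 2 * hz - z.re ^ 2 * h
  · rw [circleParam_fst_im, normSq_circleParam_fst]
    ring

theorem circleCoord_circleParam (hs : 0 < s) (hc : 0 < c) (z : ℂ) :
    circleCoord s c (circleParam s c z) = z := by
  have hpos : 0 < s ^ 2 + c ^ 2 * z.re ^ 2 := by positivity
  have h1 : 1 - c ^ 2 * Complex.normSq (circleParam s c z).1 =
      s ^ 2 / (s ^ 2 + c ^ 2 * z.re ^ 2) := by
    rw [normSq_circleParam_fst]
    field_simp
    ring
  have h2 : sheetCoord s (circleParam s c z) = s * z.im / √(s ^ 2 + c ^ 2 * z.re ^ 2) :=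
    sheetCoord_sheet (circleParam_fst_ne hs hc z)
  have hsq : 0 < √(s ^ 2 + c ^ 2 * z.re ^ 2) := Real.sqrt_pos.2 hpos
  apply Complex.ext
  · simp only [circleCoord, Complex.add_re, Complex.ofReal_re, Complex.mul_re, Complex.I_re,
      Complex.ofReal_im, Complex.I_im, mul_zero, zero_mul, sub_zero, add_zero]
    rw [h1, circleParam_fst_re]
    field_simp
  · simp only [circleCoord, Complex.add_im, Complex.ofReal_re, Complex.mul_im, Complex.I_re,
      Complex.ofReal_im, Complex.I_im, mul_zero, zero_add, mul_one, add_zero]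
    rw [h1, h2, Real.sqrt_div (sq_nonneg s), Real.sqrt_sq hs.le]
    field_simp

theorem circle_bound (hc : 0 < c) (hc1 : c < 1) {w : ℂ × ℂ} (hw : w ∈ modelSphere) :
    0 < 1 - c ^ 2 * Complex.normSq w.1 := by
  have := normSq_le_one_of_mem_modelSphere hw
  have h0 := Complex.normSq_nonneg w.1
  nlinarith

theorem modelCircle₁_fst_ne (hs : 0 < s) (hc : 0 < c) {w : ℂ × ℂ} (hw : w ∈ modelCircle₁ s c) :
    w.1 ≠ 2 * s := by
  intro h
  have h1 := hw.2
  rw [h, Complex.normSq_apply] at h1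
  simp [hc.ne', hs.ne'] at h1

theorem circleParam_circleCoord (hs : 0 < s) (hc : 0 < c) (h : s ^ 2 + c ^ 2 = 1) {w : ℂ × ℂ}
    (hw : w ∈ modelCircle₁ s c) :
    Complex.normSq (circleCoord s c w) = 1 ∧ circleParam s c (circleCoord s c w) = w := by
  have hc1 : c < 1 := by nlinarith
  have hne := modelCircle₁_fst_ne hs hc hw
  have hm := circle_bound hc hc1 hw.1.1
  have hsq := sheetCoord_sq hw.1 hne
  have hsp : Complex.normSq w.1 + Complex.normSq w.2 = 1 := hw.1.1
  have h1 := hw.2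
  set m := 1 - c ^ 2 * Complex.normSq w.1 with hmdef
  have hmim : m - c * w.1.im = 1 := by rw [hmdef]; linear_combination c * h1
  have hns : Complex.normSq w.1 = w.1.re ^ 2 + w.1.im ^ 2 := by rw [Complex.normSq_apply]; ring
  have hre : (circleCoord s c w).re = s * w.1.re / m := by
    simp only [circleCoord, Complex.add_re, Complex.ofReal_re, Complex.mul_re, Complex.I_re,
      Complex.ofReal_im, Complex.I_im, mul_zero, zero_mul, sub_zero, add_zero, hmdef]
  have him : (circleCoord s c w).im = sheetCoord s w / √m := by
    simp only [circleCoord, Complex.add_im, Complex.ofReal_re, Complex.mul_im, Complex.I_re,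
      Complex.ofReal_im, Complex.I_im, mul_zero, zero_add, mul_one, add_zero, hmdef]
  -- Subtract `(c Im v)²` from `c²|v|²`: on the circle `c²|v|² = 1 - m` and `c Im v = m - 1`.
  have hcre : c ^ 2 * w.1.re ^ 2 = m - m ^ 2 := by
    linear_combination (-c ^ 2) * hns + hmdef + (m - 1 + c * w.1.im) * hmim
  have hy : s ^ 2 + c ^ 2 * (circleCoord s c w).re ^ 2 = s ^ 2 / m := by
    rw [hre]
    field_simp
    linear_combination hcre
  have hv : (circleParam s c (circleCoord s c w)).1 = w.1 := by
    apply Complex.ext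
    · rw [circleParam_fst_re, hy, hre]
      field_simp
    · rw [circleParam_fst_im, hy, hre]
      field_simp
      linear_combination c * hns - w.1.im * hmim + h1
  refine ⟨?_, Prod.ext hv ?_⟩
  · rw [Complex.normSq_apply, hre, him]
    have hsm := Real.sq_sqrt hm.le
    have key : s ^ 2 * w.1.re ^ 2 + Complex.normSq w.2 * m = m ^ 2 := by
      refine mul_left_cancel₀ (pow_ne_zero 2 hc.ne') ?_
      linear_combination s ^ 2 * hcre + m * c ^ 2 * hsp - m * hmdef + (m - m ^ 2) * h
    rw [← sq, ← sq, div_pow, div_pow, hsm, hsq]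
    field_simp
    linear_combination key
  · have h2 : (circleParam s c (circleCoord s c w)).2 =
        sheet s (s * (circleCoord s c w).im / √(s ^ 2 + c ^ 2 * (circleCoord s c w).re ^ 2))
          (circleParam s c (circleCoord s c w)).1 := rfl
    rw [h2, hv, hy, him, Real.sqrt_div (sq_nonneg s), Real.sqrt_sq hs.le]
    have hsm0 : √m ≠ 0 := (Real.sqrt_pos.2 hm).ne'
    have h3 : s * (sheetCoord s w / √m) / (s / √m) = sheetCoord s w := by
      field_simp
    rw [h3, sheet_sheetCoord hw.1 hne]

theorem contDiff_circleParam (hs : 0 < s) (hc : 0 < c) : ContDiff ℝ ∞ (circleParam s c) := by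
  have h1 : ContDiff ℝ ∞ (fun z : ℂ => ((z.re : ℝ) : ℂ) / (s + Complex.I * (c * z.re : ℝ))) := by
    refine contDiff_iff_contDiffAt.2 fun z => contDiffAt_cdiv ?_ ?_ (circle_denom_ne hs _)
    · fun_prop
    · fun_prop
  have h2 : ContDiff ℝ ∞ (fun z : ℂ => s * z.im / √(s ^ 2 + c ^ 2 * z.re ^ 2)) := by
    have hpos : ∀ z : ℂ, 0 < s ^ 2 + c ^ 2 * z.re ^ 2 := fun z => by positivity
    have h3 : ContDiff ℝ ∞ (fun z : ℂ => s ^ 2 + c ^ 2 * z.re ^ 2) := by fun_prop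
    have h4 : ContDiff ℝ ∞ (fun z : ℂ => s * z.im) := by fun_prop
    exact h4.div (h3.sqrt fun z => (hpos z).ne') fun z => (Real.sqrt_pos.2 (hpos z)).ne'
  have h5 : ∀ z, ContDiffAt ℝ ∞ ((fun p : ℝ × ℂ => sheet s p.1 p.2) ∘ fun z : ℂ =>
      (s * z.im / √(s ^ 2 + c ^ 2 * z.re ^ 2),
        ((z.re : ℝ) : ℂ) / (s + Complex.I * (c * z.re : ℝ)))) z := fun z =>
    ContDiffAt.comp z (contDiffAt_sheet (circleParam_fst_ne hs hc z)) (h2.prodMk h1).contDiffAt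
  exact h1.prodMk (contDiff_iff_contDiffAt.2 h5)

theorem areDiffeomorphic_modelCircle₁ (hs : 0 < s) (hc : 0 < c) (h : s ^ 2 + c ^ 2 = 1) :
    AreDiffeomorphic (Metric.sphere (0 : ℂ) 1) (modelCircle₁ s c) := by
  have hc1 : c < 1 := by nlinarith
  have hsph : ∀ z : ℂ, z ∈ Metric.sphere (0 : ℂ) 1 ↔ Complex.normSq z = 1 := by
    intro z
    rw [mem_sphere_zero_iff_norm, Complex.normSq_eq_norm_sq]
    exact (pow_eq_one_iff_of_nonneg (norm_nonneg z) two_ne_zero).symm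
  refine ⟨circleParam s c, circleCoord s c, ?_, ?_, ?_, ?_, ?_, ?_⟩
  · exact SmoothOnSubset.of_contDiffAt fun z _ =>
      .of_forall fun y => (contDiff_circleParam hs hc).contDiffAt
  · refine SmoothOnSubset.of_contDiffAt fun w hw => ?_
    have e1 : ∀ᶠ y in 𝓝 w, y.1 ≠ 2 * (s : ℂ) :=
      continuousAt_fst.eventually_ne (modelCircle₁_fst_ne hs hc hw)
    have hcont : Continuous fun y : ℂ × ℂ => 1 - c ^ 2 * Complex.normSq y.1 := by fun_prop
    have e2 : ∀ᶠ y : ℂ × ℂ in 𝓝 w, 0 < 1 - c ^ 2 * Complex.normSq y.1 :=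
      continuousAt_const.eventually_lt hcont.continuousAt (circle_bound hc hc1 hw.1.1)
    filter_upwards [e1, e2] with y h1 h2
    have n1 : ContDiffAt ℝ ∞ (fun y : ℂ × ℂ => 1 - c ^ 2 * Complex.normSq y.1) y := by fun_prop
    have r1 : ContDiffAt ℝ ∞ (fun y : ℂ × ℂ => s * y.1.re) y := by fun_prop
    have k1 := contDiff_ofReal.contDiffAt.comp y (r1.div n1 h2.ne')
    have k2 := contDiff_ofReal.contDiffAt.comp y
      ((contDiffAt_sheetCoord h1).div (n1.sqrt h2.ne') (Real.sqrt_pos.2 h2).ne')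
    exact k1.add (k2.mul contDiffAt_const)
  · intro z hz
    exact circleParam_mem hs hc h ((hsph z).1 hz)
  · intro w hw
    exact (hsph _).2 (circleParam_circleCoord hs hc h hw).1
  · intro z _
    exact circleCoord_circleParam hs hc z
  · intro w hw
    exact (circleParam_circleCoord hs hc h hw).2

end Circles

end FordFaces

namespace FordFaces

/-! ### Incidences, arcs, components and tangency of the two circles. -/

section Incidence

variable {s c : ℝ}

theorem areDiffeomorphic_modelCircle₂ (hs : 0 < s) (hc : 0 < c) (h : s ^ 2 + c ^ 2 = 1) :
    AreDiffeomorphic (Metric.sphere (0 : ℂ) 1) (modelCircle₂ s c) := by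
  have hsm : ∀ X, SmoothOnSubset conjPair X := fun X => by
    refine SmoothOnSubset.of_contDiffAt fun w _ => .of_forall fun y => ?_
    exact (Complex.conjCLE.contDiff.contDiffAt.comp y contDiffAt_fst).prodMk
      (Complex.conjCLE.contDiff.contDiffAt.comp y contDiffAt_snd)
  refine (areDiffeomorphic_modelCircle₁ hs hc h).trans ?_
  rw [← conjPair_image_modelCircle₁]
  exact AreDiffeomorphic.image subset_rfl (hsm _) (hsm _) fun w _ => conjPair_conjPair w

/-- The common vertices of the bigon and the quadrilateral. -/
def modelA : ℂ × ℂ := (0, Complex.I)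

def modelB : ℂ × ℂ := (0, -Complex.I)

theorem modelA_ne_modelB : modelA ≠ modelB := by
  intro h
  have := congrArg (fun w : ℂ × ℂ => w.2.im) h
  simp [modelA, modelB] at this
  norm_num at this

theorem modelA_mem (s : ℝ) : modelA ∈ modelSpinal s := by
  constructor <;> simp [modelA, modelSphere]

theorem modelB_mem (s : ℝ) : modelB ∈ modelSpinal s := by
  constructor <;> simp [modelB, modelSphere]

theorem fst_eq_zero_iff (hs : 0 < s) {w : ℂ × ℂ} (hw : w ∈ modelSpinal s) :
    w.1 = 0 ↔ w = modelA ∨ w = modelB := by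
  constructor
  · intro h
    have h1 : Complex.normSq w.1 + Complex.normSq w.2 = 1 := hw.1
    have h2 := hw.2
    rw [h] at h1 h2
    simp only [Complex.zero_re, Complex.zero_im, sub_zero, mul_zero, map_zero, zero_add] at h1 h2
    have h3 : w.2.re = 0 := by
      rcases mul_eq_zero.1 h2 with h | h
      · exact h
      · linarith
    rw [Complex.normSq_apply, h3] at h1
    have h4 : (w.2.im - 1) * (w.2.im + 1) = 0 := by linarith
    rcases mul_eq_zero.1 h4 with h5 | h5
    · left
      refine Prod.ext h (Complex.ext ?_ ?_)
      · simp [modelA, h3]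
      · simp only [modelA, Complex.I_im]; linarith
    · right
      refine Prod.ext h (Complex.ext ?_ ?_)
      · simp [modelB, h3]
      · simp only [modelB, Complex.neg_im, Complex.I_im]; linarith
  · rintro (rfl | rfl) <;> rfl

theorem abs_im_le_one {w : ℂ × ℂ} (hw : w ∈ modelSphere) : w.1.re ^ 2 + w.1.im ^ 2 ≤ 1 := by
  have := normSq_le_one_of_mem_modelSphere hw
  rw [Complex.normSq_apply] at this
  linarith

/-- On the imaginary axis the inequality would read `|Im v| ≤ c|Im v|²`, impossible for `0 < |Im v|
≤ 1` and `c < 1`. This is what separates the bigon from the quadrilateral. -/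
theorem re_ne_zero_of_abs_im_le (hc1 : c < 1) {w : ℂ × ℂ} (hw : w ∈ modelSphere)
    (h : |w.1.im| ≤ c * Complex.normSq w.1) (h0 : w.1 ≠ 0) : w.1.re ≠ 0 := by
  intro hre
  have h1 := abs_im_le_one hw
  rw [Complex.normSq_apply, hre] at h
  rw [hre] at h1
  have h2 : 0 < |w.1.im| := abs_pos.2 fun him => h0 (Complex.ext hre him)
  have h3 : w.1.im ^ 2 = |w.1.im| ^ 2 := (sq_abs _).symm
  have h4 : |w.1.im| ≤ 1 := by nlinarith
  nlinarith [mul_pos h2 (sub_pos.2 hc1)]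

theorem modelCircle₁_abs {w : ℂ × ℂ} (hc : 0 < c) (hw : w ∈ modelCircle₁ s c) :
    |w.1.im| = c * Complex.normSq w.1 := by
  have h := hw.2
  rw [← h, abs_of_nonpos]
  have := mul_nonneg hc.le (Complex.normSq_nonneg w.1)
  linarith

theorem modelCircle₂_abs {w : ℂ × ℂ} (hc : 0 < c) (hw : w ∈ modelCircle₂ s c) :
    |w.1.im| = c * Complex.normSq w.1 := by
  have h := hw.2
  rw [← h, abs_of_nonneg]
  have := mul_nonneg hc.le (Complex.normSq_nonneg w.1)
  linarith

theorem modelCircle₁_inter_modelCircle₂ (hs : 0 < s) (hc : 0 < c) :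
    modelCircle₁ s c ∩ modelCircle₂ s c = {modelA, modelB} := by
  ext w
  constructor
  · rintro ⟨h1, h2⟩
    have h3 := h1.2
    have h4 := h2.2
    have h5 : c * Complex.normSq w.1 = 0 := by linarith
    have h6 : w.1 = 0 := by
      rcases mul_eq_zero.1 h5 with h | h
      · exact absurd h hc.ne'
      · exact Complex.normSq_eq_zero.1 h
    exact (fst_eq_zero_iff hs h1.1).1 h6
  · rintro (rfl | rfl)
    · exact ⟨⟨modelA_mem s, by simp [modelA]⟩, ⟨modelA_mem s, by simp [modelA]⟩⟩
    · exact ⟨⟨modelB_mem s, by simp [modelB]⟩, ⟨modelB_mem s, by simp [modelB]⟩⟩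

/-- The vertices of the quadrilateral on the two circles. -/
def modelVertex₁ (s c : ℝ) : ℂ × ℂ := (⟨s, -c⟩, 0)

def modelVertex₂ (s c : ℝ) : ℂ × ℂ := (⟨s, c⟩, 0)

theorem modelVertex₁_mem (h : s ^ 2 + c ^ 2 = 1) : modelVertex₁ s c ∈ modelCircle₁ s c := by
  have h1 : Complex.normSq (⟨s, -c⟩ : ℂ) = 1 := by rw [Complex.normSq_mk]; linarith
  refine ⟨⟨?_, ?_⟩, ?_⟩
  · change Complex.normSq (⟨s, -c⟩ : ℂ) + Complex.normSq 0 = 1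
    rw [h1]; simp
  · simp [modelVertex₁]
  · change - -c = c * Complex.normSq (⟨s, -c⟩ : ℂ)
    rw [h1]; ring

theorem modelVertex₂_mem (h : s ^ 2 + c ^ 2 = 1) : modelVertex₂ s c ∈ modelCircle₂ s c := by
  have h1 : Complex.normSq (⟨s, c⟩ : ℂ) = 1 := by rw [Complex.normSq_mk]; linarith
  refine ⟨⟨?_, ?_⟩, ?_⟩
  · change Complex.normSq (⟨s, c⟩ : ℂ) + Complex.normSq 0 = 1
    rw [h1]; simp
  · simp [modelVertex₂]
  · change c = c * Complex.normSq (⟨s, c⟩ : ℂ)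
    rw [h1]; ring

/-! ### The arcs of the circles -/

theorem circle_diff_subset (hs : 0 < s) (hc1 : c < 1) {C : Set (ℂ × ℂ)}
    (hC : ∀ w ∈ C, w ∈ modelSpinal s ∧ |w.1.im| = c * Complex.normSq w.1) :
    C \ {modelA, modelB} ⊆ {w | 0 < w.1.re} ∪ {w | w.1.re < 0} := by
  rintro w ⟨hw, hw'⟩
  have h1 := hC w hw
  have h2 : w.1 ≠ 0 := fun h => hw' ((fst_eq_zero_iff hs h1.1).1 h)
  exact (re_ne_zero_of_abs_im_le hc1 h1.1.1 h1.2.le h2).lt_or_gt.symm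

theorem isOpen_re_pos : IsOpen {w : ℂ × ℂ | 0 < w.1.re} := isOpen_lt continuous_const (by fun_prop)

theorem isOpen_re_neg : IsOpen {w : ℂ × ℂ | w.1.re < 0} := isOpen_lt (by fun_prop) continuous_const

theorem disjoint_re : Disjoint {w : ℂ × ℂ | 0 < w.1.re} {w : ℂ × ℂ | w.1.re < 0} :=
  Set.disjoint_left.2 fun w h1 h2 => by
    have h1' : 0 < w.1.re := h1
    have h2' : w.1.re < 0 := h2
    exact lt_asymm h1' h2'

theorem diff_inter_re_pos (C : Set (ℂ × ℂ)) :
    (C \ {modelA, modelB}) ∩ {w | 0 < w.1.re} = C ∩ {w | 0 < w.1.re} := by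
  ext w
  refine ⟨fun h => ⟨h.1.1, h.2⟩, fun h => ⟨⟨h.1, ?_⟩, h.2⟩⟩
  rintro (rfl | rfl)
  · exact lt_irrefl (0 : ℝ) h.2
  · exact lt_irrefl (0 : ℝ) h.2

/-- Under `circleParam` the sign of `Re v` is that of `Re z`, so this arc is the image of an open
half circle, parametrized by `Im z`. -/
theorem isPreconnected_modelCircle₁_inter (hs : 0 < s) (hc : 0 < c) (h : s ^ 2 + c ^ 2 = 1) :
    IsPreconnected (modelCircle₁ s c ∩ {w | 0 < w.1.re}) := by
  have h1 : IsPreconnected (Set.Ioo (-1 : ℝ) 1) := isPreconnected_Ioo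
  let g : ℝ → ℂ := fun p => (√(1 - p ^ 2) : ℝ) + (p : ℝ) * Complex.I
  have hg : Continuous fun p => circleParam s c (g p) :=
    (contDiff_circleParam hs hc).continuous.comp (by fun_prop)
  convert h1.image _ hg.continuousOn using 1
  ext w
  constructor
  · rintro ⟨hw, hre⟩
    obtain ⟨e1, e2⟩ := circleParam_circleCoord hs hc h hw
    set z := circleCoord s c w
    have h2 : 0 < z.re := by
      have h3 : 0 < w.1.re := hre
      rw [← e2, circleParam_fst_re] at h3
      by_contra! h4
      have : z.re * s / (s ^ 2 + c ^ 2 * z.re ^ 2) ≤ 0 :=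
        div_nonpos_of_nonpos_of_nonneg (mul_nonpos_of_nonpos_of_nonneg h4 hs.le) (by positivity)
      linarith
    rw [Complex.normSq_apply] at e1
    refine ⟨z.im, ⟨by nlinarith, by nlinarith⟩, ?_⟩
    have : g z.im = z := by
      apply Complex.ext
      · simp only [g, Complex.add_re, Complex.ofReal_re, Complex.mul_re, Complex.I_re,
          Complex.ofReal_im, Complex.I_im, mul_zero, zero_mul, sub_zero, add_zero]
        rw [show 1 - z.im ^ 2 = z.re ^ 2 by linarith, Real.sqrt_sq h2.le]
      · simp [g]
    simp only [this, e2]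
  · rintro ⟨p, hp, rfl⟩
    have hpos : 0 < 1 - p ^ 2 := by nlinarith [hp.1, hp.2]
    have hre : (g p).re = √(1 - p ^ 2) := by simp [g]
    have him : (g p).im = p := by simp [g]
    refine ⟨circleParam_mem hs hc h ?_, ?_⟩
    · rw [Complex.normSq_apply, hre, him, ← sq, Real.sq_sqrt hpos.le]; ring
    · change 0 < (circleParam s c (g p)).1.re
      rw [circleParam_fst_re, hre]
      have := Real.sqrt_pos.2 hpos
      positivity

theorem conjPair_image_inter_re_pos (s c : ℝ) :
    conjPair '' (modelCircle₁ s c ∩ {w | 0 < w.1.re}) = modelCircle₂ s c ∩ {w | 0 < w.1.re} := by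
  apply conjPair_image
  · rintro w ⟨hw, hw'⟩
    refine ⟨?_, ?_⟩
    · rw [← conjPair_image_modelCircle₁]; exact ⟨w, hw, rfl⟩
    · simpa [conjPair] using hw'
  · rintro w ⟨hw, hw'⟩
    refine ⟨?_, ?_⟩
    · rw [← conjPair_image_modelCircle₁] at hw
      obtain ⟨x, hx, rfl⟩ := hw
      rwa [conjPair_conjPair]
    · simpa [conjPair] using hw'

theorem isPreconnected_modelCircle₂_inter (hs : 0 < s) (hc : 0 < c) (h : s ^ 2 + c ^ 2 = 1) :
    IsPreconnected (modelCircle₂ s c ∩ {w | 0 < w.1.re}) := by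
  rw [← conjPair_image_inter_re_pos]
  exact (isPreconnected_modelCircle₁_inter hs hc h).image _ continuous_conjPair.continuousOn

theorem modelArc₁ (hs : 0 < s) (hc : 0 < c) (h : s ^ 2 + c ^ 2 = 1) :
    connectedComponentIn (modelCircle₁ s c \ {modelA, modelB}) (modelVertex₁ s c) =
      modelCircle₁ s c ∩ {w | 0 < w.1.re} := by
  have hc1 : c < 1 := by nlinarith
  rw [connectedComponentIn_eq_inter isOpen_re_pos isOpen_re_neg
    (circle_diff_subset hs hc1 fun w hw => ⟨hw.1, modelCircle₁_abs hc hw⟩) disjoint_re] <;>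
    rw [diff_inter_re_pos]
  · exact isPreconnected_modelCircle₁_inter hs hc h
  · exact ⟨modelVertex₁_mem h, hs⟩

theorem modelArc₂ (hs : 0 < s) (hc : 0 < c) (h : s ^ 2 + c ^ 2 = 1) :
    connectedComponentIn (modelCircle₂ s c \ {modelA, modelB}) (modelVertex₂ s c) =
      modelCircle₂ s c ∩ {w | 0 < w.1.re} := by
  have hc1 : c < 1 := by nlinarith
  rw [connectedComponentIn_eq_inter isOpen_re_pos isOpen_re_neg
    (circle_diff_subset hs hc1 fun w hw => ⟨hw.1, modelCircle₂_abs hc hw⟩) disjoint_re] <;>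
    rw [diff_inter_re_pos]
  · exact isPreconnected_modelCircle₂_inter hs hc h
  · exact ⟨modelVertex₂_mem h, hs⟩

/-- The union of the arcs bounding the bigon (`ε = -1`) or the quadrilateral (`ε = 1`). -/
def modelBoundary (ε s c : ℝ) : Set (ℂ × ℂ) :=
  (modelCircle₁ s c ∪ modelCircle₂ s c) ∩ {w | 0 ≤ ε * w.1.re}

theorem mem_circles_iff (hc : 0 < c) {w : ℂ × ℂ} : w ∈ modelCircle₁ s c ∪ modelCircle₂ s c ↔
    w ∈ modelSpinal s ∧ |w.1.im| = c * Complex.normSq w.1 := by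
  constructor
  · rintro (h | h)
    · exact ⟨h.1, modelCircle₁_abs hc h⟩
    · exact ⟨h.1, modelCircle₂_abs hc h⟩
  · rintro ⟨h1, h2⟩
    rcases le_total 0 w.1.im with h | h
    · rw [abs_of_nonneg h] at h2
      exact Or.inr ⟨h1, h2⟩
    · rw [abs_of_nonpos h] at h2
      exact Or.inl ⟨h1, h2⟩

theorem mem_modelBoundary_iff {ε : ℝ} (hc : 0 < c) {w : ℂ × ℂ} : w ∈ modelBoundary ε s c ↔
    w ∈ modelClosedPiece ε s c ∧ |w.1.im| = c * Complex.normSq w.1 := by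
  constructor
  · rintro ⟨h1, h2⟩
    rw [mem_circles_iff hc] at h1
    exact ⟨⟨h1.1, h1.2.le, h2⟩, h1.2⟩
  · rintro ⟨h1, h2⟩
    exact ⟨(mem_circles_iff hc).2 ⟨h1.1, h2⟩, h1.2.2⟩

theorem modelClosedPiece_diff {ε : ℝ} (hε : ε ^ 2 = 1) (hc : 0 < c) (hc1 : c < 1) :
    modelClosedPiece ε s c \ modelPiece ε s c = modelBoundary ε s c := by
  ext w
  rw [mem_modelBoundary_iff hc]
  constructor
  · rintro ⟨h1, h2⟩
    refine ⟨h1, ?_⟩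
    by_contra h3
    have h4 := lt_of_le_of_ne h1.2.1 h3
    refine h2 ⟨h1.1, h4, lt_of_le_of_ne h1.2.2 fun h5 => ?_⟩
    have h6 : w.1 ≠ 0 := by
      intro h6
      rw [h6] at h4
      simp at h4
    have h7 := re_ne_zero_of_abs_im_le hc1 h1.1.1 h1.2.1 h6
    rcases mul_eq_zero.1 h5.symm with h8 | h8
    · rw [h8] at hε; norm_num at hε
    · exact h7 h8
  · rintro ⟨h1, h2⟩
    exact ⟨h1, fun h3 => h3.2.1.ne h2⟩

theorem modelClosedPiece_inter (hs : 0 < s) (hc1 : c < 1) :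
    modelClosedPiece (-1) s c ∩ modelClosedPiece 1 s c = {modelA, modelB} := by
  ext w
  constructor
  · rintro ⟨h1, h2⟩
    refine (fst_eq_zero_iff hs h1.1).1 ?_
    by_contra h3
    have h4 := h1.2.2
    have h5 := h2.2.2
    exact re_ne_zero_of_abs_im_le hc1 h1.1.1 h1.2.1 h3 (by linarith)
  · rintro (rfl | rfl)
    · constructor <;> exact ⟨modelA_mem s, by simp [modelA]⟩
    · constructor <;> exact ⟨modelB_mem s, by simp [modelB]⟩

/-! ### The complement of the circles -/

/-- The complement of the two circles in the model. -/
def modelComplement (s c : ℝ) : Set (ℂ × ℂ) :=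
  modelSpinal s \ (modelCircle₁ s c ∪ modelCircle₂ s c)

theorem mem_modelComplement_iff (hc : 0 < c) {w : ℂ × ℂ} : w ∈ modelComplement s c ↔
    w ∈ modelSpinal s ∧ |w.1.im| ≠ c * Complex.normSq w.1 := by
  constructor
  · rintro ⟨h1, h2⟩
    exact ⟨h1, fun h3 => h2 ((mem_circles_iff hc).2 ⟨h1, h3⟩)⟩
  · rintro ⟨h1, h2⟩
    exact ⟨h1, fun h3 => h2 ((mem_circles_iff hc).1 h3).2⟩

theorem modelComplement_cases (hc : 0 < c) (hc1 : c < 1) {w : ℂ × ℂ}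
    (hw : w ∈ modelComplement s c) : w ∈ modelCap₁ s c ∨ w ∈ modelCap₂ s c ∨
      w ∈ modelPiece (-1) s c ∨ w ∈ modelPiece 1 s c := by
  obtain ⟨h1, h2⟩ := (mem_modelComplement_iff hc).1 hw
  rcases h2.lt_or_gt with h | h
  · have h3 : w.1 ≠ 0 := by
      intro h3
      rw [h3] at h
      simp at h
    rcases (re_ne_zero_of_abs_im_le hc1 h1.1 h.le h3).lt_or_gt with h4 | h4
    · exact Or.inr (Or.inr (Or.inl ⟨h1, h, by linarith⟩))
    · exact Or.inr (Or.inr (Or.inr ⟨h1, h, by linarith⟩))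
  · rcases le_total 0 w.1.im with h3 | h3
    · rw [abs_of_nonneg h3] at h
      exact Or.inr (Or.inl ⟨h1, h⟩)
    · rw [abs_of_nonpos h3] at h
      exact Or.inl ⟨h1, h⟩

theorem modelCap₁_subset (hc : 0 < c) : modelCap₁ s c ⊆ modelComplement s c := by
  intro w hw
  refine (mem_modelComplement_iff hc).2 ⟨hw.1, ?_⟩
  have h1 := hw.2
  have h2 := neg_le_abs w.1.im
  exact (h1.trans_le h2).ne'

theorem modelCap₂_subset (hc : 0 < c) : modelCap₂ s c ⊆ modelComplement s c := by
  intro w hw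
  refine (mem_modelComplement_iff hc).2 ⟨hw.1, ?_⟩
  have h1 := hw.2
  have h2 := le_abs_self w.1.im
  exact (h1.trans_le h2).ne'

theorem modelPiece_subset_complement (ε : ℝ) (hc : 0 < c) :
    modelPiece ε s c ⊆ modelComplement s c := fun _ hw =>
  (mem_modelComplement_iff hc).2 ⟨hw.1, hw.2.1.ne⟩

theorem disjoint_modelCap₁_modelCap₂ (hc : 0 < c) {w : ℂ × ℂ} (h1 : w ∈ modelCap₁ s c)
    (h2 : w ∈ modelCap₂ s c) : False := by
  have h3 := h1.2
  have h4 := h2.2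
  have := mul_nonneg hc.le (Complex.normSq_nonneg w.1)
  linarith

theorem component_modelCap₁ (hc : 0 < c) (hc1 : c < 1) {w : ℂ × ℂ} (hw : w ∈ modelCap₁ s c) :
    connectedComponentIn (modelComplement s c) w = modelCap₁ s c := by
  have e : modelComplement s c ∩ {w | c * Complex.normSq w.1 < -w.1.im} = modelCap₁ s c :=
    Set.Subset.antisymm (fun w h => ⟨h.1.1, h.2⟩) fun w h => ⟨modelCap₁_subset hc h, h.2⟩
  have h1 : IsOpen {w : ℂ × ℂ | c * Complex.normSq w.1 < -w.1.im} :=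
    isOpen_lt (by fun_prop) (by fun_prop)
  have h2 : IsOpen {w : ℂ × ℂ | -w.1.im < c * Complex.normSq w.1} :=
    isOpen_lt (by fun_prop) (by fun_prop)
  rw [connectedComponentIn_eq_inter h1 h2 ?_ ?_ ?_ ?_, e]
  · intro x hx
    have h : -x.1.im ≠ c * Complex.normSq x.1 := fun h => hx.2 (Or.inl ⟨hx.1, h⟩)
    exact h.lt_or_gt.symm
  · refine Set.disjoint_left.2 fun x h1 h2 => ?_
    have h1' : c * Complex.normSq x.1 < -x.1.im := h1
    have h2' : -x.1.im < c * Complex.normSq x.1 := h2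
    exact lt_asymm h1' h2'
  · rw [e]; exact isPreconnected_modelCap₁ hc hc1
  · rw [e]; exact hw

theorem component_modelCap₂ (hc : 0 < c) (hc1 : c < 1) {w : ℂ × ℂ} (hw : w ∈ modelCap₂ s c) :
    connectedComponentIn (modelComplement s c) w = modelCap₂ s c := by
  have e : modelComplement s c ∩ {w | c * Complex.normSq w.1 < w.1.im} = modelCap₂ s c :=
    Set.Subset.antisymm (fun w h => ⟨h.1.1, h.2⟩) fun w h => ⟨modelCap₂_subset hc h, h.2⟩
  have h1 : IsOpen {w : ℂ × ℂ | c * Complex.normSq w.1 < w.1.im} :=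
    isOpen_lt (by fun_prop) (by fun_prop)
  have h2 : IsOpen {w : ℂ × ℂ | w.1.im < c * Complex.normSq w.1} :=
    isOpen_lt (by fun_prop) (by fun_prop)
  rw [connectedComponentIn_eq_inter h1 h2 ?_ ?_ ?_ ?_, e]
  · intro x hx
    have h : x.1.im ≠ c * Complex.normSq x.1 := fun h => hx.2 (Or.inr ⟨hx.1, h⟩)
    exact h.lt_or_gt.symm
  · refine Set.disjoint_left.2 fun x h1 h2 => ?_
    have h1' : c * Complex.normSq x.1 < x.1.im := h1
    have h2' : x.1.im < c * Complex.normSq x.1 := h2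
    exact lt_asymm h1' h2'
  · rw [e]; exact isPreconnected_modelCap₂ hc hc1
  · rw [e]; exact hw

/-- In the complement, a point with `|Im v| < c|v|²` has `Re v ≠ 0`. The open sets `u` and `v` below
therefore cover the complement. -/
theorem component_modelPiece {ε : ℝ} (hε : ε ^ 2 = 1) (hs : 0 < s) (hc : 0 < c) (hc1 : c < 1)
    {w : ℂ × ℂ} (hw : w ∈ modelPiece ε s c) :
    connectedComponentIn (modelComplement s c) w = modelPiece ε s c := by
  set u : Set (ℂ × ℂ) := {w | |w.1.im| < c * Complex.normSq w.1} ∩ {w | 0 < ε * w.1.re} with hu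
  set v : Set (ℂ × ℂ) := {w | c * Complex.normSq w.1 < |w.1.im|} ∪ {w | ε * w.1.re < 0} with hv
  have e : modelComplement s c ∩ u = modelPiece ε s c :=
    Set.Subset.antisymm (fun w h => ⟨h.1.1, h.2⟩)
      fun w h => ⟨modelPiece_subset_complement ε hc h, h.2⟩
  have h1 : IsOpen u := (isOpen_lt (by fun_prop) (by fun_prop)).inter
    (isOpen_lt (by fun_prop) (by fun_prop))
  have h2 : IsOpen v := (isOpen_lt (by fun_prop) (by fun_prop)).union
    (isOpen_lt (by fun_prop) (by fun_prop))
  rw [connectedComponentIn_eq_inter h1 h2 ?_ ?_ ?_ ?_, e]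
  · intro x hx
    obtain ⟨h3, h4⟩ := (mem_modelComplement_iff hc).1 hx
    rcases h4.lt_or_gt with h | h
    · have h5 : x.1 ≠ 0 := by
        intro h5
        rw [h5] at h
        simp at h
      have h6 := re_ne_zero_of_abs_im_le hc1 h3.1 h.le h5
      have h7 : ε * x.1.re ≠ 0 := mul_ne_zero (by rintro rfl; norm_num at hε) h6
      rcases h7.lt_or_gt with h8 | h8
      · exact Or.inr (Or.inr h8)
      · exact Or.inl ⟨h, h8⟩
    · exact Or.inr (Or.inl h)
  · refine Set.disjoint_left.2 ?_
    rintro x ⟨h3, h4⟩ (h5 | h5)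
    · have h3' : |x.1.im| < c * Complex.normSq x.1 := h3
      have h5' : c * Complex.normSq x.1 < |x.1.im| := h5
      exact lt_asymm h3' h5'
    · have h4' : 0 < ε * x.1.re := h4
      have h5' : ε * x.1.re < 0 := h5
      exact lt_asymm h4' h5'
  · rw [e]; exact isPreconnected_modelPiece hε hc hc1 hs
  · rw [e]; exact hw

/-! ### Tangency -/

/-- A function vanishing on `C` has a derivative that kills the tangent vectors. Along the line in
the direction `y` that derivative is the linear coefficient of a polynomial, which can be read off
by expansion. -/
theorem eq_zero_of_mem_tangentConeAt {F : ℂ × ℂ → ℝ} {C : Set (ℂ × ℂ)} {x y : ℂ × ℂ} {p q : ℝ}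
    (hx : x ∈ C) (hF : DifferentiableAt ℝ F x) (hFC : ∀ w ∈ C, F w = 0)
    (hy : y ∈ tangentConeAt ℝ C x) (h : ∀ t : ℝ, F (x + t • y) = p * t ^ 2 + q * t) : q = 0 := by
  have h1 : HasFDerivWithinAt F (0 : ℂ × ℂ →L[ℝ] ℝ) C x :=
    (hasFDerivWithinAt_const (0 : ℝ) x C).congr hFC (hFC x hx)
  have h2 : fderiv ℝ F x y = 0 := hF.hasFDerivAt.hasFDerivWithinAt.unique_on h1 hy
  have h3 : HasDerivAt (fun t : ℝ => F (x + t • y)) (fderiv ℝ F x y) 0 :=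
    hF.hasFDerivAt.hasLineDerivAt y
  have h4 : HasDerivAt (fun t : ℝ => p * t ^ 2 + q * t) q 0 := by
    have := ((hasDerivAt_pow 2 (0 : ℝ)).const_mul p).fun_add ((hasDerivAt_id (0 : ℝ)).const_mul q)
    refine this.congr_deriv ?_
    simp
  rw [funext h, h2] at h3
  exact h4.unique h3

/-- The three defining equations, linearized, leave only the real direction in `v`; the
parametrization has nonzero velocity and fills this line. The answer does not involve the sign that
distinguishes the two circles, which is why they are tangent. -/
theorem tangentConeAt_modelCircle₁ (hs : 0 < s) (hc : 0 < c) (h : s ^ 2 + c ^ 2 = 1) {σ : ℝ}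
    (hσ : σ ^ 2 = 1) : tangentConeAt ℝ (modelCircle₁ s c) (0, σ * Complex.I) =
      Set.range fun t : ℝ => ((t : ℂ), (0 : ℂ)) := by
  have hmem : ((0 : ℂ), (σ : ℂ) * Complex.I) ∈ modelCircle₁ s c := by
    refine ⟨⟨?_, ?_⟩, ?_⟩
    · change Complex.normSq 0 + Complex.normSq (σ * Complex.I) = 1
      simp [← sq, hσ]
    · simp
    · simp
  have hsub : tangentConeAt ℝ (modelCircle₁ s c) (0, σ * Complex.I) ⊆
      Set.range fun t : ℝ => ((t : ℂ), (0 : ℂ)) := by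
    intro y hy
    have hσ0 : σ ≠ 0 := by rintro rfl; norm_num at hσ
    -- `k1`, `k2` and `k3` linearize the sphere, the Giraud condition and the spinal condition at
    -- `(0, σi)`.
    have k1 : 2 * σ * y.2.im = 0 := by
      refine eq_zero_of_mem_tangentConeAt (p := Complex.normSq y.1 + Complex.normSq y.2)
        (F := fun w => Complex.normSq w.1 + Complex.normSq w.2 - 1) hmem ?_ ?_ hy ?_
      · refine ContDiffAt.differentiableAt (n := 1) ?_ one_ne_zero
        fun_prop
      · intro w hw
        have : Complex.normSq w.1 + Complex.normSq w.2 = 1 := hw.1.1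
        linarith
      · intro t
        simp only [Complex.normSq_apply, Prod.fst_add, Prod.snd_add, Prod.smul_fst, Prod.smul_snd,
          Complex.add_re, Complex.add_im, Complex.real_smul, Complex.mul_re, Complex.mul_im,
          Complex.ofReal_re, Complex.ofReal_im, Complex.zero_re, Complex.zero_im, Complex.I_re,
          Complex.I_im]
        linear_combination hσ
    have k2 : c * 0 + y.1.im = 0 := by
      refine eq_zero_of_mem_tangentConeAt (p := c * Complex.normSq y.1)
        (F := fun w => w.1.im + c * Complex.normSq w.1) hmem ?_ ?_ hy ?_
      · refine ContDiffAt.differentiableAt (n := 1) ?_ one_ne_zero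
        fun_prop
      · intro w hw
        have := hw.2
        linarith
      · intro t
        simp only [Complex.normSq_apply, Prod.fst_add, Prod.smul_fst,
          Complex.add_re, Complex.add_im, Complex.real_smul, Complex.mul_re, Complex.mul_im,
          Complex.ofReal_re, Complex.ofReal_im, Complex.zero_re, Complex.zero_im]
        ring
    have k3 : 2 * s * y.2.re - σ * y.1.im = 0 := by
      refine eq_zero_of_mem_tangentConeAt (p := -(y.2.re * y.1.re + y.2.im * y.1.im))
        (F := fun w => w.2.re * (2 * s - w.1.re) - w.2.im * w.1.im) hmem ?_ ?_ hy ?_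
      · refine ContDiffAt.differentiableAt (n := 1) ?_ one_ne_zero
        fun_prop
      · intro w hw
        exact hw.1.2
      · intro t
        simp only [Prod.fst_add, Prod.snd_add, Prod.smul_fst, Prod.smul_snd,
          Complex.add_re, Complex.add_im, Complex.real_smul, Complex.mul_re, Complex.mul_im,
          Complex.ofReal_re, Complex.ofReal_im, Complex.zero_re, Complex.zero_im, Complex.I_re,
          Complex.I_im]
        ring
    have i1 : y.1.im = 0 := by linarith
    have i2 : y.2.im = 0 := by
      rcases mul_eq_zero.1 k1 with h | h
      · exact absurd h (mul_ne_zero two_ne_zero hσ0)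
      · exact h
    have i3 : y.2.re = 0 := by
      rw [i1] at k3
      rcases mul_eq_zero.1 (by linarith : 2 * s * y.2.re = 0) with h | h
      · linarith
      · exact h
    refine ⟨y.1.re, Prod.ext (Complex.ext ?_ ?_) (Complex.ext ?_ ?_)⟩ <;> simp [i1, i2, i3]
  refine Set.Subset.antisymm hsub ?_
  let g : ℝ → ℂ := fun t => (t : ℝ) + (σ * √(1 - t ^ 2) : ℝ) * Complex.I
  have hg0 : g 0 = σ * Complex.I := by simp [g]
  have hd : DifferentiableAt ℝ (fun t => circleParam s c (g t)) 0 := by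
    have hg : DifferentiableAt ℝ g 0 := by
      refine ContDiffAt.differentiableAt (n := 1) ?_ one_ne_zero
      have h1 : ContDiffAt ℝ 1 (fun t : ℝ => √(1 - t ^ 2)) 0 :=
        ContDiffAt.sqrt (by fun_prop) (by norm_num)
      have h2 := contDiff_ofReal.contDiffAt.comp (0 : ℝ) (contDiffAt_const (c := σ) |>.mul h1)
      exact (contDiff_ofReal.contDiffAt).add (h2.mul contDiffAt_const)
    exact ((contDiff_circleParam hs hc).differentiable (by simp) _).comp 0 hg
  have hval : circleParam s c (g 0) = (0, σ * Complex.I) := by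
    rw [hg0]
    have e : |2 * s| = 2 * s := abs_of_pos (by positivity)
    have e' : (s : ℂ) ≠ 0 := by exact_mod_cast hs.ne'
    refine Prod.ext (by simp [circleParam]) ?_
    have e2 : ‖2 * (s : ℂ)‖ = 2 * s := by
      rw [← Complex.ofReal_ofNat, ← Complex.ofReal_mul, Complex.norm_real, Real.norm_eq_abs, e]
    simp [circleParam, sheet, Real.sqrt_sq hs.le, abs_of_pos hs]
    field_simp
  have hmaps : Set.MapsTo (fun t => circleParam s c (g t)) (Set.Ioo (-1) 1) (modelCircle₁ s c) := by
    intro t ht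
    refine circleParam_mem hs hc h ?_
    have hpos : 0 < 1 - t ^ 2 := by nlinarith [ht.1, ht.2]
    rw [Complex.normSq_apply]
    simp [g, ← sq, mul_pow, hσ, Real.sq_sqrt hpos.le]
  set d := fderiv ℝ (fun t => circleParam s c (g t)) 0 1 with hdd
  have hT : tangentConeAt ℝ (Set.Ioo (-1 : ℝ) 1) 0 = Set.univ :=
    tangentConeAt_of_mem_nhds (Ioo_mem_nhds (by norm_num) (by norm_num))
  have hcone : ∀ t : ℝ, t • d ∈ tangentConeAt ℝ (modelCircle₁ s c) (0, σ * Complex.I) := by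
    intro t
    have ht : t ∈ tangentConeAt ℝ (Set.Ioo (-1 : ℝ) 1) 0 := by rw [hT]; trivial
    have h1 := (hd.hasFDerivAt.hasFDerivWithinAt (s := Set.Ioo (-1) 1)).mapsTo_tangent_cone ht
    rw [hval] at h1
    have h2 := tangentConeAt_mono hmaps.image_subset h1
    have h3 : fderiv ℝ (fun t => circleParam s c (g t)) 0 t = t • d := by
      rw [hdd, ← map_smul, smul_eq_mul, mul_one]
    rwa [h3] at h2
  -- Only the first component of the velocity has to be computed: the inclusion `hsub` already
  -- forces the second one to vanish.
  have hd1 : d.1 = ((1 / s : ℝ) : ℂ) := by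
    have k1 : HasDerivAt (fun t => (circleParam s c (g t)).1) d.1 0 :=
      (ContinuousLinearMap.fst ℝ ℂ ℂ).hasFDerivAt.comp_hasDerivAt (0 : ℝ) hd.hasDerivAt
    have k2 : HasDerivAt (fun t : ℝ => (t : ℂ) / ((s : ℂ) + Complex.I * (c * t : ℝ)))
        ((1 / s : ℝ) : ℂ) 0 := by
      have n1 : HasDerivAt (fun t : ℝ => (t : ℂ)) 1 0 := Complex.ofRealCLM.hasDerivAt
      have n2 : HasDerivAt (fun t : ℝ => (s : ℂ) + Complex.I * (c * t : ℝ)) (Complex.I * c) 0 := by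
        refine HasDerivAt.const_add _ (HasDerivAt.const_mul _ ?_)
        simpa using n1.const_mul (c : ℂ)
      refine (n1.div n2 (circle_denom_ne hs 0)).congr_deriv ?_
      have e' : (s : ℂ) ≠ 0 := by exact_mod_cast hs.ne'
      simp
      field_simp
    refine k1.unique ?_
    refine k2.congr_of_eventuallyEq (.of_forall fun t => ?_)
    simp [circleParam, g]
  obtain ⟨t₀, ht₀⟩ := hsub (one_smul ℝ d ▸ hcone 1)
  rintro _ ⟨t, rfl⟩
  have h5 : t₀ = 1 / s := by
    have : (t₀ : ℂ) = d.1 := congrArg Prod.fst ht₀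
    rw [hd1] at this
    exact_mod_cast this
  have h6 : ((t : ℂ), (0 : ℂ)) = (t * s) • d := by
    rw [← ht₀, h5]
    refine Prod.ext ?_ ?_
    · simp [hs.ne']
    · simp
  have h7 := hcone (t * s)
  rw [← h6] at h7
  exact h7

theorem tangentConeAt_modelCircle₂ (hs : 0 < s) (hc : 0 < c) (h : s ^ 2 + c ^ 2 = 1) {σ : ℝ}
    (hσ : σ ^ 2 = 1) : tangentConeAt ℝ (modelCircle₂ s c) (0, σ * Complex.I) =
      Set.range fun t : ℝ => ((t : ℂ), (0 : ℂ)) := by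
  -- Conjugation exchanges the two circles but also the points `±i`, so the previous result is
  -- applied at `-σ`.
  have hσ' : (-σ) ^ 2 = 1 := by rw [neg_sq, hσ]
  have hmem : ((0 : ℂ), ((-σ : ℝ) : ℂ) * Complex.I) ∈ modelCircle₁ s c := by
    refine ⟨⟨?_, ?_⟩, ?_⟩
    · change Complex.normSq 0 + Complex.normSq (((-σ : ℝ) : ℂ) * Complex.I) = 1
      simp [← sq, hσ]
    · simp
    · simp
  let L : ℂ × ℂ →L[ℝ] ℂ × ℂ := ((Complex.conjCLE : ℂ →L[ℝ] ℂ).comp (.fst ℝ ℂ ℂ)).prod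
    ((Complex.conjCLE : ℂ →L[ℝ] ℂ).comp (.snd ℝ ℂ ℂ))
  have hL : (conjPair : ℂ × ℂ → ℂ × ℂ) = L := by
    ext w <;> simp [conjPair, L]
  have hdiff : ∀ w, HasFDerivAt conjPair L w := fun w => by
    rw [hL]; exact L.hasFDerivAt
  have h1 := tangentConeAt_image hmem (hdiff _).differentiableAt (hdiff _).differentiableAt
    (fun w _ => conjPair_conjPair w)
  have h2 : conjPair ((0 : ℂ), ((-σ : ℝ) : ℂ) * Complex.I) = (0, σ * Complex.I) := by
    simp [conjPair]
  rw [conjPair_image_modelCircle₁, h2, tangentConeAt_modelCircle₁ hs hc h hσ',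
    (hdiff _).fderiv] at h1
  rw [h1, ← hL, ← Set.range_comp]
  congr 1
  ext t <;> simp [conjPair]

end Incidence

end FordFaces

namespace FordFaces

/-! ### Smoothness of a given inverse. -/

section InverseFunction

variable {E : Type*} [NormedAddCommGroup E] [NormedSpace ℝ E] [FiniteDimensional ℝ E]

/-- An injective smooth map with injective derivatives on an open set has a smooth inverse. -/
theorem contDiffAt_of_leftInvOn {f g : E → E} {V : Set E} (hV : IsOpen V)
    (hf : ∀ x ∈ V, ContDiffAt ℝ ∞ f x) (hf' : ∀ x ∈ V, Function.Injective (fderiv ℝ f x))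
    (hg : Set.LeftInvOn g f V) {x : E} (hx : x ∈ V) :
    ContDiffAt ℝ ∞ g (f x) ∧ f '' V ∈ 𝓝 (f x) := by
  have : CompleteSpace E := FiniteDimensional.complete ℝ E
  let e : E ≃L[ℝ] E :=
    (LinearEquiv.ofInjectiveEndo (fderiv ℝ f x : E →ₗ[ℝ] E) (hf' x hx)).toContinuousLinearEquiv
  have he : (e : E →L[ℝ] E) = fderiv ℝ f x := by ext y; rfl
  have h0 : HasStrictFDerivAt f (e : E →L[ℝ] E) x := by
    rw [he]; exact (hf x hx).hasStrictFDerivAt (by simp)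
  have h1 := (hf x hx).to_localInverse h0.hasFDerivAt (by simp)
  have h2 : ContDiffAt.localInverse (hf x hx) h0.hasFDerivAt (by simp) (f x) = x :=
    (hf x hx).localInverse_apply_image h0.hasFDerivAt (by simp)
  have h3 := ((hf x hx).hasStrictFDerivAt' h0.hasFDerivAt (by simp)).eventually_right_inverse
  refine ⟨h1.congr_of_eventuallyEq ?_, ?_⟩
  -- Close to `f x` the local inverse takes values in `V`, and there the left inverse property of
  -- `g` identifies the two maps.
  · have h4 : ∀ᶠ y in 𝓝 (f x), ContDiffAt.localInverse (hf x hx) h0.hasFDerivAt (by simp) y ∈ V :=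
      h1.continuousAt.eventually_mem (by rw [h2]; exact hV.mem_nhds hx)
    filter_upwards [h3, h4] with y h5 h6
    have h7 := hg h6
    have h8 : f (ContDiffAt.localInverse (hf x hx) h0.hasFDerivAt (by simp) y) = y := h5
    rwa [h8] at h7
  · rw [← h0.map_nhds_eq_of_equiv]
    exact Filter.image_mem_map (hV.mem_nhds hx)

end InverseFunction

/-! ### Collapsing the disk in the torus onto a slit -/

section Collapse

open Real

/-- The factor which collapses the disk `k² + d² ≤ 1/2` of the plane onto a slit. -/
noncomputable def slitFactor (p : ℝ × ℝ) : ℝ := smoothTransition (2 * (p.1 ^ 2 + p.2 ^ 2) - 1)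

/-- The factor vanishes for `k² + d² ≤ 1/2` and equals `1` for `k² + d² ≥ 1`: the closed disk is
flattened onto `k = 0`, `d² ≤ 1/2`, and nothing moves far away. -/
noncomputable def slitMap (p : ℝ × ℝ) : ℝ × ℝ := (p.1 * slitFactor p, p.2)

theorem slitFactor_eq_one {p : ℝ × ℝ} (h : 1 ≤ p.1 ^ 2 + p.2 ^ 2) : slitFactor p = 1 :=
  smoothTransition.one_of_one_le (by linarith)

theorem slitFactor_pos {p : ℝ × ℝ} (h : 1 / 2 < p.1 ^ 2 + p.2 ^ 2) : 0 < slitFactor p :=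
  smoothTransition.pos_of_pos (by linarith)

theorem slitFactor_eq_zero {p : ℝ × ℝ} (h : p.1 ^ 2 + p.2 ^ 2 ≤ 1 / 2) : slitFactor p = 0 :=
  smoothTransition.zero_of_nonpos (by linarith)

theorem slitFactor_nonneg (p : ℝ × ℝ) : 0 ≤ slitFactor p := smoothTransition.nonneg _

theorem slitFactor_le_one (p : ℝ × ℝ) : slitFactor p ≤ 1 := smoothTransition.le_one _

theorem contDiff_slitFactor : ContDiff ℝ ∞ slitFactor :=
  smoothTransition.contDiff.comp (by fun_prop)

theorem contDiff_slitMap : ContDiff ℝ ∞ slitMap :=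
  (contDiff_fst.mul contDiff_slitFactor).prodMk contDiff_snd

theorem slitFactor_mono {k k' d : ℝ} (h : k ^ 2 ≤ k' ^ 2) : slitFactor (k, d) ≤ slitFactor (k', d) :=
  smoothTransition.monotone (by simp only; linarith)

/-- On a line of constant `d`, the factor is a nondecreasing function of `|k|` and is positive
outside the disk, so `|k|` times the factor is strictly increasing in `|k|`. -/
theorem slitMap_injOn : Set.InjOn slitMap {p | 1 / 2 < p.1 ^ 2 + p.2 ^ 2} := by
  have key : ∀ {k k' d : ℝ}, 1 / 2 < k ^ 2 + d ^ 2 → 1 / 2 < k' ^ 2 + d ^ 2 → k ^ 2 < k' ^ 2 →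
      k * slitFactor (k, d) ≠ k' * slitFactor (k', d) := by
    intro k k' d h1 h2 h3 h4
    have f1 := slitFactor_pos (p := (k, d)) h1
    have f2 := slitFactor_mono (d := d) h3.le
    have h5 : (k * slitFactor (k, d)) ^ 2 = (k' * slitFactor (k', d)) ^ 2 := by rw [h4]
    rw [mul_pow, mul_pow] at h5
    have h6 : slitFactor (k, d) ^ 2 ≤ slitFactor (k', d) ^ 2 := pow_le_pow_left₀ f1.le f2 2
    have h7 : 0 < slitFactor (k', d) ^ 2 := pow_pos (f1.trans_le f2) 2
    have h8 := mul_le_mul_of_nonneg_left h6 (sq_nonneg k)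
    have h9 := mul_lt_mul_of_pos_right h3 h7
    linarith
  rintro ⟨k, d⟩ h ⟨k', d'⟩ h' e
  have e1 : k * slitFactor (k, d) = k' * slitFactor (k', d') := congrArg Prod.fst e
  have e2 : d = d' := congrArg Prod.snd e
  subst e2
  rcases lt_trichotomy (k ^ 2) (k' ^ 2) with h1 | h1 | h1
  · exact absurd e1 (key h h' h1)
  · have h2 : slitFactor (k, d) = slitFactor (k', d) := by simp only [slitFactor, h1]
    rw [← h2] at e1
    have := mul_right_cancel₀ (slitFactor_pos (p := (k, d)) h).ne' e1
    rw [this]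
  · exact absurd e1.symm (key h' h h1)

theorem slitMap_mem {p : ℝ × ℝ} (h : 1 / 2 < p.1 ^ 2 + p.2 ^ 2) :
    ¬((slitMap p).1 = 0 ∧ (slitMap p).2 ^ 2 ≤ 1 / 2) := by
  rintro ⟨h1, h2⟩
  have h2' : p.2 ^ 2 ≤ 1 / 2 := h2
  rcases mul_eq_zero.1 h1 with h3 | h3
  · rw [h3] at h; linarith
  · exact (slitFactor_pos h).ne' h3

theorem slitMap_surj {p : ℝ × ℝ} (h : ¬(p.1 = 0 ∧ p.2 ^ 2 ≤ 1 / 2)) :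
    ∃ q : ℝ × ℝ, 1 / 2 < q.1 ^ 2 + q.2 ^ 2 ∧ slitMap q = p := by
  rcases eq_or_ne p.1 0 with h0 | h0
  · have h1 : 1 / 2 < p.2 ^ 2 := by
      by_contra! h1
      exact h ⟨h0, h1⟩
    refine ⟨p, by rw [h0]; linarith, Prod.ext ?_ rfl⟩
    simp [slitMap, h0]
  -- The preimage is sought as `(t p₁, p₂)`, which requires `t` times the factor to be `1`. At `t =
  -- 0` this product is `0`. For `t = max 1 (1/|p₁|)` one has `|t p₁| ≥ 1`, so the factor is `1` and
  -- the product is at least `1`.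
  · obtain ⟨t, ht, ht'⟩ : ∃ t : ℝ, 0 < t ∧ t * slitFactor (t * p.1, p.2) = 1 := by
      have hc : Continuous fun t : ℝ => t * slitFactor (t * p.1, p.2) :=
        continuous_id.mul (contDiff_slitFactor.continuous.comp (by fun_prop))
      have hT : 1 ≤ max 1 (1 / |p.1|) := le_max_left _ _
      have h1 : slitFactor (max 1 (1 / |p.1|) * p.1, p.2) = 1 := by
        apply slitFactor_eq_one
        have h2 : 1 ≤ max 1 (1 / |p.1|) * |p.1| := by
          have := mul_le_mul_of_nonneg_right (le_max_right 1 (1 / |p.1|)) (abs_nonneg p.1)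
          rwa [div_mul_cancel₀ _ (abs_ne_zero.2 h0)] at this
        have h3 : (max 1 (1 / |p.1|) * p.1) ^ 2 = (max 1 (1 / |p.1|) * |p.1|) ^ 2 := by
          rw [mul_pow, mul_pow, sq_abs]
        simp only
        rw [h3]
        nlinarith [sq_nonneg p.2]
      have h2 : (1 : ℝ) ∈ Set.Icc ((0 : ℝ) * slitFactor (0 * p.1, p.2))
          (max 1 (1 / |p.1|) * slitFactor (max 1 (1 / |p.1|) * p.1, p.2)) := by
        rw [h1]; constructor <;> linarith
      obtain ⟨t, ht, ht'⟩ := intermediate_value_Icc (by linarith : (0 : ℝ) ≤ max 1 (1 / |p.1|))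
        hc.continuousOn h2
      refine ⟨t, lt_of_le_of_ne ht.1 ?_, ht'⟩
      rintro rfl
      simp at ht'
    refine ⟨(t * p.1, p.2), ?_, Prod.ext ?_ rfl⟩
    · by_contra! h1
      rw [slitFactor_eq_zero h1] at ht'
      simp at ht'
    · simp only [slitMap]
      linear_combination p.1 * ht'

/-- The derivative is triangular, since `d` is preserved. Its entry in the direction `k` is the
factor plus a nonnegative multiple of `k²`, because the transition function is nondecreasing. -/
theorem fderiv_slitMap_injective {p : ℝ × ℝ} (h : 1 / 2 < p.1 ^ 2 + p.2 ^ 2) :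
    Function.Injective (fderiv ℝ slitMap p) := by
  refine (injective_iff_map_eq_zero _).2 fun y hy => ?_
  have hd : HasFDerivAt slitMap (fderiv ℝ slitMap p) p :=
    (contDiff_slitMap.differentiable (by simp) p).hasFDerivAt
  have h2 : y.2 = 0 := by
    have h1 : HasFDerivAt (fun q => (slitMap q).2)
        ((ContinuousLinearMap.snd ℝ ℝ ℝ).comp (fderiv ℝ slitMap p)) p := hd.snd
    have h2 : HasFDerivAt (fun q : ℝ × ℝ => q.2) (ContinuousLinearMap.snd ℝ ℝ ℝ) p := hasFDerivAt_snd
    have h3 := congrArg (fun L : ℝ × ℝ →L[ℝ] ℝ => L y) (h1.unique h2)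
    simpa [hy] using h3.symm
  have hy' : y = y.1 • ((1 : ℝ), (0 : ℝ)) := Prod.ext (by simp) (by simp [h2])
  have h3 : HasDerivAt (fun t : ℝ => (slitMap (t, p.2)).1) ((fderiv ℝ slitMap p) (1, 0)).1 p.1 := by
    have h4 : HasDerivAt (fun t : ℝ => (t, p.2)) ((1 : ℝ), (0 : ℝ)) p.1 :=
      (hasDerivAt_id p.1).prodMk (hasDerivAt_const p.1 p.2)
    exact (ContinuousLinearMap.fst ℝ ℝ ℝ).hasFDerivAt.comp_hasDerivAt p.1
      (HasFDerivAt.comp_hasDerivAt p.1 (f := fun t : ℝ => (t, p.2)) hd h4)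
  obtain ⟨m, hm, hm'⟩ : ∃ m : ℝ, 0 ≤ m ∧ HasDerivAt (fun t : ℝ => slitFactor (t, p.2)) (m * p.1) p.1 := by
    have h4 : HasDerivAt smoothTransition (deriv smoothTransition (2 * (p.1 ^ 2 + p.2 ^ 2) - 1))
        (2 * (p.1 ^ 2 + p.2 ^ 2) - 1) :=
      ((smoothTransition.contDiff (n := 1)).differentiable (by simp) _).hasDerivAt
    have h5 : HasDerivAt (fun t : ℝ => 2 * (t ^ 2 + p.2 ^ 2) - 1) (4 * p.1) p.1 := by
      have := (((hasDerivAt_pow 2 p.1).add_const (p.2 ^ 2)).const_mul 2).sub_const 1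
      refine this.congr_deriv ?_
      norm_num
      ring
    refine ⟨deriv smoothTransition (2 * (p.1 ^ 2 + p.2 ^ 2) - 1) * 4, ?_, ?_⟩
    · have := smoothTransition.monotone.deriv_nonneg (x := 2 * (p.1 ^ 2 + p.2 ^ 2) - 1)
      positivity
    · rw [mul_assoc]
      exact HasDerivAt.comp p.1 h4 h5
  have h6 : HasDerivAt (fun t : ℝ => (slitMap (t, p.2)).1)
      (slitFactor p + m * p.1 ^ 2) p.1 := by
    refine ((hasDerivAt_id p.1).mul hm').congr_deriv ?_
    simp only [id]
    ring
  have h7 := h3.unique h6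
  have h8 : 0 < slitFactor p + m * p.1 ^ 2 := by
    have := slitFactor_pos h
    positivity
  rw [hy', map_smul] at hy
  have h9 := congrArg Prod.fst hy
  rw [Prod.smul_fst, h7, smul_eq_mul, Prod.fst_zero] at h9
  rcases mul_eq_zero.1 h9 with h10 | h10
  · exact Prod.ext h10 h2
  · exact absurd h10 h8.ne'

/-- The inverse of `slitMap` on the complement of the closed disk. -/
noncomputable def slitInv : ℝ × ℝ → ℝ × ℝ :=
  Function.invFunOn slitMap {p | 1 / 2 < p.1 ^ 2 + p.2 ^ 2}

theorem slitInv_slitMap {p : ℝ × ℝ} (h : 1 / 2 < p.1 ^ 2 + p.2 ^ 2) : slitInv (slitMap p) = p :=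
  slitMap_injOn.leftInvOn_invFunOn h

theorem slitInv_spec {p : ℝ × ℝ} (h : ¬(p.1 = 0 ∧ p.2 ^ 2 ≤ 1 / 2)) :
    1 / 2 < (slitInv p).1 ^ 2 + (slitInv p).2 ^ 2 ∧ slitMap (slitInv p) = p := by
  obtain ⟨q, hq, rfl⟩ := slitMap_surj h
  rw [slitInv_slitMap hq]
  exact ⟨hq, rfl⟩

theorem slitMap_eq_self {p : ℝ × ℝ} (h : 1 ≤ p.1 ^ 2 + p.2 ^ 2) : slitMap p = p := by
  simp [slitMap, slitFactor_eq_one h]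

theorem slitInv_eq_self {p : ℝ × ℝ} (h : 1 ≤ p.1 ^ 2 + p.2 ^ 2) : slitInv p = p := by
  conv_lhs => rw [← slitMap_eq_self h]
  exact slitInv_slitMap (by linarith)

theorem slitInv_snd {p : ℝ × ℝ} (h : ¬(p.1 = 0 ∧ p.2 ^ 2 ≤ 1 / 2)) : (slitInv p).2 = p.2 := by
  have h1 : (slitMap (slitInv p)).2 = p.2 := by rw [(slitInv_spec h).2]
  exact h1

theorem isOpen_exterior : IsOpen {p : ℝ × ℝ | 1 / 2 < p.1 ^ 2 + p.2 ^ 2} :=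
  isOpen_lt continuous_const (by fun_prop)

theorem contDiffAt_slitInv {p : ℝ × ℝ} (h : ¬(p.1 = 0 ∧ p.2 ^ 2 ≤ 1 / 2)) :
    ∀ᶠ q in 𝓝 p, ContDiffAt ℝ ∞ slitInv q := by
  have key : ∀ q : ℝ × ℝ, 1 / 2 < q.1 ^ 2 + q.2 ^ 2 → ContDiffAt ℝ ∞ slitInv (slitMap q) ∧
      slitMap '' {p : ℝ × ℝ | 1 / 2 < p.1 ^ 2 + p.2 ^ 2} ∈ 𝓝 (slitMap q) := fun q hq =>
    contDiffAt_of_leftInvOn isOpen_exterior (fun _ _ => contDiff_slitMap.contDiffAt)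
      (fun _ h => fderiv_slitMap_injective h) (fun _ h => slitInv_slitMap h) hq
  obtain ⟨h1, h2⟩ := slitInv_spec h
  rw [← h2]
  filter_upwards [(key _ h1).2]
  rintro _ ⟨r, hr, rfl⟩
  exact (key r hr).1

end Collapse

end FordFaces

namespace FordFaces

/-! ### Collapsing a closed disk of the torus onto an arc. -/

section TorusCollapse

open Real

/-- Half the sum and half the difference of the arguments of the coordinates. -/
noncomputable def torusCoord (z : ℂ × ℂ) : ℝ × ℝ :=
  ((z.1.arg + z.2.arg) / 2, (z.1.arg - z.2.arg) / 2)

/-- The diagonal rotation of the torus by the angle `μ`. -/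
noncomputable def torusRotate (μ : ℝ) (z : ℂ × ℂ) : ℂ × ℂ := (z.1 * eI μ, z.2 * eI μ)

theorem eI_add (a b : ℝ) : eI (a + b) = eI a * eI b := by
  unfold eI
  rw [← Complex.exp_add]
  push_cast
  ring_nf

@[simp] theorem eI_zero : eI 0 = 1 := by simp [eI]

theorem norm_eI (a : ℝ) : ‖eI a‖ = 1 := by
  rw [eI, mul_comm, Complex.norm_exp_ofReal_mul_I]

theorem eI_eq (a : ℝ) : eI a = Complex.cos a + Complex.sin a * Complex.I := by
  rw [eI, mul_comm, Complex.exp_mul_I]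

theorem arg_eI {a : ℝ} (h : a ∈ Set.Ioc (-π) π) : (eI a).arg = a := by
  rw [eI_eq, Complex.arg_cos_add_sin_mul_I h]

theorem eI_arg {z : ℂ} (h : ‖z‖ = 1) : eI z.arg = z := by
  have := Complex.norm_mul_exp_arg_mul_I z
  rw [h, Complex.ofReal_one, one_mul, mul_comm] at this
  exact this

theorem contDiff_eI : ContDiff ℝ ∞ eI := by
  unfold eI
  have h : ContDiff ℝ ∞ (fun t : ℝ => Complex.I * (t : ℂ)) := contDiff_const.mul contDiff_ofReal
  exact h.cexp

theorem mem_torus_iff {z : ℂ × ℂ} : z ∈ torus ↔ ‖z.1‖ = 1 ∧ ‖z.2‖ = 1 := by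
  simp [torus]

theorem torusRotate_mem {z : ℂ × ℂ} (h : z ∈ torus) (μ : ℝ) : torusRotate μ z ∈ torus := by
  rw [mem_torus_iff] at *
  simp [torusRotate, norm_eI, h]

theorem torusRotate_add (μ ν : ℝ) (z : ℂ × ℂ) :
    torusRotate μ (torusRotate ν z) = torusRotate (ν + μ) z := by
  simp [torusRotate, eI_add, mul_assoc]

@[simp] theorem torusRotate_zero (z : ℂ × ℂ) : torusRotate 0 z = z := by simp [torusRotate]

theorem torusCoord_mem (z : ℂ × ℂ) : (torusCoord z).1 + (torusCoord z).2 ∈ Set.Ioc (-π) π ∧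
    (torusCoord z).1 - (torusCoord z).2 ∈ Set.Ioc (-π) π := by
  have h1 : (torusCoord z).1 + (torusCoord z).2 = z.1.arg := by simp only [torusCoord]; ring
  have h2 : (torusCoord z).1 - (torusCoord z).2 = z.2.arg := by simp only [torusCoord]; ring
  rw [h1, h2]
  exact ⟨Complex.arg_mem_Ioc _, Complex.arg_mem_Ioc _⟩

theorem eI_torusCoord {z : ℂ × ℂ} (h : z ∈ torus) :
    (eI ((torusCoord z).1 + (torusCoord z).2), eI ((torusCoord z).1 - (torusCoord z).2)) = z := by
  have h1 : (torusCoord z).1 + (torusCoord z).2 = z.1.arg := by simp only [torusCoord]; ring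
  have h2 : (torusCoord z).1 - (torusCoord z).2 = z.2.arg := by simp only [torusCoord]; ring
  rw [mem_torus_iff] at h
  rw [h1, h2, eI_arg h.1, eI_arg h.2]

theorem torusCoord_eI {k d : ℝ} (h1 : k + d ∈ Set.Ioc (-π) π) (h2 : k - d ∈ Set.Ioc (-π) π) :
    torusCoord (eI (k + d), eI (k - d)) = (k, d) := by
  simp only [torusCoord, arg_eI h1, arg_eI h2]
  exact Prod.ext (by simp only; ring) (by simp only; ring)

theorem torusCoord_injOn : Set.InjOn torusCoord torus := by
  intro z hz w hw h
  rw [← eI_torusCoord hz, h, eI_torusCoord hw]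

theorem torusRotate_eq {z : ℂ × ℂ} (h : z ∈ torus) (μ : ℝ) : torusRotate μ z =
    (eI ((torusCoord z).1 + μ + (torusCoord z).2), eI ((torusCoord z).1 + μ - (torusCoord z).2)) := by
  conv_lhs => rw [← eI_torusCoord h]
  simp only [torusRotate, ← eI_add]
  exact Prod.ext (by simp only; ring_nf) (by simp only; ring_nf)

/-- The two conditions guarantee that the rotated arguments are still principal values, so that no
branch cut is crossed. -/
theorem torusCoord_torusRotate {z : ℂ × ℂ} (h : z ∈ torus) {k : ℝ}
    (h1 : k + (torusCoord z).2 ∈ Set.Ioc (-π) π) (h2 : k - (torusCoord z).2 ∈ Set.Ioc (-π) π) :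
    torusCoord (torusRotate (k - (torusCoord z).1) z) = (k, (torusCoord z).2) := by
  rw [torusRotate_eq h, add_sub_cancel, torusCoord_eI h1 h2]

/-- Angles of absolute value at most `1 < π` are recovered by the principal argument. In terms of
`k` and `d` they are `k + d` and `k - d`, so the sum of their squares is `2(k² + d²)`; hence the
radius `1/2` from here on. -/
theorem mem_torusCover_image {z : ℂ × ℂ} {P : ℝ → Prop} (hP : ∀ x, P x → x ≤ 1) :
    z ∈ torusCover '' {t | P (t.1 ^ 2 + t.2 ^ 2)} ↔
      z ∈ torus ∧ P (2 * ((torusCoord z).1 ^ 2 + (torusCoord z).2 ^ 2)) := by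
  constructor
  · rintro ⟨t, ht, rfl⟩
    have h0 := hP _ ht
    have hpi := Real.pi_gt_three
    have b1 : t.1 ∈ Set.Ioc (-π) π := ⟨by nlinarith [sq_nonneg t.2], by nlinarith [sq_nonneg t.2]⟩
    have b2 : t.2 ∈ Set.Ioc (-π) π := ⟨by nlinarith [sq_nonneg t.1], by nlinarith [sq_nonneg t.1]⟩
    refine ⟨mem_torus_iff.2 ⟨norm_eI _, norm_eI _⟩, ?_⟩
    have h1 : torusCoord (torusCover t) = ((t.1 + t.2) / 2, (t.1 - t.2) / 2) := by
      simp only [torusCoord, torusCover, arg_eI b1, arg_eI b2]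
    rw [h1]
    have ht' : P (t.1 ^ 2 + t.2 ^ 2) := ht
    convert ht' using 1
    ring
  · rintro ⟨h1, h2⟩
    refine ⟨((torusCoord z).1 + (torusCoord z).2, (torusCoord z).1 - (torusCoord z).2), ?_,
      eI_torusCoord h1⟩
    change P _
    convert h2 using 1
    ring

theorem mem_openDiskInTorus {z : ℂ × ℂ} : z ∈ openDiskInTorus ↔
    z ∈ torus ∧ (torusCoord z).1 ^ 2 + (torusCoord z).2 ^ 2 < 1 / 2 := by
  rw [openDiskInTorus, mem_torusCover_image (P := fun x => x < 1) fun x h => le_of_lt h]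
  refine and_congr_right fun _ => ⟨fun h => ?_, fun h => ?_⟩ <;> linarith

theorem mem_closedDiskInTorus {z : ℂ × ℂ} : z ∈ closedDiskInTorus ↔
    z ∈ torus ∧ (torusCoord z).1 ^ 2 + (torusCoord z).2 ^ 2 ≤ 1 / 2 := by
  rw [closedDiskInTorus, mem_torusCover_image (P := fun x => x ≤ 1) fun x h => h]
  refine and_congr_right fun _ => ⟨fun h => ?_, fun h => ?_⟩ <;> linarith

/-- The slit in the torus. -/
def torusSlit : Set (ℂ × ℂ) := {z | (torusCoord z).1 = 0 ∧ (torusCoord z).2 ^ 2 ≤ 1 / 2}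

/-- Rotating both factors by the same angle changes `k` and leaves `d` fixed, exactly as `slitMap`
does. Written as a rotation, the map remains meaningful across the branch cut of the argument. -/
noncomputable def torusCollapse (z : ℂ × ℂ) : ℂ × ℂ :=
  torusRotate ((slitMap (torusCoord z)).1 - (torusCoord z).1) z

noncomputable def torusExpand (z : ℂ × ℂ) : ℂ × ℂ :=
  torusRotate ((slitInv (torusCoord z)).1 - (torusCoord z).1) z

theorem torusCollapse_mem {z : ℂ × ℂ} (h : z ∈ torus) : torusCollapse z ∈ torus :=
  torusRotate_mem h _

theorem torusCoord_torusCollapse {z : ℂ × ℂ} (h : z ∈ torus) :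
    torusCoord (torusCollapse z) = slitMap (torusCoord z) := by
  have h0 := slitFactor_nonneg (torusCoord z)
  have h1 := slitFactor_le_one (torusCoord z)
  obtain ⟨⟨a1, a2⟩, ⟨b1, b2⟩⟩ := torusCoord_mem z
  have e : (slitMap (torusCoord z)).1 = (torusCoord z).1 * slitFactor (torusCoord z) := rfl
  refine torusCoord_torusRotate h ?_ ?_ <;> rw [e] <;>
    generalize slitFactor (torusCoord z) = f at * <;>
    generalize (torusCoord z).1 = k at * <;> generalize (torusCoord z).2 = d at *
  -- With `0 ≤ f ≤ 1`, `kf ± d` is a convex combination of `k ± d` and `±d`, all of which lie in the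
  -- principal interval.
  · have c1 : -π < d := by linarith
    have c2 : d < π := by linarith
    constructor <;> nlinarith
  · have c1 : -π < -d := by linarith
    have c2 : -d < π := by linarith
    constructor <;> nlinarith

theorem torusCoord_torusExpand {z : ℂ × ℂ} (h : z ∈ torus) (hs : z ∉ torusSlit) :
    torusCoord (torusExpand z) = slitInv (torusCoord z) := by
  obtain ⟨h1, h2⟩ := slitInv_spec hs
  have h3 := slitInv_snd hs
  have hpi := Real.pi_gt_three
  have key : (slitInv (torusCoord z)).1 + (torusCoord z).2 ∈ Set.Ioc (-π) π ∧
      (slitInv (torusCoord z)).1 - (torusCoord z).2 ∈ Set.Ioc (-π) π := by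
    -- Outside the unit radius the inverse is the identity. Inside it, `(k ± d)² ≤ 2(k² + d²) < 2`,
    -- far below `π²`.
    by_cases h4 : 1 ≤ (slitInv (torusCoord z)).1 ^ 2 + (slitInv (torusCoord z)).2 ^ 2
    · rw [slitMap_eq_self h4] at h2
      rw [h2]
      exact torusCoord_mem z
    · rw [h3] at h4
      push Not at h4
      refine ⟨⟨?_, ?_⟩, ⟨?_, ?_⟩⟩ <;> nlinarith [sq_nonneg ((slitInv (torusCoord z)).1 + (torusCoord z).2),
        sq_nonneg ((slitInv (torusCoord z)).1 - (torusCoord z).2)]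
  have := torusCoord_torusRotate h key.1 key.2
  rw [← h3] at this
  rw [torusExpand, this]

theorem torusExpand_torusCollapse {z : ℂ × ℂ} (h : z ∈ torus \ closedDiskInTorus) :
    torusExpand (torusCollapse z) = z := by
  have h1 : 1 / 2 < (torusCoord z).1 ^ 2 + (torusCoord z).2 ^ 2 := by
    by_contra! h1
    exact h.2 (mem_closedDiskInTorus.2 ⟨h.1, h1⟩)
  rw [torusExpand, torusCoord_torusCollapse h.1, slitInv_slitMap h1, torusCollapse, torusRotate_add]
  simp

theorem torusCollapse_torusExpand {z : ℂ × ℂ} (h : z ∈ torus \ torusSlit) :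
    torusCollapse (torusExpand z) = z := by
  rw [torusCollapse, torusCoord_torusExpand h.1 h.2, (slitInv_spec h.2).2, torusExpand,
    torusRotate_add]
  simp

/-- Away from the right half plane, the arguments are large. -/
theorem one_lt_of_re_neg {z : ℂ × ℂ} (h : z.1.re < 0 ∨ z.2.re < 0) :
    1 ≤ (torusCoord z).1 ^ 2 + (torusCoord z).2 ^ 2 := by
  have key : ∀ w : ℂ, w.re < 0 → 2 ≤ w.arg ^ 2 := by
    intro w hw
    have h1 : ¬|w.arg| ≤ π / 2 := by rw [Complex.abs_arg_le_pi_div_two_iff]; exact not_le.2 hw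
    have h2 := Real.pi_gt_three
    rw [← sq_abs]
    nlinarith
  have h1 : (torusCoord z).1 ^ 2 + (torusCoord z).2 ^ 2 = (z.1.arg ^ 2 + z.2.arg ^ 2) / 2 := by
    simp only [torusCoord]; ring
  rw [h1]
  rcases h with h | h
  · nlinarith [key _ h, sq_nonneg z.2.arg]
  · nlinarith [key _ h, sq_nonneg z.1.arg]

theorem contDiffAt_arg {z : ℂ} (h : z ∈ Complex.slitPlane) : ContDiffAt ℝ ∞ Complex.arg z := by
  have h1 : ContDiffAt ℝ ∞ Complex.log z := (Complex.contDiffAt_log h).restrict_scalars ℝ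
  have h2 : Complex.arg = fun w => (Complex.log w).im := funext fun w => (Complex.log_im w).symm
  rw [h2]
  exact contDiff_im.contDiffAt.comp z h1

/-- Rotations by angles given by smooth functions of `torusCoord` are smooth. -/
theorem smoothOnSubset_torusRotate {f : ℝ × ℝ → ℝ × ℝ} {X : Set (ℂ × ℂ)} (hX : X ⊆ torus)
    (hf : ∀ p : ℝ × ℝ, 1 ≤ p.1 ^ 2 + p.2 ^ 2 → f p = p)
    (hf' : ∀ z ∈ X, ∀ᶠ p in 𝓝 (torusCoord z), ContDiffAt ℝ ∞ f p) :
    SmoothOnSubset (fun z => torusRotate ((f (torusCoord z)).1 - (torusCoord z).1) z) X := by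
  have hrot : ∀ {m : ℂ × ℂ → ℝ} {z : ℂ × ℂ}, ContDiffAt ℝ ∞ m z →
      ContDiffAt ℝ ∞ (fun z => torusRotate (m z) z) z := by
    intro m z hm
    have h1 : ContDiffAt ℝ ∞ (fun z => eI (m z)) z := contDiff_eI.contDiffAt.comp z hm
    exact (contDiffAt_fst.mul h1).prodMk (contDiffAt_snd.mul h1)
  refine SmoothOnSubset.of_eventually fun z hz => ?_
  have hz1 := mem_torus_iff.1 (hX hz)
  -- The argument jumps only on the negative real axis. Wherever one coordinate has negative real
  -- part, `f` is the identity, so the rotation is trivial in a neighbourhood.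
  by_cases h : z.1.re < 0 ∨ z.2.re < 0
  · refine ⟨id, .of_forall fun y => contDiffAt_id, ?_⟩
    have : ∀ᶠ y : ℂ × ℂ in 𝓝 z, y.1.re < 0 ∨ y.2.re < 0 := by
      rcases h with h | h
      · have h1 : ContinuousAt (fun y : ℂ × ℂ => y.1.re) z := by fun_prop
        filter_upwards [h1.eventually_lt continuousAt_const h] with y hy
        exact Or.inl hy
      · have h1 : ContinuousAt (fun y : ℂ × ℂ => y.2.re) z := by fun_prop
        filter_upwards [h1.eventually_lt continuousAt_const h] with y hy
        exact Or.inr hy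
    filter_upwards [this] with y hy _
    rw [hf _ (one_lt_of_re_neg hy)]
    simp
  · push Not at h
    have hs : ∀ w : ℂ, ‖w‖ = 1 → 0 ≤ w.re → w ∈ Complex.slitPlane := by
      intro w h1 h2
      rw [Complex.mem_slitPlane_iff]
      by_contra! h3
      have : w = 0 := Complex.ext (le_antisymm h3.1 h2) h3.2
      rw [this] at h1
      simp at h1
    have s1 := hs _ hz1.1 h.1
    have s2 := hs _ hz1.2 h.2
    have hcoord : ∀ y : ℂ × ℂ, y.1 ∈ Complex.slitPlane → y.2 ∈ Complex.slitPlane →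
        ContDiffAt ℝ ∞ torusCoord y := by
      intro y h1 h2
      have a1 : ContDiffAt ℝ ∞ (fun y : ℂ × ℂ => y.1.arg) y :=
        ContDiffAt.comp y (contDiffAt_arg h1) contDiffAt_fst
      have a2 : ContDiffAt ℝ ∞ (fun y : ℂ × ℂ => y.2.arg) y :=
        ContDiffAt.comp y (contDiffAt_arg h2) contDiffAt_snd
      exact ((a1.add a2).div_const 2).prodMk ((a1.sub a2).div_const 2)
    refine ⟨_, ?_, .of_forall fun _ _ => rfl⟩
    filter_upwards [continuousAt_fst.eventually_mem (Complex.isOpen_slitPlane.mem_nhds s1),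
      continuousAt_snd.eventually_mem (Complex.isOpen_slitPlane.mem_nhds s2),
      (hcoord z s1 s2).continuousAt.eventually (hf' z hz)] with y h1 h2 h3
    have h4 := hcoord y h1 h2
    have h5 : ContDiffAt ℝ ∞ (fun y => (f (torusCoord y)).1) y :=
      contDiffAt_fst.comp y (h3.comp y h4)
    exact hrot (h5.sub (contDiffAt_fst.comp y h4))

theorem smoothOnSubset_torusCollapse : SmoothOnSubset torusCollapse torus :=
  smoothOnSubset_torusRotate subset_rfl (fun _ h => slitMap_eq_self h)
    fun _ _ => .of_forall fun _ => contDiff_slitMap.contDiffAt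

theorem smoothOnSubset_torusExpand : SmoothOnSubset torusExpand (torus \ torusSlit) :=
  smoothOnSubset_torusRotate Set.sdiff_subset (fun _ h => slitInv_eq_self h)
    fun _ h => contDiffAt_slitInv h.2

theorem torusCollapse_notMem {z : ℂ × ℂ} (h : z ∈ torus \ closedDiskInTorus) :
    torusCollapse z ∉ torusSlit := by
  intro h1
  have h2 : 1 / 2 < (torusCoord z).1 ^ 2 + (torusCoord z).2 ^ 2 := by
    by_contra! h1
    exact h.2 (mem_closedDiskInTorus.2 ⟨h.1, h1⟩)
  refine slitMap_mem h2 ?_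
  rw [← torusCoord_torusCollapse h.1]
  exact h1

theorem torusExpand_mem {z : ℂ × ℂ} (h : z ∈ torus \ torusSlit) :
    torusExpand z ∈ torus \ closedDiskInTorus := by
  refine ⟨torusRotate_mem h.1 _, fun h1 => ?_⟩
  have h2 := (mem_closedDiskInTorus.1 h1).2
  rw [torusCoord_torusExpand h.1 h.2] at h2
  exact absurd (slitInv_spec h.2).1 (not_lt.2 h2)

theorem areDiffeomorphic_torus_slit :
    AreDiffeomorphic (torus \ closedDiskInTorus) (torus \ torusSlit) :=
  ⟨torusCollapse, torusExpand, smoothOnSubset_torusCollapse.mono Set.sdiff_subset,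
    smoothOnSubset_torusExpand, fun _ h => ⟨torusCollapse_mem h.1, torusCollapse_notMem h⟩,
    fun _ h => torusExpand_mem h, fun _ h => torusExpand_torusCollapse h,
    fun _ h => torusCollapse_torusExpand h⟩

end TorusCollapse

end FordFaces

namespace FordFaces

/-! ### The model spinal surface is a torus -/

section TorusModel

/-- The quadratic form `|η|² + κ² |χ|²` of the half sum `η` and the half difference `χ`. -/
noncomputable def torusForm (κ : ℝ) (z : ℂ × ℂ) : ℝ :=
  Complex.normSq ((z.1 + z.2) / 2) + κ ^ 2 * Complex.normSq ((z.1 - z.2) / 2)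

/-- The positive root `ρ` of `|2s - ρη|² + κ²ρ²|χ|² = 1`, with `η` and `χ` the half sum and half
difference: the point where the ray leaving `(2s, 0)` in the direction `(-η, κχ)` meets the unit
sphere. -/
noncomputable def torusScale (s κ : ℝ) (z : ℂ × ℂ) : ℝ :=
  (2 * s * ((z.1 + z.2) / 2).re + √(4 * s ^ 2 * ((z.1 + z.2) / 2).re ^ 2 +
    torusForm κ z * (1 - 4 * s ^ 2))) / torusForm κ z

/-- The map from the torus to the model. -/
noncomputable def torusToSpinal (s κ : ℝ) (z : ℂ × ℂ) : ℂ × ℂ :=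
  (2 * s - torusScale s κ z * ((z.1 + z.2) / 2), (torusScale s κ z * κ : ℝ) * ((z.1 - z.2) / 2))

/-- The map from the model to the torus. -/
noncomputable def spinalToTorus (s κ : ℝ) (w : ℂ × ℂ) : ℂ × ℂ :=
  ((2 * s - w.1 + w.2 / κ) / (‖2 * s - w.1 + w.2 / κ‖ : ℝ),
    (2 * s - w.1 - w.2 / κ) / (‖2 * s - w.1 - w.2 / κ‖ : ℝ))

variable {s κ : ℝ}

/-- The constant term `-(1 - 4s²)` is negative, so the roots have opposite signs and the positive
one is unique. -/
theorem eq_root {s e a r : ℝ} (hs : 4 * s ^ 2 < 1) (hr : 0 < r) (ha : 0 < a)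
    (h : r ^ 2 * a - 4 * s * r * e - (1 - 4 * s ^ 2) = 0) :
    (2 * s * e + √(4 * s ^ 2 * e ^ 2 + a * (1 - 4 * s ^ 2))) / a = r := by
  have h1 : 4 * s ^ 2 * e ^ 2 + a * (1 - 4 * s ^ 2) = (r * a - 2 * s * e) ^ 2 := by
    linear_combination (-a) * h
  have h2 : 0 ≤ r * a - 2 * s * e := by
    have : 0 < r * (2 * (r * a - 2 * s * e)) := by nlinarith [mul_pos (pow_pos hr 2) ha]
    have := pos_of_mul_pos_right this hr.le
    linarith
  rw [h1, Real.sqrt_sq h2]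
  field_simp
  ring

theorem root_spec {s e a : ℝ} (hs : 4 * s ^ 2 < 1) (ha : 0 < a) :
    0 < (2 * s * e + √(4 * s ^ 2 * e ^ 2 + a * (1 - 4 * s ^ 2))) / a ∧
    ((2 * s * e + √(4 * s ^ 2 * e ^ 2 + a * (1 - 4 * s ^ 2))) / a) ^ 2 * a -
      4 * s * ((2 * s * e + √(4 * s ^ 2 * e ^ 2 + a * (1 - 4 * s ^ 2))) / a) * e -
      (1 - 4 * s ^ 2) = 0 := by
  have h0 : 0 < a * (1 - 4 * s ^ 2) := mul_pos ha (by linarith)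
  have h1 : 0 ≤ 4 * s ^ 2 * e ^ 2 + a * (1 - 4 * s ^ 2) := by positivity
  have h2 := Real.sq_sqrt h1
  set q := √(4 * s ^ 2 * e ^ 2 + a * (1 - 4 * s ^ 2))
  have hq : 0 ≤ q := Real.sqrt_nonneg _
  constructor
  · apply div_pos _ ha
    have : |2 * s * e| < q := abs_lt_of_sq_lt_sq (by nlinarith) hq
    linarith [(abs_lt.1 this).1]
  · field_simp
    linear_combination h2

theorem torusForm_pos (hκ : κ ≠ 0) {z : ℂ × ℂ} (h : z ∈ torus) : 0 < torusForm κ z := by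
  have h1 := Complex.normSq_nonneg ((z.1 + z.2) / 2)
  have h2 := Complex.normSq_nonneg ((z.1 - z.2) / 2)
  have hκ2 : 0 < κ ^ 2 := by positivity
  refine lt_of_le_of_ne (add_nonneg h1 (mul_nonneg hκ2.le h2)) fun h3 => ?_
  have h4 : Complex.normSq ((z.1 + z.2) / 2) = 0 := by
    have := mul_nonneg hκ2.le h2
    unfold torusForm at h3
    linarith
  have h5 : Complex.normSq ((z.1 - z.2) / 2) = 0 := by
    unfold torusForm at h3
    rw [h4, zero_add] at h3
    rcases mul_eq_zero.1 h3.symm with h | h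
    · exact absurd h hκ2.ne'
    · exact h
  rw [Complex.normSq_eq_zero] at h4 h5
  have h6 : z.1 = 0 := by linear_combination h4 + h5
  have := (mem_torus_iff.1 h).1
  rw [h6] at this
  simp at this

theorem torusScale_spec (hs : 4 * s ^ 2 < 1) (hκ : κ ≠ 0) {z : ℂ × ℂ} (h : z ∈ torus) :
    0 < torusScale s κ z ∧ torusScale s κ z ^ 2 * torusForm κ z -
      4 * s * torusScale s κ z * ((z.1 + z.2) / 2).re - (1 - 4 * s ^ 2) = 0 :=
  root_spec hs (torusForm_pos hκ h)

theorem half_add_re (z : ℂ × ℂ) : ((z.1 + z.2) / 2).re = (z.1.re + z.2.re) / 2 := by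
  rw [show (2 : ℂ) = ((2 : ℝ) : ℂ) by simp, Complex.div_ofReal_re, Complex.add_re]

theorem half_add_im (z : ℂ × ℂ) : ((z.1 + z.2) / 2).im = (z.1.im + z.2.im) / 2 := by
  rw [show (2 : ℂ) = ((2 : ℝ) : ℂ) by simp, Complex.div_ofReal_im, Complex.add_im]

theorem half_sub_re (z : ℂ × ℂ) : ((z.1 - z.2) / 2).re = (z.1.re - z.2.re) / 2 := by
  rw [show (2 : ℂ) = ((2 : ℝ) : ℂ) by simp, Complex.div_ofReal_re, Complex.sub_re]

theorem half_sub_im (z : ℂ × ℂ) : ((z.1 - z.2) / 2).im = (z.1.im - z.2.im) / 2 := by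
  rw [show (2 : ℂ) = ((2 : ℝ) : ℂ) by simp, Complex.div_ofReal_im, Complex.sub_im]

theorem torusForm_eq (κ : ℝ) (z : ℂ × ℂ) : torusForm κ z =
    ((z.1.re + z.2.re) / 2) ^ 2 + ((z.1.im + z.2.im) / 2) ^ 2 +
      κ ^ 2 * (((z.1.re - z.2.re) / 2) ^ 2 + ((z.1.im - z.2.im) / 2) ^ 2) := by
  rw [torusForm, Complex.normSq_apply, Complex.normSq_apply, half_add_re, half_add_im, half_sub_re,
    half_sub_im]
  ring

theorem torusToSpinal_fst_re (z : ℂ × ℂ) : (torusToSpinal s κ z).1.re =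
    2 * s - torusScale s κ z * ((z.1.re + z.2.re) / 2) := by
  rw [torusToSpinal, Complex.sub_re, Complex.re_ofReal_mul, half_add_re]
  simp

theorem torusToSpinal_fst_im (z : ℂ × ℂ) : (torusToSpinal s κ z).1.im =
    -(torusScale s κ z * ((z.1.im + z.2.im) / 2)) := by
  rw [torusToSpinal, Complex.sub_im, Complex.im_ofReal_mul, half_add_im]
  simp

theorem torusToSpinal_snd_re (z : ℂ × ℂ) : (torusToSpinal s κ z).2.re =
    torusScale s κ z * κ * ((z.1.re - z.2.re) / 2) := by
  rw [torusToSpinal, Complex.re_ofReal_mul, half_sub_re]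

theorem torusToSpinal_snd_im (z : ℂ × ℂ) : (torusToSpinal s κ z).2.im =
    torusScale s κ z * κ * ((z.1.im - z.2.im) / 2) := by
  rw [torusToSpinal, Complex.im_ofReal_mul, half_sub_im]

theorem re_sq_add_im_sq {z : ℂ} (h : ‖z‖ = 1) : z.re ^ 2 + z.im ^ 2 = 1 := by
  have := Complex.normSq_eq_norm_sq z
  rw [h, Complex.normSq_apply] at this
  linarith

/-- Two complex numbers of equal modulus have orthogonal half sum and half difference, which is the
spinal equation. The sphere equation is the quadratic equation defining the scale. -/
theorem torusToSpinal_mem (hs : 4 * s ^ 2 < 1) (hκ : κ ≠ 0) {z : ℂ × ℂ} (h : z ∈ torus) :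
    torusToSpinal s κ z ∈ modelSpinal s := by
  have h1 := (torusScale_spec hs hκ h).2
  rw [torusForm_eq, half_add_re] at h1
  have h2 := re_sq_add_im_sq (mem_torus_iff.1 h).1
  have h3 := re_sq_add_im_sq (mem_torus_iff.1 h).2
  constructor
  · change Complex.normSq _ + Complex.normSq _ = 1
    rw [Complex.normSq_apply, Complex.normSq_apply, torusToSpinal_fst_re, torusToSpinal_fst_im,
      torusToSpinal_snd_re, torusToSpinal_snd_im]
    linear_combination h1
  · rw [torusToSpinal_fst_re, torusToSpinal_fst_im, torusToSpinal_snd_re, torusToSpinal_snd_im]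
    linear_combination (torusScale s κ z ^ 2 * κ / 4) * (h2 - h3)

theorem spinalToTorus_torusToSpinal (hs : 4 * s ^ 2 < 1) (hκ : κ ≠ 0) {z : ℂ × ℂ} (h : z ∈ torus) :
    spinalToTorus s κ (torusToSpinal s κ z) = z := by
  have h1 := (torusScale_spec hs hκ h).1
  have hκ' : (κ : ℂ) ≠ 0 := by exact_mod_cast hκ
  have h0 : (torusScale s κ z : ℂ) ≠ 0 := by exact_mod_cast h1.ne'
  have e1 : 2 * s - (torusToSpinal s κ z).1 + (torusToSpinal s κ z).2 / κ =
      torusScale s κ z * z.1 := by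
    simp only [torusToSpinal]
    push_cast
    field_simp
    ring
  have e2 : 2 * s - (torusToSpinal s κ z).1 - (torusToSpinal s κ z).2 / κ =
      torusScale s κ z * z.2 := by
    simp only [torusToSpinal]
    push_cast
    field_simp
    ring
  obtain ⟨h2, h3⟩ := mem_torus_iff.1 h
  refine Prod.ext ?_ ?_
  · simp only [spinalToTorus]
    rw [e1, norm_mul, h2, mul_one, Complex.norm_real, Real.norm_eq_abs, abs_of_pos h1]
    field_simp
  · simp only [spinalToTorus]
    rw [e2, norm_mul, h3, mul_one, Complex.norm_real, Real.norm_eq_abs, abs_of_pos h1]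
    field_simp

theorem norm_eq_sqrt (z : ℂ) : ‖z‖ = √(z.re ^ 2 + z.im ^ 2) := by
  rw [Complex.norm_def, Complex.normSq_apply, sq, sq]

/-- Conversely, orthogonality of `2s - v` and `u` makes the two norms equal. They could vanish only
at `v = 2s`, `u = 0`, which is not on the sphere when `4s² < 1`. -/
theorem spinal_sum_norm (hs : 4 * s ^ 2 < 1) (hκ : κ ≠ 0) {w : ℂ × ℂ} (hw : w ∈ modelSpinal s) :
    ‖2 * s - w.1 + w.2 / κ‖ = ‖2 * s - w.1 - w.2 / κ‖ ∧ 0 < ‖2 * s - w.1 + w.2 / κ‖ := by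
  have h1 : Complex.normSq w.1 + Complex.normSq w.2 = 1 := hw.1
  have h2 := hw.2
  rw [Complex.normSq_apply, Complex.normSq_apply] at h1
  have e1 : ‖2 * s - w.1 + w.2 / κ‖ =
      √((2 * s - w.1.re) ^ 2 + w.1.im ^ 2 + (w.2.re ^ 2 + w.2.im ^ 2) / κ ^ 2) := by
    rw [norm_eq_sqrt]
    congr 1
    simp only [Complex.add_re, Complex.sub_re, Complex.mul_re, Complex.re_ofNat, Complex.ofReal_re,
      Complex.im_ofNat, Complex.ofReal_im, Complex.div_ofReal_re, Complex.add_im, Complex.sub_im,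
      Complex.mul_im, Complex.div_ofReal_im]
    field_simp
    linear_combination (2 * κ) * h2
  have e2 : ‖2 * s - w.1 - w.2 / κ‖ =
      √((2 * s - w.1.re) ^ 2 + w.1.im ^ 2 + (w.2.re ^ 2 + w.2.im ^ 2) / κ ^ 2) := by
    rw [norm_eq_sqrt]
    congr 1
    simp only [Complex.sub_re, Complex.mul_re, Complex.re_ofNat, Complex.ofReal_re,
      Complex.im_ofNat, Complex.ofReal_im, Complex.div_ofReal_re, Complex.sub_im,
      Complex.mul_im, Complex.div_ofReal_im]
    field_simp
    linear_combination (-2 * κ) * h2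
  refine ⟨e1.trans e2.symm, ?_⟩
  rw [e1]
  apply Real.sqrt_pos.2
  have hκ2 : 0 < κ ^ 2 := by positivity
  have p1 : 0 ≤ (w.2.re ^ 2 + w.2.im ^ 2) / κ ^ 2 := by positivity
  refine lt_of_le_of_ne (by positivity) fun h3 => ?_
  have h4 : (2 * s - w.1.re) ^ 2 = 0 := by nlinarith [sq_nonneg (2 * s - w.1.re), sq_nonneg w.1.im]
  have h5 : w.1.im ^ 2 = 0 := by nlinarith [sq_nonneg (2 * s - w.1.re), sq_nonneg w.1.im]
  have h6 : (w.2.re ^ 2 + w.2.im ^ 2) / κ ^ 2 = 0 := by linarith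
  have h7 : w.2.re ^ 2 + w.2.im ^ 2 = 0 := by
    rcases div_eq_zero_iff.1 h6 with h | h
    · exact h
    · exact absurd h hκ2.ne'
  have h8 : w.1.re = 2 * s := by
    have := pow_eq_zero_iff two_ne_zero |>.1 h4
    linarith
  rw [h8] at h1
  nlinarith

theorem spinalToTorus_mem (hs : 4 * s ^ 2 < 1) (hκ : κ ≠ 0) {w : ℂ × ℂ} (hw : w ∈ modelSpinal s) :
    spinalToTorus s κ w ∈ torus := by
  obtain ⟨h1, h2⟩ := spinal_sum_norm hs hκ hw
  have h3 := h1 ▸ h2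
  rw [mem_torus_iff]
  simp only [spinalToTorus, norm_div, Complex.norm_real, norm_norm]
  exact ⟨div_self h2.ne', div_self h3.ne'⟩

theorem torusToSpinal_spinalToTorus (hs : 4 * s ^ 2 < 1) (hκ : κ ≠ 0) {w : ℂ × ℂ}
    (hw : w ∈ modelSpinal s) : torusToSpinal s κ (spinalToTorus s κ w) = w := by
  obtain ⟨h1, h2⟩ := spinal_sum_norm hs hκ hw
  set m := ‖2 * s - w.1 + w.2 / κ‖ with hmdef
  have hm : (m : ℂ) ≠ 0 := by exact_mod_cast h2.ne'
  have hκ' : (κ : ℂ) ≠ 0 := by exact_mod_cast hκ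
  have e1 : ((spinalToTorus s κ w).1 + (spinalToTorus s κ w).2) / 2 = (2 * s - w.1) / m := by
    simp only [spinalToTorus, ← h1, ← hmdef]
    field_simp
    ring
  have e2 : ((spinalToTorus s κ w).1 - (spinalToTorus s κ w).2) / 2 = w.2 / κ / m := by
    simp only [spinalToTorus, ← h1, ← hmdef]
    field_simp
    ring
  have h3 : Complex.normSq w.1 + Complex.normSq w.2 = 1 := hw.1
  rw [Complex.normSq_apply, Complex.normSq_apply] at h3
  have hpos := torusForm_pos hκ (spinalToTorus_mem hs hκ hw)
  have e3 : torusForm κ (spinalToTorus s κ w) * m ^ 2 =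
      (2 * s - w.1.re) ^ 2 + w.1.im ^ 2 + (w.2.re ^ 2 + w.2.im ^ 2) := by
    rw [torusForm, e1, e2]
    simp only [Complex.normSq_div, Complex.normSq_ofReal]
    rw [Complex.normSq_apply, Complex.normSq_apply]
    simp only [Complex.sub_re, Complex.mul_re, Complex.re_ofNat, Complex.ofReal_re,
      Complex.im_ofNat, Complex.ofReal_im, Complex.sub_im, Complex.mul_im]
    field_simp
    ring
  have hρ : torusScale s κ (spinalToTorus s κ w) = m := by
    refine eq_root hs h2 hpos ?_
    rw [e1, Complex.div_ofReal_re]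
    simp only [Complex.sub_re, Complex.mul_re, Complex.re_ofNat, Complex.ofReal_re,
      Complex.im_ofNat, Complex.ofReal_im]
    field_simp
    linear_combination e3 + h3
  refine Prod.ext ?_ ?_
  · simp only [torusToSpinal]
    rw [hρ, e1]
    field_simp
    ring
  · simp only [torusToSpinal]
    rw [hρ, e2]
    push_cast
    field_simp

theorem smoothOnSubset_torusToSpinal (hs : 4 * s ^ 2 < 1) (hκ : κ ≠ 0) :
    SmoothOnSubset (torusToSpinal s κ) torus := by
  refine SmoothOnSubset.of_contDiffAt fun z hz => ?_
  have hform : ContDiff ℝ ∞ (torusForm κ) := by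
    rw [funext (torusForm_eq κ)]
    fun_prop
  have h1 : ∀ᶠ y in 𝓝 z, 0 < torusForm κ y :=
    continuousAt_const.eventually_lt hform.continuous.continuousAt (torusForm_pos hκ hz)
  filter_upwards [h1] with y hy
  have c1 : ContDiffAt ℝ ∞ (fun z : ℂ × ℂ => ((z.1 + z.2) / 2).re) y := by
    simp only [half_add_re]
    fun_prop
  have c2 : ContDiffAt ℝ ∞ (fun z : ℂ × ℂ => 4 * s ^ 2 * ((z.1 + z.2) / 2).re ^ 2 +
      torusForm κ z * (1 - 4 * s ^ 2)) y :=
    (contDiffAt_const.mul (c1.pow 2)).add (hform.contDiffAt.mul contDiffAt_const)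
  have hpos : 0 < 4 * s ^ 2 * ((y.1 + y.2) / 2).re ^ 2 + torusForm κ y * (1 - 4 * s ^ 2) := by
    have := mul_pos hy (sub_pos.2 hs)
    positivity
  have c3 : ContDiffAt ℝ ∞ (torusScale s κ) y :=
    ((contDiffAt_const.mul c1).add (c2.sqrt hpos.ne')).div hform.contDiffAt hy.ne'
  have c4 : ContDiffAt ℝ ∞ (fun z => (torusScale s κ z : ℂ)) y :=
    contDiff_ofReal.contDiffAt.comp y c3
  have c5 : ContDiffAt ℝ ∞ (fun z => ((torusScale s κ z * κ : ℝ) : ℂ)) y :=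
    contDiff_ofReal.contDiffAt.comp y (c3.mul contDiffAt_const)
  have c6 : ContDiffAt ℝ ∞ (fun z : ℂ × ℂ => (z.1 + z.2) / 2) y := by fun_prop
  have c7 : ContDiffAt ℝ ∞ (fun z : ℂ × ℂ => (z.1 - z.2) / 2) y := by fun_prop
  exact (contDiffAt_const.sub (c4.mul c6)).prodMk (c5.mul c7)

theorem smoothOnSubset_spinalToTorus (hs : 4 * s ^ 2 < 1) (hκ : κ ≠ 0) :
    SmoothOnSubset (spinalToTorus s κ) (modelSpinal s) := by
  refine SmoothOnSubset.of_contDiffAt fun w hw => ?_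
  obtain ⟨h1, h2⟩ := spinal_sum_norm hs hκ hw
  have h3 := h1 ▸ h2
  have f1 : ContDiff ℝ ∞ (fun w : ℂ × ℂ => 2 * (s : ℂ) - w.1 + w.2 / κ) := by fun_prop
  have f2 : ContDiff ℝ ∞ (fun w : ℂ × ℂ => 2 * (s : ℂ) - w.1 - w.2 / κ) := by fun_prop
  filter_upwards [f1.continuous.continuousAt.eventually_ne (norm_pos_iff.1 h2),
    f2.continuous.continuousAt.eventually_ne (norm_pos_iff.1 h3)] with y n1 n2
  exact (contDiffAt_cdiv f1.contDiffAt
      (contDiff_ofReal.contDiffAt.comp y (f1.contDiffAt.norm ℝ n1))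
      (Complex.ofReal_ne_zero.2 (norm_ne_zero_iff.2 n1))).prodMk
    (contDiffAt_cdiv f2.contDiffAt
      (contDiff_ofReal.contDiffAt.comp y (f2.contDiffAt.norm ℝ n2))
      (Complex.ofReal_ne_zero.2 (norm_ne_zero_iff.2 n2)))

/-- The slit in the model. -/
def modelSlit : Set (ℂ × ℂ) := {w | w.1.im = 0 ∧ w.1.re ≤ 0}

/-- The parameter for which the slits correspond. -/
noncomputable def slitParam (s : ℝ) : ℝ := Real.cos (√(1 / 2)) / (2 * s * Real.sin (√(1 / 2)))

theorem sqrt_half_bounds : 0 < √(1 / 2 : ℝ) ∧ √(1 / 2 : ℝ) < 1 := by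
  refine ⟨Real.sqrt_pos.2 (by norm_num), ?_⟩
  rw [Real.sqrt_lt' one_pos]
  norm_num

theorem slitParam_pos (hs : 0 < s) : 0 < slitParam s := by
  obtain ⟨h1, h2⟩ := sqrt_half_bounds
  have hpi := Real.pi_gt_three
  have h3 := Real.sin_pos_of_pos_of_lt_pi h1 (by linarith)
  have h4 : 0 < Real.cos √(1 / 2) := Real.cos_pos_of_mem_Ioo ⟨by linarith, by linarith⟩
  unfold slitParam
  positivity

/-- Here `a = cos d`, `b = sin d`, and `(a₀, b₀)` are the values at the end of the slit. From
`(κρb)² ≤ 1` and `ρa ≥ 2s` one gets `κ|tan d| ≤ 1/(2s) = κ tan d₀`, stated without division. -/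
theorem slit_bound {ρ κ a b a₀ b₀ : ℝ} (h : (ρ * a - 2 * s) ^ 2 + (κ * ρ * b) ^ 2 = 1)
    (hab : b ^ 2 + a ^ 2 = 1) (hab₀ : b₀ ^ 2 + a₀ ^ 2 = 1) (hκ : κ * (2 * s * b₀) = a₀)
    (hs : 0 < s) (h2 : 2 * s ≤ ρ * a) : a₀ ^ 2 ≤ a ^ 2 := by
  have h6 : (κ * ρ * b) ^ 2 ≤ 1 := by linarith [sq_nonneg (ρ * a - 2 * s)]
  have a1 : (2 * s) ^ 2 ≤ (ρ * a) ^ 2 := pow_le_pow_left₀ (by positivity) h2 2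
  have a2 := mul_le_mul_of_nonneg_left a1 (sq_nonneg (κ * b * b₀))
  have a3 := mul_le_mul_of_nonneg_left h6 (sq_nonneg (a * b₀))
  have a4 : (κ * b * b₀) ^ 2 * (2 * s) ^ 2 = (a₀ * b) ^ 2 := by rw [← hκ]; ring
  have a5 : (κ * b * b₀) ^ 2 * (ρ * a) ^ 2 = (a * b₀) ^ 2 * (κ * ρ * b) ^ 2 := by ring
  have a6 : (a₀ * b) ^ 2 ≤ (a * b₀) ^ 2 := by linarith
  have a7 : (a₀ * b) ^ 2 = a₀ ^ 2 - a₀ ^ 2 * a ^ 2 := by linear_combination a₀ ^ 2 * hab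
  have a8 : (a * b₀) ^ 2 = a ^ 2 - a₀ ^ 2 * a ^ 2 := by linear_combination a ^ 2 * hab₀
  linarith

/-- Put `x = ρa` and suppose `x < 2s`. The bound on the tangent gives `4s²(1 - (x - 2s)²) ≤ x²`,
hence `4s² - x² ≤ 4s²(x - 2s)² ≤ (2s - x)²`. Dividing by `2s - x` gives `x ≤ 0`, a contradiction. -/
theorem slit_bound' {ρ κ a b a₀ b₀ : ℝ} (h : (ρ * a - 2 * s) ^ 2 + (κ * ρ * b) ^ 2 = 1)
    (hab : b ^ 2 + a ^ 2 = 1) (hab₀ : b₀ ^ 2 + a₀ ^ 2 = 1) (hκ : κ * (2 * s * b₀) = a₀)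
    (hs : 4 * s ^ 2 < 1) (hb₀ : 0 < b₀) (hx : 0 < ρ * a)
    (h2 : a₀ ^ 2 ≤ a ^ 2) : 2 * s ≤ ρ * a := by
  by_contra! h7
  have a7 : (a₀ * b) ^ 2 = a₀ ^ 2 - a₀ ^ 2 * a ^ 2 := by linear_combination a₀ ^ 2 * hab
  have a8 : (a * b₀) ^ 2 = a ^ 2 - a₀ ^ 2 * a ^ 2 := by linear_combination a ^ 2 * hab₀
  have a6 : (a₀ * b) ^ 2 ≤ (a * b₀) ^ 2 := by linarith
  have a5 : (κ * (2 * s) * b) ^ 2 ≤ a ^ 2 := by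
    have : b₀ ^ 2 * (κ * (2 * s) * b) ^ 2 ≤ b₀ ^ 2 * a ^ 2 := by
      have e : b₀ ^ 2 * (κ * (2 * s) * b) ^ 2 = (a₀ * b) ^ 2 := by rw [← hκ]; ring
      rw [e]
      linarith
    exact le_of_mul_le_mul_left this (by positivity)
  have h9 : (κ * ρ * b) ^ 2 * (2 * s) ^ 2 ≤ (ρ * a) ^ 2 := by
    have := mul_le_mul_of_nonneg_left a5 (sq_nonneg ρ)
    have e : ρ ^ 2 * (κ * (2 * s) * b) ^ 2 = (κ * ρ * b) ^ 2 * (2 * s) ^ 2 := by ring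
    linarith [mul_pow ρ a 2]
  generalize ρ * a = x at *
  have h10 : (1 - (x - 2 * s) ^ 2) * (2 * s) ^ 2 ≤ x ^ 2 := by
    have : (κ * ρ * b) ^ 2 = 1 - (x - 2 * s) ^ 2 := by linarith
    rwa [this] at h9
  have h11 : (x - 2 * s) ^ 2 * (4 * s ^ 2) ≤ (x - 2 * s) ^ 2 := by
    have := mul_le_mul_of_nonneg_left hs.le (sq_nonneg (x - 2 * s))
    linarith
  have h12 := mul_pos hx (sub_pos.2 h7)
  nlinarith

theorem torusSlit_angles {k d : ℝ} (hm1 : k + d ∈ Set.Ioc (-Real.pi) Real.pi)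
    (hm2 : k - d ∈ Set.Ioc (-Real.pi) Real.pi) (hs0 : 0 < s) (hs : 4 * s ^ 2 < 1) {ρ : ℝ}
    (hρ : 0 < ρ)
    (hroot : (ρ * (Real.cos k * Real.cos d) - 2 * s) ^ 2 + (ρ * (Real.sin k * Real.cos d)) ^ 2 +
      (slitParam s * ρ * Real.sin d) ^ 2 = 1) :
    (ρ * (Real.sin k * Real.cos d) = 0 ∧ 2 * s ≤ ρ * (Real.cos k * Real.cos d)) ↔
      k = 0 ∧ d ^ 2 ≤ 1 / 2 := by
  have hpi := Real.pi_gt_three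
  obtain ⟨hd1, hd2⟩ := sqrt_half_bounds
  have hsinD := Real.sin_pos_of_pos_of_lt_pi hd1 (by linarith)
  have hcosD : 0 < Real.cos √(1 / 2) := Real.cos_pos_of_mem_Ioo ⟨by linarith, by linarith⟩
  have hκ : slitParam s * (2 * s * Real.sin √(1 / 2)) = Real.cos √(1 / 2) := by
    unfold slitParam
    field_simp
  have hD := Real.sin_sq_add_cos_sq √(1 / 2)
  have hd := Real.sin_sq_add_cos_sq d
  have hDsq : √(1 / 2 : ℝ) ^ 2 = 1 / 2 := Real.sq_sqrt (by norm_num)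
  have habs : |d| ≤ Real.pi := by
    rw [abs_le]; constructor <;> linarith [hm1.1, hm1.2, hm2.1, hm2.2]
  constructor
  · rintro ⟨h1, h2⟩
    have h3 : 0 < Real.cos k * Real.cos d := pos_of_mul_pos_right (by linarith) hρ.le
    have h4 : Real.sin k = 0 := by
      rcases mul_eq_zero.1 h1 with h | h
      · exact absurd h hρ.ne'
      · rcases mul_eq_zero.1 h with h | h
        · exact h
        · rw [h, mul_zero] at h3
          exact absurd h3 (lt_irrefl 0)
    -- The other zero `k = π` would force `d = 0` by the bounds on the arguments, and then `cos k
    -- cos d` is negative.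
    have h5 : k = 0 := by
      by_contra h5
      have h6 : k ≤ Real.pi := by linarith [hm1.2, hm2.2]
      have h7 : -Real.pi < k := by linarith [hm1.1, hm2.1]
      rcases lt_or_gt_of_ne h5 with h8 | h8
      · exact (Real.sin_neg_of_neg_of_neg_pi_lt h8 h7).ne h4
      · rcases h6.lt_or_eq with h9 | h9
        · exact (Real.sin_pos_of_pos_of_lt_pi h8 h9).ne' h4
        · have h10 : d = 0 := by linarith [hm1.2, hm2.2]
          rw [h9, h10, Real.cos_pi, Real.cos_zero] at h3
          linarith
    refine ⟨h5, ?_⟩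
    rw [h5, Real.cos_zero, one_mul] at h2 h3
    rw [h5, Real.cos_zero, Real.sin_zero, one_mul, zero_mul, mul_zero] at hroot
    have h8 := slit_bound (by linarith) hd hD hκ hs0 h2
    have h9 : Real.cos √(1 / 2) ≤ Real.cos |d| := by
      rw [Real.cos_abs]
      exact le_of_sq_le_sq h8 h3.le
    have h10 : |d| ≤ √(1 / 2) := by
      by_contra! h10
      exact absurd (Real.cos_lt_cos_of_nonneg_of_le_pi hd1.le habs h10) (not_lt.2 h9)
    rw [← sq_abs, ← hDsq]
    exact pow_le_pow_left₀ (abs_nonneg d) h10 2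
  · rintro ⟨h1, h2⟩
    rw [h1, Real.cos_zero, Real.sin_zero, one_mul, zero_mul, mul_zero] at hroot
    rw [h1, Real.cos_zero, Real.sin_zero, one_mul, zero_mul, mul_zero]
    have h3 : |d| ≤ √(1 / 2) := Real.abs_le_sqrt h2
    have h4 : Real.cos √(1 / 2) ≤ Real.cos d := by
      rw [← Real.cos_abs d]
      exact Real.cos_le_cos_of_nonneg_of_le_pi (abs_nonneg d) (by linarith) h3
    exact ⟨rfl, slit_bound' (by linarith) hd hD hκ hs hsinD
      (mul_pos hρ (hcosD.trans_le h4)) (pow_le_pow_left₀ hcosD.le h4 2)⟩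

theorem eI_re (t : ℝ) : (eI t).re = Real.cos t := by
  rw [eI_eq, ← Complex.ofReal_cos, ← Complex.ofReal_sin, Complex.add_re, Complex.ofReal_re,
    Complex.re_ofReal_mul, Complex.I_re, mul_zero, add_zero]

theorem eI_im (t : ℝ) : (eI t).im = Real.sin t := by
  rw [eI_eq, ← Complex.ofReal_cos, ← Complex.ofReal_sin, Complex.add_im, Complex.ofReal_im,
    Complex.im_ofReal_mul, Complex.I_im, mul_one, zero_add]

/-- In complex form: the half sum is `e^{ik} cos d` and the half difference is `i e^{ik} sin d`. -/
theorem torus_half_sums {z : ℂ × ℂ} (h : z ∈ torus) :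
    (z.1.re + z.2.re) / 2 = Real.cos (torusCoord z).1 * Real.cos (torusCoord z).2 ∧
    (z.1.im + z.2.im) / 2 = Real.sin (torusCoord z).1 * Real.cos (torusCoord z).2 ∧
    (z.1.re - z.2.re) / 2 = -(Real.sin (torusCoord z).1 * Real.sin (torusCoord z).2) ∧
    (z.1.im - z.2.im) / 2 = Real.cos (torusCoord z).1 * Real.sin (torusCoord z).2 := by
  have hz := eI_torusCoord h
  have e1 : z.1 = eI ((torusCoord z).1 + (torusCoord z).2) := (congrArg Prod.fst hz).symm
  have e2 : z.2 = eI ((torusCoord z).1 - (torusCoord z).2) := (congrArg Prod.snd hz).symm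
  have r1 : z.1.re = _ := (congrArg Complex.re e1).trans (eI_re _)
  have r2 : z.2.re = _ := (congrArg Complex.re e2).trans (eI_re _)
  have r3 : z.1.im = _ := (congrArg Complex.im e1).trans (eI_im _)
  have r4 : z.2.im = _ := (congrArg Complex.im e2).trans (eI_im _)
  rw [r1, r2, r3, r4, Real.cos_add, Real.cos_sub, Real.sin_add, Real.sin_sub]
  refine ⟨?_, ?_, ?_, ?_⟩ <;> ring

theorem torusToSpinal_mem_slit_iff (hs0 : 0 < s) (hs : 4 * s ^ 2 < 1) {z : ℂ × ℂ} (h : z ∈ torus) :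
    torusToSpinal s (slitParam s) z ∈ modelSlit ↔ z ∈ torusSlit := by
  obtain ⟨hρ, hroot⟩ := torusScale_spec hs (slitParam_pos hs0).ne' h
  obtain ⟨hm1, hm2⟩ := torusCoord_mem z
  obtain ⟨s1, s2, s3, s4⟩ := torus_half_sums h
  have h1 : torusToSpinal s (slitParam s) z ∈ modelSlit ↔
      (torusToSpinal s (slitParam s) z).1.im = 0 ∧ (torusToSpinal s (slitParam s) z).1.re ≤ 0 :=
    Iff.rfl
  rw [h1, torusToSpinal_fst_im, torusToSpinal_fst_re, neg_eq_zero, sub_nonpos, s1, s2]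
  rw [torusForm_eq, half_add_re, s1, s2, s3, s4] at hroot
  refine torusSlit_angles hm1 hm2 hs0 hs hρ ?_
  linear_combination hroot - (slitParam s * torusScale s (slitParam s) z *
    Real.sin (torusCoord z).2) ^ 2 * Real.sin_sq_add_cos_sq (torusCoord z).1

theorem areDiffeomorphic_torusSlit_modelSlit (hs0 : 0 < s) (hs : 4 * s ^ 2 < 1) :
    AreDiffeomorphic (torus \ torusSlit) (modelSpinal s \ modelSlit) := by
  have hκ := (slitParam_pos hs0).ne'
  refine ⟨torusToSpinal s (slitParam s), spinalToTorus s (slitParam s),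
    (smoothOnSubset_torusToSpinal hs hκ).mono Set.sdiff_subset,
    (smoothOnSubset_spinalToTorus hs hκ).mono Set.sdiff_subset, ?_, ?_,
    fun z hz => spinalToTorus_torusToSpinal hs hκ hz.1,
    fun w hw => torusToSpinal_spinalToTorus hs hκ hw.1⟩
  · intro z hz
    exact ⟨torusToSpinal_mem hs hκ hz.1, fun h => hz.2 ((torusToSpinal_mem_slit_iff hs0 hs hz.1).1 h)⟩
  · intro w hw
    have h1 := spinalToTorus_mem hs hκ hw.1
    refine ⟨h1, fun h => hw.2 ?_⟩
    have := (torusToSpinal_mem_slit_iff hs0 hs h1).2 h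
    rwa [torusToSpinal_spinalToTorus hs hκ hw.1] at this

end TorusModel

end FordFaces

namespace FordFaces

/-! ### Opening the slit along the circles `|v| = R` -/

section Fan

/-- The rescaling of the distance `|v| - Re v` by the factor `θ` along the circles `|v| = R`. -/
noncomputable def fanGain (θ : ℝ) (v : ℂ) : ℝ :=
  √(θ * (2 * ‖v‖ - θ * (‖v‖ - v.re)) / (‖v‖ + v.re))

noncomputable def fanBase (θ : ℝ) (v : ℂ) : ℂ :=
  (‖v‖ - θ * (‖v‖ - v.re) : ℝ) + (v.im * fanGain θ v : ℝ) * Complex.I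

/-- The second coordinate before normalization. -/
noncomputable def fanRaw (s θ : ℝ) (w : ℂ × ℂ) : ℂ :=
  (fanGain θ w.1 * w.2.re : ℝ) +
    ((2 * s + w.1.re) / (2 * s + ‖w.1‖) * w.2.im +
      w.1.im * (θ / (‖w.1‖ + w.1.re) - 1 / (2 * s + ‖w.1‖)) * w.2.re : ℝ) * Complex.I

/-- The second coordinate is to be the point of the same sheet over the new base `v'`, in a form
that stays smooth at `v = 2s`. With `t = r/|2s - v|` the two sums under the root are `(1 + t²)|2s -
v|²` and `(1 + t²)|2s - v'|²`. Unlike the bare norms they do not vanish at `v = 2s`, where `u ≠ 0`.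
-/
noncomputable def fanMap (s θ : ℝ) (w : ℂ × ℂ) : ℂ × ℂ :=
  (fanBase θ w.1,
    (√((Complex.normSq (2 * s - w.1) + Complex.normSq w.2) /
      (Complex.normSq (2 * s - fanBase θ w.1) + Complex.normSq (fanRaw s θ w))) : ℝ) *
        fanRaw s θ w)

@[simp] theorem fanBase_re (θ : ℝ) (v : ℂ) : (fanBase θ v).re = ‖v‖ - θ * (‖v‖ - v.re) := by
  simp only [fanBase, Complex.add_re, Complex.ofReal_re, Complex.re_ofReal_mul, Complex.I_re,
    mul_zero, add_zero]

@[simp] theorem fanBase_im (θ : ℝ) (v : ℂ) : (fanBase θ v).im = v.im * fanGain θ v := by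
  simp only [fanBase, Complex.add_im, Complex.ofReal_im, Complex.im_ofReal_mul, Complex.I_im,
    mul_one, zero_add]

@[simp] theorem fanRaw_re (s θ : ℝ) (w : ℂ × ℂ) : (fanRaw s θ w).re = fanGain θ w.1 * w.2.re := by
  simp only [fanRaw, Complex.add_re, Complex.ofReal_re, Complex.re_ofReal_mul, Complex.I_re,
    mul_zero, add_zero]

@[simp] theorem fanRaw_im (s θ : ℝ) (w : ℂ × ℂ) : (fanRaw s θ w).im =
    (2 * s + w.1.re) / (2 * s + ‖w.1‖) * w.2.im +
      w.1.im * (θ / (‖w.1‖ + w.1.re) - 1 / (2 * s + ‖w.1‖)) * w.2.re := by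
  simp only [fanRaw, Complex.add_im, Complex.ofReal_im, Complex.im_ofReal_mul, Complex.I_im,
    mul_one, zero_add]

theorem norm_sq_eq (v : ℂ) : ‖v‖ ^ 2 = v.re ^ 2 + v.im ^ 2 := by
  rw [← Complex.normSq_eq_norm_sq, Complex.normSq_apply, sq, sq]

theorem normSq_eq (v : ℂ) : Complex.normSq v = v.re ^ 2 + v.im ^ 2 := by
  rw [Complex.normSq_apply, sq, sq]

theorem normSq_two_mul_sub' (s : ℝ) (v : ℂ) :
    Complex.normSq (2 * (s : ℂ) - v) = (2 * s - v.re) ^ 2 + v.im ^ 2 := by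
  rw [Complex.normSq_eq_norm_sq, normSq_two_mul_sub]

variable {s θ : ℝ}

theorem fanGain_sq {v : ℂ} (hθ : 0 < θ) (h1 : 0 < ‖v‖ + v.re)
    (h2 : 0 ≤ 2 * ‖v‖ - θ * (‖v‖ - v.re)) :
    fanGain θ v ^ 2 * (‖v‖ + v.re) = θ * (2 * ‖v‖ - θ * (‖v‖ - v.re)) := by
  rw [fanGain, Real.sq_sqrt (by positivity)]
  field_simp

/-- The gain was chosen for this: on `|v| = R` its square is the quotient of the new `R² - (Re v)²`
by the old one. -/
theorem norm_fanBase {v : ℂ} (hθ : 0 < θ) (h1 : 0 < ‖v‖ + v.re)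
    (h2 : 0 ≤ 2 * ‖v‖ - θ * (‖v‖ - v.re)) : ‖fanBase θ v‖ = ‖v‖ := by
  have h3 := fanGain_sq hθ h1 h2
  have h4 := norm_sq_eq v
  rw [← sq_eq_sq₀ (norm_nonneg _) (norm_nonneg _), norm_sq_eq (fanBase θ v), fanBase_re,
    fanBase_im]
  linear_combination (‖v‖ - v.re) * h3 - fanGain θ v ^ 2 * h4

theorem fanBase_eq_iff {v : ℂ} (hs : 0 < s) (hθ : 0 < θ) (h1 : 0 < ‖v‖ + v.re)
    (h2 : 0 ≤ 2 * ‖v‖ - θ * (‖v‖ - v.re)) : fanBase θ v = 2 * s ↔ v = 2 * s := by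
  have hn : ‖(2 * s : ℂ)‖ = 2 * s := by
    rw [← Complex.ofReal_ofNat, ← Complex.ofReal_mul, Complex.norm_real, Real.norm_eq_abs,
      abs_of_pos (by positivity)]
  constructor
  · intro h
    have h3 := norm_fanBase hθ h1 h2
    rw [h, hn] at h3
    have h4 := congrArg Complex.re h
    rw [fanBase_re] at h4
    simp only [Complex.mul_re, Complex.re_ofNat, Complex.ofReal_re, Complex.im_ofNat,
      Complex.ofReal_im, mul_zero, sub_zero] at h4
    have h5 : θ * (‖v‖ - v.re) = 0 := by linarith
    have h6 : v.re = 2 * s := by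
      rcases mul_eq_zero.1 h5 with h | h
      · exact absurd h hθ.ne'
      · linarith
    have h7 := norm_sq_eq v
    rw [← h3, h6] at h7
    have h8 : v.im = 0 := by
      have : v.im ^ 2 = 0 := by linarith
      exact pow_eq_zero_iff two_ne_zero |>.1 this
    apply Complex.ext
    · simpa using h6
    · simpa using h8
  · rintro rfl
    apply Complex.ext
    · rw [fanBase_re, hn]; simp
    · rw [fanBase_im]; simp

/-- This explains `fanRaw`: it is `i t (2s - v')` with `t = r/|2s - v|`, where `t` has been
eliminated through `Re u = t Im v` and `Im u = t(2s - Re v)`. The quotient that is singular at `v =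
2s` disappears. -/
theorem fanRaw_eq {w : ℂ × ℂ} (hw : w ∈ modelSpinal s) (hne : w.1 ≠ 2 * s) (hs : 0 < s)
    (h1 : 0 < ‖w.1‖ + w.1.re) :
    fanRaw s θ w = Complex.I * (sheetCoord s w / ‖2 * (s : ℂ) - w.1‖ : ℝ) *
      (2 * s - fanBase θ w.1) := by
  have h0 : 0 < ‖2 * (s : ℂ) - w.1‖ := norm_pos_iff.2 (sub_ne_zero.2 hne.symm)
  have e1 := congrArg Complex.re (sheet_sheetCoord hw hne)
  have e2 := congrArg Complex.im (sheet_sheetCoord hw hne)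
  rw [sheet_re] at e1
  rw [sheet_im] at e2
  have h4 := norm_sq_eq w.1
  have hR := norm_nonneg w.1
  have hp : 0 < 2 * s + ‖w.1‖ := by positivity
  apply Complex.ext
  · rw [fanRaw_re, ← e1]
    simp
    ring
  · rw [fanRaw_im, ← e1, ← e2]
    simp only [Complex.mul_im, Complex.I_re, Complex.ofReal_im, mul_zero, Complex.I_im,
      Complex.ofReal_re, one_mul, zero_add, Complex.sub_re, Complex.mul_re, Complex.re_ofNat,
      Complex.im_ofNat, sub_zero, fanBase_re, Complex.sub_im, zero_mul, sub_self, add_zero]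
    field_simp
    linear_combination (sheetCoord s w * (w.1.re + ‖w.1‖ - θ * (2 * s + ‖w.1‖))) * h4

theorem fanMap_snd {w : ℂ × ℂ} (hw : w ∈ modelSpinal s) (hne : w.1 ≠ 2 * s) (hs : 0 < s)
    (hθ : 0 < θ) (h1 : 0 < ‖w.1‖ + w.1.re) (h2 : 0 ≤ 2 * ‖w.1‖ - θ * (‖w.1‖ - w.1.re)) :
    (fanMap s θ w).2 = sheet s (sheetCoord s w) (fanBase θ w.1) := by
  have h0 : 0 < ‖2 * (s : ℂ) - w.1‖ := norm_pos_iff.2 (sub_ne_zero.2 hne.symm)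
  have h0' : 0 < ‖2 * (s : ℂ) - fanBase θ w.1‖ :=
    norm_pos_iff.2 (sub_ne_zero.2 (Ne.symm (mt (fanBase_eq_iff hs hθ h1 h2).1 hne)))
  have e1 := fanRaw_eq (θ := θ) hw hne hs h1
  have e2 : Complex.normSq (fanRaw s θ w) = (sheetCoord s w / ‖2 * (s : ℂ) - w.1‖) ^ 2 *
      ‖2 * (s : ℂ) - fanBase θ w.1‖ ^ 2 := by
    rw [e1, Complex.normSq_mul, Complex.normSq_mul, Complex.normSq_I, Complex.normSq_ofReal,
      Complex.normSq_eq_norm_sq (2 * (s : ℂ) - fanBase θ w.1)]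
    ring
  have e3 : (Complex.normSq (2 * s - w.1) + Complex.normSq w.2) /
      (Complex.normSq (2 * s - fanBase θ w.1) + Complex.normSq (fanRaw s θ w)) =
      (‖2 * (s : ℂ) - w.1‖ / ‖2 * (s : ℂ) - fanBase θ w.1‖) ^ 2 := by
    rw [e2, ← sheetCoord_sq hw hne, Complex.normSq_eq_norm_sq, Complex.normSq_eq_norm_sq]
    field_simp
  simp only [fanMap]
  rw [e3, Real.sqrt_sq (by positivity), e1, sheet]
  have c1 : ((‖2 * (s : ℂ) - w.1‖ : ℝ) : ℂ) ≠ 0 := by exact_mod_cast h0.ne'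
  have c2 : ((‖2 * (s : ℂ) - fanBase θ w.1‖ : ℝ) : ℂ) ≠ 0 := by exact_mod_cast h0'.ne'
  push_cast
  field_simp

theorem norm_two_mul (hs : 0 < s) : ‖(2 * s : ℂ)‖ = 2 * s := by
  rw [← Complex.ofReal_ofNat, ← Complex.ofReal_mul, Complex.norm_real, Real.norm_eq_abs,
    abs_of_pos (by positivity)]

theorem fanGain_center (hs : 0 < s) {v : ℂ} (h : v = 2 * s) : fanGain θ v = √θ := by
  rw [fanGain, h, norm_two_mul hs]
  congr 1
  simp
  field_simp
  norm_num

/-- Over `v = 2s` the map acts on the circle of values of `u` by stretching `Re u` by `√θ` and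
normalizing; the stretch by `1/√θ` undoes it. -/
theorem fanRaw_center (hs : 0 < s) {w : ℂ × ℂ} (h : w.1 = 2 * s) :
    (fanRaw s θ w).re = √θ * w.2.re ∧ (fanRaw s θ w).im = w.2.im := by
  rw [fanRaw_re, fanRaw_im, fanGain_center hs h, h, norm_two_mul hs]
  refine ⟨rfl, ?_⟩
  simp
  field_simp

theorem fanRaw_center_pos (hs : 0 < s) (hθ : 0 < θ) {w : ℂ × ℂ} (h : w.1 = 2 * s) (h0 : w.2 ≠ 0) :
    0 < Complex.normSq (fanRaw s θ w) := by
  rw [Complex.normSq_pos]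
  intro h1
  obtain ⟨e1, e2⟩ := fanRaw_center (θ := θ) hs h
  rw [h1, Complex.zero_re] at e1
  rw [h1, Complex.zero_im] at e2
  refine h0 (Complex.ext ?_ e2.symm)
  rcases mul_eq_zero.1 e1.symm with h2 | h2
  · exact absurd h2 (Real.sqrt_pos.2 hθ).ne'
  · exact h2

theorem snd_ne_zero (hs1 : 4 * s ^ 2 < 1) {w : ℂ × ℂ} (hw : w ∈ modelSpinal s) (h : w.1 = 2 * s) :
    w.2 ≠ 0 := by
  intro h0
  have h1 : Complex.normSq w.1 + Complex.normSq w.2 = 1 := hw.1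
  rw [h, h0, normSq_eq] at h1
  simp at h1
  rcases h1 with h1 | h1 <;> nlinarith

theorem fanMap_center (hs : 0 < s) (hθ : 0 < θ) {w : ℂ × ℂ}
    (h : w.1 = 2 * s) (h0 : w.2 ≠ 0) : (fanMap s θ w).1 = 2 * s ∧
      (fanMap s θ w).2 = (√(Complex.normSq w.2 / Complex.normSq (fanRaw s θ w)) : ℝ) *
        fanRaw s θ w ∧ Complex.normSq (fanMap s θ w).2 = Complex.normSq w.2 := by
  have e0 : fanBase θ w.1 = 2 * s := by
    have h3 : 0 < ‖w.1‖ + w.1.re := by rw [h, norm_two_mul hs]; simp; linarith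
    refine (fanBase_eq_iff hs hθ h3 ?_).2 h
    rw [h, norm_two_mul hs]
    simp
    linarith
  have e1 : (fanMap s θ w).2 = (√(Complex.normSq w.2 / Complex.normSq (fanRaw s θ w)) : ℝ) *
      fanRaw s θ w := by
    simp only [fanMap]
    rw [e0, h]
    simp
  refine ⟨e0, e1, ?_⟩
  have hpos := fanRaw_center_pos hs hθ h h0
  have hnn := Complex.normSq_nonneg w.2
  rw [e1, Complex.normSq_mul, Complex.normSq_ofReal, Real.mul_self_sqrt (by positivity)]
  field_simp

theorem fanMap_mem (hs : 0 < s) (hs1 : 4 * s ^ 2 < 1) (hθ : 0 < θ) {w : ℂ × ℂ}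
    (hw : w ∈ modelSpinal s) (h1 : 0 < ‖w.1‖ + w.1.re)
    (h2 : 0 ≤ 2 * ‖w.1‖ - θ * (‖w.1‖ - w.1.re)) : fanMap s θ w ∈ modelSpinal s := by
  have h3 : Complex.normSq w.1 + Complex.normSq w.2 = 1 := hw.1
  by_cases hne : w.1 = 2 * s
  · obtain ⟨e1, -, e3⟩ := fanMap_center hs hθ hne (snd_ne_zero hs1 hw hne)
    refine ⟨?_, ?_⟩
    · change Complex.normSq _ + Complex.normSq _ = 1
      rw [e1, e3, ← hne, h3]
    · rw [e1]; simp
  · have e1 := fanMap_snd hw hne hs hθ h1 h2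
    have e2 : fanMap s θ w = (fanBase θ w.1, sheet s (sheetCoord s w) (fanBase θ w.1)) :=
      Prod.ext rfl e1
    rw [e2]
    refine sheet_mem ?_ fun h => absurd ((fanBase_eq_iff hs hθ h1 h2).1 h) hne
    rw [sheetCoord_sq hw hne, Complex.normSq_eq_norm_sq, norm_fanBase hθ h1 h2,
      ← Complex.normSq_eq_norm_sq, h3]

theorem fanBase_fanBase {θ' : ℝ} (hθ : 0 < θ) (hθ' : θ * θ' = 1) {v : ℂ} (h1 : 0 < ‖v‖ + v.re)
    (h2 : 0 < 2 * ‖v‖ - θ * (‖v‖ - v.re)) : fanBase θ' (fanBase θ v) = v := by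
  have hn := norm_fanBase hθ h1 h2.le
  have hθ0 : 0 < θ' := pos_of_mul_pos_right (by rw [hθ']; exact one_pos) hθ.le
  apply Complex.ext
  · rw [fanBase_re, hn, fanBase_re]
    linear_combination (v.re - ‖v‖) * hθ'
  · rw [fanBase_im, fanBase_im, mul_assoc]
    have h3 : fanGain θ v * fanGain θ' (fanBase θ v) = 1 := by
      have h4 : 0 ≤ θ * (2 * ‖v‖ - θ * (‖v‖ - v.re)) / (‖v‖ + v.re) := by positivity
      rw [fanGain, fanGain, hn, fanBase_re, ← Real.sqrt_mul h4]
      rw [Real.sqrt_eq_one]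
      have e1 : 2 * ‖v‖ - θ' * (‖v‖ - (‖v‖ - θ * (‖v‖ - v.re))) = ‖v‖ + v.re := by
        linear_combination (v.re - ‖v‖) * hθ'
      have e2 : ‖v‖ + (‖v‖ - θ * (‖v‖ - v.re)) = 2 * ‖v‖ - θ * (‖v‖ - v.re) := by ring
      rw [e1, e2]
      field_simp
      linear_combination hθ'
    rw [h3, mul_one]

/-- Away from `v = 2s` the sheet coordinate is preserved, so it suffices that the base map with
factor `1/θ` inverts the one with factor `θ`. Over `v = 2s` the two stretches of the circle are
compared directly. -/
theorem fanMap_fanMap {θ' : ℝ} (hs : 0 < s) (hs1 : 4 * s ^ 2 < 1) (hθ : 0 < θ) (hθ' : θ * θ' = 1)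
    {w : ℂ × ℂ} (hw : w ∈ modelSpinal s) (h1 : 0 < ‖w.1‖ + w.1.re)
    (h2 : 0 < 2 * ‖w.1‖ - θ * (‖w.1‖ - w.1.re)) : fanMap s θ' (fanMap s θ w) = w := by
  have hb := fanBase_fanBase hθ hθ' h1 h2
  have hn := norm_fanBase hθ h1 h2.le
  have hm := fanMap_mem hs hs1 hθ hw h1 h2.le
  have hθ0 : 0 < θ' := pos_of_mul_pos_right (by rw [hθ']; exact one_pos) hθ.le
  have h1' : 0 < ‖(fanMap s θ w).1‖ + (fanMap s θ w).1.re := by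
    simp only [fanMap]
    rw [hn, fanBase_re]
    linarith
  have h2' : 0 ≤ 2 * ‖(fanMap s θ w).1‖ - θ' * (‖(fanMap s θ w).1‖ - (fanMap s θ w).1.re) := by
    simp only [fanMap]
    rw [hn, fanBase_re]
    have e1 : 2 * ‖w.1‖ - θ' * (‖w.1‖ - (‖w.1‖ - θ * (‖w.1‖ - w.1.re))) = ‖w.1‖ + w.1.re := by
      linear_combination (w.1.re - ‖w.1‖) * hθ'
    rw [e1]
    exact h1.le
  refine Prod.ext hb ?_
  by_cases hne : w.1 = 2 * s
  · have h0 := snd_ne_zero hs1 hw hne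
    obtain ⟨e1, e2, e3⟩ := fanMap_center hs hθ hne h0
    have h0' := snd_ne_zero hs1 hm e1
    obtain ⟨-, e5, -⟩ := fanMap_center hs hθ0 e1 h0'
    have p1 := Complex.normSq_pos.2 h0
    have p2 := fanRaw_center_pos hs hθ hne h0
    have p3 := fanRaw_center_pos hs hθ0 e1 h0'
    set n := √(Complex.normSq w.2 / Complex.normSq (fanRaw s θ w))
    have hnpos : 0 < n := Real.sqrt_pos.2 (by positivity)
    obtain ⟨r1, r2⟩ := fanRaw_center (θ := θ) hs hne
    obtain ⟨r3, r4⟩ := fanRaw_center (θ := θ') hs e1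
    have hsq : √θ' * √θ = 1 := by
      rw [← Real.sqrt_mul hθ0.le, mul_comm, hθ', Real.sqrt_one]
    have e6 : fanRaw s θ' (fanMap s θ w) = n * w.2 := by
      apply Complex.ext
      · rw [r3, e2, Complex.re_ofReal_mul, r1, Complex.re_ofReal_mul]
        linear_combination n * w.2.re * hsq
      · rw [r4, e2, Complex.im_ofReal_mul, r2, Complex.im_ofReal_mul]
    rw [e5, e6, e3, Complex.normSq_mul, Complex.normSq_ofReal]
    have e7 : Complex.normSq w.2 / (n * n * Complex.normSq w.2) = (1 / n) ^ 2 := by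
      field_simp
    rw [e7, Real.sqrt_sq (by positivity)]
    have hn0 : (n : ℂ) ≠ 0 := by exact_mod_cast hnpos.ne'
    push_cast
    field_simp
  · have hne' : (fanMap s θ w).1 ≠ 2 * s := mt (fanBase_eq_iff hs hθ h1 h2.le).1 hne
    rw [fanMap_snd hm hne' hs hθ0 h1' h2']
    have e1 : fanMap s θ w = (fanBase θ w.1, sheet s (sheetCoord s w) (fanBase θ w.1)) :=
      Prod.ext rfl (fanMap_snd hw hne hs hθ h1 h2.le)
    have e2 : sheetCoord s (fanMap s θ w) = sheetCoord s w := by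
      rw [e1]
      exact sheetCoord_sheet hne'
    rw [e2]
    have e3 : fanBase θ' (fanMap s θ w).1 = w.1 := hb
    rw [e3, sheet_sheetCoord hw hne]

theorem contDiffAt_fanBase {θ : ℂ × ℂ → ℝ} {w : ℂ × ℂ} (hθ : ContDiffAt ℝ ∞ θ w) (hθ0 : 0 < θ w)
    (h1 : 0 < ‖w.1‖ + w.1.re) (h2 : 0 < 2 * ‖w.1‖ - θ w * (‖w.1‖ - w.1.re)) :
    ContDiffAt ℝ ∞ (fun y => fanGain (θ y) y.1) w ∧ ContDiffAt ℝ ∞ (fun y => fanBase (θ y) y.1) w := by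
  have hv : w.1 ≠ 0 := by
    intro h
    rw [h] at h1
    simp at h1
  have n1 : ContDiffAt ℝ ∞ (fun y : ℂ × ℂ => ‖y.1‖) w := contDiffAt_fst.norm ℝ hv
  have r1 : ContDiffAt ℝ ∞ (fun y : ℂ × ℂ => y.1.re) w := by fun_prop
  have r2 : ContDiffAt ℝ ∞ (fun y : ℂ × ℂ => y.1.im) w := by fun_prop
  have g1 : ContDiffAt ℝ ∞ (fun y => fanGain (θ y) y.1) w := by
    refine ContDiffAt.sqrt (((hθ.mul ((contDiffAt_const.mul n1).sub (hθ.mul (n1.sub r1)))).div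
      (n1.add r1) h1.ne')) ?_
    positivity
  refine ⟨g1, ?_⟩
  exact (contDiff_ofReal.contDiffAt.comp w (n1.sub (hθ.mul (n1.sub r1)))).add
    ((contDiff_ofReal.contDiffAt.comp w (r2.mul g1)).mul contDiffAt_const)

theorem contDiffAt_fanRaw {θ : ℂ × ℂ → ℝ} {w : ℂ × ℂ} (hs : 0 < s) (hθ : ContDiffAt ℝ ∞ θ w)
    (hθ0 : 0 < θ w) (h1 : 0 < ‖w.1‖ + w.1.re) (h2 : 0 < 2 * ‖w.1‖ - θ w * (‖w.1‖ - w.1.re)) :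
    ContDiffAt ℝ ∞ (fun y => fanRaw s (θ y) y) w := by
  have hv : w.1 ≠ 0 := by
    intro h
    rw [h] at h1
    simp at h1
  have n1 : ContDiffAt ℝ ∞ (fun y : ℂ × ℂ => ‖y.1‖) w := contDiffAt_fst.norm ℝ hv
  have r1 : ContDiffAt ℝ ∞ (fun y : ℂ × ℂ => y.1.re) w := by fun_prop
  have r2 : ContDiffAt ℝ ∞ (fun y : ℂ × ℂ => y.1.im) w := by fun_prop
  have r3 : ContDiffAt ℝ ∞ (fun y : ℂ × ℂ => y.2.re) w := by fun_prop
  have r4 : ContDiffAt ℝ ∞ (fun y : ℂ × ℂ => y.2.im) w := by fun_prop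
  have g1 := (contDiffAt_fanBase hθ hθ0 h1 h2).1
  have hp : 2 * s + ‖w.1‖ ≠ 0 := by positivity
  have d1 : ContDiffAt ℝ ∞ (fun y : ℂ × ℂ => 2 * s + ‖y.1‖) w := contDiffAt_const.add n1
  have i1 : ContDiffAt ℝ ∞ (fun y : ℂ × ℂ => (2 * s + y.1.re) / (2 * s + ‖y.1‖) * y.2.im +
      y.1.im * (θ y / (‖y.1‖ + y.1.re) - 1 / (2 * s + ‖y.1‖)) * y.2.re) w :=
    (((contDiffAt_const.add r1).div d1 hp).mul r4).add
      ((r2.mul ((hθ.div (n1.add r1) h1.ne').sub (contDiffAt_const.div d1 hp))).mul r3)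
  exact (contDiff_ofReal.contDiffAt.comp w (g1.mul r3)).add
    ((contDiff_ofReal.contDiffAt.comp w i1).mul contDiffAt_const)

theorem contDiffAt_fanMap {θ : ℂ × ℂ → ℝ} {w : ℂ × ℂ} (hs : 0 < s) (hs1 : 4 * s ^ 2 < 1)
    (hθ : ∀ᶠ y in 𝓝 w, ContDiffAt ℝ ∞ θ y)
    (hθ0 : 0 < θ w) (hw : w ∈ modelSpinal s) (h1 : 0 < ‖w.1‖ + w.1.re)
    (h2 : 0 < 2 * ‖w.1‖ - θ w * (‖w.1‖ - w.1.re)) :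
    ∀ᶠ y in 𝓝 w, ContDiffAt ℝ ∞ (fun y => fanMap s (θ y) y) y := by
  have c0 := hθ.self_of_nhds
  have m1 : ContDiff ℝ ∞ (fun y : ℂ × ℂ => Complex.normSq (2 * s - y.1) + Complex.normSq y.2) := by
    simp only [normSq_two_mul_sub']
    fun_prop
  have m2 : ∀ y, 0 < θ y → ContDiffAt ℝ ∞ θ y → 0 < ‖y.1‖ + y.1.re →
      0 < 2 * ‖y.1‖ - θ y * (‖y.1‖ - y.1.re) →
      ContDiffAt ℝ ∞ (fun y : ℂ × ℂ => Complex.normSq (2 * s - fanBase (θ y) y.1) +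
        Complex.normSq (fanRaw s (θ y) y)) y := by
    intro y k1 k2 k3 k4
    have b1 := (contDiffAt_fanBase k2 k1 k3 k4).2
    have b2 := contDiffAt_fanRaw hs k2 k1 k3 k4
    exact (contDiff_normSq.contDiffAt.comp y (contDiffAt_const.sub b1)).add
      (contDiff_normSq.contDiffAt.comp y b2)
  have p1 : 0 < Complex.normSq (2 * s - w.1) + Complex.normSq w.2 := by
    by_cases hne : w.1 = 2 * s
    · have := Complex.normSq_pos.2 (snd_ne_zero hs1 hw hne)
      linarith [Complex.normSq_nonneg (2 * s - w.1)]
    · have := Complex.normSq_pos.2 (sub_ne_zero.2 (Ne.symm hne))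
      linarith [Complex.normSq_nonneg w.2]
  have p2 : 0 < Complex.normSq (2 * s - fanBase (θ w) w.1) + Complex.normSq (fanRaw s (θ w) w) := by
    by_cases hne : w.1 = 2 * s
    · have := fanRaw_center_pos hs hθ0 hne (snd_ne_zero hs1 hw hne)
      linarith [Complex.normSq_nonneg (2 * s - fanBase (θ w) w.1)]
    · have := Complex.normSq_pos.2 (sub_ne_zero.2 (Ne.symm (mt (fanBase_eq_iff hs hθ0 h1 h2.le).1 hne)))
      linarith [Complex.normSq_nonneg (fanRaw s (θ w) w)]
  have cn : Continuous fun y : ℂ × ℂ => ‖y.1‖ + y.1.re := by fun_prop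
  have cn' : ContinuousAt (fun y : ℂ × ℂ => 2 * ‖y.1‖ - θ y * (‖y.1‖ - y.1.re)) w := by
    have := c0.continuousAt
    fun_prop
  filter_upwards [hθ, continuousAt_const.eventually_lt c0.continuousAt hθ0,
    continuousAt_const.eventually_lt cn.continuousAt h1, continuousAt_const.eventually_lt cn' h2,
    continuousAt_const.eventually_lt m1.continuous.continuousAt p1,
    continuousAt_const.eventually_lt (m2 w hθ0 c0 h1 h2).continuousAt p2] with y a1 a2 a3 a4 a5 a6
  refine ContDiffAt.prodMk (contDiffAt_fanBase a1 a2 a3 a4).2 ?_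
  refine ContDiffAt.mul (contDiff_ofReal.contDiffAt.comp y ?_) (contDiffAt_fanRaw hs a1 a2 a3 a4)
  exact (m1.contDiffAt.div (m2 y a2 a1 a3 a4) a6.ne').sqrt (div_pos a5 a6).ne'

end Fan

end FordFaces

namespace FordFaces

/-! ### Closing the complement of the slit onto the quadrilateral, and opening it again. -/

section FanRatio

/-- The factor which carries the complement of the slit to the quadrilateral. -/
noncomputable def fanRatio (c : ℝ) (w : ℂ × ℂ) : ℝ := (1 - √(1 - c ^ 2 * Complex.normSq w.1)) / 2

variable {s c : ℝ}

/-- On `|v| = R` the two Giraud curves have, for `Re v ≥ 0`, the common abscissa `R√(1 - c²R²) = R(1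
- 2q)`. So `R - Re v` ranges below `2Rq` on the quadrilateral, and below `2R` off the slit. -/
theorem fanRatio_spec (hc : 0 < c) (hc1 : c < 1) {w : ℂ × ℂ} (hw : w ∈ modelSphere) :
    0 ≤ fanRatio c w ∧ fanRatio c w < 1 / 2 ∧
      (1 - 2 * fanRatio c w) ^ 2 = 1 - c ^ 2 * Complex.normSq w.1 := by
  have h1 := circle_bound hc hc1 hw
  have h2 := Real.sq_sqrt h1.le
  have h3 := Real.sqrt_pos.2 h1
  have h4 : √(1 - c ^ 2 * Complex.normSq w.1) ≤ 1 := by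
    refine Real.sqrt_le_one.2 ?_
    have := mul_nonneg (sq_nonneg c) (Complex.normSq_nonneg w.1)
    linarith
  unfold fanRatio
  refine ⟨by linarith, by linarith, ?_⟩
  linear_combination h2

theorem fanRatio_pos (hc : 0 < c) (hc1 : c < 1) {w : ℂ × ℂ} (hw : w ∈ modelSphere)
    (h : w.1 ≠ 0) : 0 < fanRatio c w := by
  obtain ⟨h1, h2, h3⟩ := fanRatio_spec hc hc1 hw
  refine lt_of_le_of_ne h1 fun h4 => ?_
  rw [← h4] at h3
  have := mul_pos (pow_pos hc 2) (Complex.normSq_pos.2 h)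
  linarith

theorem fanRatio_congr {w w' : ℂ × ℂ} (h : ‖w.1‖ = ‖w'.1‖) : fanRatio c w = fanRatio c w' := by
  rw [fanRatio, fanRatio, Complex.normSq_eq_norm_sq, Complex.normSq_eq_norm_sq, h]

/-- On `|v| = R` one has `(cR²)² - (Im v)² = (Re v)² - (R(1 - 2q))²`, so both conditions compare the
same squares. -/
theorem abs_im_lt_iff (hc : 0 < c) (hc1 : c < 1) {w : ℂ × ℂ} (hw : w ∈ modelSphere) :
    (|w.1.im| < c * Complex.normSq w.1 ∧ 0 < w.1.re) ↔
      ‖w.1‖ - w.1.re < 2 * ‖w.1‖ * fanRatio c w := by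
  obtain ⟨h1, h2, h3⟩ := fanRatio_spec hc hc1 hw
  have h4 := norm_sq_eq w.1
  have hR := norm_nonneg w.1
  rw [Complex.normSq_eq_norm_sq] at *
  set t := 1 - 2 * fanRatio c w
  have ht : 0 < t := by simp only [t]; linarith
  have e : ‖w.1‖ - w.1.re < 2 * ‖w.1‖ * fanRatio c w ↔ ‖w.1‖ * t < w.1.re := by
    simp only [t]; constructor <;> intro h <;> linarith
  have key : (c * ‖w.1‖ ^ 2) ^ 2 - w.1.im ^ 2 = w.1.re ^ 2 - (‖w.1‖ * t) ^ 2 := by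
    linear_combination ‖w.1‖ ^ 2 * h3 + h4
  rw [e]
  constructor
  · rintro ⟨h5, h6⟩
    have h7 : w.1.im ^ 2 < (c * ‖w.1‖ ^ 2) ^ 2 := by
      rw [← sq_abs]; exact pow_lt_pow_left₀ h5 (abs_nonneg _) two_ne_zero
    exact lt_of_pow_lt_pow_left₀ 2 h6.le (by linarith)
  · intro h5
    have h6 : 0 ≤ ‖w.1‖ * t := by positivity
    refine ⟨?_, h6.trans_lt h5⟩
    have h7 : (‖w.1‖ * t) ^ 2 < w.1.re ^ 2 := pow_lt_pow_left₀ h5 h6 two_ne_zero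
    exact abs_lt_of_sq_lt_sq (by linarith) (by positivity)

theorem abs_im_le_iff (hc : 0 < c) (hc1 : c < 1) {w : ℂ × ℂ} (hw : w ∈ modelSphere) :
    (|w.1.im| ≤ c * Complex.normSq w.1 ∧ 0 ≤ w.1.re) ↔
      ‖w.1‖ - w.1.re ≤ 2 * ‖w.1‖ * fanRatio c w := by
  obtain ⟨h1, h2, h3⟩ := fanRatio_spec hc hc1 hw
  have h4 := norm_sq_eq w.1
  have hR := norm_nonneg w.1
  rw [Complex.normSq_eq_norm_sq] at *
  set t := 1 - 2 * fanRatio c w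
  have ht : 0 < t := by simp only [t]; linarith
  have e : ‖w.1‖ - w.1.re ≤ 2 * ‖w.1‖ * fanRatio c w ↔ ‖w.1‖ * t ≤ w.1.re := by
    simp only [t]; constructor <;> intro h <;> linarith
  have key : (c * ‖w.1‖ ^ 2) ^ 2 - w.1.im ^ 2 = w.1.re ^ 2 - (‖w.1‖ * t) ^ 2 := by
    linear_combination ‖w.1‖ ^ 2 * h3 + h4
  rw [e]
  constructor
  · rintro ⟨h5, h6⟩
    have h7 : w.1.im ^ 2 ≤ (c * ‖w.1‖ ^ 2) ^ 2 := by
      rw [← sq_abs]; exact pow_le_pow_left₀ (abs_nonneg _) h5 2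
    exact le_of_sq_le_sq (by linarith) h6
  · intro h5
    have h6 : 0 ≤ ‖w.1‖ * t := by positivity
    refine ⟨?_, h6.trans h5⟩
    have h7 : (‖w.1‖ * t) ^ 2 ≤ w.1.re ^ 2 := pow_le_pow_left₀ h6 h5 2
    exact abs_le_of_sq_le_sq (by linarith) (by positivity)

theorem mem_modelPiece_iff (hc : 0 < c) (hc1 : c < 1) {w : ℂ × ℂ} (hw : w ∈ modelSpinal s) :
    w ∈ modelPiece 1 s c ↔ ‖w.1‖ - w.1.re < 2 * ‖w.1‖ * fanRatio c w := by
  rw [← abs_im_lt_iff hc hc1 hw.1]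
  constructor
  · intro h
    exact ⟨h.2.1, by simpa using h.2.2⟩
  · intro h
    exact ⟨hw, h.1, by simpa using h.2⟩

theorem mem_modelClosedPiece_iff (hc : 0 < c) (hc1 : c < 1) {w : ℂ × ℂ} (hw : w ∈ modelSpinal s) :
    w ∈ modelClosedPiece 1 s c ↔ ‖w.1‖ - w.1.re ≤ 2 * ‖w.1‖ * fanRatio c w := by
  rw [← abs_im_le_iff hc hc1 hw.1]
  constructor
  · intro h
    exact ⟨h.2.1, by simpa using h.2.2⟩
  · intro h
    exact ⟨hw, h.1, by simpa using h.2⟩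

theorem notMem_modelSlit_iff {w : ℂ × ℂ} : w ∉ modelSlit ↔ 0 < ‖w.1‖ + w.1.re := by
  have h1 := norm_sq_eq w.1
  have hR := norm_nonneg w.1
  have h2 : w ∈ modelSlit ↔ w.1.im = 0 ∧ w.1.re ≤ 0 := Iff.rfl
  rw [← not_le, not_iff_not, h2]
  constructor
  · rintro ⟨h3, h4⟩
    rw [h3] at h1
    have h5 : ‖w.1‖ = |w.1.re| := by
      rw [← sq_eq_sq₀ hR (abs_nonneg _), sq_abs]; linarith
    rw [h5, abs_of_nonpos h4]; simp
  · intro h3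
    have h4 : w.1.re ≤ 0 := by linarith
    refine ⟨?_, h4⟩
    have h5 : w.1.im ^ 2 ≤ 0 := by nlinarith
    exact pow_eq_zero_iff two_ne_zero |>.1 (le_antisymm h5 (sq_nonneg _))

theorem contDiffAt_fanRatio (hc : 0 < c) (hc1 : c < 1) {w : ℂ × ℂ} (hw : w ∈ modelSphere) :
    ∀ᶠ y in 𝓝 w, ContDiffAt ℝ ∞ (fanRatio c) y := by
  have h1 : ContDiff ℝ ∞ fun y : ℂ × ℂ => 1 - c ^ 2 * Complex.normSq y.1 := by fun_prop
  filter_upwards [continuousAt_const.eventually_lt h1.continuous.continuousAt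
    (circle_bound hc hc1 hw)] with y hy
  exact (contDiffAt_const.sub (h1.contDiffAt.sqrt hy.ne')).div_const 2

theorem contDiffAt_fanRatio_inv (hc : 0 < c) (hc1 : c < 1) {w : ℂ × ℂ} (hw : w ∈ modelSphere)
    (h : w.1 ≠ 0) : ∀ᶠ y in 𝓝 w, ContDiffAt ℝ ∞ (fun y => 1 / fanRatio c y) y := by
  have h1 := contDiffAt_fanRatio hc hc1 hw
  filter_upwards [h1, continuousAt_const.eventually_lt h1.self_of_nhds.continuousAt
    (fanRatio_pos hc hc1 hw h)] with y h2 h3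
  exact contDiffAt_const.div h2 h3.ne'

/-- The factor varies with the point, but only through `|v|`, which the map preserves; hence the
reciprocal factor gives the inverse. -/
noncomputable def fanClose (s c : ℝ) (w : ℂ × ℂ) : ℂ × ℂ := fanMap s (fanRatio c w) w

noncomputable def fanOpen (s c : ℝ) (w : ℂ × ℂ) : ℂ × ℂ := fanMap s (1 / fanRatio c w) w

theorem fanClose_cond (hc : 0 < c) (hc1 : c < 1) {w : ℂ × ℂ} (hw : w ∈ modelSpinal s)
    (h : w ∉ modelSlit) : 0 < fanRatio c w ∧ 0 < ‖w.1‖ + w.1.re ∧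
      0 < 2 * ‖w.1‖ - fanRatio c w * (‖w.1‖ - w.1.re) := by
  rw [notMem_modelSlit_iff] at h
  have h0 : w.1 ≠ 0 := by
    intro h0
    rw [h0] at h
    simp at h
  obtain ⟨h1, h2, -⟩ := fanRatio_spec hc hc1 hw.1
  have h3 := norm_pos_iff.2 h0
  have h5 : ‖w.1‖ - w.1.re ≤ 2 * ‖w.1‖ := by linarith
  refine ⟨fanRatio_pos hc hc1 hw.1 h0, h, ?_⟩
  nlinarith [mul_le_mul_of_nonneg_left h5 h1]

theorem fanOpen_cond (hc : 0 < c) (hc1 : c < 1) {w : ℂ × ℂ} (hw : w ∈ modelClosedPiece 1 s c)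
    (h0 : w.1 ≠ 0) : 0 < 1 / fanRatio c w ∧ 0 < ‖w.1‖ + w.1.re ∧
      0 ≤ 2 * ‖w.1‖ - 1 / fanRatio c w * (‖w.1‖ - w.1.re) := by
  have hq := fanRatio_pos hc hc1 hw.1.1 h0
  have h1 := (mem_modelClosedPiece_iff hc hc1 hw.1).1 hw
  have h3 := norm_pos_iff.2 h0
  have h4 : 0 ≤ w.1.re := by simpa using hw.2.2
  refine ⟨by positivity, by positivity, ?_⟩
  rw [sub_nonneg, div_mul_eq_mul_div, one_mul, div_le_iff₀ hq]
  exact h1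

theorem fst_ne_zero_of_mem_modelPiece {w : ℂ × ℂ} (hw : w ∈ modelPiece 1 s c) : w.1 ≠ 0 := by
  intro h
  have := hw.2.2
  rw [h] at this
  simp at this

theorem fanOpen_cond' (hc : 0 < c) (hc1 : c < 1) {w : ℂ × ℂ} (hw : w ∈ modelPiece 1 s c) :
    0 < 2 * ‖w.1‖ - 1 / fanRatio c w * (‖w.1‖ - w.1.re) := by
  have hq := fanRatio_pos hc hc1 hw.1.1 (fst_ne_zero_of_mem_modelPiece hw)
  have h1 := (mem_modelPiece_iff hc hc1 hw.1).1 hw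
  rw [sub_pos, div_mul_eq_mul_div, one_mul, div_lt_iff₀ hq]
  exact h1

theorem fanClose_mem (hs : 0 < s) (hs1 : 4 * s ^ 2 < 1) (hc : 0 < c) (hc1 : c < 1)
    {w : ℂ × ℂ} (hw : w ∈ modelSpinal s) (h : w ∉ modelSlit) :
    fanClose s c w ∈ modelPiece 1 s c ∧ fanOpen s c (fanClose s c w) = w := by
  obtain ⟨h1, h2, h3⟩ := fanClose_cond hc hc1 hw h
  have hm : fanClose s c w ∈ modelSpinal s := fanMap_mem hs hs1 h1 hw h2 h3.le
  have hn : ‖(fanClose s c w).1‖ = ‖w.1‖ := norm_fanBase h1 h2 h3.le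
  have hq : fanRatio c (fanClose s c w) = fanRatio c w := fanRatio_congr hn
  constructor
  · rw [mem_modelPiece_iff hc hc1 hm, hn, hq]
    simp only [fanClose, fanMap, fanBase_re]
    nlinarith
  · rw [fanOpen, hq]
    exact fanMap_fanMap hs hs1 h1 (mul_one_div_cancel h1.ne') hw h2 h3

theorem fanOpen_mem (hs : 0 < s) (hs1 : 4 * s ^ 2 < 1) (hc : 0 < c) (hc1 : c < 1)
    {w : ℂ × ℂ} (hw : w ∈ modelPiece 1 s c) :
    fanOpen s c w ∈ modelSpinal s \ modelSlit ∧ fanClose s c (fanOpen s c w) = w := by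
  have h0 := fst_ne_zero_of_mem_modelPiece hw
  obtain ⟨h1, h2, -⟩ := fanOpen_cond hc hc1 (modelPiece_subset _ _ _ hw) h0
  have h3 := fanOpen_cond' hc hc1 hw
  have hm : fanOpen s c w ∈ modelSpinal s := fanMap_mem hs hs1 h1 hw.1 h2 h3.le
  have hn : ‖(fanOpen s c w).1‖ = ‖w.1‖ := norm_fanBase h1 h2 h3.le
  have hq : fanRatio c (fanOpen s c w) = fanRatio c w := fanRatio_congr hn
  refine ⟨⟨hm, ?_⟩, ?_⟩
  · rw [notMem_modelSlit_iff, hn]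
    simp only [fanOpen, fanMap, fanBase_re]
    linarith
  · rw [fanClose, hq]
    exact fanMap_fanMap hs hs1 h1
      (one_div_mul_cancel (fanRatio_pos hc hc1 hw.1.1 h0).ne') hw.1 h2 h3

theorem areDiffeomorphic_slit_piece (hs : 0 < s) (hs1 : 4 * s ^ 2 < 1) (hc : 0 < c) (hc1 : c < 1) :
    AreDiffeomorphic (modelSpinal s \ modelSlit) (modelPiece 1 s c) := by
  refine ⟨fanClose s c, fanOpen s c, ?_, ?_,
    fun w hw => (fanClose_mem hs hs1 hc hc1 hw.1 hw.2).1,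
    fun w hw => (fanOpen_mem hs hs1 hc hc1 hw).1,
    fun w hw => (fanClose_mem hs hs1 hc hc1 hw.1 hw.2).2,
    fun w hw => (fanOpen_mem hs hs1 hc hc1 hw).2⟩
  · refine SmoothOnSubset.of_contDiffAt fun w hw => ?_
    obtain ⟨h1, h2, h3⟩ := fanClose_cond hc hc1 hw.1 hw.2
    exact contDiffAt_fanMap hs hs1 (contDiffAt_fanRatio hc hc1 hw.1.1) h1 hw.1 h2 h3
  · refine SmoothOnSubset.of_contDiffAt fun w hw => ?_
    have h0 := fst_ne_zero_of_mem_modelPiece hw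
    obtain ⟨h1, h2, -⟩ := fanOpen_cond hc hc1 (modelPiece_subset _ _ _ hw) h0
    exact contDiffAt_fanMap hs hs1 (contDiffAt_fanRatio_inv hc hc1 hw.1.1 h0) h1 hw.1 h2
      (fanOpen_cond' hc hc1 hw)

theorem norm_fanOpen (hc : 0 < c) (hc1 : c < 1) {w : ℂ × ℂ} (hw : w ∈ modelClosedPiece 1 s c) :
    ‖(fanOpen s c w).1‖ = ‖w.1‖ := by
  by_cases h0 : w.1 = 0
  · have : (fanOpen s c w).1 = 0 := by
      simp [fanOpen, fanMap, h0, fanBase]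
    rw [this, h0]
  · obtain ⟨h1, h2, h3⟩ := fanOpen_cond hc hc1 hw h0
    exact norm_fanBase h1 h2 h3

/-- At `v = 0` the ratio vanishes and `1 / 0 = 0`. With this default value the map fixes the two
vertices, which is also its continuous extension. -/
theorem fanOpen_of_fst_eq_zero (hs : 0 < s) {w : ℂ × ℂ} (hw : w ∈ modelSpinal s) (h0 : w.1 = 0) :
    fanOpen s c w = w := by
  have h1 := hw.2
  rw [h0] at h1
  simp only [Complex.zero_re, Complex.zero_im, sub_zero, mul_zero] at h1
  have h2 : w.2.re = 0 := by
    rcases mul_eq_zero.1 h1 with h | h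
    · exact h
    · linarith
  have e1 : fanRatio c w = 0 := by simp [fanRatio, h0]
  have e2 : fanBase (1 / fanRatio c w) w.1 = 0 := by simp [fanBase, h0]
  have e3 : fanRaw s (1 / fanRatio c w) w = w.2 := by
    apply Complex.ext
    · rw [fanRaw_re, h2, mul_zero]
    · rw [fanRaw_im, h2, h0]
      simp [hs.ne']
  refine Prod.ext (e2.trans h0.symm) ?_
  simp only [fanOpen, fanMap]
  rw [e2, e3, h0, div_self, Real.sqrt_one, Complex.ofReal_one, one_mul]
  have : 0 < Complex.normSq (2 * s - 0) := by
    rw [Complex.normSq_pos, sub_zero]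
    simp [hs.ne']
  have := Complex.normSq_nonneg w.2
  positivity

/-- Away from the centre, the map preserves the sheets. -/
theorem fanOpen_snd (hs : 0 < s) (hc : 0 < c) (hc1 : c < 1) {w : ℂ × ℂ}
    (hw : w ∈ modelClosedPiece 1 s c) (hne : w.1 ≠ 2 * s) : (fanOpen s c w).1 ≠ 2 * s ∧
      (fanOpen s c w).2 = sheet s (sheetCoord s w) (fanOpen s c w).1 := by
  by_cases h0 : w.1 = 0
  · rw [fanOpen_of_fst_eq_zero hs hw.1 h0, sheet_sheetCoord hw.1 hne]
    exact ⟨hne, rfl⟩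
  · obtain ⟨h1, h2, h3⟩ := fanOpen_cond hc hc1 hw h0
    exact ⟨mt (fanBase_eq_iff hs h1 h2 h3).1 hne, fanMap_snd hw.1 hne hs h1 h2 h3⟩

theorem fanOpen_mem_modelSpinal (hs : 0 < s) (hs1 : 4 * s ^ 2 < 1) (hc : 0 < c) (hc1 : c < 1)
    {w : ℂ × ℂ} (hw : w ∈ modelClosedPiece 1 s c) : fanOpen s c w ∈ modelSpinal s := by
  by_cases h0 : w.1 = 0
  · rw [fanOpen_of_fst_eq_zero hs hw.1 h0]
    exact hw.1
  · obtain ⟨h1, h2, h3⟩ := fanOpen_cond hc hc1 hw h0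
    exact fanMap_mem hs hs1 h1 hw.1 h2 h3

/-- The factor blows up at `v = 0`, but the modulus of `v` is preserved, which settles continuity
there. Elsewhere the formula is continuous even on the boundary, where the gain vanishes. -/
theorem continuousOn_fanOpen_fst (hc : 0 < c) (hc1 : c < 1) :
    ContinuousOn (fun w => (fanOpen s c w).1) (modelClosedPiece 1 s c) := by
  intro w hw
  by_cases h0 : w.1 = 0
  · have e : (fanOpen s c w).1 = 0 := by
      rw [← norm_eq_zero, norm_fanOpen hc hc1 hw, h0, norm_zero]
    rw [ContinuousWithinAt, e]
    have h1 : Filter.Tendsto (fun y : ℂ × ℂ => ‖y.1‖) (𝓝[modelClosedPiece 1 s c] w) (𝓝 0) := by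
      have : ContinuousWithinAt (fun y : ℂ × ℂ => ‖y.1‖) (modelClosedPiece 1 s c) w := by fun_prop
      simpa [ContinuousWithinAt, h0] using this
    refine squeeze_zero_norm' ?_ h1
    filter_upwards [self_mem_nhdsWithin] with y hy
    rw [norm_fanOpen hc hc1 hy]
  · obtain ⟨h1, h2, h3⟩ := fanOpen_cond hc hc1 hw h0
    have hq := fanRatio_pos hc hc1 hw.1.1 h0
    have c1 : ContinuousAt (fun y => 1 / fanRatio c y) w :=
      (contDiffAt_fanRatio_inv hc hc1 hw.1.1 h0).self_of_nhds.continuousAt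
    have c2 : ContinuousAt (fun y : ℂ × ℂ => ‖y.1‖) w := by fun_prop
    have c3 : ContinuousAt (fun y : ℂ × ℂ => y.1.re) w := by fun_prop
    have c4 : ContinuousAt (fun y : ℂ × ℂ => y.1.im) w := by fun_prop
    have c5 : ContinuousAt (fun y => fanGain (1 / fanRatio c y) y.1) w :=
      ((c1.mul ((continuousAt_const.mul c2).sub (c1.mul (c2.sub c3)))).div₀
        (c2.add c3) h2.ne').sqrt
    have c6 : ContinuousAt (fun y : ℂ × ℂ => fanBase (1 / fanRatio c y) y.1) w :=
      (Complex.continuous_ofReal.continuousAt.comp (c2.sub (c1.mul (c2.sub c3)))).add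
        ((Complex.continuous_ofReal.continuousAt.comp (c4.mul c5)).mul continuousAt_const)
    exact c6.continuousWithinAt

/-- Near `v = 2s`, an interior point, the smooth formula is used. Everywhere else the map is
described by its base and its unchanged sheet coordinate, which remains valid on the boundary and at
the vertices. -/
theorem continuousOn_fanOpen (hs : 0 < s) (hs1 : 4 * s ^ 2 < 1) (hc : 0 < c) (hc1 : c < 1) :
    ContinuousOn (fanOpen s c) (modelClosedPiece 1 s c) := by
  intro w hw
  by_cases hne : w.1 = 2 * s
  · have h0 : w.1 ≠ 0 := by
      rw [hne]
      simp [hs.ne']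
    obtain ⟨h1, h2, -⟩ := fanOpen_cond hc hc1 hw h0
    refine (contDiffAt_fanMap hs hs1 (contDiffAt_fanRatio_inv hc hc1 hw.1.1 h0) h1 hw.1 h2
      ?_).self_of_nhds.continuousAt.continuousWithinAt
    rw [hne, norm_two_mul hs]
    simp [hs]
  · have hF := continuousOn_fanOpen_fst (s := s) hc hc1 w hw
    have hc2 : ContinuousWithinAt (fun y => (sheetCoord s y, (fanOpen s c y).1))
        (modelClosedPiece 1 s c) w :=
      (contDiffAt_sheetCoord hne).continuousAt.continuousWithinAt.prodMk hF
    have h3 : ContinuousAt (fun p : ℝ × ℂ => sheet s p.1 p.2)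
        ((fun y => (sheetCoord s y, (fanOpen s c y).1)) w) :=
      continuousAt_sheet fun h => absurd h (fanOpen_snd hs hc hc1 hw hne).1
    have h4 : ContinuousWithinAt ((fun p : ℝ × ℂ => sheet s p.1 p.2) ∘
        (fun y => (sheetCoord s y, (fanOpen s c y).1))) (modelClosedPiece 1 s c) w :=
      ContinuousAt.comp_continuousWithinAt (f := fun y => (sheetCoord s y, (fanOpen s c y).1)) h3 hc2
    have h5 : ∀ᶠ y : ℂ × ℂ in 𝓝[modelClosedPiece 1 s c] w, y.1 ≠ 2 * (s : ℂ) :=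
      (continuousAt_fst.eventually_ne hne).filter_mono nhdsWithin_le_nhds
    refine (hF.prodMk h4).congr_of_eventuallyEq ?_ (Prod.ext rfl (fanOpen_snd hs hc hc1 hw hne).2)
    filter_upwards [h5, self_mem_nhdsWithin] with y hy hyK
    exact Prod.ext rfl (fanOpen_snd hs hc hc1 hyK hy).2

end FanRatio

end FordFaces

namespace FordFaces

/-! ### Surfaces with boundary which cover the model, two to one over the slit -/

section SlitCover

variable {X Y : Type*} [TopologicalSpace X] [TopologicalSpace Y]

/-- The map `f` identifies the interior of the surface `K` with the complement of the slit in the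
model, and folds its boundary onto the slit; the two sides are distinguished by the sign of `σ`. -/
structure SlitCover (s : ℝ) (K : Set X) (f : X → ℂ × ℂ) (σ : X → ℝ) : Prop where
  isCompact : IsCompact K
  continuousOn : ContinuousOn f K
  continuousOn_sign : ContinuousOn σ K
  mapsTo : Set.MapsTo f K (modelSpinal s)
  injOn : ∀ x ∈ K, ∀ x' ∈ K, f x ∉ modelSlit → f x = f x' → x = x'
  surj : ∀ y ∈ modelSpinal s, y ∉ modelSlit → ∃ x ∈ K, f x = y
  surj_slit : ∀ y ∈ modelSpinal s, y ∈ modelSlit → ∀ ε : ℝ, ε ^ 2 = 1 →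
    ∃ x ∈ K, f x = y ∧ 0 ≤ ε * σ x
  fiber : ∀ x ∈ K, ∀ x' ∈ K, f x ∈ modelSlit → f x = f x' → x = x' ∨ σ x * σ x' < 0
  sign_slit : ∀ x ∈ K, f x ∈ modelSlit → (σ x = 0 ↔ (f x).1 = 0)
  sign : ∀ x ∈ K, f x ∉ modelSlit → 0 ≤ σ x * (f x).1.im ∧ ((f x).1.im = 0 → σ x = 0)

/-- Off the slit the sign condition is automatic, since `σ` and `σ'` both follow the sign of `Im v`.
On the slit it selects one side: two distinct candidates have opposite signs, so both being
admissible forces `σ x = 0`. Then `f x` is an end of the slit, where `σ'` vanishes too,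
contradicting the opposite signs. -/
theorem SlitCover.existsUnique {s : ℝ} {K : Set X} {f : X → ℂ × ℂ} {σ : X → ℝ} {K' : Set Y}
    {f' : Y → ℂ × ℂ} {σ' : Y → ℝ} (h : SlitCover s K f σ) (h' : SlitCover s K' f' σ') {x : X}
    (hx : x ∈ K) : ∃! y, y ∈ K' ∧ f x = f' y ∧ 0 ≤ σ x * σ' y := by
  by_cases hs : f x ∈ modelSlit
  · obtain ⟨ε, hε, hεx⟩ : ∃ ε : ℝ, ε ^ 2 = 1 ∧ 0 ≤ ε * σ x := by
      rcases le_total 0 (σ x) with h0 | h0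
      · exact ⟨1, by norm_num, by linarith⟩
      · exact ⟨-1, by norm_num, by linarith⟩
    obtain ⟨y, hy, e, hy'⟩ := h'.surj_slit _ (h.mapsTo hx) hs ε hε
    refine ⟨y, ⟨hy, e.symm, ?_⟩, ?_⟩
    · have := mul_nonneg hεx hy'
      nlinarith
    · rintro z ⟨hz, ez, hz'⟩
      rcases h'.fiber y hy z hz (e ▸ hs) (e.trans ez) with h1 | h1
      · exact h1.symm
      · exfalso
        have hyσ : 0 ≤ σ x * σ' y := by
          have := mul_nonneg hεx hy'
          nlinarith
        have h2 : σ x = 0 := by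
          by_contra h2
          have h3 : 0 < σ x ^ 2 := by positivity
          nlinarith [mul_nonneg hyσ hz', mul_pos_of_neg_of_neg h1 (neg_lt_zero.2 h3)]
        have h3 := (h.sign_slit x hx hs).1 h2
        rw [ez] at h3 hs
        rw [(h'.sign_slit z hz hs).2 h3] at h1
        simp at h1
  · obtain ⟨y, hy, e⟩ := h'.surj _ (h.mapsTo hx) hs
    refine ⟨y, ⟨hy, e.symm, ?_⟩, ?_⟩
    · obtain ⟨h1, h2⟩ := h.sign x hx hs
      obtain ⟨h3, h4⟩ := h'.sign y hy (e ▸ hs)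
      rw [e] at h3
      by_cases h5 : (f x).1.im = 0
      · rw [h2 h5]; simp
      · have h6 : 0 < (f x).1.im ^ 2 := by positivity
        have h7 := mul_nonneg h1 h3
        have h8 : 0 ≤ (σ x * σ' y) * (f x).1.im ^ 2 := by linarith
        exact nonneg_of_mul_nonneg_left h8 h6
    · rintro z ⟨hz, ez, -⟩
      exact h'.injOn z hz y hy (ez ▸ hs) (ez.symm.trans e.symm)

/-- The pairs `(x, y)` with `f x = f' y` and `σ x σ' y ≥ 0` form a closed subset of a compact
product. Both projections of it are continuous bijections, hence homeomorphisms. The condition is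
weak so that the set is closed. -/
theorem SlitCover.exists_homeomorph [T2Space X] [T2Space Y] {s : ℝ} {K : Set X} {f : X → ℂ × ℂ}
    {σ : X → ℝ} {K' : Set Y} {f' : Y → ℂ × ℂ} {σ' : Y → ℝ} (h : SlitCover s K f σ)
    (h' : SlitCover s K' f' σ') : ∃ e : K ≃ₜ K', ∀ x : K, f' (e x : Y) = f x := by
  have hK : CompactSpace K := isCompact_iff_compactSpace.1 h.isCompact
  have hK' : CompactSpace K' := isCompact_iff_compactSpace.1 h'.isCompact
  have c1 := continuousOn_iff_continuous_domRestrict.1 h.continuousOn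
  have c2 := continuousOn_iff_continuous_domRestrict.1 h'.continuousOn
  have c3 := continuousOn_iff_continuous_domRestrict.1 h.continuousOn_sign
  have c4 := continuousOn_iff_continuous_domRestrict.1 h'.continuousOn_sign
  let W : Set (K × K') := {p | f p.1 = f' p.2 ∧ 0 ≤ σ p.1 * σ' p.2}
  have hW : IsClosed W :=
    (isClosed_eq (c1.comp continuous_fst) (c2.comp continuous_snd)).inter
      (isClosed_le continuous_const ((c3.comp continuous_fst).mul (c4.comp continuous_snd)))
  have hWc : CompactSpace W := isCompact_iff_compactSpace.1 hW.isCompact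
  have b1 : Function.Bijective fun p : W => p.1.1 := by
    constructor
    · rintro ⟨⟨x, y⟩, hp⟩ ⟨⟨x', y'⟩, hp'⟩ (e : x = x')
      subst e
      obtain ⟨z, -, hz⟩ := h.existsUnique h' x.2
      have e1 := hz y ⟨y.2, hp⟩
      have e2 := hz y' ⟨y'.2, hp'⟩
      have : y = y' := Subtype.ext (e1.trans e2.symm)
      subst this
      rfl
    · intro x
      obtain ⟨y, ⟨hy, hy'⟩, -⟩ := h.existsUnique h' x.2
      exact ⟨⟨(x, ⟨y, hy⟩), hy'⟩, rfl⟩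
  have b2 : Function.Bijective fun p : W => p.1.2 := by
    constructor
    · rintro ⟨⟨x, y⟩, hp⟩ ⟨⟨x', y'⟩, hp'⟩ (e : y = y')
      subst e
      obtain ⟨z, -, hz⟩ := h'.existsUnique h y.2
      have e1 := hz x ⟨x.2, hp.1.symm, by rw [mul_comm]; exact hp.2⟩
      have e2 := hz x' ⟨x'.2, hp'.1.symm, by rw [mul_comm]; exact hp'.2⟩
      have : x = x' := Subtype.ext (e1.trans e2.symm)
      subst this
      rfl
    · intro y
      obtain ⟨x, ⟨hx, hx', hx''⟩, -⟩ := h'.existsUnique h y.2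
      exact ⟨⟨(⟨x, hx⟩, y), hx'.symm, by rw [mul_comm]; exact hx''⟩, rfl⟩
  let e1 : W ≃ₜ K := Continuous.homeoOfEquivCompactToT2 (f := Equiv.ofBijective _ b1)
    (continuous_fst.comp continuous_subtype_val)
  let e2 : W ≃ₜ K' := Continuous.homeoOfEquivCompactToT2 (f := Equiv.ofBijective _ b2)
    (continuous_snd.comp continuous_subtype_val)
  refine ⟨e1.symm.trans e2, fun x => ?_⟩
  have h1 := (e1.symm x).2.1
  have h2 : (e1.symm x).1.1 = x := e1.apply_symm_apply x
  rw [h2] at h1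
  exact h1.symm

end SlitCover

/-! ### The closed quadrilateral as a slit cover. -/

section Covers

variable {s c : ℝ}

/-- Opening divides `R - Re v` by `q`, so the boundary value `2Rq` becomes `2R`, that is `v = -R`, a
point of the slit. -/
theorem im_eq_of_mem_boundary (hc : 0 < c) (hc1 : c < 1) {w : ℂ × ℂ}
    (hw : w ∈ modelClosedPiece 1 s c) :
    fanOpen s c w ∈ modelSlit ↔ |w.1.im| = c * Complex.normSq w.1 := by
  have h1 : fanOpen s c w ∈ modelSlit ↔ w ∉ modelPiece 1 s c := by
    rw [← not_iff_not, notMem_modelSlit_iff, not_not, norm_fanOpen hc hc1 hw,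
      mem_modelPiece_iff hc hc1 hw.1]
    by_cases h0 : w.1 = 0
    · simp [fanOpen, fanMap, fanBase, h0]
    · have hq := fanRatio_pos hc hc1 hw.1.1 h0
      have e : (fanOpen s c w).1.re = ‖w.1‖ - 1 / fanRatio c w * (‖w.1‖ - w.1.re) := by
        simp only [fanOpen, fanMap, fanBase_re]
      rw [e]
      have : ‖w.1‖ + (‖w.1‖ - 1 / fanRatio c w * (‖w.1‖ - w.1.re)) =
          (2 * ‖w.1‖ * fanRatio c w - (‖w.1‖ - w.1.re)) / fanRatio c w := by
        field_simp
        ring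
      rw [this, div_pos_iff_of_pos_right hq, sub_pos]
  have hε : (1 : ℝ) ^ 2 = 1 := by norm_num
  have h2 : w ∈ modelBoundary 1 s c ↔ w ∉ modelPiece 1 s c := by
    rw [← modelClosedPiece_diff hε hc hc1]
    exact ⟨fun h => h.2, fun h => ⟨hw, h⟩⟩
  rw [h1, ← h2, mem_modelBoundary_iff hc]
  exact ⟨fun h => h.2, fun h => ⟨hw, h⟩⟩

theorem modelPiece_of_notMem (hc : 0 < c) (hc1 : c < 1) {w : ℂ × ℂ}
    (hw : w ∈ modelClosedPiece 1 s c) (h : fanOpen s c w ∉ modelSlit) : w ∈ modelPiece 1 s c := by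
  by_contra h1
  have hε : (1 : ℝ) ^ 2 = 1 := by norm_num
  have h2 : w ∈ modelBoundary 1 s c := by
    rw [← modelClosedPiece_diff hε hc hc1]
    exact ⟨hw, h1⟩
  exact h ((im_eq_of_mem_boundary hc hc1 hw).2 ((mem_modelBoundary_iff hc).1 h2).2)

theorem isCompact_modelClosedPiece (ε s c : ℝ) : IsCompact (modelClosedPiece ε s c) :=
  isCompact_modelSphere.of_isClosed_subset (isClosed_modelClosedPiece ε s c)
    ((modelClosedPiece_subset ε s c).trans (modelSpinal_subset s))

theorem re_eq_of_abs_im_eq (hc : 0 < c) (hc1 : c < 1) {w : ℂ × ℂ}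
    (hw : w ∈ modelClosedPiece 1 s c) (h : |w.1.im| = c * Complex.normSq w.1) :
    w.1.re = ‖w.1‖ - 2 * ‖w.1‖ * fanRatio c w := by
  have h1 := (mem_modelClosedPiece_iff hc hc1 hw.1).1 hw
  have h2 : ¬‖w.1‖ - w.1.re < 2 * ‖w.1‖ * fanRatio c w := by
    rw [← mem_modelPiece_iff hc hc1 hw.1]
    exact fun h2 => h2.2.1.ne h
  linarith [not_lt.1 h2]

theorem slitCover_modelClosedPiece (hs : 0 < s) (hs1 : 4 * s ^ 2 < 1) (hc : 0 < c) (hc1 : c < 1) :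
    SlitCover s (modelClosedPiece 1 s c) (fanOpen s c) (fun w => w.1.im) where
  isCompact := isCompact_modelClosedPiece 1 s c
  continuousOn := continuousOn_fanOpen hs hs1 hc hc1
  continuousOn_sign := by fun_prop
  mapsTo _ hw := fanOpen_mem_modelSpinal hs hs1 hc hc1 hw
  injOn w hw w' hw' h e := by
    have h1 := (fanOpen_mem hs hs1 hc hc1 (modelPiece_of_notMem hc hc1 hw h)).2
    have h2 := (fanOpen_mem hs hs1 hc hc1 (modelPiece_of_notMem hc hc1 hw' (e ▸ h))).2
    rw [← h1, e, h2]
  surj y hy h :=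
    have h1 := fanClose_mem hs hs1 hc hc1 hy h
    ⟨fanClose s c y, modelPiece_subset _ _ _ h1.1, h1.2⟩
  surj_slit y hy h ε hε := by
    obtain ⟨hy1, hy2⟩ : y.1.im = 0 ∧ y.1.re ≤ 0 := h
    have hR : ‖y.1‖ = -y.1.re := by
      rw [← sq_eq_sq₀ (norm_nonneg _) (by linarith), norm_sq_eq, hy1]; ring
    by_cases h0 : y.1 = 0
    · refine ⟨y, ⟨hy, ?_, ?_⟩, fanOpen_of_fst_eq_zero hs hy h0, ?_⟩ <;> simp [h0]
    · obtain ⟨q1, q2, q3⟩ := fanRatio_spec hc hc1 hy.1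
      rw [Complex.normSq_eq_norm_sq] at q3
      have hq := fanRatio_pos hc hc1 hy.1 h0
      have hpos := norm_pos_iff.2 h0
      set q := fanRatio c y
      set R := ‖y.1‖
      -- The point where the circle `|v| = R` meets the Giraud curve `Im v = εc|v|²` with `Re v ≥
      -- 0`; the sign `ε` chooses the side.
      let v : ℂ := ⟨R - 2 * R * q, ε * (c * R ^ 2)⟩
      have hvR : ‖v‖ = R := by
        rw [← sq_eq_sq₀ (norm_nonneg _) hpos.le, norm_sq_eq]
        simp only [v]
        linear_combination R ^ 2 * q3 + c ^ 2 * R ^ 4 * hε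
      have hvne : v ≠ 2 * s := by
        intro e
        have := congrArg Complex.im e
        simp only [v, Complex.mul_im, Complex.re_ofNat, Complex.ofReal_im, mul_zero,
          Complex.im_ofNat, Complex.ofReal_re, zero_mul, add_zero] at this
        have hε0 : ε ≠ 0 := by rintro rfl; norm_num at hε
        have hcR : 0 < c * R ^ 2 := by positivity
        exact mul_ne_zero hε0 hcR.ne' this
      have hyne : y.1 ≠ 2 * s := by
        intro e
        rw [e] at hy2
        simp at hy2
        linarith
      have hyS : Complex.normSq y.1 + Complex.normSq y.2 = 1 := hy.1
      have hwS : (v, sheet s (sheetCoord s y) v) ∈ modelSpinal s := by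
        refine sheet_mem ?_ fun e => absurd e hvne
        rw [sheetCoord_sq hy hyne, Complex.normSq_eq_norm_sq, hvR, ← Complex.normSq_eq_norm_sq, hyS]
      have hqw : fanRatio c (v, sheet s (sheetCoord s y) v) = q := fanRatio_congr hvR
      have hw : (v, sheet s (sheetCoord s y) v) ∈ modelClosedPiece 1 s c := by
        rw [mem_modelClosedPiece_iff hc hc1 hwS, hqw]
        simp only
        rw [hvR]
        simp [v]
      refine ⟨_, hw, ?_, ?_⟩
      · have e1 : (fanOpen s c (v, sheet s (sheetCoord s y) v)).1 = y.1 := by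
          have g0 : fanGain (1 / q) v = 0 := by
            rw [fanGain, hvR]
            have : 2 * R - 1 / q * (R - v.re) = 0 := by
              simp only [v]
              field_simp
              ring
            rw [this]
            simp
          apply Complex.ext
          · simp only [fanOpen, fanMap, fanBase_re]
            rw [hqw, hvR]
            simp only [v]
            have : 1 / q * (R - (R - 2 * R * q)) = 2 * R := by field_simp; ring
            linarith
          · simp only [fanOpen, fanMap, fanBase_im]
            rw [hqw, g0, mul_zero, hy1]
        refine Prod.ext e1 ?_
        rw [(fanOpen_snd hs hc hc1 hw hvne).2, e1, sheetCoord_sheet hvne, sheet_sheetCoord hy hyne]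
      · simp only [v]
        have : 0 ≤ ε ^ 2 * (c * R ^ 2) := by positivity
        linarith
  fiber w hw w' hw' h e := by
    have b1 := (im_eq_of_mem_boundary hc hc1 hw).1 h
    have b2 := (im_eq_of_mem_boundary hc hc1 hw').1 (e ▸ h)
    have hn : ‖w.1‖ = ‖w'.1‖ := by
      rw [← norm_fanOpen hc hc1 hw, ← norm_fanOpen hc hc1 hw', e]
    by_cases h0 : w.1 = 0
    · have h0' : w'.1 = 0 := by rw [← norm_eq_zero, ← hn, h0, norm_zero]
      left
      rw [← fanOpen_of_fst_eq_zero (c := c) hs hw.1 h0, e, fanOpen_of_fst_eq_zero hs hw'.1 h0']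
    · have r1 := re_eq_of_abs_im_eq hc hc1 hw b1
      have r2 := re_eq_of_abs_im_eq hc hc1 hw' b2
      rw [fanRatio_congr hn, hn] at r1
      have i1 : |w.1.im| = |w'.1.im| := by
        rw [b1, b2, Complex.normSq_eq_norm_sq, Complex.normSq_eq_norm_sq, hn]
      have hne0 : w.1.im ≠ 0 := by
        rw [← abs_pos, b1]
        have := Complex.normSq_pos.2 h0
        positivity
      -- Both points lie on the boundary over the same `R`, so they differ at most by the sign of
      -- `Im v`. If the signs agree, the sheet coordinate is recovered from the common image.
      rcases abs_eq_abs.1 i1 with i2 | i2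
      · left
        have hv : w.1 = w'.1 := Complex.ext (r1.trans r2.symm) i2
        have hne : w.1 ≠ 2 * s := by
          intro e
          rw [e] at hne0
          simp at hne0
        have hne' : w'.1 ≠ 2 * s := hv ▸ hne
        have f1 := fanOpen_snd hs hc hc1 hw hne
        have f2 := fanOpen_snd hs hc hc1 hw' hne'
        have e1 : sheetCoord s w = sheetCoord s (fanOpen s c w) := by
          rw [show fanOpen s c w = ((fanOpen s c w).1, sheet s (sheetCoord s w) (fanOpen s c w).1)
            from Prod.ext rfl f1.2, sheetCoord_sheet f1.1]
        have e2 : sheetCoord s w' = sheetCoord s (fanOpen s c w') := by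
          rw [show fanOpen s c w' = ((fanOpen s c w').1, sheet s (sheetCoord s w') (fanOpen s c w').1)
            from Prod.ext rfl f2.2, sheetCoord_sheet f2.1]
        refine Prod.ext hv ?_
        rw [← sheet_sheetCoord hw.1 hne, ← sheet_sheetCoord hw'.1 hne', e1, e2, e, hv]
      · right
        have : 0 < w'.1.im ^ 2 := by
          have : w'.1.im ≠ 0 := by
            intro h
            rw [i2, h] at hne0
            simp at hne0
          positivity
        rw [i2]
        linarith
  sign_slit w hw h := by
    have b1 := (im_eq_of_mem_boundary hc hc1 hw).1 h
    have e : (fanOpen s c w).1 = 0 ↔ w.1 = 0 := by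
      rw [← norm_eq_zero, norm_fanOpen hc hc1 hw, norm_eq_zero]
    rw [e]
    constructor
    · intro h1
      have h1' : w.1.im = 0 := h1
      rw [h1', abs_zero] at b1
      rcases mul_eq_zero.1 b1.symm with h2 | h2
      · exact absurd h2 hc.ne'
      · exact Complex.normSq_eq_zero.1 h2
    · intro h1
      simp [h1]
  sign w hw h := by
    have hp := modelPiece_of_notMem hc hc1 hw h
    obtain ⟨h1, h2, -⟩ := fanOpen_cond hc hc1 hw (fst_ne_zero_of_mem_modelPiece hp)
    have h3 := fanOpen_cond' hc hc1 hp
    have hg : 0 < fanGain (1 / fanRatio c w) w.1 := Real.sqrt_pos.2 (by positivity)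
    have e : (fanOpen s c w).1.im = w.1.im * fanGain (1 / fanRatio c w) w.1 := by
      simp only [fanOpen, fanMap, fanBase_im]
    rw [e]
    constructor
    · have := mul_nonneg (mul_self_nonneg w.1.im) hg.le
      change 0 ≤ w.1.im * (w.1.im * fanGain (1 / fanRatio c w) w.1)
      linarith
    · intro h4
      rcases mul_eq_zero.1 h4 with h5 | h5
      · exact h5
      · exact absurd h5 hg.ne'

end Covers

end FordFaces

namespace FordFaces

/-! ### The torus minus an open disk as a slit cover. -/

section TorusCover

open Real

theorem torusCollapse_mem_torusSlit_iff {z : ℂ × ℂ} (h : z ∈ torus) :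
    torusCollapse z ∈ torusSlit ↔ z ∈ closedDiskInTorus := by
  constructor
  · intro h1
    by_contra h2
    exact torusCollapse_notMem ⟨h, h2⟩ h1
  · intro h1
    have h2 := (mem_closedDiskInTorus.1 h1).2
    change (torusCoord (torusCollapse z)).1 = 0 ∧ (torusCoord (torusCollapse z)).2 ^ 2 ≤ 1 / 2
    rw [torusCoord_torusCollapse h]
    simp only [slitMap, slitFactor_eq_zero h2, mul_zero, true_and]
    linarith [sq_nonneg (torusCoord z).1]

/-- The argument is discontinuous at `-1`, but its square on the unit circle is the continuous
function `arccos(Re z)²`. -/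
theorem isClosed_torus_diff_openDiskInTorus : IsClosed (torus \ openDiskInTorus) := by
  have h1 : torus \ openDiskInTorus =
      torus ∩ {z | 1 ≤ arccos z.1.re ^ 2 + arccos z.2.re ^ 2} := by
    ext z
    rw [Set.mem_sdiff, mem_openDiskInTorus, Set.mem_inter_iff]
    refine and_congr_right fun hz => ?_
    have key : ∀ w : ℂ, ‖w‖ = 1 → arccos w.re ^ 2 = w.arg ^ 2 := by
      intro w hw
      have hw0 : w ≠ 0 := by rw [← norm_pos_iff, hw]; exact one_pos
      have h2 := Complex.cos_arg hw0
      rw [hw, div_one] at h2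
      rw [← h2, ← cos_abs, arccos_cos (abs_nonneg _) (Complex.abs_arg_le_pi w), sq_abs]
    obtain ⟨n1, n2⟩ := mem_torus_iff.1 hz
    have h3 : (torusCoord z).1 ^ 2 + (torusCoord z).2 ^ 2 = (z.1.arg ^ 2 + z.2.arg ^ 2) / 2 := by
      simp only [torusCoord]; ring
    rw [Set.mem_ofPred_eq, key _ n1, key _ n2, h3, and_iff_right hz, not_lt]
    constructor <;> intro h <;> linarith
  rw [h1]
  refine (Metric.isClosed_sphere.prod Metric.isClosed_sphere).inter
    (isClosed_le continuous_const ?_)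
  have := continuous_arccos
  fun_prop

theorem isCompact_torus_diff_openDiskInTorus : IsCompact (torus \ openDiskInTorus) :=
  ((isCompact_sphere _ _).prod (isCompact_sphere _ _)).of_isClosed_subset
    isClosed_torus_diff_openDiskInTorus Set.sdiff_subset

/-- The collapsing map from the torus to the model. -/
noncomputable def torusFold (s : ℝ) (z : ℂ × ℂ) : ℂ × ℂ :=
  torusToSpinal s (slitParam s) (torusCollapse z)

variable {s : ℝ}

theorem torusFold_mem_modelSlit_iff (hs0 : 0 < s) (hs : 4 * s ^ 2 < 1) {z : ℂ × ℂ}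
    (h : z ∈ torus) : torusFold s z ∈ modelSlit ↔ z ∈ closedDiskInTorus := by
  rw [torusFold, torusToSpinal_mem_slit_iff hs0 hs (torusCollapse_mem h),
    torusCollapse_mem_torusSlit_iff h]

theorem torusFold_inj (hs0 : 0 < s) (hs : 4 * s ^ 2 < 1) {z z' : ℂ × ℂ} (h : z ∈ torus)
    (h' : z' ∈ torus) (e : torusFold s z = torusFold s z') : torusCollapse z = torusCollapse z' := by
  have hκ := (slitParam_pos hs0).ne'
  rw [← spinalToTorus_torusToSpinal hs hκ (torusCollapse_mem h),
    ← spinalToTorus_torusToSpinal hs hκ (torusCollapse_mem h')]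
  exact congrArg _ e

theorem sq_eq_half {z : ℂ × ℂ} (h : z ∈ torus \ openDiskInTorus) (h' : z ∈ closedDiskInTorus) :
    (torusCoord z).1 ^ 2 + (torusCoord z).2 ^ 2 = 1 / 2 := by
  refine le_antisymm (mem_closedDiskInTorus.1 h').2 ?_
  by_contra! h1
  exact h.2 (mem_openDiskInTorus.2 ⟨h.1, h1⟩)

theorem torusCoord_of_sq_add_sq {k d : ℝ} (h : k ^ 2 + d ^ 2 = 1 / 2) :
    torusCoord (eI (k + d), eI (k - d)) = (k, d) := by
  have hpi := Real.pi_gt_three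
  refine torusCoord_eI ⟨?_, ?_⟩ ⟨?_, ?_⟩ <;> nlinarith [sq_nonneg (k + d), sq_nonneg (k - d)]

theorem cos_pos_of_sq_le {d : ℝ} (h : d ^ 2 ≤ 1) : 0 < cos d := by
  have hpi := Real.pi_gt_three
  obtain ⟨h1, h2⟩ := abs_le.1 (abs_le_one_iff_mul_self_le_one.2 (by nlinarith : d * d ≤ 1))
  exact cos_pos_of_mem_Ioo ⟨by linarith, by linarith⟩

theorem sin_eq_zero_iff_of_sq_le {k : ℝ} (h : k ^ 2 ≤ 1) : sin k = 0 ↔ k = 0 := by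
  have hpi := Real.pi_gt_three
  obtain ⟨h1, h2⟩ := abs_le.1 (abs_le_one_iff_mul_self_le_one.2 (by nlinarith : k * k ≤ 1))
  exact sin_eq_zero_iff_of_lt_of_lt (by linarith) (by linarith)

theorem sin_mul_sin_nonneg {k t : ℝ} (hk : k ^ 2 ≤ 1) (h0 : 0 < t) (h1 : t ≤ 1) :
    0 ≤ sin k * sin (k * t) ∧ (sin (k * t) = 0 → sin k = 0) := by
  have hpi := Real.pi_gt_three
  obtain ⟨a1, a2⟩ := abs_le.1 (abs_le_one_iff_mul_self_le_one.2 (by nlinarith : k * k ≤ 1))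
  have ht : t ^ 2 ≤ 1 := by nlinarith
  have hkt : (k * t) ^ 2 ≤ 1 := by
    rw [mul_pow]
    exact mul_le_one₀ hk (sq_nonneg t) ht
  constructor
  · rcases le_total 0 k with h | h
    · refine mul_nonneg (sin_nonneg_of_nonneg_of_le_pi h (by linarith))
        (sin_nonneg_of_nonneg_of_le_pi (by positivity) (by nlinarith))
    · exact mul_nonneg_of_nonpos_of_nonpos (sin_nonpos_of_nonpos_of_neg_pi_le h (by linarith))
        (sin_nonpos_of_nonpos_of_neg_pi_le (by nlinarith) (by nlinarith))
  · rw [sin_eq_zero_iff_of_sq_le hkt, sin_eq_zero_iff_of_sq_le hk]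
    intro h
    exact (mul_eq_zero.1 h).resolve_right h0.ne'

/-- The end points of the slits correspond. -/
theorem two_mul_eq_iff (hs0 : 0 < s) (hs : 4 * s ^ 2 < 1) {ρ d : ℝ} (hρ : 0 < ρ)
    (hd : d ^ 2 ≤ 1 / 2)
    (hroot : (ρ * cos d - 2 * s) ^ 2 + (slitParam s * ρ * sin d) ^ 2 = 1) :
    ρ * cos d = 2 * s ↔ d ^ 2 = 1 / 2 := by
  have hpi := Real.pi_gt_three
  obtain ⟨hd1, hd2⟩ := sqrt_half_bounds
  have hsinD := sin_pos_of_pos_of_lt_pi hd1 (by linarith)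
  have hcosD : 0 < cos √(1 / 2) := cos_pos_of_mem_Ioo ⟨by linarith, by linarith⟩
  have hκ : slitParam s * (2 * s * sin √(1 / 2)) = cos √(1 / 2) := by
    unfold slitParam
    field_simp
  have hD := sin_sq_add_cos_sq √(1 / 2)
  have hd' := sin_sq_add_cos_sq d
  have hDsq : √(1 / 2 : ℝ) ^ 2 = 1 / 2 := sq_sqrt (by norm_num)
  have hcosd := cos_pos_of_sq_le (by linarith : d ^ 2 ≤ 1)
  have e1 : d ^ 2 = 1 / 2 ↔ cos d ^ 2 = cos √(1 / 2) ^ 2 := by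
    have habs : |d| ≤ π := by
      have : |d| ≤ 1 := abs_le_one_iff_mul_self_le_one.2 (by nlinarith)
      linarith
    constructor
    · intro h
      rw [← cos_abs d, show |d| = √(1 / 2) from by rw [← h, sqrt_sq_eq_abs]]
    · intro h
      have h1 : cos |d| = cos √(1 / 2) := by
        rw [cos_abs]
        exact (sq_eq_sq₀ hcosd.le hcosD.le).1 h
      have h2 := injOn_cos ⟨abs_nonneg d, habs⟩ ⟨hd1.le, by linarith⟩ h1
      rw [← sq_abs, h2, hDsq]
  rw [e1]
  generalize slitParam s = κ at *
  generalize cos √(1 / 2) = a₀ at *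
  generalize sin √(1 / 2) = b₀ at *
  generalize sin d = b at *
  generalize cos d = a at *
  have hκ0 : 0 < κ := by
    by_contra! h
    have : 0 < 2 * s * b₀ := by positivity
    nlinarith
  constructor
  · intro h
    have h1 : (κ * ρ * b) ^ 2 = 1 := by rw [h] at hroot; linarith
    have h2 : (a₀ * b) ^ 2 = (a * b₀) ^ 2 := by
      have e : (a₀ * b) ^ 2 = (κ * ρ * b) ^ 2 * (a * b₀) ^ 2 := by
        rw [← hκ, ← h]; ring
      rw [e, h1, one_mul]
    linear_combination (-1) * h2 + a₀ ^ 2 * hd' - a ^ 2 * hD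
  · intro h
    have h1 : b ^ 2 = b₀ ^ 2 := by linarith
    have h2 : a = a₀ := (sq_eq_sq₀ hcosd.le hcosD.le).1 h
    have h3 : (2 * s) ^ 2 * (κ * ρ * b) ^ 2 = (ρ * a) ^ 2 := by
      rw [h2, ← hκ, mul_pow _ b, h1]; ring
    have h4 : 0 < ρ * a := by positivity
    generalize ρ * a = x at *
    -- Eliminating `κρb` leaves a quadratic equation in `x = ρ cos d`; its second linear factor is
    -- positive for `x > 0` and `4s² < 1`.
    have h5 : (x - 2 * s) * ((1 + 4 * s ^ 2) * x + 2 * s * (1 - 4 * s ^ 2)) = 0 := by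
      linear_combination 4 * s ^ 2 * hroot - h3
    rcases mul_eq_zero.1 h5 with h6 | h6
    · linarith
    · have : 0 < 2 * s * (1 - 4 * s ^ 2) := mul_pos (by linarith) (by linarith)
      have : 0 < (1 + 4 * s ^ 2) * x := by positivity
      linarith

/-- The side is measured by `-Im η = -sin k cos d`, because `Im v = -ρ Im η` on the torus model. The
boundary circle is `k² + d² = 1/2`, and the points `(±k, d)` collapse to the same point of the slit.
-/
theorem slitCover_torus (hs0 : 0 < s) (hs : 4 * s ^ 2 < 1) :
    SlitCover s (torus \ openDiskInTorus) (torusFold s) (fun z => -((z.1.im + z.2.im) / 2)) where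
  isCompact := isCompact_torus_diff_openDiskInTorus
  continuousOn :=
    (((smoothOnSubset_torusToSpinal hs (slitParam_pos hs0).ne').continuousOn).comp
      smoothOnSubset_torusCollapse.continuousOn fun _ h => torusCollapse_mem h).mono Set.sdiff_subset
  continuousOn_sign := by fun_prop
  mapsTo _ h := torusToSpinal_mem hs (slitParam_pos hs0).ne' (torusCollapse_mem h.1)
  injOn z hz z' hz' h e := by
    have h' : z ∉ closedDiskInTorus := fun h1 => h ((torusFold_mem_modelSlit_iff hs0 hs hz.1).2 h1)
    have h'' : z' ∉ closedDiskInTorus :=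
      fun h1 => h (e ▸ (torusFold_mem_modelSlit_iff hs0 hs hz'.1).2 h1)
    rw [← torusExpand_torusCollapse ⟨hz.1, h'⟩, torusFold_inj hs0 hs hz.1 hz'.1 e,
      torusExpand_torusCollapse ⟨hz'.1, h''⟩]
  surj y hy h := by
    have hκ := (slitParam_pos hs0).ne'
    have h1 := spinalToTorus_mem hs hκ hy
    have h2 : spinalToTorus s (slitParam s) y ∉ torusSlit := by
      rw [← torusToSpinal_mem_slit_iff hs0 hs h1, torusToSpinal_spinalToTorus hs hκ hy]
      exact h
    have h3 := torusExpand_mem ⟨h1, h2⟩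
    refine ⟨torusExpand (spinalToTorus s (slitParam s) y), ⟨h3.1, fun h4 => h3.2 ?_⟩, ?_⟩
    · exact mem_closedDiskInTorus.2 ⟨h3.1, (mem_openDiskInTorus.1 h4).2.le⟩
    · rw [torusFold, torusCollapse_torusExpand ⟨h1, h2⟩, torusToSpinal_spinalToTorus hs hκ hy]
  surj_slit y hy h ε hε := by
    have hκ := (slitParam_pos hs0).ne'
    have h1 := spinalToTorus_mem hs hκ hy
    have h2 : spinalToTorus s (slitParam s) y ∈ torusSlit := by
      rw [← torusToSpinal_mem_slit_iff hs0 hs h1, torusToSpinal_spinalToTorus hs hκ hy]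
      exact h
    have h2' : (torusCoord (spinalToTorus s (slitParam s) y)).1 = 0 ∧
      (torusCoord (spinalToTorus s (slitParam s) y)).2 ^ 2 ≤ 1 / 2 := h2
    obtain ⟨h3, h4⟩ := h2'
    set z := spinalToTorus s (slitParam s) y
    set d := (torusCoord z).2
    -- The boundary points over the slit point `(0, d)` have `k = ±t`; the choice `k = -εt` makes
    -- `-sin k cos d` of sign `ε`.
    set t := √(1 / 2 - d ^ 2)
    have ht : t ^ 2 = 1 / 2 - d ^ 2 := sq_sqrt (by linarith)
    have hkd : (-ε * t) ^ 2 + d ^ 2 = 1 / 2 := by linear_combination ht + t ^ 2 * hε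
    have hcoord := torusCoord_of_sq_add_sq hkd
    set x : ℂ × ℂ := (eI (-ε * t + d), eI (-ε * t - d))
    have hx : x ∈ torus := mem_torus_iff.2 ⟨norm_eI _, norm_eI _⟩
    have e : torusCollapse x = z := by
      refine torusCoord_injOn (torusCollapse_mem hx) h1 ?_
      have h5 : slitFactor (-ε * t, d) = 0 := slitFactor_eq_zero hkd.le
      rw [torusCoord_torusCollapse hx, hcoord, slitMap, h5, mul_zero, ← h3]
    refine ⟨x, ⟨hx, fun h5 => ?_⟩, ?_, ?_⟩
    · have h6 := (mem_openDiskInTorus.1 h5).2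
      rw [hcoord] at h6
      exact h6.ne hkd
    · rw [torusFold, e, torusToSpinal_spinalToTorus hs hκ hy]
    · obtain ⟨-, s2, -, -⟩ := torus_half_sums hx
      rw [hcoord] at s2
      rw [s2]
      have hpi := Real.pi_gt_three
      have h7 : 0 ≤ sin t := sin_nonneg_of_nonneg_of_le_pi (sqrt_nonneg _)
        ((sqrt_le_one.2 (by linarith [sq_nonneg d])).trans (by linarith))
      have h8 := cos_pos_of_sq_le (by linarith : d ^ 2 ≤ 1)
      have h9 := mul_nonneg h7 h8.le
      rcases sq_eq_sq_iff_eq_or_eq_neg.1 (hε.trans (one_pow 2).symm) with rfl | rfl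
      · rw [neg_one_mul, sin_neg]; linarith
      · rw [neg_neg, one_mul]; linarith
  fiber z hz z' hz' h e := by
    have c1 := (torusFold_mem_modelSlit_iff hs0 hs hz.1).1 h
    have c2 := (torusFold_mem_modelSlit_iff hs0 hs hz'.1).1 (e ▸ h)
    have k1 := sq_eq_half hz c1
    have k2 := sq_eq_half hz' c2
    have hcol := congrArg torusCoord (torusFold_inj hs0 hs hz.1 hz'.1 e)
    rw [torusCoord_torusCollapse hz.1, torusCoord_torusCollapse hz'.1] at hcol
    have hd : (torusCoord z).2 = (torusCoord z').2 := (Prod.ext_iff.1 hcol).2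
    have hk : (torusCoord z).1 ^ 2 = (torusCoord z').1 ^ 2 := by rw [hd] at k1; linarith
    rcases sq_eq_sq_iff_eq_or_eq_neg.1 hk with h1 | h1
    · exact Or.inl (torusCoord_injOn hz.1 hz'.1 (Prod.ext h1 hd))
    · by_cases h0 : (torusCoord z').1 = 0
      · exact Or.inl (torusCoord_injOn hz.1 hz'.1 (Prod.ext (by rw [h1, h0, neg_zero]) hd))
      · right
        obtain ⟨-, s2, -, -⟩ := torus_half_sums hz.1
        obtain ⟨-, s2', -, -⟩ := torus_half_sums hz'.1
        rw [s2, s2', h1, hd, sin_neg]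
        have h3 := cos_pos_of_sq_le
          (by linarith [sq_nonneg (torusCoord z').1] : (torusCoord z').2 ^ 2 ≤ 1)
        have h4 := mt (sin_eq_zero_iff_of_sq_le
          (by linarith [sq_nonneg (torusCoord z').2] : (torusCoord z').1 ^ 2 ≤ 1)).1 h0
        have h5 : 0 < (sin (torusCoord z').1 * cos (torusCoord z').2) ^ 2 := by positivity
        linarith
  sign_slit z hz h := by
    have c1 := (torusFold_mem_modelSlit_iff hs0 hs hz.1).1 h
    have k1 := sq_eq_half hz c1
    obtain ⟨-, s2, -, -⟩ := torus_half_sums hz.1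
    obtain ⟨hρ, hroot⟩ := torusScale_spec hs (slitParam_pos hs0).ne' (torusCollapse_mem hz.1)
    obtain ⟨t1, t2, t3, t4⟩ := torus_half_sums (torusCollapse_mem hz.1)
    rw [torusForm_eq, half_add_re] at hroot
    have hcol : torusCoord (torusCollapse z) = (0, (torusCoord z).2) := by
      rw [torusCoord_torusCollapse hz.1, slitMap, slitFactor_eq_zero k1.le, mul_zero]
    rw [hcol] at t1 t2 t3 t4
    simp only [cos_zero, sin_zero, one_mul, zero_mul, neg_zero] at t1 t2 t3 t4
    rw [t1, t2, t3, t4] at hroot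
    have hd : (torusCoord z).2 ^ 2 ≤ 1 / 2 := by linarith [sq_nonneg (torusCoord z).1]
    -- On the boundary circle the side vanishes exactly when `k = 0`, i.e. `d² = 1/2`; by the choice
    -- of `slitParam` this is the end `v = 0` of the slit.
    have h2 := two_mul_eq_iff hs0 hs hρ hd (by linear_combination hroot)
    have him : (torusFold s z).1.im = 0 := h.1
    have hre : (torusFold s z).1.re = 2 * s - torusScale s (slitParam s) (torusCollapse z) *
        cos (torusCoord z).2 := by
      rw [torusFold, torusToSpinal_fst_re, t1]
    have h3 : (torusFold s z).1 = 0 ↔ torusScale s (slitParam s) (torusCollapse z) *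
        cos (torusCoord z).2 = 2 * s := by
      rw [Complex.ext_iff, him, hre]
      simp only [Complex.zero_re, Complex.zero_im, and_true]
      constructor <;> intro h <;> linarith
    have h4 := cos_pos_of_sq_le (by linarith : (torusCoord z).2 ^ 2 ≤ 1)
    rw [h3, h2, s2, neg_eq_zero, mul_eq_zero, or_iff_left h4.ne', sin_eq_zero_iff_of_sq_le
      (by linarith [sq_nonneg (torusCoord z).2]), ← pow_eq_zero_iff (two_ne_zero)]
    constructor <;> intro h <;> linarith
  sign z hz h := by
    have c1 := mt (torusFold_mem_modelSlit_iff hs0 hs hz.1).2 h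
    have k1 : 1 / 2 < (torusCoord z).1 ^ 2 + (torusCoord z).2 ^ 2 := by
      by_contra! h1
      exact c1 (mem_closedDiskInTorus.2 ⟨hz.1, h1⟩)
    obtain ⟨-, s2, -, -⟩ := torus_half_sums hz.1
    obtain ⟨hρ, -⟩ := torusScale_spec hs (slitParam_pos hs0).ne' (torusCollapse_mem hz.1)
    obtain ⟨-, t2, -, -⟩ := torus_half_sums (torusCollapse_mem hz.1)
    rw [torusCoord_torusCollapse hz.1] at t2
    have him : (torusFold s z).1.im = -(torusScale s (slitParam s) (torusCollapse z) *
        (sin ((torusCoord z).1 * slitFactor (torusCoord z)) * cos (torusCoord z).2)) := by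
      rw [torusFold, torusToSpinal_fst_im, t2, slitMap]
    -- Multiplying `k` by a factor in `(0, 1]` preserves its sign, and `sin` respects it for small
    -- angles. For large angles the factor is `1`.
    have key : 0 ≤ sin (torusCoord z).1 * sin ((torusCoord z).1 * slitFactor (torusCoord z)) ∧
        (sin ((torusCoord z).1 * slitFactor (torusCoord z)) = 0 → sin (torusCoord z).1 = 0) := by
      by_cases h1 : 1 ≤ (torusCoord z).1 ^ 2 + (torusCoord z).2 ^ 2
      · rw [slitFactor_eq_one h1, mul_one]
        exact ⟨mul_self_nonneg _, id⟩
      · exact sin_mul_sin_nonneg (by linarith [sq_nonneg (torusCoord z).2]) (slitFactor_pos k1)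
          (slitFactor_le_one _)
    rw [s2, him]
    constructor
    · have := mul_nonneg hρ.le (mul_nonneg key.1 (sq_nonneg (cos (torusCoord z).2)))
      linarith
    · intro h1
      rcases mul_eq_zero.1 (neg_eq_zero.1 h1) with h2 | h2
      · exact absurd h2 hρ.ne'
      · rcases mul_eq_zero.1 h2 with h3 | h3
        · rw [key.2 h3]; simp
        · rw [h3]; simp

theorem exists_homeomorph_torus_modelClosedPiece {c : ℝ} (hs0 : 0 < s) (hs : 4 * s ^ 2 < 1)
    (hc : 0 < c) (hc1 : c < 1) :
    ∃ e : (torus \ openDiskInTorus : Set (ℂ × ℂ)) ≃ₜ modelClosedPiece 1 s c,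
      ∀ x : (torus \ openDiskInTorus : Set (ℂ × ℂ)),
      (x : ℂ × ℂ) ∈ closedDiskInTorus ↔
        |(e x : ℂ × ℂ).1.im| = c * Complex.normSq (e x : ℂ × ℂ).1 := by
  obtain ⟨e, he⟩ := (slitCover_torus hs0 hs).exists_homeomorph
    (slitCover_modelClosedPiece hs0 hs hc hc1)
  refine ⟨e, fun x => ?_⟩
  rw [← im_eq_of_mem_boundary hc hc1 (e x).2, he, torusFold_mem_modelSlit_iff hs0 hs x.2.1]

theorem areDiffeomorphic_torus_modelPiece {c : ℝ} (hs0 : 0 < s) (hs : 4 * s ^ 2 < 1)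
    (hc : 0 < c) (hc1 : c < 1) :
    AreDiffeomorphic (torus \ closedDiskInTorus) (modelPiece 1 s c) :=
  (areDiffeomorphic_torus_slit.trans (areDiffeomorphic_torusSlit_modelSlit hs0 hs)).trans
    (areDiffeomorphic_slit_piece hs0 hs hc hc1)

end TorusCover

end FordFaces

namespace FordFaces

/-! ### The symmetries of the Hermitian form -/

section Group

theorem sqrtTwo_sq : sqrtTwo ^ 2 = 2 := by
  unfold sqrtTwo
  rw [← Complex.ofReal_pow, Real.sq_sqrt (by norm_num)]
  norm_num

theorem star_sqrtTwo : star sqrtTwo = sqrtTwo := Complex.conj_ofReal _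

theorem eI_mul_eI_neg (α : ℝ) : eI α * eI (-α) = 1 := by rw [← eI_add, add_neg_cancel, eI_zero]

theorem star_eI (α : ℝ) : star (eI α) = eI (-α) := by
  change starRingEnd ℂ (eI α) = _
  unfold eI
  rw [← Complex.exp_conj]
  simp

theorem cos_eq_eI (α : ℝ) : (Real.cos α : ℂ) = (eI α + eI (-α)) / 2 := by
  rw [eI_eq, eI_eq]
  simp only [Complex.ofReal_cos, Complex.ofReal_neg, Complex.cos_neg, Complex.sin_neg]
  ring

theorem sin_eq_eI (α : ℝ) : (Real.sin α : ℂ) = (eI α - eI (-α)) * (-Complex.I / 2) := by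
  rw [eI_eq, eI_eq]
  simp only [Complex.ofReal_sin, Complex.ofReal_neg, Complex.cos_neg, Complex.sin_neg]
  linear_combination (Complex.sin α) * Complex.I_sq

/-- The matrix of the symmetry which exchanges `pV` and `pW` up to sign. -/
noncomputable def matT (α : ℝ) : Matrix (Fin 3) (Fin 3) ℂ :=
  !![-1, 0, 0; sqrtTwo * eI α, 1, 0; 1, sqrtTwo * eI (-α), -1]

theorem matT_det (α : ℝ) : (matT α).det = 1 := by
  simp [matT, Matrix.det_fin_three]

noncomputable def T (α : ℝ) : Matrix.SpecialLinearGroup (Fin 3) ℂ := ⟨matT α, matT_det α⟩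

theorem smul_vec (M : Matrix.SpecialLinearGroup (Fin 3) ℂ) (v : Fin 3 → ℂ) (i : Fin 3) :
    (M • v) i = M.1 i 0 * v 0 + M.1 i 1 * v 1 + M.1 i 2 * v 2 := by
  rw [Matrix.SpecialLinearGroup.smul_def]
  simp [Matrix.mulVec, dotProduct, Fin.sum_univ_three]

/-- The isometries of the Hermitian form. -/
def hermGroup : Subgroup (Matrix.SpecialLinearGroup (Fin 3) ℂ) where
  carrier := {g | ∀ z w : Fin 3 → ℂ, herm (g • z) (g • w) = herm z w}
  mul_mem' {g h} hg hh z w := by rw [mul_smul, mul_smul, hg, hh]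
  one_mem' z w := by rw [one_smul, one_smul]
  inv_mem' {g} hg z w := by
    have := hg (g⁻¹ • z) (g⁻¹ • w)
    rw [smul_inv_smul, smul_inv_smul] at this
    exact this.symm

theorem herm_smul {g : Matrix.SpecialLinearGroup (Fin 3) ℂ} (hg : g ∈ hermGroup) (z w : Fin 3 → ℂ) :
    herm (g • z) (g • w) = herm z w := hg z w

theorem U_mem_hermGroup (α : ℝ) : U α ∈ hermGroup := by
  intro z w
  have h1 := sqrtTwo_sq
  have h2 := eI_mul_eI_neg α
  simp only [herm, smul_vec]
  simp only [U, matU, Matrix.of_apply, Matrix.cons_val', Matrix.cons_val_zero,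
    Matrix.cons_val_one, Matrix.cons_val, star_add, star_mul', star_neg, star_pow, star_eI,
    neg_neg, star_sqrtTwo, star_one, cos_eq_eI, star_div₀, star_ofNat]
  -- Conjugation has already been resolved as the exchange of `e` and `f`. What remains is a
  -- polynomial identity modulo `e f = 1` and `r² = 2`.
  generalize eI α = e at *
  generalize eI (-α) = f at *
  generalize sqrtTwo = r at *
  generalize star (z 0) = a0
  generalize star (z 1) = a1
  generalize star (z 2) = a2
  generalize w 0 = b0
  generalize w 1 = b1
  generalize w 2 = b2
  grind

theorem T_mem_hermGroup (α : ℝ) : T α ∈ hermGroup := by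
  intro z w
  have h1 := sqrtTwo_sq
  have h2 := eI_mul_eI_neg α
  simp only [herm, smul_vec]
  simp only [T, matT, Matrix.of_apply, Matrix.cons_val', Matrix.cons_val_zero,
    Matrix.cons_val_one, Matrix.cons_val, star_add, star_mul', star_neg, star_eI,
    neg_neg, star_sqrtTwo, star_one, star_zero]
  generalize eI α = e at *
  generalize eI (-α) = f at *
  generalize sqrtTwo = r at *
  generalize star (z 0) = a0
  generalize star (z 1) = a1
  generalize star (z 2) = a2
  generalize w 0 = b0
  generalize w 1 = b1
  generalize w 2 = b2
  grind

/-- The vector `U⁻¹ pW`. -/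
noncomputable def pW' (α : ℝ) : Fin 3 → ℂ :=
  ![1, sqrtTwo * eI (-α) + (sqrtTwo / 2) * eI α, -1]

/-- The vector `U⁻¹ pB`. -/
noncomputable def pB' (α : ℝ) : Fin 3 → ℂ := ![-1, -(sqrtTwo * eI (-α)), 1]

/-- The vector `U pA`. -/
noncomputable def pA' (α : ℝ) : Fin 3 → ℂ := ![1, -(sqrtTwo * eI α), -1]

theorem vec_ext {v w : Fin 3 → ℂ} (h0 : v 0 = w 0) (h1 : v 1 = w 1) (h2 : v 2 = w 2) : v = w := by
  funext i
  fin_cases i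
  · exact h0
  · exact h1
  · exact h2

theorem U_smul_pU (α : ℝ) : U α • pU α = pU α := by
  have h1 := sqrtTwo_sq
  have h2 := eI_mul_eI_neg α
  apply vec_ext <;> simp only [smul_vec] <;> simp [U, matU, pU, cos_eq_eI, -Complex.ofReal_cos] <;> grind

theorem U_smul_pA (α : ℝ) : U α • pA = pA' α := by
  apply vec_ext <;> simp only [smul_vec] <;> simp [U, matU, pA, pA']

theorem U_smul_pB' (α : ℝ) : U α • pB' α = pB := by
  have h1 := sqrtTwo_sq
  have h2 := eI_mul_eI_neg α
  apply vec_ext <;> simp only [smul_vec] <;> simp [U, matU, pB, pB', cos_eq_eI, -Complex.ofReal_cos] <;> grind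

theorem U_smul_pW' (α : ℝ) : U α • pW' α = pW α := by
  have h1 := sqrtTwo_sq
  have h2 := eI_mul_eI_neg α
  apply vec_ext <;> simp only [smul_vec] <;> simp [U, matU, pW, pW', cos_eq_eI, -Complex.ofReal_cos] <;> grind

theorem T_smul_pU (α : ℝ) : T α • pU α = -pU α := by
  have h1 := sqrtTwo_sq
  have h2 := eI_mul_eI_neg α
  apply vec_ext <;> simp only [smul_vec, Pi.neg_apply] <;> simp [T, matT, pU] <;> grind

theorem T_smul_pV (α : ℝ) : T α • pV α = -pW α := by
  have h1 := sqrtTwo_sq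
  have h2 := eI_mul_eI_neg α
  apply vec_ext <;> simp only [smul_vec, Pi.neg_apply] <;> simp [T, matT, pV, pW] <;> grind

theorem T_smul_pW (α : ℝ) : T α • pW α = -pV α := by
  have h1 := sqrtTwo_sq
  have h2 := eI_mul_eI_neg α
  apply vec_ext <;> simp only [smul_vec, Pi.neg_apply] <;> simp [T, matT, pV, pW] <;> grind

/-- `T` sends `pW` and `U⁻¹pW`, the neighbours of a face of sign plus, to `pV` and `U pV` up to
sign, the neighbours of a face of sign minus. One model therefore serves both signs. -/
theorem T_smul_pW' (α : ℝ) : T α • pW' α = -(U α • pV α) := by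
  have h1 := sqrtTwo_sq
  have h2 := eI_mul_eI_neg α
  apply vec_ext <;> simp only [smul_vec, Pi.neg_apply] <;> simp [T, matT, U, matU, pV, pW', cos_eq_eI, -Complex.ofReal_cos] <;>
    grind

theorem T_smul_pA (α : ℝ) : T α • pA = -(U α • pA) := by
  apply vec_ext <;> simp only [smul_vec, Pi.neg_apply] <;> simp [T, matT, U, matU, pA]

theorem T_smul_pB (α : ℝ) : T α • pB = -pB := by
  apply vec_ext <;> simp only [smul_vec, Pi.neg_apply] <;> simp [T, matT, pB]

theorem T_smul_pA' (α : ℝ) : T α • pA' α = -pA := by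
  have h1 := sqrtTwo_sq
  have h2 := eI_mul_eI_neg α
  apply vec_ext <;> simp only [smul_vec, Pi.neg_apply] <;> simp [T, matT, pA, pA']
  grind

theorem T_smul_pB' (α : ℝ) : T α • pB' α = -(U α • pB) := by
  have h1 := sqrtTwo_sq
  have h2 := eI_mul_eI_neg α
  apply vec_ext <;> simp only [smul_vec, Pi.neg_apply] <;> simp [T, matT, U, matU, pB, pB', cos_eq_eI, -Complex.ofReal_cos]
  all_goals grind

theorem Upow_eq (α : ℝ) (k : ℤ) (v : Fin 3 → ℂ) : Upow α k v = U α ^ k • v := by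
  rw [Matrix.SpecialLinearGroup.smul_def]
  rfl

theorem U_zpow_smul_pU (α : ℝ) (k : ℤ) : U α ^ k • pU α = pU α :=
  zpow_mem (show U α ∈ MulAction.stabilizer _ (pU α) from U_smul_pU α) k

theorem U_zpow_mem_hermGroup (α : ℝ) (k : ℤ) : U α ^ k ∈ hermGroup := zpow_mem (U_mem_hermGroup α) k

end Group

end FordFaces

namespace FordFaces

/-! ### The sphere at infinity -/

section Chart

/-- The null vector over a point of the sphere. -/
noncomputable def liftVec (w : ℂ × ℂ) : Fin 3 → ℂ :=
  ![w.2 + Complex.I, sqrtTwo * w.1, w.2 - Complex.I]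

/-- The point of `ℂ²` below a vector. -/
noncomputable def dropVec (y : Fin 3 → ℂ) : ℂ × ℂ :=
  (Complex.I * (sqrtTwo * y 1 / (y 0 - y 2)), Complex.I * ((y 0 + y 2) / (y 0 - y 2)))

@[simp] theorem liftVec_zero (w : ℂ × ℂ) : liftVec w 0 = w.2 + Complex.I := rfl
@[simp] theorem liftVec_one (w : ℂ × ℂ) : liftVec w 1 = sqrtTwo * w.1 := rfl
@[simp] theorem liftVec_two (w : ℂ × ℂ) : liftVec w 2 = w.2 - Complex.I := rfl

theorem liftVec_sub (w : ℂ × ℂ) : liftVec w 0 - liftVec w 2 = 2 * Complex.I := by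
  simp only [liftVec_zero, liftVec_two]; ring

theorem two_mul_I_ne_zero : (2 * Complex.I) ≠ 0 := mul_ne_zero two_ne_zero Complex.I_ne_zero

theorem liftVec_ne_zero (w : ℂ × ℂ) : liftVec w ≠ 0 := by
  intro h
  have h1 := liftVec_sub w
  rw [h] at h1
  simp at h1

theorem dropVec_liftVec (w : ℂ × ℂ) : dropVec (liftVec w) = w := by
  have h1 := sqrtTwo_sq
  have h2 := Complex.I_ne_zero
  unfold dropVec
  rw [liftVec_sub]
  refine Prod.ext ?_ ?_ <;> simp only [liftVec_zero, liftVec_one, liftVec_two] <;> field_simp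
  · rw [h1, mul_comm]
  · ring

theorem dropVec_smul {a : ℂ} (ha : a ≠ 0) (y : Fin 3 → ℂ) : dropVec (a • y) = dropVec y := by
  simp only [dropVec, Pi.smul_apply, smul_eq_mul]
  rw [← mul_sub, ← mul_add, mul_left_comm sqrtTwo, mul_div_mul_left _ _ ha, mul_div_mul_left _ _ ha]

theorem liftVec_dropVec {y : Fin 3 → ℂ} (hy : y 0 - y 2 ≠ 0) :
    liftVec (dropVec y) = (2 * Complex.I / (y 0 - y 2)) • y := by
  have h1 := sqrtTwo_sq
  apply vec_ext <;> simp only [liftVec_zero, liftVec_one, liftVec_two, dropVec, Pi.smul_apply,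
    smul_eq_mul] <;> field_simp
  · ring
  · linear_combination y 1 * h1
  · ring

theorem herm_smul_left (a : ℂ) (z w : Fin 3 → ℂ) : herm (a • z) w = star a * herm z w := by
  simp only [herm, Pi.smul_apply, smul_eq_mul, star_mul']
  ring

theorem herm_smul_right (a : ℂ) (z w : Fin 3 → ℂ) : herm z (a • w) = a * herm z w := by
  simp only [herm, Pi.smul_apply, smul_eq_mul]
  ring

theorem herm_liftVec (w : ℂ × ℂ) :
    herm (liftVec w) (liftVec w) = (2 * (Complex.normSq w.1 + Complex.normSq w.2 - 1) : ℝ) := by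
  simp only [herm, liftVec_zero, liftVec_one, liftVec_two, star_add, star_sub, star_mul',
    star_sqrtTwo]
  push_cast
  rw [Complex.normSq_eq_conj_mul_self, Complex.normSq_eq_conj_mul_self]
  simp only [Complex.star_def, Complex.conj_I]
  linear_combination (starRingEnd ℂ w.1 * w.1) * sqrtTwo_sq + 2 * Complex.I_sq

/-- If `y₀ = y₂`, the form takes the value `2|y₂|² + |y₁|²`, which vanishes only at the origin. -/
theorem sub_ne_zero_of_herm {y : Fin 3 → ℂ} (hy : y ≠ 0) (h : herm y y = 0) : y 0 - y 2 ≠ 0 := by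
  intro h0
  have h1 : y 0 = y 2 := sub_eq_zero.1 h0
  have h2 : (2 * Complex.normSq (y 2) + Complex.normSq (y 1) : ℝ) = (0 : ℂ) := by
    rw [← h]
    push_cast
    rw [Complex.normSq_eq_conj_mul_self, Complex.normSq_eq_conj_mul_self, herm, h1]
    simp only [Complex.star_def]
    ring
  have h3 := Complex.ofReal_eq_zero.1 h2
  have h4 := Complex.normSq_nonneg (y 2)
  have h5 := Complex.normSq_nonneg (y 1)
  have h6 : y 2 = 0 := Complex.normSq_eq_zero.1 (by linarith)
  have h7 : y 1 = 0 := Complex.normSq_eq_zero.1 (by linarith)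
  exact hy (vec_ext (h1.trans h6) h7 h6)

theorem mem_modelSphere_iff_herm {w : ℂ × ℂ} :
    w ∈ modelSphere ↔ herm (liftVec w) (liftVec w) = 0 := by
  rw [herm_liftVec, Complex.ofReal_eq_zero]
  change _ = (1 : ℝ) ↔ _
  constructor <;> intro h <;> linarith

theorem dropVec_mem {y : Fin 3 → ℂ} (hy : y ≠ 0) (h : herm y y = 0) : dropVec y ∈ modelSphere := by
  rw [mem_modelSphere_iff_herm, liftVec_dropVec (sub_ne_zero_of_herm hy h), herm_smul_left,
    herm_smul_right, h, mul_zero, mul_zero]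

abbrev SL3 : Type := Matrix.SpecialLinearGroup (Fin 3) ℂ

/-- The point at infinity corresponding to a point of the sphere. -/
noncomputable def toBoundary (P : SL3) (w : ℂ × ℂ) : CP2 :=
  P • Projectivization.mk ℂ (liftVec w) (liftVec_ne_zero w)

noncomputable def ofBoundary (P : SL3) (x : CP2) : ℂ × ℂ := dropVec (P⁻¹ • x.rep)

/-- The chosen representative is arbitrary, so only information up to a nonzero scalar is extracted
from it. -/
theorem exists_rep_smul_mk (P : SL3) (v : Fin 3 → ℂ) (hv : v ≠ 0) :
    ∃ a : ℂ, a ≠ 0 ∧ (P • Projectivization.mk ℂ v hv).rep = a • P • v := by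
  rw [Projectivization.smul_mk]
  obtain ⟨a, ha⟩ := Projectivization.exists_smul_eq_mk_rep ℂ (P • v)
    ((smul_ne_zero_iff_ne P).2 hv)
  exact ⟨a, a.ne_zero, ha.symm⟩

theorem exists_rep (P : SL3) (w : ℂ × ℂ) :
    ∃ a : ℂ, a ≠ 0 ∧ (toBoundary P w).rep = a • P • liftVec w := exists_rep_smul_mk P _ _

theorem smul_smul_vec (P : SL3) (a : ℂ) (v : Fin 3 → ℂ) : P • a • v = a • P • v := smul_comm P a v

theorem ofBoundary_toBoundary (P : SL3) (w : ℂ × ℂ) : ofBoundary P (toBoundary P w) = w := by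
  obtain ⟨a, ha, h⟩ := exists_rep P w
  rw [ofBoundary, h, smul_smul_vec, inv_smul_smul, dropVec_smul ha, dropVec_liftVec]

theorem toBoundary_mem_iff {P : SL3} (hP : P ∈ hermGroup) {w : ℂ × ℂ} :
    toBoundary P w ∈ boundaryH2C ↔ w ∈ modelSphere := by
  obtain ⟨a, ha, h⟩ := exists_rep P w
  change herm _ _ = 0 ↔ _
  rw [h, herm_smul_left, herm_smul_right, herm_smul hP, mem_modelSphere_iff_herm]
  have := star_ne_zero.2 ha
  simp [ha]

theorem exists_toBoundary {P : SL3} (hP : P ∈ hermGroup) {x : CP2} (hx : x ∈ boundaryH2C) :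
    ∃ w ∈ modelSphere, toBoundary P w = x := by
  have h1 : P⁻¹ • x.rep ≠ 0 := (smul_ne_zero_iff_ne _).2 x.rep_nonzero
  have h2 : herm (P⁻¹ • x.rep) (P⁻¹ • x.rep) = 0 := by
    rw [herm_smul (inv_mem hP)]; exact hx
  refine ⟨dropVec (P⁻¹ • x.rep), dropVec_mem h1 h2, ?_⟩
  have h3 := sub_ne_zero_of_herm h1 h2
  rw [toBoundary, Projectivization.smul_mk]
  conv_rhs => rw [← x.mk_rep]
  rw [Projectivization.mk_eq_mk_iff']
  refine ⟨2 * Complex.I / ((P⁻¹ • x.rep) 0 - (P⁻¹ • x.rep) 2), ?_⟩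
  rw [liftVec_dropVec h3, smul_smul_vec, smul_inv_smul]

theorem toBoundary_image {P : SL3} (hP : P ∈ hermGroup) : toBoundary P '' modelSphere = boundaryH2C := by
  ext x
  constructor
  · rintro ⟨w, hw, rfl⟩
    exact (toBoundary_mem_iff hP).2 hw
  · intro hx
    exact exists_toBoundary hP hx

theorem continuous_smul_vec (P : SL3) : Continuous fun v : Fin 3 → ℂ => P • v := by
  refine continuous_pi fun i => ?_
  simp only [smul_vec]
  fun_prop

theorem continuous_toBoundary (P : SL3) : Continuous (toBoundary P) := by
  have h1 : Continuous (Projectivization.mk' ℂ : { v : Fin 3 → ℂ // v ≠ 0 } → CP2) :=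
    continuous_coinduced_rng
  have h2 : Continuous liftVec := by
    refine continuous_pi fun i => ?_
    fin_cases i <;> simp only [liftVec] <;> simp <;> fun_prop
  exact h1.comp (((continuous_smul_vec P).comp h2).subtype_mk
    fun w => (smul_ne_zero_iff_ne P).2 (liftVec_ne_zero w))

theorem isQuotientMap_mk' :
    Topology.IsQuotientMap (Projectivization.mk' ℂ : { v : Fin 3 → ℂ // v ≠ 0 } → CP2) :=
  ⟨⟨rfl⟩, fun x => ⟨⟨x.rep, x.rep_nonzero⟩, x.mk_rep⟩⟩

theorem isClosed_boundaryH2C : IsClosed boundaryH2C := by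
  rw [← isQuotientMap_mk'.isClosed_preimage]
  have : Projectivization.mk' ℂ ⁻¹' boundaryH2C =
      {v : { v : Fin 3 → ℂ // v ≠ 0 } | herm v.1 v.1 = 0} := by
    ext v
    obtain ⟨a, ha⟩ := Projectivization.exists_smul_eq_mk_rep ℂ v.1 v.2
    change herm (Projectivization.mk ℂ v.1 v.2).rep (Projectivization.mk ℂ v.1 v.2).rep = 0 ↔
      herm v.1 v.1 = 0
    rw [← ha, Units.smul_def, herm_smul_left, herm_smul_right]
    have := star_ne_zero.2 a.ne_zero
    simp
  rw [this]
  refine isClosed_eq ?_ continuous_const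
  have c : ∀ i, Continuous fun v : { v : Fin 3 → ℂ // v ≠ 0 } => v.1 i :=
    fun i => (continuous_apply i).comp continuous_subtype_val
  exact (((c 0).star.mul (c 2)).add ((c 1).star.mul (c 1))).add ((c 2).star.mul (c 0))

/-- The choice of representatives need not be continuous, but `dropVec` is homogeneous of degree
`0`. Continuity is checked on vectors and descends through the quotient map over the open set where
the denominator does not vanish. -/
theorem continuousOn_ofBoundary {P : SL3} (hP : P ∈ hermGroup) :
    ContinuousOn (ofBoundary P) boundaryH2C := by
  let O : Set CP2 := {x | (P⁻¹ • x.rep) 0 - (P⁻¹ • x.rep) 2 ≠ 0}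
  have key : ∀ v : { v : Fin 3 → ℂ // v ≠ 0 }, ∃ a : ℂ, a ≠ 0 ∧
      P⁻¹ • (Projectivization.mk' ℂ v).rep = a • P⁻¹ • v.1 := by
    intro v
    obtain ⟨a, ha⟩ := Projectivization.exists_smul_eq_mk_rep ℂ v.1 v.2
    refine ⟨a, a.ne_zero, ?_⟩
    rw [Projectivization.mk'_eq_mk, ← ha, Units.smul_def, smul_smul_vec]
  have hc := continuous_smul_vec P⁻¹
  have hc0 : Continuous fun v : { v : Fin 3 → ℂ // v ≠ 0 } => P⁻¹ • v.1 :=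
    hc.comp continuous_subtype_val
  have hpre : Projectivization.mk' ℂ ⁻¹' O =
      {v : { v : Fin 3 → ℂ // v ≠ 0 } | (P⁻¹ • v.1) 0 - (P⁻¹ • v.1) 2 ≠ 0} := by
    ext v
    obtain ⟨a, ha, h⟩ := key v
    change (P⁻¹ • (Projectivization.mk' ℂ v).rep) 0 - (P⁻¹ • (Projectivization.mk' ℂ v).rep) 2 ≠ 0 ↔
      (P⁻¹ • v.1) 0 - (P⁻¹ • v.1) 2 ≠ 0
    rw [h, Pi.smul_apply, Pi.smul_apply, ← smul_sub, smul_ne_zero_iff]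
    exact and_iff_right ha
  have hO : IsOpen O := by
    rw [← isQuotientMap_mk'.isOpen_preimage, hpre]
    exact isOpen_ne_fun (by fun_prop) continuous_const
  have hsub : boundaryH2C ⊆ O := by
    intro x hx
    refine sub_ne_zero_of_herm ((smul_ne_zero_iff_ne _).2 x.rep_nonzero) ?_
    rw [herm_smul (inv_mem hP)]
    exact hx
  refine ContinuousOn.mono ?_ hsub
  rw [isQuotientMap_mk'.continuousOn_isOpen_iff hO, hpre]
  have e : ofBoundary P ∘ Projectivization.mk' ℂ =
      fun v : { v : Fin 3 → ℂ // v ≠ 0 } => dropVec (P⁻¹ • v.1) := by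
    funext v
    obtain ⟨a, ha, h⟩ := key v
    rw [Function.comp_apply, ofBoundary, h, dropVec_smul ha]
  rw [e]
  unfold dropVec
  intro v hv
  have hv' : (P⁻¹ • v.1) 0 - (P⁻¹ • v.1) 2 ≠ 0 := hv
  apply ContinuousAt.continuousWithinAt
  have c : ∀ i, ContinuousAt (fun v : { v : Fin 3 → ℂ // v ≠ 0 } => (P⁻¹ • v.1) i) v :=
    fun i => ((continuous_apply i).comp hc0).continuousAt
  exact (continuousAt_const.mul ((continuousAt_const.mul (c 1)).div ((c 0).sub (c 2)) hv')).prodMk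
    (continuousAt_const.mul (((c 0).add (c 2)).div ((c 0).sub (c 2)) hv'))

theorem embedsClosed_toBoundary {P : SL3} (hP : P ∈ hermGroup) :
    EmbedsClosed (toBoundary P) (ofBoundary P) modelSphere where
  continuousOn := (continuous_toBoundary P).continuousOn
  continuousOn_inv := by
    rw [toBoundary_image hP]
    exact continuousOn_ofBoundary hP
  leftInv w _ := ofBoundary_toBoundary P w
  isClosed := isClosed_modelSphere
  isClosed_image := by
    rw [toBoundary_image hP]
    exact isClosed_boundaryH2C

/-! ### Smoothness in the ball model -/

/-- The action on the ball model. -/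
noncomputable def ballMap (P : SL3) (w : ℂ × ℂ) : ℂ × ℂ := dropVec (P • liftVec w)

theorem ballChart_eq (x : CP2) : ballChart x = -Complex.I • dropVec x.rep := by
  rw [ballChart, dropVec]
  refine Prod.ext ?_ ?_ <;> simp only [Prod.smul_mk, smul_eq_mul, sqrtTwo] <;>
    rw [← mul_assoc, neg_mul, Complex.I_mul_I, neg_neg, one_mul]

theorem ballChart_toBoundary (P : SL3) (w : ℂ × ℂ) :
    ballChart (toBoundary P w) = -Complex.I • ballMap P w := by
  obtain ⟨a, ha, h⟩ := exists_rep P w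
  rw [ballChart_eq, h, dropVec_smul ha, ballMap]

theorem smul_liftVec_sub_ne_zero {P : SL3} (hP : P ∈ hermGroup) {w : ℂ × ℂ} (hw : w ∈ modelSphere) :
    (P • liftVec w) 0 - (P • liftVec w) 2 ≠ 0 := by
  refine sub_ne_zero_of_herm ((smul_ne_zero_iff_ne _).2 (liftVec_ne_zero w)) ?_
  rw [herm_smul hP]
  exact mem_modelSphere_iff_herm.1 hw

theorem ballMap_inv_ballMap {P : SL3} (hP : P ∈ hermGroup) {w : ℂ × ℂ} (hw : w ∈ modelSphere) :
    ballMap P⁻¹ (ballMap P w) = w := by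
  have h := smul_liftVec_sub_ne_zero hP hw
  rw [ballMap, ballMap, liftVec_dropVec h, smul_smul_vec, inv_smul_smul,
    dropVec_smul (div_ne_zero two_mul_I_ne_zero h), dropVec_liftVec]

theorem ballMap_mem {P : SL3} (hP : P ∈ hermGroup) {w : ℂ × ℂ} (hw : w ∈ modelSphere) :
    ballMap P w ∈ modelSphere := by
  refine dropVec_mem ((smul_ne_zero_iff_ne _).2 (liftVec_ne_zero w)) ?_
  rw [herm_smul hP]
  exact mem_modelSphere_iff_herm.1 hw

theorem contDiff_smul_liftVec (P : SL3) (i : Fin 3) :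
    ContDiff ℝ ∞ fun w : ℂ × ℂ => (P • liftVec w) i := by
  simp only [smul_vec, liftVec_zero, liftVec_one, liftVec_two]
  fun_prop

theorem contDiffAt_ballMap {P : SL3} (hP : P ∈ hermGroup) {w : ℂ × ℂ} (hw : w ∈ modelSphere) :
    ∀ᶠ y in 𝓝 w, ContDiffAt ℝ ∞ (ballMap P) y := by
  have h0 := contDiff_smul_liftVec P 0
  have h1 := contDiff_smul_liftVec P 1
  have h2 := contDiff_smul_liftVec P 2
  filter_upwards [(h0.sub h2).continuous.continuousAt.eventually_ne
    (smul_liftVec_sub_ne_zero hP hw)] with y hy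
  exact (contDiffAt_const.mul (contDiffAt_cdiv (contDiffAt_const.mul h1.contDiffAt)
    (h0.sub h2).contDiffAt hy)).prodMk
    (contDiffAt_const.mul (contDiffAt_cdiv (h0.add h2).contDiffAt (h0.sub h2).contDiffAt hy))

theorem contDiff_smul_pair (a : ℂ) : ContDiff ℝ ∞ fun w : ℂ × ℂ => a • w :=
  (contDiff_const.mul contDiff_fst).prodMk (contDiff_const.mul contDiff_snd)

theorem ballChart_image (P : SL3) (X : Set (ℂ × ℂ)) :
    ballChart '' (toBoundary P '' X) = (fun w => -Complex.I • ballMap P w) '' X := by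
  rw [Set.image_image]
  exact Set.image_congr fun w _ => ballChart_toBoundary P w

theorem I_smul_neg_I_smul (w : ℂ × ℂ) : Complex.I • -Complex.I • w = w := by
  rw [smul_smul, mul_neg, Complex.I_mul_I, neg_neg, one_smul]

theorem contDiffAt_chart {P : SL3} (hP : P ∈ hermGroup) {w : ℂ × ℂ} (hw : w ∈ modelSphere) :
    ∀ᶠ y in 𝓝 w, ContDiffAt ℝ ∞ (fun w => -Complex.I • ballMap P w) y := by
  filter_upwards [contDiffAt_ballMap hP hw] with y hy
  exact (contDiff_smul_pair _).contDiffAt.comp y hy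

theorem contDiffAt_chart_inv {P : SL3} (hP : P ∈ hermGroup) {w : ℂ × ℂ} (hw : w ∈ modelSphere) :
    ∀ᶠ y in 𝓝 (-Complex.I • ballMap P w),
      ContDiffAt ℝ ∞ (fun b : ℂ × ℂ => ballMap P⁻¹ (Complex.I • b)) y := by
  have hc := contDiff_smul_pair Complex.I
  have h1 := contDiffAt_ballMap (inv_mem hP) (ballMap_mem hP hw)
  rw [← I_smul_neg_I_smul (ballMap P w)] at h1
  filter_upwards [hc.continuous.continuousAt.eventually h1] with y hy
  exact ContDiffAt.comp (g := ballMap P⁻¹) (f := fun b => Complex.I • b) y hy hc.contDiffAt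

theorem leftInvOn_chart {P : SL3} (hP : P ∈ hermGroup) :
    Set.LeftInvOn (fun b : ℂ × ℂ => ballMap P⁻¹ (Complex.I • b))
      (fun w => -Complex.I • ballMap P w) modelSphere := by
  intro w hw
  simp only [I_smul_neg_I_smul, ballMap_inv_ballMap hP hw]

theorem areDiffeomorphic_ballChart_image {P : SL3} (hP : P ∈ hermGroup) {X : Set (ℂ × ℂ)}
    (hX : X ⊆ modelSphere) : AreDiffeomorphic X (ballChart '' (toBoundary P '' X)) := by
  rw [ballChart_image]
  refine AreDiffeomorphic.image hX (SmoothOnSubset.of_contDiffAt fun w hw => contDiffAt_chart hP hw)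
    (SmoothOnSubset.of_contDiffAt ?_) (leftInvOn_chart hP)
  rintro _ ⟨w, hw, rfl⟩
  exact contDiffAt_chart_inv hP hw

theorem tangentConeAt_ballChart_image {P : SL3} (hP : P ∈ hermGroup) {X : Set (ℂ × ℂ)}
    (hX : X ⊆ modelSphere) {w : ℂ × ℂ} (hw : w ∈ X) :
    tangentConeAt ℝ (ballChart '' (toBoundary P '' X)) (ballChart (toBoundary P w)) =
      fderiv ℝ (fun w => -Complex.I • ballMap P w) w '' tangentConeAt ℝ X w := by
  rw [ballChart_image, ballChart_toBoundary]
  have h1 := (contDiffAt_chart hP (hX hw)).self_of_nhds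
  have h2 := (contDiffAt_chart_inv hP (hX hw)).self_of_nhds
  exact tangentConeAt_image (f := fun w => -Complex.I • ballMap P w) hw
    (h1.differentiableAt (by simp)) (h2.differentiableAt (by simp)) ((leftInvOn_chart hP).mono hX)

theorem tangentAt_toBoundary {P : SL3} (hP : P ∈ hermGroup) {X X' : Set (ℂ × ℂ)}
    (hX : X ⊆ modelSphere) (hX' : X' ⊆ modelSphere) {w : ℂ × ℂ} (hw : w ∈ X) (hw' : w ∈ X')
    (h : tangentConeAt ℝ X w = tangentConeAt ℝ X' w) :
    TangentAt (toBoundary P '' X) (toBoundary P '' X') (toBoundary P w) := by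
  rw [TangentAt, tangentConeAt_ballChart_image hP hX hw, tangentConeAt_ballChart_image hP hX' hw', h]

end Chart

end FordFaces

namespace FordFaces

/-! ### Identification with the model -/

section Identification

theorem herm_neg_right (z w : Fin 3 → ℂ) : herm z (-w) = -herm z w := by
  simp only [herm, Pi.neg_apply]
  ring

theorem eI_double (α : ℝ) : 2 * eI α + eI (-α) = (⟨3 * Real.cos α, Real.sin α⟩ : ℂ) := by
  apply Complex.ext <;>
    simp only [Complex.add_re, Complex.add_im, Complex.mul_re, Complex.mul_im, Complex.re_ofNat,
      Complex.im_ofNat, eI_re, eI_im, Real.cos_neg, Real.sin_neg] <;> ring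

theorem normSq_eI (α : ℝ) : Complex.normSq (eI α) = 1 := by
  rw [Complex.normSq_eq_norm_sq, norm_eI, one_pow]

/-- Up to the unimodular factor `e^{iα}`, the pairing is the conjugate of `2cu + (2s - v)`. For `pV`
it is, up to `-e^{iα}`, that of `2cu - (2s - v)`, so equality of the moduli is orthogonality of `u`
and `2s - v`. -/
theorem norm_herm_pU (α : ℝ) (w : ℂ × ℂ) : ‖herm (liftVec w) (pU α)‖ ^ 2 =
    (2 * Real.cos α * w.2.re + (2 * Real.sin α - w.1.re)) ^ 2 +
      (2 * Real.cos α * w.2.im - w.1.im) ^ 2 := by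
  have h : herm (liftVec w) (pU α) = eI α * ⟨2 * Real.cos α * w.2.re + (2 * Real.sin α - w.1.re),
      -(2 * Real.cos α * w.2.im - w.1.im)⟩ := by
    have e1 : (⟨2 * Real.cos α * w.2.re + (2 * Real.sin α - w.1.re),
      -(2 * Real.cos α * w.2.im - w.1.im)⟩ : ℂ) =
        2 * (Real.cos α : ℂ) * star w.2 + 2 * (Real.sin α : ℂ) - star w.1 := by
      apply Complex.ext <;> simp [-Complex.ofReal_cos, -Complex.ofReal_sin]
      · ring
      · ring
    rw [e1, cos_eq_eI, sin_eq_eI]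
    have h1 := sqrtTwo_sq
    have h2 := eI_mul_eI_neg α
    simp only [herm, liftVec_zero, liftVec_one, liftVec_two, pU, Matrix.cons_val_zero,
      Matrix.cons_val_one, Matrix.cons_val, star_add, star_sub, star_mul', star_sqrtTwo,
      Complex.star_def, Complex.conj_I]
    linear_combination (-starRingEnd ℂ w.1 * eI α / 2) * h1 - (starRingEnd ℂ w.2 + Complex.I) * h2
  rw [← Complex.normSq_eq_norm_sq, h, map_mul, normSq_eI, one_mul, Complex.normSq_mk]
  ring

theorem norm_herm_pV (α : ℝ) (w : ℂ × ℂ) : ‖herm (liftVec w) (pV α)‖ ^ 2 =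
    (2 * Real.cos α * w.2.re - (2 * Real.sin α - w.1.re)) ^ 2 +
      (2 * Real.cos α * w.2.im + w.1.im) ^ 2 := by
  have h : herm (liftVec w) (pV α) = -eI α * ⟨2 * Real.cos α * w.2.re - (2 * Real.sin α - w.1.re),
      -(2 * Real.cos α * w.2.im + w.1.im)⟩ := by
    have e1 : (⟨2 * Real.cos α * w.2.re - (2 * Real.sin α - w.1.re),
      -(2 * Real.cos α * w.2.im + w.1.im)⟩ : ℂ) =
        2 * (Real.cos α : ℂ) * star w.2 - 2 * (Real.sin α : ℂ) + star w.1 := by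
      apply Complex.ext <;> simp [-Complex.ofReal_cos, -Complex.ofReal_sin]
      · ring
      · ring
    rw [e1, cos_eq_eI, sin_eq_eI]
    have h1 := sqrtTwo_sq
    have h2 := eI_mul_eI_neg α
    simp only [herm, liftVec_zero, liftVec_one, liftVec_two, pV, Matrix.cons_val_zero,
      Matrix.cons_val_one, Matrix.cons_val, star_add, star_sub, star_mul', star_sqrtTwo,
      Complex.star_def, Complex.conj_I]
    linear_combination (-starRingEnd ℂ w.1 * eI α / 2) * h1 + (starRingEnd ℂ w.2 - Complex.I) * h2
  rw [← Complex.normSq_eq_norm_sq, h, map_mul, Complex.normSq_neg, normSq_eI, one_mul,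
    Complex.normSq_mk]
  ring

theorem norm_herm_pW (α : ℝ) (w : ℂ × ℂ) : ‖herm (liftVec w) (pW α)‖ ^ 2 =
    (3 * Real.cos α * w.1.re + Real.sin α * w.1.im) ^ 2 +
      (-2 + Real.sin α * w.1.re - 3 * Real.cos α * w.1.im) ^ 2 := by
  have h : herm (liftVec w) (pW α) = eI α * eI α * ⟨3 * Real.cos α * w.1.re + Real.sin α * w.1.im,
      -2 + Real.sin α * w.1.re - 3 * Real.cos α * w.1.im⟩ := by
    have e1 : (⟨3 * Real.cos α * w.1.re + Real.sin α * w.1.im,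
      -2 + Real.sin α * w.1.re - 3 * Real.cos α * w.1.im⟩ : ℂ) =
        -2 * Complex.I + star w.1 * (2 * eI α + eI (-α)) := by
      rw [eI_double]
      apply Complex.ext <;> simp <;> ring
    rw [e1]
    have h1 := sqrtTwo_sq
    have h2 := eI_mul_eI_neg α
    simp only [herm, liftVec_zero, liftVec_one, liftVec_two, pW, Matrix.cons_val_zero,
      Matrix.cons_val_one, Matrix.cons_val, star_add, star_sub, star_mul', star_sqrtTwo,
      Complex.star_def, Complex.conj_I]
    linear_combination (starRingEnd ℂ w.1 * (eI α ^ 3 + eI α / 2)) * h1 -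
      (starRingEnd ℂ w.1 * eI α) * h2
  rw [← Complex.normSq_eq_norm_sq, h, map_mul, map_mul, normSq_eI, one_mul, one_mul,
    Complex.normSq_mk]
  ring

theorem norm_herm_pW' (α : ℝ) (w : ℂ × ℂ) : ‖herm (liftVec w) (pW' α)‖ ^ 2 =
    (3 * Real.cos α * w.1.re - Real.sin α * w.1.im) ^ 2 +
      (2 - Real.sin α * w.1.re - 3 * Real.cos α * w.1.im) ^ 2 := by
  have h : herm (liftVec w) (pW' α) = ⟨3 * Real.cos α * w.1.re - Real.sin α * w.1.im,
      2 - Real.sin α * w.1.re - 3 * Real.cos α * w.1.im⟩ := by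
    have e1 : (⟨3 * Real.cos α * w.1.re - Real.sin α * w.1.im,
      2 - Real.sin α * w.1.re - 3 * Real.cos α * w.1.im⟩ : ℂ) =
        2 * Complex.I + star w.1 * (2 * eI (-α) + eI α) := by
      have := eI_double (-α)
      rw [neg_neg] at this
      rw [this, Real.cos_neg, Real.sin_neg]
      apply Complex.ext <;> simp <;> ring
    rw [e1]
    have h1 := sqrtTwo_sq
    simp only [herm, liftVec_zero, liftVec_one, liftVec_two, pW', Matrix.cons_val_zero,
      Matrix.cons_val_one, Matrix.cons_val, star_add, star_sub, star_mul', star_sqrtTwo,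
      Complex.star_def, Complex.conj_I]
    linear_combination (starRingEnd ℂ w.1 * (eI (-α) + eI α / 2)) * h1
  rw [← Complex.normSq_eq_norm_sq, h, Complex.normSq_mk]
  ring

theorem norm_le_iff_sub {a b d : ℝ} (ha : 0 ≤ a) (hb : 0 ≤ b) (h : a ^ 2 - b ^ 2 = d) :
    a ≤ b ↔ d ≤ 0 := by
  rw [← sq_le_sq₀ ha hb, ← h, sub_nonpos]

theorem norm_eq_iff_sub {a b d : ℝ} (ha : 0 ≤ a) (hb : 0 ≤ b) (h : a ^ 2 - b ^ 2 = d) :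
    a = b ↔ d = 0 := by
  rw [← sq_eq_sq₀ ha hb, ← h, sub_eq_zero]

variable {α : ℝ}

theorem norm_herm_pU_eq_pV_iff (hc : 0 < Real.cos α) {w : ℂ × ℂ} :
    ‖herm (liftVec w) (pU α)‖ = ‖herm (liftVec w) (pV α)‖ ↔
      w.2.re * (2 * Real.sin α - w.1.re) - w.2.im * w.1.im = 0 := by
  rw [norm_eq_iff_sub (d := 8 * Real.cos α *
    (w.2.re * (2 * Real.sin α - w.1.re) - w.2.im * w.1.im)) (norm_nonneg _) (norm_nonneg _)]
  · simp [hc.ne', -mul_eq_zero, mul_eq_zero_iff_left]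
  · rw [norm_herm_pU, norm_herm_pV]
    ring

/-- On the surface `|2cu + (2s - v)|²` equals `4c²(1 - |v|²) + |2s - v|²`: orthogonality removes the
cross term and the sphere equation removes `|u|²`. The pairing with `pW` does not involve `u` at
all. -/
theorem norm_herm_pU_sub_pW {w : ℂ × ℂ} (hw : w ∈ modelSpinal (Real.sin α)) :
    ‖herm (liftVec w) (pU α)‖ ^ 2 - ‖herm (liftVec w) (pW α)‖ ^ 2 =
      12 * Real.cos α * (-w.1.im - Real.cos α * Complex.normSq w.1) := by
  have h1 : Complex.normSq w.1 + Complex.normSq w.2 = 1 := hw.1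
  have h2 := hw.2
  rw [norm_herm_pU, norm_herm_pW, Complex.normSq_apply]
  rw [Complex.normSq_apply, Complex.normSq_apply] at h1
  have h3 := Real.sin_sq_add_cos_sq α
  generalize Real.sin α = s at *
  generalize Real.cos α = c at *
  linear_combination 4 * c * h2 + 4 * c ^ 2 * h1 +
    (4 - (w.1.re ^ 2 + w.1.im ^ 2)) * h3

theorem norm_herm_pU_sub_pW' {w : ℂ × ℂ} (hw : w ∈ modelSpinal (Real.sin α)) :
    ‖herm (liftVec w) (pU α)‖ ^ 2 - ‖herm (liftVec w) (pW' α)‖ ^ 2 =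
      12 * Real.cos α * (w.1.im - Real.cos α * Complex.normSq w.1) := by
  have h1 : Complex.normSq w.1 + Complex.normSq w.2 = 1 := hw.1
  have h2 := hw.2
  rw [norm_herm_pU, norm_herm_pW', Complex.normSq_apply]
  rw [Complex.normSq_apply, Complex.normSq_apply] at h1
  have h3 := Real.sin_sq_add_cos_sq α
  generalize Real.sin α = s at *
  generalize Real.cos α = c at *
  linear_combination 4 * c * h2 + 4 * c ^ 2 * h1 +
    (4 - (w.1.re ^ 2 + w.1.im ^ 2)) * h3

theorem boundaryH2C_subset : boundaryH2C ⊆ closedH2C := fun x hx => by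
  have h : herm x.rep x.rep = 0 := hx
  change (herm x.rep x.rep).re ≤ 0
  rw [h]
  exact le_rfl

/-- The isometry which identifies the model with the spinal surface. -/
noncomputable def frame (α : ℝ) : Sgn → ℤ → SL3
  | .plus, k => U α ^ k
  | .minus, k => U α ^ k * T α

theorem frame_mem (α : ℝ) (s : Sgn) (k : ℤ) : frame α s k ∈ hermGroup := by
  cases s
  · exact U_zpow_mem_hermGroup α k
  · exact mul_mem (U_zpow_mem_hermGroup α k) (T_mem_hermGroup α)

/-- `q` corresponds to `q₀` in the frame `P`. -/
def Corresponds (P : SL3) (q q₀ : Fin 3 → ℂ) : Prop := q = P • q₀ ∨ q = -(P • q₀)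

theorem Corresponds.norm_herm {P : SL3} (hP : P ∈ hermGroup) {q q₀ : Fin 3 → ℂ}
    (h : Corresponds P q q₀) (z : Fin 3 → ℂ) : ‖herm (P • z) q‖ = ‖herm z q₀‖ := by
  rcases h with rfl | rfl
  · rw [herm_smul hP]
  · rw [herm_neg_right, norm_neg, herm_smul hP]

theorem corresponds_pU (α : ℝ) (s : Sgn) (k : ℤ) : Corresponds (frame α s k) (pU α) (pU α) := by
  cases s
  · exact Or.inl (U_zpow_smul_pU α k).symm
  · right
    rw [frame, mul_smul, T_smul_pU, smul_neg, U_zpow_smul_pU, neg_neg]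

/-- The vectors which define the three bisectors. -/
noncomputable def vec₁ (α : ℝ) : Sgn → ℤ → Fin 3 → ℂ
  | .plus, k => Upow α k (pV α)
  | .minus, k => Upow α k (pW α)

noncomputable def vec₂ (α : ℝ) : Sgn → ℤ → Fin 3 → ℂ
  | .plus, k => Upow α k (pW α)
  | .minus, k => Upow α k (pV α)

noncomputable def vec₃ (α : ℝ) : Sgn → ℤ → Fin 3 → ℂ
  | .plus, k => Upow α (k - 1) (pW α)
  | .minus, k => Upow α (k + 1) (pV α)

theorem corresponds_vec₁ (α : ℝ) (s : Sgn) (k : ℤ) : Corresponds (frame α s k) (vec₁ α s k) (pV α) := by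
  cases s
  · exact Or.inl (Upow_eq α k _)
  · right
    rw [frame, mul_smul, T_smul_pV, smul_neg, neg_neg]
    exact Upow_eq α k _

theorem corresponds_vec₂ (α : ℝ) (s : Sgn) (k : ℤ) : Corresponds (frame α s k) (vec₂ α s k) (pW α) := by
  cases s
  · exact Or.inl (Upow_eq α k _)
  · right
    rw [frame, mul_smul, T_smul_pW, smul_neg, neg_neg]
    exact Upow_eq α k _

theorem corresponds_vec₃ (α : ℝ) (s : Sgn) (k : ℤ) :
    Corresponds (frame α s k) (vec₃ α s k) (pW' α) := by
  cases s
  · left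
    rw [frame, vec₃, Upow_eq, ← U_smul_pW', smul_smul, ← zpow_add_one, sub_add_cancel]
  · right
    rw [frame, mul_smul, T_smul_pW', smul_neg, neg_neg, smul_smul, ← zpow_add_one]
    exact Upow_eq α (k + 1) _

/-- One factor `t` serves all vectors at once, so equalities and inequalities between moduli can be
tested on the explicit lift. The sign in `Corresponds` is invisible to moduli. -/
theorem norm_herm_rep {P : SL3} (hP : P ∈ hermGroup) (w : ℂ × ℂ) : ∃ t : ℝ, 0 < t ∧
    ∀ q q₀, Corresponds P q q₀ → ‖herm (toBoundary P w).rep q‖ = t * ‖herm (liftVec w) q₀‖ := by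
  obtain ⟨a, ha, h⟩ := exists_rep P w
  refine ⟨‖a‖, norm_pos_iff.2 ha, fun q q₀ hq => ?_⟩
  rw [h, herm_smul_left, norm_mul, norm_star, hq.norm_herm hP]

theorem toBoundary_mem_extor_iff {P : SL3} (hP : P ∈ hermGroup) (w : ℂ × ℂ)
    {q q₀ q' q₀' : Fin 3 → ℂ} (h : Corresponds P q q₀) (h' : Corresponds P q' q₀') :
    toBoundary P w ∈ extor q q' ↔ ‖herm (liftVec w) q₀‖ = ‖herm (liftVec w) q₀'‖ := by
  obtain ⟨t, ht, h1⟩ := norm_herm_rep hP w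
  change ‖_‖ = ‖_‖ ↔ _
  rw [h1 _ _ h, h1 _ _ h', mul_right_inj' ht.ne']

theorem eq_image_of_iff {P : SL3} (hP : P ∈ hermGroup) {X : Set CP2} {Y : Set (ℂ × ℂ)}
    (hX : X ⊆ boundaryH2C) (hY : Y ⊆ modelSphere)
    (h : ∀ w ∈ modelSphere, toBoundary P w ∈ X ↔ w ∈ Y) : X = toBoundary P '' Y := by
  ext x
  constructor
  · intro hx
    obtain ⟨w, hw, rfl⟩ := exists_toBoundary hP (hX hx)
    exact ⟨w, (h w hw).1 hx, rfl⟩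
  · rintro ⟨w, hw, rfl⟩
    exact (h w (hY hw)).2 hw

theorem spinal_eq_inter (α : ℝ) (s : Sgn) (k : ℤ) :
    spinal α s k = extor (pU α) (vec₁ α s k) ∩ boundaryH2C := by
  have : spinal α s k = bisector (pU α) (vec₁ α s k) ∩ boundaryH2C := by cases s <;> rfl
  rw [this, bisector, Set.inter_assoc, Set.inter_eq_right.2 boundaryH2C_subset]

theorem circle₁_eq_inter (α : ℝ) (s : Sgn) (k : ℤ) :
    circle₁ α s k = spinal α s k ∩ extor (pU α) (vec₂ α s k) := by
  have : circle₁ α s k = spinal α s k ∩ (bisector (pU α) (vec₂ α s k) ∩ boundaryH2C) := by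
    cases s <;> rfl
  rw [this, bisector, Set.inter_assoc (extor _ _), Set.inter_eq_right.2 boundaryH2C_subset]
  ext x
  exact ⟨fun h => ⟨h.1, h.2.1⟩, fun h => ⟨h.1, h.2, h.1.2⟩⟩

theorem circle₂_eq_inter (α : ℝ) (s : Sgn) (k : ℤ) :
    circle₂ α s k = spinal α s k ∩ extor (pU α) (vec₃ α s k) := by
  have : circle₂ α s k = spinal α s k ∩ (bisector (pU α) (vec₃ α s k) ∩ boundaryH2C) := by
    cases s <;> rfl
  rw [this, bisector, Set.inter_assoc (extor _ _), Set.inter_eq_right.2 boundaryH2C_subset]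
  ext x
  exact ⟨fun h => ⟨h.1, h.2.1⟩, fun h => ⟨h.1, h.2, h.1.2⟩⟩

theorem faceInfinity_eq_inter (α : ℝ) (s : Sgn) (k : ℤ) :
    faceInfinity α s k = spinal α s k ∩ {x | ‖herm x.rep (pU α)‖ ≤
      min ‖herm x.rep (vec₂ α s k)‖ ‖herm x.rep (vec₃ α s k)‖} := by
  ext x
  cases s <;> exact ⟨fun h => ⟨⟨h.1.1, h.2⟩, h.1.2⟩, fun h => ⟨⟨h.1.1, h.2⟩, h.1.2⟩⟩

theorem toBoundary_mem_spinal_iff (hc : 0 < Real.cos α) (s : Sgn) (k : ℤ) {w : ℂ × ℂ} :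
    toBoundary (frame α s k) w ∈ spinal α s k ↔ w ∈ modelSpinal (Real.sin α) := by
  have hP := frame_mem α s k
  rw [spinal_eq_inter, Set.mem_inter_iff, toBoundary_mem_iff hP,
    toBoundary_mem_extor_iff hP w (corresponds_pU α s k) (corresponds_vec₁ α s k),
    norm_herm_pU_eq_pV_iff hc]
  exact ⟨fun h => ⟨h.2, h.1⟩, fun h => ⟨h.2, h.1⟩⟩

theorem spinal_eq_image (hc : 0 < Real.cos α) (s : Sgn) (k : ℤ) :
    spinal α s k = toBoundary (frame α s k) '' modelSpinal (Real.sin α) :=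
  eq_image_of_iff (frame_mem α s k) Set.inter_subset_right (modelSpinal_subset _)
    fun _ _ => toBoundary_mem_spinal_iff hc s k

theorem circle₁_eq_image (hc : 0 < Real.cos α) (s : Sgn) (k : ℤ) :
    circle₁ α s k = toBoundary (frame α s k) '' modelCircle₁ (Real.sin α) (Real.cos α) := by
  have hP := frame_mem α s k
  refine eq_image_of_iff hP ?_ (fun w hw => hw.1.1) fun w hw => ?_
  · rw [circle₁_eq_inter]
    exact fun x hx => hx.1.2
  · rw [circle₁_eq_inter, Set.mem_inter_iff, toBoundary_mem_spinal_iff hc s k,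
      toBoundary_mem_extor_iff hP w (corresponds_pU α s k) (corresponds_vec₂ α s k)]
    refine and_congr_right fun hS => ?_
    rw [norm_eq_iff_sub (norm_nonneg _) (norm_nonneg _) (norm_herm_pU_sub_pW hS), mul_eq_zero,
      or_iff_right (by positivity), sub_eq_zero]

theorem circle₂_eq_image (hc : 0 < Real.cos α) (s : Sgn) (k : ℤ) :
    circle₂ α s k = toBoundary (frame α s k) '' modelCircle₂ (Real.sin α) (Real.cos α) := by
  have hP := frame_mem α s k
  refine eq_image_of_iff hP ?_ (fun w hw => hw.1.1) fun w hw => ?_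
  · rw [circle₂_eq_inter]
    exact fun x hx => hx.1.2
  · rw [circle₂_eq_inter, Set.mem_inter_iff, toBoundary_mem_spinal_iff hc s k,
      toBoundary_mem_extor_iff hP w (corresponds_pU α s k) (corresponds_vec₃ α s k)]
    refine and_congr_right fun hS => ?_
    rw [norm_eq_iff_sub (norm_nonneg _) (norm_nonneg _) (norm_herm_pU_sub_pW' hS), mul_eq_zero,
      or_iff_right (by positivity), sub_eq_zero]

/-- The two inequalities defining the face read `-Im v ≤ c|v|²` and `Im v ≤ c|v|²`; the sign of `Re
v` then sorts the points into the two pieces. -/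
theorem faceInfinity_eq_image (hc : 0 < Real.cos α) (s : Sgn) (k : ℤ) :
    faceInfinity α s k = toBoundary (frame α s k) ''
      (modelClosedPiece (-1) (Real.sin α) (Real.cos α) ∪
        modelClosedPiece 1 (Real.sin α) (Real.cos α)) := by
  have hP := frame_mem α s k
  refine eq_image_of_iff hP ?_ ?_ fun w hw => ?_
  · rw [faceInfinity_eq_inter]
    exact fun x hx => hx.1.2
  · rintro w (hw | hw) <;> exact hw.1.1
  · have h1 : w ∈ modelClosedPiece (-1) (Real.sin α) (Real.cos α) ∪
        modelClosedPiece 1 (Real.sin α) (Real.cos α) ↔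
        w ∈ modelSpinal (Real.sin α) ∧ |w.1.im| ≤ Real.cos α * Complex.normSq w.1 := by
      constructor
      · rintro (h | h) <;> exact ⟨h.1, h.2.1⟩
      · intro h
        rcases le_total 0 w.1.re with h0 | h0
        · exact Or.inr ⟨h.1, h.2, by linarith⟩
        · exact Or.inl ⟨h.1, h.2, by linarith⟩
    rw [h1, faceInfinity_eq_inter, Set.mem_inter_iff, toBoundary_mem_spinal_iff hc s k]
    refine and_congr_right fun hS => ?_
    obtain ⟨t, ht, h2⟩ := norm_herm_rep hP w
    rw [Set.mem_ofPred_eq, h2 _ _ (corresponds_pU α s k), h2 _ _ (corresponds_vec₂ α s k),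
      h2 _ _ (corresponds_vec₃ α s k), le_min_iff, mul_le_mul_iff_right₀ ht,
      mul_le_mul_iff_right₀ ht,
      norm_le_iff_sub (norm_nonneg _) (norm_nonneg _) (norm_herm_pU_sub_pW hS),
      norm_le_iff_sub (norm_nonneg _) (norm_nonneg _) (norm_herm_pU_sub_pW' hS), abs_le]
    have h12 : 0 < 12 * Real.cos α := by positivity
    have key : ∀ d, 12 * Real.cos α * d ≤ 0 ↔ d ≤ 0 := fun d =>
      ⟨fun h => nonpos_of_mul_nonpos_right h h12,
        fun h => mul_nonpos_of_nonneg_of_nonpos h12.le h⟩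
    rw [key, key]
    constructor <;> rintro ⟨a1, a2⟩ <;> constructor <;> linarith

theorem smul_mk_eq (P Q : SL3) {v v' : Fin 3 → ℂ} (hv : v ≠ 0) (hv' : v' ≠ 0) (a : ℂ)
    (h : a • Q • v' = P • v) :
    P • Projectivization.mk ℂ v hv = Q • Projectivization.mk ℂ v' hv' := by
  rw [Projectivization.smul_mk, Projectivization.smul_mk, Projectivization.mk_eq_mk_iff']
  exact ⟨a, h⟩

theorem liftVec_modelA : liftVec modelA = (2 * Complex.I) • pA := by
  apply vec_ext <;> simp [modelA, pA]
  ring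

theorem liftVec_modelB : liftVec modelB = (-2 * Complex.I) • pB := by
  apply vec_ext <;> simp [modelB, pB]
  ring

theorem liftVec_modelVertex₁ (α : ℝ) :
    liftVec (modelVertex₁ (Real.sin α) (Real.cos α)) = Complex.I • pA' α := by
  have e : (⟨Real.sin α, -Real.cos α⟩ : ℂ) = -Complex.I * eI α := by
    apply Complex.ext <;> simp [eI_re, eI_im]
  apply vec_ext <;> simp [modelVertex₁, pA']
  rw [e]
  ring

theorem liftVec_modelVertex₂ (α : ℝ) :
    liftVec (modelVertex₂ (Real.sin α) (Real.cos α)) = (-Complex.I) • pB' α := by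
  have e : (⟨Real.sin α, Real.cos α⟩ : ℂ) = Complex.I * eI (-α) := by
    apply Complex.ext <;> simp [eI_re, eI_im]
  apply vec_ext <;> simp [modelVertex₂, pB']
  rw [e]
  ring

theorem vertexA_eq (α : ℝ) (s : Sgn) (k : ℤ) :
    vertexA α s k = toBoundary (frame α s k) modelA := by
  cases s
  · refine (smul_mk_eq _ _ _ _ (2 * Complex.I) ?_).symm
    rw [liftVec_modelA, frame, smul_smul_vec]
  · refine (smul_mk_eq _ _ _ _ (-2 * Complex.I) ?_).symm
    rw [liftVec_modelA, frame, smul_smul_vec, mul_smul (U α ^ k) (T α), T_smul_pA, zpow_add_one, mul_smul (U α ^ k) (U α), smul_neg,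
      smul_neg, neg_mul, neg_smul]

theorem vertexB_eq (α : ℝ) (s : Sgn) (k : ℤ) :
    vertexB α s k = toBoundary (frame α s k) modelB := by
  cases s
  · refine (smul_mk_eq _ _ _ _ (-2 * Complex.I) ?_).symm
    rw [liftVec_modelB, frame, smul_smul_vec]
  · refine (smul_mk_eq _ _ _ _ (2 * Complex.I) ?_).symm
    rw [liftVec_modelB, frame, smul_smul_vec, mul_smul (U α ^ k) (T α), T_smul_pB, smul_neg, smul_neg, neg_mul,
      neg_smul, neg_neg]

theorem vertex₁_eq (α : ℝ) (s : Sgn) (k : ℤ) : vertex₁ α s k =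
    toBoundary (frame α s k) (modelVertex₁ (Real.sin α) (Real.cos α)) := by
  cases s
  · refine (smul_mk_eq _ _ _ _ Complex.I ?_).symm
    rw [liftVec_modelVertex₁, frame, smul_smul_vec, zpow_add_one, mul_smul, U_smul_pA]
  · refine (smul_mk_eq _ _ _ _ (-Complex.I) ?_).symm
    rw [liftVec_modelVertex₁, frame, smul_smul_vec, mul_smul (U α ^ k) (T α), T_smul_pA', smul_neg, smul_neg,
      neg_smul]

theorem vertex₂_eq (α : ℝ) (s : Sgn) (k : ℤ) : vertex₂ α s k =
    toBoundary (frame α s k) (modelVertex₂ (Real.sin α) (Real.cos α)) := by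
  cases s
  · refine (smul_mk_eq _ _ _ _ (-Complex.I) ?_).symm
    rw [liftVec_modelVertex₂, frame, smul_smul_vec, ← U_smul_pB' α, smul_smul, ← zpow_add_one,
      sub_add_cancel]
  · refine (smul_mk_eq _ _ _ _ Complex.I ?_).symm
    rw [liftVec_modelVertex₂, frame, smul_smul_vec, mul_smul (U α ^ k) (T α), T_smul_pB', zpow_add_one,
      mul_smul (U α ^ k) (U α),      smul_neg, smul_neg, neg_smul, neg_neg]

end Identification

end FordFaces

namespace FordFaces

/-! ### Bigons and quadrilaterals in the model and in the boundary at infinity -/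

section Assembly

variable {s c : ℝ}

theorem modelCircles_inter_re_pos (hs : 0 < s) (hc : 0 < c) (hc1 : c < 1) :
    modelCircle₁ s c ∩ {w | 0 < w.1.re} ∪ modelCircle₂ s c ∩ {w | 0 < w.1.re} ∪
      {modelA, modelB} = modelBoundary 1 s c := by
  ext w
  have e : w ∈ modelCircle₁ s c ∩ {w | 0 < w.1.re} ∪ modelCircle₂ s c ∩ {w | 0 < w.1.re} ↔
      w ∈ modelCircle₁ s c ∪ modelCircle₂ s c ∧ 0 < w.1.re := by
    rw [← Set.union_inter_distrib_right]
    rfl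
  have e' : w ∈ modelBoundary 1 s c ↔ w ∈ modelCircle₁ s c ∪ modelCircle₂ s c ∧ 0 ≤ 1 * w.1.re :=
    Iff.rfl
  rw [Set.mem_union, e, e', one_mul, ← modelCircle₁_inter_modelCircle₂ hs hc]
  constructor
  · rintro (⟨h1, h2⟩ | h)
    · exact ⟨h1, h2.le⟩
    · refine ⟨Or.inl h.1, ?_⟩
      rw [modelCircle₁_inter_modelCircle₂ hs hc] at h
      rcases h with rfl | rfl <;> simp [modelA, modelB]
  · rintro ⟨h1, h2⟩
    by_cases h0 : w.1 = 0
    · obtain ⟨h3, -⟩ := (mem_circles_iff hc).1 h1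
      right
      rw [modelCircle₁_inter_modelCircle₂ hs hc]
      exact (fst_eq_zero_iff hs h3).1 h0
    · obtain ⟨h3, h4⟩ := (mem_circles_iff hc).1 h1
      exact Or.inl ⟨h1, h2.lt_of_ne' (re_ne_zero_of_abs_im_le hc1 h3.1 h4.le h0)⟩

theorem modelCircles_diff_re_pos (s c : ℝ) :
    modelCircle₁ s c \ (modelCircle₁ s c ∩ {w | 0 < w.1.re}) ∪
      modelCircle₂ s c \ (modelCircle₂ s c ∩ {w | 0 < w.1.re}) = modelBoundary (-1) s c := by
  have e : {w : ℂ × ℂ | 0 < w.1.re}ᶜ = {w : ℂ × ℂ | 0 ≤ -1 * w.1.re} := by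
    ext w
    change ¬0 < w.1.re ↔ 0 ≤ -1 * w.1.re
    rw [not_lt]
    constructor <;> intro h <;> linarith
  rw [Set.sdiff_self_inter, Set.sdiff_self_inter, modelBoundary,
    Set.union_inter_distrib_right, ← e]
  rfl

/-- The points of the circles on the real locus `u = 0`. -/
theorem equator_mem {ε : ℝ} (hε : ε ^ 2 = 1) (hs : 0 < s) (h : s ^ 2 + c ^ 2 = 1) :
    ((⟨ε * s, -c⟩, 0) : ℂ × ℂ) ∈ modelBoundary ε s c ∧
      ((⟨ε * s, c⟩, 0) : ℂ × ℂ) ∈ modelBoundary ε s c := by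
  have n1 : Complex.normSq ⟨ε * s, -c⟩ = 1 := by
    rw [Complex.normSq_mk]; linear_combination h + s ^ 2 * hε
  have n2 : Complex.normSq ⟨ε * s, c⟩ = 1 := by
    rw [Complex.normSq_mk]; linear_combination h + s ^ 2 * hε
  have hr : 0 ≤ ε * (ε * s) := by
    rw [← mul_assoc, ← sq, hε, one_mul]; exact hs.le
  refine ⟨⟨Or.inl ⟨⟨?_, ?_⟩, ?_⟩, hr⟩, ⟨Or.inr ⟨⟨?_, ?_⟩, ?_⟩, hr⟩⟩
  · change Complex.normSq ⟨ε * s, -c⟩ + Complex.normSq 0 = 1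
    rw [n1]; simp
  · simp
  · change -(-c) = c * Complex.normSq ⟨ε * s, -c⟩
    rw [n1]; ring
  · change Complex.normSq ⟨ε * s, c⟩ + Complex.normSq 0 = 1
    rw [n2]; simp
  · simp
  · change c = c * Complex.normSq ⟨ε * s, c⟩
    rw [n2]; ring

theorem mem_modelSpinal_of_snd_eq_zero {v : ℂ} (s : ℝ) (h : Complex.normSq v = 1) :
    (v, (0 : ℂ)) ∈ modelSpinal s := by
  constructor
  · change Complex.normSq v + Complex.normSq 0 = 1
    rw [h]; simp
  · simp

theorem neg_I_mem_modelCap₁ (s : ℝ) (hc1 : c < 1) : (-Complex.I, 0) ∈ modelCap₁ s c :=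
  ⟨mem_modelSpinal_of_snd_eq_zero s (by simp), by simpa using hc1⟩

theorem I_mem_modelCap₂ (s : ℝ) (hc1 : c < 1) : (Complex.I, 0) ∈ modelCap₂ s c :=
  ⟨mem_modelSpinal_of_snd_eq_zero s (by simp), by simpa using hc1⟩

theorem real_mem_modelPiece {ε : ℝ} (hε : ε ^ 2 = 1) (s : ℝ) (hc : 0 < c) :
    ((ε : ℂ), 0) ∈ modelPiece ε s c := by
  have h1 : Complex.normSq (ε : ℂ) = 1 := by rw [Complex.normSq_ofReal, ← sq, hε]
  refine ⟨mem_modelSpinal_of_snd_eq_zero s h1, ?_, ?_⟩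
  · change |(ε : ℂ).im| < c * Complex.normSq (ε : ℂ)
    rw [h1]; simpa using hc
  · change 0 < ε * (ε : ℂ).re
    rw [Complex.ofReal_re, ← sq, hε]; exact one_pos

/-- The pieces of the model. -/
def modelPieces (s c : ℝ) : Set (Set (ℂ × ℂ)) :=
  {modelCap₁ s c, modelCap₂ s c, modelPiece (-1) s c, modelPiece 1 s c}

theorem ncard_modelPieces (hc : 0 < c) (hc1 : c < 1) : (modelPieces s c).ncard = 4 := by
  have h1 := neg_I_mem_modelCap₁ s hc1
  have h2 := I_mem_modelCap₂ s hc1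
  have h3 := real_mem_modelPiece (ε := -1) (by norm_num) s hc
  have d : ∀ ε : ℝ, ∀ w ∈ modelPiece ε s c, w ∉ modelCap₁ s c ∧ w ∉ modelCap₂ s c := by
    intro ε w hw
    have b1 := (abs_lt.1 hw.2.1)
    exact ⟨fun h => by linarith [h.2, b1.1], fun h => by linarith [h.2, b1.2]⟩
  have n1 : modelCap₁ s c ≠ modelCap₂ s c :=
    fun e => disjoint_modelCap₁_modelCap₂ hc h1 (e ▸ h1)
  have n2 : ∀ ε, modelCap₁ s c ≠ modelPiece ε s c := fun ε e => (d ε _ (e ▸ h1)).1 h1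
  have n3 : ∀ ε, modelCap₂ s c ≠ modelPiece ε s c := fun ε e => (d ε _ (e ▸ h2)).2 h2
  have n4 : modelPiece (-1) s c ≠ modelPiece 1 s c := by
    intro e
    have := (e ▸ h3 : _ ∈ modelPiece 1 s c).2.2
    simp at this
    linarith
  rw [modelPieces, Set.ncard_insert_of_notMem, Set.ncard_insert_of_notMem, Set.ncard_pair n4]
  · rintro (h | h)
    · exact n3 _ h
    · exact n3 _ h
  · rintro (h | h | h)
    · exact n1 h
    · exact n2 _ h
    · exact n2 _ h

/-- A piece is determined by its boundary. -/
theorem eq_modelPiece_of_boundary {ε : ℝ} (hε : ε ^ 2 = 1) (hs : 0 < s) (hc : 0 < c)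
    (h : s ^ 2 + c ^ 2 = 1) {R : Set (ℂ × ℂ)} (hR : R ∈ modelPieces s c)
    (hb : modelBoundary ε s c ⊆ closure R) : R = modelPiece ε s c := by
  obtain ⟨m1, m2⟩ := equator_mem (ε := ε) hε hs h
  have n : Complex.normSq ⟨ε * s, -c⟩ = 1 := by
    rw [Complex.normSq_mk]; linear_combination h + s ^ 2 * hε
  have n' : Complex.normSq ⟨ε * s, c⟩ = 1 := by
    rw [Complex.normSq_mk]; linear_combination h + s ^ 2 * hε
  -- The closure of a piece keeps its sign of `Re v`, so the boundary point with `Re v = εs`, `u =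
  -- 0` determines the sign.
  have key : ∀ ε', modelPiece ε' s c = R → 0 ≤ ε' * (ε * s) := by
    rintro ε' rfl
    have h1 : IsClosed {w : ℂ × ℂ | 0 ≤ ε' * w.1.re} := isClosed_le continuous_const (by fun_prop)
    exact closure_minimal (fun w hw => hw.2.2.le) h1 (hb m1)
  -- The caps are excluded because the prescribed boundary contains points with `|v| = 1` and `Im v
  -- = ±c`: the closure of either cap misses one of them.
  rcases hR with rfl | rfl | rfl | rfl
  · exfalso
    have h1 : IsClosed {w : ℂ × ℂ | c * Complex.normSq w.1 ≤ -w.1.im} :=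
      isClosed_le (by fun_prop) (by fun_prop)
    have h2 := closure_minimal (fun w hw => hw.2.le) h1 (hb m2)
    have h3 : c * Complex.normSq ⟨ε * s, c⟩ ≤ -c := h2
    rw [n'] at h3
    linarith
  · exfalso
    have h1 : IsClosed {w : ℂ × ℂ | c * Complex.normSq w.1 ≤ w.1.im} :=
      isClosed_le (by fun_prop) (by fun_prop)
    have h2 := closure_minimal (fun w hw => hw.2.le) h1 (hb m1)
    have h3 : c * Complex.normSq ⟨ε * s, -c⟩ ≤ -c := h2
    rw [n] at h3
    linarith
  · have h1 := key _ rfl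
    rcases sq_eq_sq_iff_eq_or_eq_neg.1 (hε.trans (one_pow 2).symm) with rfl | rfl
    · linarith
    · rfl
  · have h1 := key _ rfl
    rcases sq_eq_sq_iff_eq_or_eq_neg.1 (hε.trans (one_pow 2).symm) with rfl | rfl
    · rfl
    · linarith

variable {α : ℝ}

theorem toBoundary_injective (P : SL3) : Function.Injective (toBoundary P) :=
  Function.LeftInverse.injective (ofBoundary_toBoundary P)

theorem vertices_eq_image (α : ℝ) (s : Sgn) (k : ℤ) : {vertexA α s k, vertexB α s k} =
    toBoundary (frame α s k) '' {modelA, modelB} := by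
  rw [Set.image_pair, vertexA_eq, vertexB_eq]

theorem complement_eq_image (hc : 0 < Real.cos α) (s : Sgn) (k : ℤ) :
    spinal α s k \ (circle₁ α s k ∪ circle₂ α s k) =
      toBoundary (frame α s k) '' modelComplement (Real.sin α) (Real.cos α) := by
  rw [spinal_eq_image hc, circle₁_eq_image hc, circle₂_eq_image hc, ← Set.image_union,
    ← Set.image_sdiff (toBoundary_injective _)]
  rfl

theorem modelComplement_subset (s c : ℝ) : modelComplement s c ⊆ modelSphere := fun _ h => h.1.1

theorem pieces_eq_image (hs : 0 < Real.sin α) (hc : 0 < Real.cos α) (hc1 : Real.cos α < 1) (s : Sgn)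
    (k : ℤ) : pieces α s k =
      (Set.image (toBoundary (frame α s k))) '' modelPieces (Real.sin α) (Real.cos α) := by
  have E := embedsClosed_toBoundary (frame_mem α s k)
  have h1 : (-1 : ℝ) ^ 2 = 1 := by norm_num
  have h2 : (1 : ℝ) ^ 2 = 1 := by norm_num
  have comp : ∀ w ∈ modelComplement (Real.sin α) (Real.cos α),
      connectedComponentIn (spinal α s k \ (circle₁ α s k ∪ circle₂ α s k))
        (toBoundary (frame α s k) w) = toBoundary (frame α s k) ''
          connectedComponentIn (modelComplement (Real.sin α) (Real.cos α)) w := by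
    intro w hw
    rw [complement_eq_image hc, E.connectedComponentIn_image (modelComplement_subset _ _) hw]
  apply Set.Subset.antisymm
  · rintro _ ⟨x, hx, rfl⟩
    rw [complement_eq_image hc] at hx
    obtain ⟨w, hw, rfl⟩ := hx
    rw [comp w hw]
    refine ⟨_, ?_, rfl⟩
    rcases modelComplement_cases hc hc1 hw with h | h | h | h
    · rw [component_modelCap₁ hc hc1 h]; exact Or.inl rfl
    · rw [component_modelCap₂ hc hc1 h]; exact Or.inr (Or.inl rfl)
    · rw [component_modelPiece h1 hs hc hc1 h]; exact Or.inr (Or.inr (Or.inl rfl))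
    · rw [component_modelPiece h2 hs hc hc1 h]; exact Or.inr (Or.inr (Or.inr rfl))
  · rintro _ ⟨R, hR, rfl⟩
    obtain ⟨w, hw, hwR⟩ : ∃ w ∈ modelComplement (Real.sin α) (Real.cos α),
        connectedComponentIn (modelComplement (Real.sin α) (Real.cos α)) w = R := by
      rcases hR with rfl | rfl | rfl | rfl
      · have := neg_I_mem_modelCap₁ (Real.sin α) hc1
        exact ⟨_, modelCap₁_subset hc this, component_modelCap₁ hc hc1 this⟩
      · have := I_mem_modelCap₂ (Real.sin α) hc1
        exact ⟨_, modelCap₂_subset hc this, component_modelCap₂ hc hc1 this⟩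
      · have := real_mem_modelPiece h1 (Real.sin α) hc
        exact ⟨_, modelPiece_subset_complement _ hc this, component_modelPiece h1 hs hc hc1 this⟩
      · have := real_mem_modelPiece h2 (Real.sin α) hc
        exact ⟨_, modelPiece_subset_complement _ hc this, component_modelPiece h2 hs hc hc1 this⟩
    refine ⟨toBoundary (frame α s k) w, ?_, ?_⟩
    · rw [complement_eq_image hc]
      exact ⟨w, hw, rfl⟩
    · rw [comp w hw, hwR]

theorem notMem_vertices {w : ℂ × ℂ} (h : w.1.re ≠ 0) : w ∉ ({modelA, modelB} : Set (ℂ × ℂ)) := by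
  rintro (rfl | rfl) <;> exact h rfl

theorem arc₁_eq_image (hs : 0 < Real.sin α) (hc : 0 < Real.cos α) (s : Sgn) (k : ℤ) :
    arc (circle₁ α s k) (vertexA α s k) (vertexB α s k) (vertex₁ α s k) =
      toBoundary (frame α s k) '' (modelCircle₁ (Real.sin α) (Real.cos α) ∩ {w | 0 < w.1.re}) := by
  have h := Real.sin_sq_add_cos_sq α
  have E := embedsClosed_toBoundary (frame_mem α s k)
  rw [arc, vertices_eq_image, circle₁_eq_image hc, vertex₁_eq,
    ← Set.image_sdiff (toBoundary_injective _),
    E.connectedComponentIn_image (fun w hw => hw.1.1.1) ?_, modelArc₁ hs hc h]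
  exact ⟨modelVertex₁_mem h, notMem_vertices hs.ne'⟩

theorem arc₂_eq_image (hs : 0 < Real.sin α) (hc : 0 < Real.cos α) (s : Sgn) (k : ℤ) :
    arc (circle₂ α s k) (vertexA α s k) (vertexB α s k) (vertex₂ α s k) =
      toBoundary (frame α s k) '' (modelCircle₂ (Real.sin α) (Real.cos α) ∩ {w | 0 < w.1.re}) := by
  have h := Real.sin_sq_add_cos_sq α
  have E := embedsClosed_toBoundary (frame_mem α s k)
  rw [arc, vertices_eq_image, circle₂_eq_image hc, vertex₂_eq,
    ← Set.image_sdiff (toBoundary_injective _),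
    E.connectedComponentIn_image (fun w hw => hw.1.1.1) ?_, modelArc₂ hs hc h]
  exact ⟨modelVertex₂_mem h, notMem_vertices hs.ne'⟩

theorem quadBoundary_eq_image (hs : 0 < Real.sin α) (hc : 0 < Real.cos α) (hc1 : Real.cos α < 1)
    (s : Sgn) (k : ℤ) : quadBoundary α s k =
      toBoundary (frame α s k) '' modelBoundary 1 (Real.sin α) (Real.cos α) := by
  rw [quadBoundary, arc₁_eq_image hs hc, arc₂_eq_image hs hc, vertices_eq_image, ← Set.image_union,
    ← Set.image_union, modelCircles_inter_re_pos hs hc hc1]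

theorem bigonBoundary_eq_image (hs : 0 < Real.sin α) (hc : 0 < Real.cos α) (s : Sgn) (k : ℤ) :
    bigonBoundary α s k =
      toBoundary (frame α s k) '' modelBoundary (-1) (Real.sin α) (Real.cos α) := by
  rw [bigonBoundary, arc₁_eq_image hs hc, arc₂_eq_image hs hc, circle₁_eq_image hc,
    circle₂_eq_image hc, ← Set.image_sdiff (toBoundary_injective _),
    ← Set.image_sdiff (toBoundary_injective _), ← Set.image_union, modelCircles_diff_re_pos]

theorem modelClosedPiece_subset_modelSphere (ε s c : ℝ) : modelClosedPiece ε s c ⊆ modelSphere :=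
  fun _ h => h.1.1

theorem closure_image_modelPiece {ε : ℝ} (hε : ε ^ 2 = 1) (hs : 0 < Real.sin α)
    (hc : 0 < Real.cos α) (hc1 : Real.cos α < 1) (s : Sgn) (k : ℤ) :
    closure (toBoundary (frame α s k) '' modelPiece ε (Real.sin α) (Real.cos α)) =
      toBoundary (frame α s k) '' modelClosedPiece ε (Real.sin α) (Real.cos α) := by
  have E := embedsClosed_toBoundary (frame_mem α s k)
  rw [E.closure_image fun w h => h.1.1, closure_modelPiece hε hc hc1 hs]

theorem mem_pieces_and_boundary_iff {ε : ℝ} (hε : ε ^ 2 = 1) (hs : 0 < Real.sin α)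
    (hc : 0 < Real.cos α) (hc1 : Real.cos α < 1) (s : Sgn) (k : ℤ) {R : Set CP2} :
    R ∈ pieces α s k ∧ closure R \ R =
        toBoundary (frame α s k) '' modelBoundary ε (Real.sin α) (Real.cos α) ↔
      R = toBoundary (frame α s k) '' modelPiece ε (Real.sin α) (Real.cos α) := by
  have E := embedsClosed_toBoundary (frame_mem α s k)
  have hi := toBoundary_injective (frame α s k)
  rw [pieces_eq_image hs hc hc1]
  constructor
  · rintro ⟨⟨R', hR', rfl⟩, hb⟩
    have hsub : R' ⊆ modelSphere := by
      rcases hR' with rfl | rfl | rfl | rfl <;> exact fun w h => h.1.1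
    rw [E.closure_image hsub, ← Set.image_sdiff hi] at hb
    have hb' := hi.image_injective hb
    rw [eq_modelPiece_of_boundary hε hs hc (Real.sin_sq_add_cos_sq α) hR'
      (hb' ▸ Set.sdiff_subset)]
  · rintro rfl
    refine ⟨⟨_, ?_, rfl⟩, ?_⟩
    · rcases sq_eq_sq_iff_eq_or_eq_neg.1 (hε.trans (one_pow 2).symm) with rfl | rfl
      · exact Or.inr (Or.inr (Or.inr rfl))
      · exact Or.inr (Or.inr (Or.inl rfl))
    · rw [closure_image_modelPiece hε hs hc hc1, ← Set.image_sdiff hi,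
        modelClosedPiece_diff hε hc hc1]

theorem isOpenQuad_iff (hs : 0 < Real.sin α) (hc : 0 < Real.cos α) (hc1 : Real.cos α < 1) (s : Sgn)
    (k : ℤ) {R : Set CP2} : IsOpenQuad α s k R ↔
      R = toBoundary (frame α s k) '' modelPiece 1 (Real.sin α) (Real.cos α) := by
  rw [IsOpenQuad, quadBoundary_eq_image hs hc hc1,
    mem_pieces_and_boundary_iff (by norm_num) hs hc hc1]

theorem isOpenBigon_iff (hs : 0 < Real.sin α) (hc : 0 < Real.cos α) (hc1 : Real.cos α < 1) (s : Sgn)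
    (k : ℤ) {R : Set CP2} : IsOpenBigon α s k R ↔
      R = toBoundary (frame α s k) '' modelPiece (-1) (Real.sin α) (Real.cos α) := by
  rw [IsOpenBigon, bigonBoundary_eq_image hs hc,
    mem_pieces_and_boundary_iff (by norm_num) hs hc hc1]

theorem modelBoundary_subset {ε : ℝ} (hc : 0 < c) : modelBoundary ε s c ⊆ modelClosedPiece ε s c :=
  fun _ h => ((mem_modelBoundary_iff hc).1 h).1

theorem mem_image_modelBoundary_iff {ε : ℝ} (hc : 0 < c) (P : SL3) {w : ℂ × ℂ}
    (hw : w ∈ modelClosedPiece ε s c) : toBoundary P w ∈ toBoundary P '' modelBoundary ε s c ↔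
      |w.1.im| = c * Complex.normSq w.1 := by
  rw [(toBoundary_injective P).mem_set_image, mem_modelBoundary_iff hc]
  exact and_iff_right hw

theorem isClosedDisk_image {ε : ℝ} (hε : ε ^ 2 = 1) (hc : 0 < c) (hc1 : c < 1)
    (h : ∀ z, pieceBase ε z = 2 * s → z.re = 0) {P : SL3} (hP : P ∈ hermGroup) :
    IsClosedDisk (toBoundary P '' modelClosedPiece ε s c) (toBoundary P '' modelBoundary ε s c) := by
  have E := embedsClosed_toBoundary hP
  obtain ⟨e, he⟩ := exists_homeomorph_modelClosedPiece hε hc hc1 h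
  refine ⟨Set.image_mono (modelBoundary_subset hc),
    e.trans (E.homeomorph (modelClosedPiece_subset_modelSphere ε s c)), fun x => ?_⟩
  rw [he]
  exact (mem_image_modelBoundary_iff hc P (e x).2).symm

theorem isTorusMinusDisk_image (hs : 0 < s) (hs1 : 4 * s ^ 2 < 1) (hc : 0 < c) (hc1 : c < 1)
    {P : SL3} (hP : P ∈ hermGroup) :
    IsTorusMinusDisk (toBoundary P '' modelClosedPiece 1 s c)
      (toBoundary P '' modelBoundary 1 s c) := by
  have E := embedsClosed_toBoundary hP
  obtain ⟨e, he⟩ := exists_homeomorph_torus_modelClosedPiece hs hs1 hc hc1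
  refine ⟨Set.image_mono (modelBoundary_subset hc),
    e.trans (E.homeomorph (modelClosedPiece_subset_modelSphere 1 s c)), fun x => ?_⟩
  rw [he]
  exact (mem_image_modelBoundary_iff hc P (e x).2).symm

end Assembly

end FordFaces

theorem mainTheorem4 (α : ℝ) (hα : α ∈ Set.Ioo 0 (Real.pi / 2)) (s : Sgn) (k : ℤ) :
    -- the two Giraud circles are smooth circles, bitangent at two points
    (IsSmoothCircle (circle₁ α s k) ∧ IsSmoothCircle (circle₂ α s k) ∧
      vertexA α s k ≠ vertexB α s k ∧
      circle₁ α s k ∩ circle₂ α s k = {vertexA α s k, vertexB α s k} ∧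
      TangentAt (circle₁ α s k) (circle₂ α s k) (vertexA α s k) ∧
      TangentAt (circle₁ α s k) (circle₂ α s k) (vertexB α s k) ∧
      vertex₁ α s k ∈ circle₁ α s k \ {vertexA α s k, vertexB α s k} ∧
      vertex₂ α s k ∈ circle₂ α s k \ {vertexA α s k, vertexB α s k}) ∧
    -- they cut the spinal surface into four pieces, among them exactly one bigon and exactly one
    -- quadrilateral, which form the boundary at infinity of the face
    ((pieces α s k).ncard = 4 ∧
      (∃! B, IsOpenBigon α s k B) ∧ (∃! Q, IsOpenQuad α s k Q) ∧
      ∀ B Q, IsOpenBigon α s k B → IsOpenQuad α s k Q →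
        faceInfinity α s k = closure B ∪ closure Q ∧
        closure B ∩ closure Q = {vertexA α s k, vertexB α s k}) ∧
    -- the bigon is a disk
    (∀ B, IsOpenBigon α s k B → IsClosedDisk (closure B) (bigonBoundary α s k)) ∧
    -- the quadrilateral is a disk, respectively a torus minus a disk
    (∀ Q, IsOpenQuad α s k Q →
      (Real.pi / 6 ≤ α → IsClosedDisk (closure Q) (quadBoundary α s k)) ∧
      (α < Real.pi / 6 →
        IsTorusMinusDisk (closure Q) (quadBoundary α s k) ∧
        AreDiffeomorphic (torus \ closedDiskInTorus) (ballChart '' Q))) := by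
  obtain ⟨hα0, hα1⟩ := hα
  have hs : 0 < Real.sin α := Real.sin_pos_of_pos_of_lt_pi hα0 (by linarith)
  have hc : 0 < Real.cos α := Real.cos_pos_of_mem_Ioo ⟨by linarith, hα1⟩
  have h := Real.sin_sq_add_cos_sq α
  have hc1 : Real.cos α < 1 := by nlinarith
  have hP := frame_mem α s k
  have hi := toBoundary_injective (frame α s k)
  have hquad := fun R => isOpenQuad_iff hs hc hc1 s k (R := R)
  have hbigon := fun R => isOpenBigon_iff hs hc hc1 s k (R := R)
  have hclQ := closure_image_modelPiece (ε := 1) (by norm_num) hs hc hc1 s k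
  have hclB := closure_image_modelPiece (ε := -1) (by norm_num) hs hc hc1 s k
  refine ⟨⟨?_, ?_, ?_, ?_, ?_, ?_, ?_, ?_⟩, ⟨?_, ?_, ?_, ?_⟩, ?_, ?_⟩
  · rw [IsSmoothCircle, circle₁_eq_image hc]
    exact (areDiffeomorphic_modelCircle₁ hs hc h).trans
      (areDiffeomorphic_ballChart_image hP fun w hw => hw.1.1)
  · rw [IsSmoothCircle, circle₂_eq_image hc]
    exact (areDiffeomorphic_modelCircle₂ hs hc h).trans
      (areDiffeomorphic_ballChart_image hP fun w hw => hw.1.1)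
  · rw [vertexA_eq, vertexB_eq]
    exact hi.ne modelA_ne_modelB
  · rw [vertices_eq_image, circle₁_eq_image hc, circle₂_eq_image hc, ← Set.image_inter hi,
      modelCircle₁_inter_modelCircle₂ hs hc]
  · rw [circle₁_eq_image hc, circle₂_eq_image hc, vertexA_eq]
    have hA : modelA ∈ modelCircle₁ (Real.sin α) (Real.cos α) ∩
        modelCircle₂ (Real.sin α) (Real.cos α) := by
      rw [modelCircle₁_inter_modelCircle₂ hs hc]; exact Or.inl rfl
    refine tangentAt_toBoundary hP (fun w hw => hw.1.1) (fun w hw => hw.1.1) hA.1 hA.2 ?_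
    have e : modelA = (0, ((1 : ℝ) : ℂ) * Complex.I) := by simp [modelA]
    rw [e, tangentConeAt_modelCircle₁ hs hc h (by norm_num),
      tangentConeAt_modelCircle₂ hs hc h (by norm_num)]
  · rw [circle₁_eq_image hc, circle₂_eq_image hc, vertexB_eq]
    have hB : modelB ∈ modelCircle₁ (Real.sin α) (Real.cos α) ∩
        modelCircle₂ (Real.sin α) (Real.cos α) := by
      rw [modelCircle₁_inter_modelCircle₂ hs hc]; exact Or.inr rfl
    refine tangentAt_toBoundary hP (fun w hw => hw.1.1) (fun w hw => hw.1.1) hB.1 hB.2 ?_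
    have e : modelB = (0, ((-1 : ℝ) : ℂ) * Complex.I) := by simp [modelB]
    rw [e, tangentConeAt_modelCircle₁ hs hc h (by norm_num),
      tangentConeAt_modelCircle₂ hs hc h (by norm_num)]
  · rw [vertices_eq_image, circle₁_eq_image hc, vertex₁_eq, ← Set.image_sdiff hi]
    exact ⟨_, ⟨modelVertex₁_mem h, notMem_vertices hs.ne'⟩, rfl⟩
  · rw [vertices_eq_image, circle₂_eq_image hc, vertex₂_eq, ← Set.image_sdiff hi]
    exact ⟨_, ⟨modelVertex₂_mem h, notMem_vertices hs.ne'⟩, rfl⟩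
  · rw [pieces_eq_image hs hc hc1, Set.ncard_image_of_injective _ hi.image_injective,
      ncard_modelPieces hc hc1]
  · exact ⟨_, (hbigon _).2 rfl, fun R hR => (hbigon R).1 hR⟩
  · exact ⟨_, (hquad _).2 rfl, fun R hR => (hquad R).1 hR⟩
  · intro B Q hB hQ
    rw [(hbigon B).1 hB, (hquad Q).1 hQ, hclB, hclQ]
    refine ⟨?_, ?_⟩
    · rw [faceInfinity_eq_image hc, Set.image_union]
    · rw [← Set.image_inter hi, modelClosedPiece_inter hs hc1, vertices_eq_image]
  · intro B hB
    rw [(hbigon B).1 hB, hclB, bigonBoundary_eq_image hs hc]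
    exact isClosedDisk_image (by norm_num) hc hc1 (pieceBase_neg_ne hs) hP
  · intro Q hQ
    rw [(hquad Q).1 hQ, hclQ, quadBoundary_eq_image hs hc hc1]
    refine ⟨fun hα => ?_, fun hα => ?_⟩
    · have h2 : 1 / 2 ≤ Real.sin α := by
        rw [← Real.sin_pi_div_six]
        exact Real.sin_le_sin_of_le_of_le_pi_div_two (by linarith [Real.pi_pos]) hα1.le hα
      exact isClosedDisk_image (by norm_num) hc hc1 (pieceBase_one_ne h2) hP
    · have h2 : Real.sin α < 1 / 2 := by
        rw [← Real.sin_pi_div_six]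
        exact Real.sin_lt_sin_of_lt_of_le_pi_div_two (by linarith) (by linarith [Real.pi_pos]) hα
      have h3 : 4 * Real.sin α ^ 2 < 1 := by nlinarith
      exact ⟨isTorusMinusDisk_image hs h3 hc hc1 hP,
        (areDiffeomorphic_torus_modelPiece hs h3 hc hc1).trans
          (areDiffeomorphic_ballChart_image hP fun w hw => hw.1.1)⟩
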